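/- Manifolds are smooth, finite-dimensional, Hausdorff and second countable; vector bundles are real, smooth, of constant finite rank. Let $G \rightrightarrows M$ be a Lie groupoid with source $s$, target $t$ and units $1_x$ (the product $g_1g_2$ is defined when $s(g_1)=t(g_2)$). **Representations up to homotopy.** Let $G^{(0)}=M$ and, for $p>0$, let $G^{(p)}$ be the manifold of composable $p$-tuples. Let $C^p(G)=C^\infty(G^{(p)})$ with the usual coboundary $\delta$ (so $(\delta f)(g)=f(s(g))-f(t(g))$ for $p=0$). For a vector bundle $E\to M$, $C^p(G;E)$ is the space of smooth maps $\omega$ with $\omega(g_1,\dots,g_p)\in E_{t(g_1)}$ (sections of $E$ if $p=0$), and $(\omega\star f)(g_1,\dots,g_{p+q})=\omega(g_1,\dots,g_p)f(g_{p+1},\dots,g_{p+q})$ for $f\in C^q(G)$. For vector bundles $E,C\to M$, $C(G;E\oplus C[1])$ is the right $C(G)$-module with degree-$p$ part $C^p(G;E)\oplus C^{p+1}(G;C)$. A *representation up to homotopy* of $G$ on $E\oplus C[1]$ is a linear operator $\mathcal D$ of degree $1$ on it, continuous for the Fréchet topologies, with $\mathcal D^2=0$ and $\mathcal D(\omega\star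 f)=(\mathcal D\omega)\star f+(-1)^{|\omega|}\omega\star\delta f$, which preserves normalized cochains (those vanishing whenever an argument is a unit). An *isomorphism* from $(E\oplus C[1],\mathcal D)$ to $(E'\oplus C'[1],\mathcal D')$ is a degree-preserving bicontinuous isomorphism $T$ of right $C(G)$-modules, matching normalized cochains, with $T\mathcal D=\mathcal D'T$. If $E=E'$, $C=C'$ and $T$ induces the identity on $\Gamma(E)\oplus\Gamma(C)$ (modulo cochains of positive cochain degree), then $T$ is a *gauge transformation* and $\mathcal D,\mathcal D'$ are *gauge-equivalent*. **$\mathcal{VB}$-groupoids.** A *$\mathcal{VB}$-groupoid* over $G$ with side bundle $E\to M$ is a vector bundle $\Gamma\to G$ whose total space is a Lie groupoid $\Gamma\rightrightarrows E$ such that its source $\tilde s$ and target $\tilde t$ are vector bundle morphisms over $s$ and $t$, the bundle projections form a Lie groupoid morphism, and $(\gamma_1+\gamma_3)(\gamma_2+\gamma_4)=\gamma_1\gamma_2+\gamma_3\gamma_4$ whenever defined. *Isomorphisms* of $\mathcal{VB}$-groupoids over $G$ are pairs of vector bundle isomorphisms over $\mathrm{id}_G$ and $\mathrm{id}_M$ which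 form a groupoid morphism. The *core* is the bundle over $M$ with fibres $\ker(\tilde s:\Gamma_{1_x}\to E_x)$. A *horizontal lift* is a smooth bundle map $h:s^*E\to\Gamma$ over $G$ with $\tilde s(h_g(e))=e$ and $h_{1_x}(e)=\tilde 1_e$. For a horizontal lift $h$ and an identification of a vector bundle $C$ with the core, $\mathcal D_h$ denotes the representation up to homotopy on $E\oplus C[1]$ determined on $\varepsilon\in\Gamma(E)$, $\alpha\in\Gamma(C)$ by $$\mathcal D\varepsilon=\big[\Delta^E_g\varepsilon_{s(g)}-\varepsilon_{t(g)}\big]+\Omega_{g_1,g_2}\varepsilon_{s(g_2)},\qquad \mathcal D\alpha=\partial\alpha+\big[\alpha_{t(g)}-\Delta^C_g\alpha_{s(g)}\big],$$ where $\partial c=\tilde t(c)$, $\Delta^E_ge=\tilde t(h_g(e))$, $\Delta^C_gc=h_g(\partial c)\cdot c\cdot\tilde 0_{g^{-1}}$ and $\Omega_{g_1,g_2}e=\big(h_{g_1g_2}(e)-h_{g_1}(\Delta^E_{g_2}e)\cdot h_{g_2}(e)\big)\cdot\tilde 0_{(g_1g_2)^{-1}}$. **Statement.** 1. Every $\mathcal{VB}$-groupoid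 over $G$ has a horizontal lift, its core is (isomorphic to) a smooth vector bundle, and for every identification of a vector bundle $C$ with the core and every horizontal lift $h$, $\mathcal D_h$ exists and is unique. 2. $\Gamma\mapsto\mathcal D_h$ induces a well-defined bijection from isomorphism classes of $\mathcal{VB}$-groupoids over $G$ (with arbitrary side bundles) to isomorphism classes of $2$-term representations up to homotopy of $G$ (on arbitrary $E\oplus C[1]$). 3. For fixed vector bundles $E,C\to M$, there is a bijection from isomorphism classes of $\mathcal{VB}$-groupoids over $G$ with side bundle $E$ and core identified with $C$ (isomorphisms inducing the identity on $E$ and $C$) to gauge-equivalence classes of representations up to homotopy of $G$ on $E\oplus C[1]$; the class assigned to $\Gamma$ is exactly the set of all $\mathcal D_h$, for $h$ a horizontal lift of $\Gamma$. -/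

import Mathlib

open scoped Manifold ContDiff DirectSum Bundle

universe v

namespace VBG

noncomputable section

/-! ## Smooth vector bundles -/

section Bundles

variable {EB HB : Type*} [NormedAddCommGroup EB] [NormedSpace ℝ EB] [TopologicalSpace HB]

/-- A smooth real vector bundle of finite rank over the manifold `B`. -/
structure VecBun (I : ModelWithCorners ℝ EB HB) (B : Type*) [TopologicalSpace B]
    [ChartedSpace HB B] where
  /-- The typical fibre. -/
  model : Type
  [normedAddCommGroup : NormedAddCommGroup model]
  [normedSpace : NormedSpace ℝ model]
  [finiteDimensional : FiniteDimensional ℝ model]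
  /-- The fibres. -/
  fiber : B → Type v
  [addCommGroup : ∀ x, AddCommGroup (fiber x)]
  [module : ∀ x, Module ℝ (fiber x)]
  [topFiber : ∀ x, TopologicalSpace (fiber x)]
  [topTotal : TopologicalSpace (Bundle.TotalSpace model fiber)]
  [fiberBundle : FiberBundle model fiber]
  [vectorBundle : VectorBundle ℝ model fiber]
  [smooth : ContMDiffVectorBundle ∞ model fiber I]

attribute [instance] VecBun.normedAddCommGroup VecBun.normedSpace VecBun.finiteDimensional
  VecBun.addCommGroup VecBun.module VecBun.topFiber VecBun.topTotal VecBun.fiberBundle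
  VecBun.vectorBundle VecBun.smooth

variable {I : ModelWithCorners ℝ EB HB} {B : Type*} [TopologicalSpace B] [ChartedSpace HB B]

/-- The total space, a manifold modelled on `A.tModel`. -/
abbrev VecBun.Tot (A : VecBun.{v} I B) := Bundle.TotalSpace A.model A.fiber

/-- The model with corners of the total space. -/
abbrev VecBun.tModel (A : VecBun.{v} I B) := I.prod 𝓘(ℝ, A.model)

/-- The vector `a` over `x`, as a point of the total space. -/
abbrev VecBun.pt (A : VecBun.{v} I B) (x : B) (a : A.fiber x) : A.Tot := ⟨x, a⟩

/-- A point of the total space lying over `x`, as an element of the fibre at `x`. -/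
def VecBun.fiberAt (A : VecBun.{v} I B) (γ : A.Tot) {x : B} (h : γ.proj = x) : A.fiber x :=
  h ▸ γ.snd

theorem VecBun.pt_fiberAt (A : VecBun.{v} I B) (γ : A.Tot) {x : B} (h : γ.proj = x) :
    A.pt x (A.fiberAt γ h) = γ := by
  subst h; rfl

/-- An isomorphism of smooth vector bundles covering the identity of the base. -/
structure VecBunIso (A A' : VecBun.{v} I B) where
  /-- The fibrewise linear isomorphisms. -/
  equiv : ∀ x, A.fiber x ≃ₗ[ℝ] A'.fiber x
  smooth_toFun : ContMDiff A.tModel A'.tModel ∞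
    (fun a : A.Tot => A'.pt a.proj (equiv a.proj a.snd))
  smooth_invFun : ContMDiff A'.tModel A.tModel ∞
    (fun a : A'.Tot => A.pt a.proj ((equiv a.proj).symm a.snd))

/-- The map of total spaces. -/
def VecBunIso.total {A A' : VecBun.{v} I B} (φ : VecBunIso A A') (a : A.Tot) : A'.Tot :=
  A'.pt a.proj (φ.equiv a.proj a.snd)

/-- The identity isomorphism. -/
def VecBunIso.refl (A : VecBun.{v} I B) : VecBunIso A A where
  equiv _ := LinearEquiv.refl ℝ _
  smooth_toFun := contMDiff_id
  smooth_invFun := contMDiff_id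

/-- The inverse isomorphism. -/
def VecBunIso.symm {A A' : VecBun.{v} I B} (φ : VecBunIso A A') : VecBunIso A' A where
  equiv x := (φ.equiv x).symm
  smooth_toFun := φ.smooth_invFun
  smooth_invFun := φ.smooth_toFun

/-- The composite isomorphism. -/
def VecBunIso.trans {A A' A'' : VecBun.{v} I B} (φ : VecBunIso A A') (ψ : VecBunIso A' A'') :
    VecBunIso A A'' where
  equiv x := (φ.equiv x).trans (ψ.equiv x)
  smooth_toFun := ψ.smooth_toFun.comp φ.smooth_toFun
  smooth_invFun := φ.smooth_invFun.comp ψ.smooth_invFun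

@[simp] theorem VecBunIso.total_refl (A : VecBun.{v} I B) (a : A.Tot) :
    (VecBunIso.refl A).total a = a := rfl

@[simp] theorem VecBunIso.total_trans {A A' A'' : VecBun.{v} I B} (φ : VecBunIso A A')
    (ψ : VecBunIso A' A'') (a : A.Tot) : (φ.trans ψ).total a = ψ.total (φ.total a) := rfl

@[simp] theorem VecBunIso.total_symm_total {A A' : VecBun.{v} I B} (φ : VecBunIso A A')
    (a : A.Tot) : φ.symm.total (φ.total a) = a := by
  exact congrArg (A.pt a.proj) ((φ.equiv a.proj).symm_apply_apply a.snd)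

@[simp] theorem VecBunIso.total_total_symm {A A' : VecBun.{v} I B} (φ : VecBunIso A A')
    (a : A'.Tot) : φ.total (φ.symm.total a) = a := by
  exact congrArg (A'.pt a.proj) ((φ.equiv a.proj).apply_symm_apply a.snd)

/-- Sums of smooth families of vectors are smooth. -/
theorem VecBun.smooth_add (A : VecBun.{v} I B) {k : ℕ} {x : EuclideanSpace ℝ (Fin k) → B}
    {a b : ∀ z, A.fiber (x z)}
    (ha : ContMDiff (𝓡 k) A.tModel ∞ (fun z => A.pt (x z) (a z)))
    (hb : ContMDiff (𝓡 k) A.tModel ∞ (fun z => A.pt (x z) (b z))) :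
    ContMDiff (𝓡 k) A.tModel ∞ (fun z => A.pt (x z) (a z + b z)) := by
  intro z
  have h1 := Bundle.contMDiffAt_totalSpace.1 (ha z)
  have h2 := Bundle.contMDiffAt_totalSpace.1 (hb z)
  refine Bundle.contMDiffAt_totalSpace.2 ⟨h1.1, (h1.2.add h2.2).congr_of_eventuallyEq ?_⟩
  have hx : ContinuousAt x z := h1.1.continuousAt
  filter_upwards [hx.preimage_mem_nhds ((trivializationAt A.model A.fiber (x z)).open_baseSet.mem_nhds
    (FiberBundle.mem_baseSet_trivializationAt A.model A.fiber (x z)))] with y hy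
  exact ((trivializationAt A.model A.fiber (x z)).linear ℝ hy).map_add _ _

/-- Products of smooth families of vectors with smooth functions are smooth. -/
theorem VecBun.smooth_smul (A : VecBun.{v} I B) {k : ℕ} {x : EuclideanSpace ℝ (Fin k) → B}
    {f : EuclideanSpace ℝ (Fin k) → ℝ} {a : ∀ z, A.fiber (x z)}
    (hf : ContMDiff (𝓡 k) 𝓘(ℝ, ℝ) ∞ f)
    (ha : ContMDiff (𝓡 k) A.tModel ∞ (fun z => A.pt (x z) (a z))) :
    ContMDiff (𝓡 k) A.tModel ∞ (fun z => A.pt (x z) (f z • a z)) := by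
  intro z
  have h1 := Bundle.contMDiffAt_totalSpace.1 (ha z)
  refine Bundle.contMDiffAt_totalSpace.2 ⟨h1.1, ((hf z).smul h1.2).congr_of_eventuallyEq ?_⟩
  have hx : ContinuousAt x z := h1.1.continuousAt
  filter_upwards [hx.preimage_mem_nhds ((trivializationAt A.model A.fiber (x z)).open_baseSet.mem_nhds
    (FiberBundle.mem_baseSet_trivializationAt A.model A.fiber (x z)))] with y hy
  exact ((trivializationAt A.model A.fiber (x z)).linear ℝ hy).map_smul _ _

/-- The zero vector along a smooth family of base points is smooth. -/
theorem VecBun.smooth_zero (A : VecBun.{v} I B) {k : ℕ} {x : EuclideanSpace ℝ (Fin k) → B}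
    (hx : ContMDiff (𝓡 k) I ∞ x) :
    ContMDiff (𝓡 k) A.tModel ∞ (fun z => A.pt (x z) 0) :=
  (Bundle.contMDiff_zeroSection ℝ A.fiber).comp hx

end Bundles

/-! ## Lie groupoids -/

section Groupoids

variable {EG HG EM HM : Type*} [NormedAddCommGroup EG] [NormedSpace ℝ EG] [TopologicalSpace HG]
  [NormedAddCommGroup EM] [NormedSpace ℝ EM] [TopologicalSpace HM]

/-- A Lie groupoid `G ⇉ M`. The product `mul g h` is defined when `src g = tgt h`.

The source map is a submersion, so the set `G⁽²⁾` of composable pairs is an embedded submanifold of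
`G × G`. A map on an embedded submanifold `N` is smooth exactly when its composite with each smooth
map `ℝᵏ → N`, for all `k`, is smooth (take inverses of charts of `N`), and a map `ℝᵏ → N` is smooth
exactly when it is smooth as a map into the ambient manifold: this is how smoothness of the
multiplication is expressed. The target map is a submersion because of the inversion. -/
structure LieGroupoid (I : ModelWithCorners ℝ EG HG) (G : Type*) [TopologicalSpace G]
    [ChartedSpace HG G] (J : ModelWithCorners ℝ EM HM) (M : Type*) [TopologicalSpace M]
    [ChartedSpace HM M] where
  src : G → M
  tgt : G → M
  one : M → G
  inv : G → G
  mul : ∀ g h : G, src g = tgt h → G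
  src_one : ∀ x, src (one x) = x
  tgt_one : ∀ x, tgt (one x) = x
  src_inv : ∀ g, src (inv g) = tgt g
  tgt_inv : ∀ g, tgt (inv g) = src g
  src_mul : ∀ g h w, src (mul g h w) = src h
  tgt_mul : ∀ g h w, tgt (mul g h w) = tgt g
  mul_assoc : ∀ f g h (w₁ : src f = tgt g) (w₂ : src g = tgt h),
    mul (mul f g w₁) h ((src_mul f g w₁).trans w₂) =
      mul f (mul g h w₂) (w₁.trans (tgt_mul g h w₂).symm)
  one_mul : ∀ g, mul (one (tgt g)) g (src_one _) = g
  mul_one : ∀ g, mul g (one (src g)) (tgt_one _).symm = g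
  inv_mul : ∀ g, mul (inv g) g (src_inv g) = one (src g)
  mul_inv : ∀ g, mul g (inv g) (tgt_inv g).symm = one (tgt g)
  smooth_src : ContMDiff I J ∞ src
  smooth_tgt : ContMDiff I J ∞ tgt
  smooth_one : ContMDiff J I ∞ one
  smooth_inv : ContMDiff I I ∞ inv
  submersion_src : ∀ g, Function.Surjective (mfderiv I J src g)
  smooth_mul : ∀ (k : ℕ) (a b : EuclideanSpace ℝ (Fin k) → G) (w : ∀ z, src (a z) = tgt (b z)),
    ContMDiff (𝓡 k) I ∞ a → ContMDiff (𝓡 k) I ∞ b →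
      ContMDiff (𝓡 k) I ∞ (fun z => mul (a z) (b z) (w z))

variable {I : ModelWithCorners ℝ EG HG} {G : Type*} [TopologicalSpace G] [ChartedSpace HG G]
  {J : ModelWithCorners ℝ EM HM} {M : Type*} [TopologicalSpace M] [ChartedSpace HM M]

/-! ## The nerve and groupoid cochains -/

/-- A point of `G⁽ᵖ⁾`, the `p`-simplices of the nerve: composable arrows `arr 0, …, arr (p - 1)`
together with their vertices, so that `arr i` is an arrow from `vert (i + 1)` to `vert i`.
For `p = 0` this is a point of `M`; for `p > 0` the vertices are determined by the arrows. -/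
structure Nerve (𝒢 : LieGroupoid I G J M) (p : ℕ) where
  vert : Fin (p + 1) → M
  arr : Fin p → G
  tgt_arr : ∀ i : Fin p, 𝒢.tgt (arr i) = vert i.castSucc
  src_arr : ∀ i : Fin p, 𝒢.src (arr i) = vert i.succ

variable {𝒢 : LieGroupoid I G J M}

namespace Nerve

/-- The initial vertex: the point itself for `p = 0`, and `t(g₁)` for `p > 0`. -/
def base {p : ℕ} (σ : Nerve 𝒢 p) : M := σ.vert ⟨0, p.succ_pos⟩

/-- A smooth map from `ℝᵏ` to the embedded submanifold `G⁽ᵖ⁾`. -/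
def SmoothMap {p k : ℕ} (u : EuclideanSpace ℝ (Fin k) → Nerve 𝒢 p) : Prop :=
  (∀ i, ContMDiff (𝓡 k) J ∞ (fun z => (u z).vert i)) ∧
    ∀ i, ContMDiff (𝓡 k) I ∞ (fun z => (u z).arr i)

/-- `(g₁, …, g_{p+q}) ↦ (g₁, …, g_p)`. -/
def front (p q : ℕ) (σ : Nerve 𝒢 (p + q)) : Nerve 𝒢 p where
  vert i := σ.vert ⟨i.1, by omega⟩
  arr i := σ.arr ⟨i.1, by omega⟩
  tgt_arr i := σ.tgt_arr ⟨i.1, by omega⟩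
  src_arr i := σ.src_arr ⟨i.1, by omega⟩

/-- `(g₁, …, g_{p+q}) ↦ (g_{p+1}, …, g_{p+q})`. -/
def back (p q : ℕ) (σ : Nerve 𝒢 (p + q)) : Nerve 𝒢 q where
  vert i := σ.vert ⟨p + i.1, by omega⟩
  arr i := σ.arr ⟨p + i.1, by omega⟩
  tgt_arr i := σ.tgt_arr ⟨p + i.1, by omega⟩
  src_arr i := σ.src_arr ⟨p + i.1, by omega⟩

/-- The arrows of the `i`-th face: the two arrows meeting at an inner vertex `i` are multiplied;
the first (last) arrow is dropped if `i` is the initial (final) vertex. -/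
def faceArr {p : ℕ} (i : Fin (p + 2)) (σ : Nerve 𝒢 (p + 1)) (j : Fin p) : G :=
  if j.1 + 1 < i.1 then σ.arr j.castSucc
  else if j.1 + 1 = i.1 then
    𝒢.mul (σ.arr j.castSucc) (σ.arr j.succ)
      ((σ.src_arr j.castSucc).trans (σ.tgt_arr j.succ).symm)
  else σ.arr j.succ

/-- The `i`-th face map `G⁽ᵖ⁺¹⁾ → G⁽ᵖ⁾`, which deletes the vertex `i`. -/
def face {p : ℕ} (i : Fin (p + 2)) (σ : Nerve 𝒢 (p + 1)) : Nerve 𝒢 p where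
  vert j := σ.vert (i.succAbove j)
  arr := faceArr i σ
  tgt_arr j := by
    unfold faceArr
    split_ifs with h₁ h₂
    · rw [σ.tgt_arr, Fin.succAbove_of_castSucc_lt]
      rw [Fin.lt_def]; simp; omega
    · rw [𝒢.tgt_mul, σ.tgt_arr, Fin.succAbove_of_castSucc_lt]
      rw [Fin.lt_def]; simp; omega
    · rw [σ.tgt_arr, Fin.succAbove_of_le_castSucc]
      · rfl
      · rw [Fin.le_def]; simp; omega
  src_arr j := by
    unfold faceArr
    split_ifs with h₁ h₂
    · rw [σ.src_arr, Fin.succAbove_of_castSucc_lt]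
      · rfl
      · rw [Fin.lt_def]; simp; omega
    · rw [𝒢.src_mul, σ.src_arr, Fin.succAbove_of_le_castSucc]
      rw [Fin.le_def]; simp; omega
    · rw [σ.src_arr, Fin.succAbove_of_le_castSucc]
      rw [Fin.le_def]; simp; omega

variable (𝒢) in
/-- A point of `M` as an element of `G⁽⁰⁾`. -/
def point (x : M) : Nerve 𝒢 0 where
  vert _ := x
  arr := Fin.elim0
  tgt_arr i := i.elim0
  src_arr i := i.elim0

variable (𝒢) in
/-- An arrow as an element of `G⁽¹⁾`. -/
def edge (g : G) : Nerve 𝒢 1 where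
  vert := ![𝒢.tgt g, 𝒢.src g]
  arr := ![g]
  tgt_arr i := by fin_cases i; rfl
  src_arr i := by fin_cases i; rfl

variable (𝒢) in
/-- A composable pair of arrows as an element of `G⁽²⁾`. -/
def pair (g₁ g₂ : G) (w : 𝒢.src g₁ = 𝒢.tgt g₂) : Nerve 𝒢 2 where
  vert := ![𝒢.tgt g₁, 𝒢.tgt g₂, 𝒢.src g₂]
  arr := ![g₁, g₂]
  tgt_arr i := by fin_cases i <;> rfl
  src_arr i := by fin_cases i; exacts [w, rfl]

theorem SmoothMap.front {p q k : ℕ} {u : EuclideanSpace ℝ (Fin k) → Nerve 𝒢 (p + q)}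
    (h : SmoothMap u) : SmoothMap (fun z => (u z).front p q) :=
  ⟨fun _ => h.1 _, fun _ => h.2 _⟩

theorem SmoothMap.back {p q k : ℕ} {u : EuclideanSpace ℝ (Fin k) → Nerve 𝒢 (p + q)}
    (h : SmoothMap u) : SmoothMap (fun z => (u z).back p q) :=
  ⟨fun _ => h.1 _, fun _ => h.2 _⟩

theorem SmoothMap.face {p k : ℕ} (i : Fin (p + 2))
    {u : EuclideanSpace ℝ (Fin k) → Nerve 𝒢 (p + 1)}
    (h : SmoothMap u) : SmoothMap (fun z => (u z).face i) := by
  refine ⟨fun _ => h.1 _, fun j => ?_⟩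
  simp only [Nerve.face, faceArr]
  split_ifs
  · exact h.2 _
  · exact 𝒢.smooth_mul k _ _ _ (h.2 _) (h.2 _)
  · exact h.2 _

end Nerve

variable (𝒢) in
/-- `C^p(G)`: the smooth real functions on `G⁽ᵖ⁾`. -/
def FunCochain (p : ℕ) : Submodule ℝ (Nerve 𝒢 p → ℝ) where
  carrier := {f | ∀ (k : ℕ) (u : EuclideanSpace ℝ (Fin k) → Nerve 𝒢 p), Nerve.SmoothMap u →
    ContMDiff (𝓡 k) 𝓘(ℝ, ℝ) ∞ (fun z => f (u z))}
  add_mem' hf hg k u hu := (hf k u hu).add (hg k u hu)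
  zero_mem' _ _ _ := contMDiff_const
  smul_mem' _ _ hf k u hu := contMDiff_const.mul (hf k u hu)

variable (𝒢) in
/-- `C^p(G; E)`: the smooth sections over `G⁽ᵖ⁾` of the pullback of `E` along the initial vertex
map. -/
def Cochain (E : VecBun.{v} J M) (p : ℕ) : Submodule ℝ (∀ σ : Nerve 𝒢 p, E.fiber σ.base) where
  carrier := {η | ∀ (k : ℕ) (u : EuclideanSpace ℝ (Fin k) → Nerve 𝒢 p), Nerve.SmoothMap u →
    ContMDiff (𝓡 k) E.tModel ∞ (fun z => E.pt (u z).base (η (u z)))}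
  add_mem' hf hg k u hu := E.smooth_add (hf k u hu) (hg k u hu)
  zero_mem' _ _ hu := E.smooth_zero (hu.1 _)
  smul_mem' _ _ hf k u hu := E.smooth_smul contMDiff_const (hf k u hu)

/-- The coboundary `δ : C^p(G) → C^{p+1}(G)`, the alternating sum over the faces. In degree `0` it
is `(δf)(g) = f(s(g)) - f(t(g))`. -/
def delta {p : ℕ} (f : FunCochain 𝒢 p) : FunCochain 𝒢 (p + 1) :=
  ⟨fun σ => ∑ i : Fin (p + 2), (-1 : ℝ) ^ i.1 * f.1 (σ.face i), fun k _ hu =>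
    ContMDiff.sum fun i _ => contMDiff_const.mul (f.2 k _ (hu.face i))⟩

/-- The right module structure: `(η ⋆ f)(g₁, …, g_{p+q}) = η(g₁, …, g_p) f(g_{p+1}, …, g_{p+q})`,
where an empty list of arguments stands for the corresponding vertex. -/
def star (E : VecBun.{v} J M) {q : ℕ} (f : FunCochain 𝒢 q) (p : ℕ) :
    Cochain 𝒢 E p →ₗ[ℝ] Cochain 𝒢 E (p + q) where
  toFun η := ⟨fun σ => (f.1 (σ.back p q) • η.1 (σ.front p q) : E.fiber (σ.front p q).base),
    fun k u hu => E.smooth_smul (f.2 k _ hu.back) (η.2 k _ hu.front)⟩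
  map_add' η η' := Subtype.ext (funext fun σ => smul_add _ _ _)
  map_smul' c η := Subtype.ext (funext fun σ => by
    change f.1 (σ.back p q) • c • η.1 (σ.front p q) = c • f.1 (σ.back p q) • η.1 (σ.front p q)
    rw [smul_smul, smul_smul, mul_comm])

/-- The value of a `0`-cochain (a section of `E`) at `x`. -/
def atPoint {E : VecBun.{v} J M} (η : Cochain 𝒢 E 0) (x : M) : E.fiber x :=
  η.1 (Nerve.point 𝒢 x)

/-- The value of a `1`-cochain at the arrow `g`. -/
def atEdge {E : VecBun.{v} J M} (η : Cochain 𝒢 E 1) (g : G) : E.fiber (𝒢.tgt g) :=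
  η.1 (Nerve.edge 𝒢 g)

/-- The value of a `2`-cochain at the composable pair `(g₁, g₂)`, in the fibre over
`t(g₁) = t(g₁g₂)`. -/
def atPair {E : VecBun.{v} J M} (η : Cochain 𝒢 E 2) (g₁ g₂ : G) (w : 𝒢.src g₁ = 𝒢.tgt g₂) :
    E.fiber (𝒢.tgt (𝒢.mul g₁ g₂ w)) :=
  E.fiberAt (E.pt (𝒢.tgt g₁) (η.1 (Nerve.pair 𝒢 g₁ g₂ w))) (𝒢.tgt_mul g₁ g₂ w).symm

/-- A cochain is normalized if it vanishes as soon as one argument is a unit. -/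
def IsNormalized {E : VecBun.{v} J M} {p : ℕ} (η : Cochain 𝒢 E p) : Prop :=
  ∀ σ : Nerve 𝒢 p, (∃ i x, σ.arr i = 𝒢.one x) → η.1 σ = 0

/-- A family of cochains depending smoothly on a real parameter: it is smooth jointly in the
parameter and the point of `G⁽ᵖ⁾`. -/
def IsSmoothFamily {E : VecBun.{v} J M} {p : ℕ} (η : ℝ → Cochain 𝒢 E p) : Prop :=
  ∀ (k : ℕ) (r : EuclideanSpace ℝ (Fin k) → ℝ) (u : EuclideanSpace ℝ (Fin k) → Nerve 𝒢 p),
    ContMDiff (𝓡 k) 𝓘(ℝ, ℝ) ∞ r → Nerve.SmoothMap u →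
      ContMDiff (𝓡 k) E.tModel ∞ (fun z => E.pt (u z).base ((η (r z)).1 (u z)))

/-! ## Cochains with values in a 2-term graded bundle -/

variable (𝒢) in
/-- `C(G; E ⊕ C[1])`, as a vector space: the direct sum of all `C^q(G; E)` and all `C^q(G; C)`. -/
abbrev GrCochain (E C : VecBun.{v} J M) :=
  (⨁ q : ℕ, Cochain 𝒢 E q) × (⨁ q : ℕ, Cochain 𝒢 C q)

section Graded

variable {E C E' C' : VecBun.{v} J M}

/-- `x` is homogeneous of total degree `p`: it lies in `C^p(G; E) ⊕ C^{p+1}(G; C)`. -/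
def HasDegree (x : GrCochain 𝒢 E C) (p : ℤ) : Prop :=
  (∀ q : ℕ, (q : ℤ) ≠ p → x.1 q = 0) ∧ ∀ q : ℕ, (q : ℤ) - 1 ≠ p → x.2 q = 0

/-- The right action of `f ∈ C^q(G)` on `C(G; E ⊕ C[1])`. -/
def act {q : ℕ} (f : FunCochain 𝒢 q) :
    GrCochain 𝒢 E C →ₗ[ℝ] GrCochain 𝒢 E C :=
  LinearMap.prodMap
    (DirectSum.toModule ℝ ℕ _ fun p =>
      DirectSum.lof ℝ ℕ (fun q => Cochain 𝒢 E q) (p + q) ∘ₗ star E f p)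
    (DirectSum.toModule ℝ ℕ _ fun p =>
      DirectSum.lof ℝ ℕ (fun q => Cochain 𝒢 C q) (p + q) ∘ₗ star C f p)

/-- The normalized elements of `C(G; E ⊕ C[1])`. -/
def IsNormalizedGr (x : GrCochain 𝒢 E C) : Prop :=
  (∀ q, IsNormalized (x.1 q)) ∧ ∀ q, IsNormalized (x.2 q)

/-- A section of `E` as an element of `C(G; E ⊕ C[1])`, of total degree `0`. -/
def inE (ε : Cochain 𝒢 E 0) : GrCochain 𝒢 E C :=
  (DirectSum.lof ℝ ℕ (fun q => Cochain 𝒢 E q) 0 ε, 0)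

/-- A section of `C` as an element of `C(G; E ⊕ C[1])`, of total degree `-1`. -/
def inC (α : Cochain 𝒢 C 0) : GrCochain 𝒢 E C :=
  (0, DirectSum.lof ℝ ℕ (fun q => Cochain 𝒢 C q) 0 α)

/-- The quotient map `μ : C(G; E ⊕ C[1]) → Γ(E) ⊕ Γ(C)` onto the `0`-cochains. -/
def mu (x : GrCochain 𝒢 E C) : Cochain 𝒢 E 0 × Cochain 𝒢 C 0 := (x.1 0, x.2 0)

/-- Continuity of a linear map that shifts the degree by a constant, for the Fréchet topologies on
the spaces of cochains. A linear map between Fréchet spaces is continuous if and only if it takes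
smooth curves to smooth curves, and the smooth curves in the Fréchet space of sections of a vector
bundle are the smooth families of sections. -/
def IsContinuousOp (T : GrCochain 𝒢 E C →ₗ[ℝ] GrCochain 𝒢 E' C') : Prop :=
  ∀ x : ℝ → GrCochain 𝒢 E C,
    ((∀ q, IsSmoothFamily fun r => (x r).1 q) ∧ ∀ q, IsSmoothFamily fun r => (x r).2 q) →
    ((∀ q, IsSmoothFamily fun r => (T (x r)).1 q) ∧ ∀ q, IsSmoothFamily fun r => (T (x r)).2 q)

variable (𝒢 E C) in
/-- A representation up to homotopy of `G` on `E ⊕ C[1]`: a continuous operator of degree `1` on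
`C(G; E ⊕ C[1])` that satisfies the graded Leibniz rule, preserves the normalized cochains and has
square zero. -/
structure RepHtpy where
  op : GrCochain 𝒢 E C →ₗ[ℝ] GrCochain 𝒢 E C
  continuous : IsContinuousOp op
  degree : ∀ x p, HasDegree x p → HasDegree (op x) (p + 1)
  leibniz : ∀ (x : GrCochain 𝒢 E C) (p : ℤ) (q : ℕ) (f : FunCochain 𝒢 q), HasDegree x p →
    op (act f x) = act f (op x) + (-1 : ℝ) ^ p • act (delta f) x
  normalized : ∀ x, IsNormalizedGr x → IsNormalizedGr (op x)
  sq_zero : op ∘ₗ op = 0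

/-- A degree-preserving (bicontinuous) isomorphism of right `C(G)`-modules
`C(G; E ⊕ C[1]) ≃ C(G; E' ⊕ C'[1])` under which normalized cochains correspond. -/
structure IsModuleIso (T : GrCochain 𝒢 E C ≃ₗ[ℝ] GrCochain 𝒢 E' C') : Prop where
  continuous : IsContinuousOp T.toLinearMap
  continuous_symm : IsContinuousOp T.symm.toLinearMap
  degree : ∀ x p, HasDegree (T x) p ↔ HasDegree x p
  act : ∀ (x : GrCochain 𝒢 E C) (q : ℕ) (f : FunCochain 𝒢 q), T (act f x) = act f (T x)
  normalized : ∀ x, IsNormalizedGr (T x) ↔ IsNormalizedGr x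

/-- `D` and `D'` are isomorphic. -/
def RepHtpy.Isomorphic (D : RepHtpy 𝒢 E C) (D' : RepHtpy 𝒢 E' C') : Prop :=
  ∃ T : GrCochain 𝒢 E C ≃ₗ[ℝ] GrCochain 𝒢 E' C', IsModuleIso T ∧ ∀ x, T (D.op x) = D'.op (T x)

/-- `D` and `D'` are gauge-equivalent: `D' = T ∘ D ∘ T⁻¹` for a gauge transformation `T`, that is, a
module automorphism as above with `μ ∘ T = μ`. -/
def RepHtpy.GaugeEquivalent (D D' : RepHtpy 𝒢 E C) : Prop :=
  ∃ T : GrCochain 𝒢 E C ≃ₗ[ℝ] GrCochain 𝒢 E C,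
    IsModuleIso T ∧ (∀ x, mu (T x) = mu x) ∧ ∀ x, T (D.op x) = D'.op (T x)

theorem isModuleIso_refl : IsModuleIso (LinearEquiv.refl ℝ (GrCochain 𝒢 E C)) :=
  ⟨fun _ h => h, fun _ h => h, fun _ _ => Iff.rfl, fun _ _ _ => rfl, fun _ => Iff.rfl⟩

theorem IsModuleIso.symm {T : GrCochain 𝒢 E C ≃ₗ[ℝ] GrCochain 𝒢 E' C'} (h : IsModuleIso T) :
    IsModuleIso T.symm where
  continuous := h.continuous_symm
  continuous_symm := h.continuous
  degree x p := by rw [← h.degree, T.apply_symm_apply]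
  act x q f := by rw [LinearEquiv.symm_apply_eq, h.act, T.apply_symm_apply]
  normalized x := by rw [← h.normalized, T.apply_symm_apply]

theorem IsModuleIso.trans {E'' C'' : VecBun.{v} J M}
    {T : GrCochain 𝒢 E C ≃ₗ[ℝ] GrCochain 𝒢 E' C'}
    {S : GrCochain 𝒢 E' C' ≃ₗ[ℝ] GrCochain 𝒢 E'' C''}
    (h : IsModuleIso T) (k : IsModuleIso S) : IsModuleIso (T.trans S) where
  continuous x hx := k.continuous _ (h.continuous x hx)
  continuous_symm x hx := h.continuous_symm _ (k.continuous_symm x hx)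
  degree x p := (k.degree _ _).trans (h.degree _ _)
  act x q f := by simp only [LinearEquiv.trans_apply, h.act, k.act]
  normalized x := (k.normalized _).trans (h.normalized _)

variable (𝒢 E C) in
/-- Gauge equivalence of representations up to homotopy on `E ⊕ C[1]`. -/
def gaugeSetoid : Setoid (RepHtpy 𝒢 E C) where
  r := RepHtpy.GaugeEquivalent
  iseqv :=
    { refl := fun _ => ⟨LinearEquiv.refl ℝ _, isModuleIso_refl, fun _ => rfl, fun _ => rfl⟩
      symm := by
        rintro D D' ⟨T, hT, hm, hD⟩
        refine ⟨T.symm, hT.symm, fun x => ?_, fun x => ?_⟩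
        · rw [← hm, T.apply_symm_apply]
        · rw [LinearEquiv.symm_apply_eq, hD, T.apply_symm_apply]
      trans := by
        rintro D D' D'' ⟨T, hT, hm, hD⟩ ⟨S, hS, hm', hD'⟩
        refine ⟨T.trans S, hT.trans hS, fun x => ?_, fun x => ?_⟩
        · simp only [LinearEquiv.trans_apply, hm', hm]
        · simp only [LinearEquiv.trans_apply, hD, hD'] }

variable (𝒢) in
/-- A 2-term representation up to homotopy of `G`: two vector bundles `E`, `C` over `M` and a
representation up to homotopy on `E ⊕ C[1]`. -/
structure TwoTermRep where
  E : VecBun.{v} J M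
  C : VecBun.{v} J M
  rep : RepHtpy 𝒢 E C

variable (𝒢) in
/-- Isomorphism of 2-term representations up to homotopy of `G`. -/
def repSetoid : Setoid (TwoTermRep.{v} 𝒢) where
  r R R' := R.rep.Isomorphic R'.rep
  iseqv :=
    { refl := fun _ => ⟨LinearEquiv.refl ℝ _, isModuleIso_refl, fun _ => rfl⟩
      symm := by
        rintro R R' ⟨T, hT, hD⟩
        refine ⟨T.symm, hT.symm, fun x => ?_⟩
        rw [LinearEquiv.symm_apply_eq, hD, T.apply_symm_apply]
      trans := by
        rintro R R' R'' ⟨T, hT, hD⟩ ⟨S, hS, hD'⟩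
        refine ⟨T.trans S, hT.trans hS, fun x => ?_⟩
        simp only [LinearEquiv.trans_apply, hD, hD'] }

end Graded

/-! ## `VB`-groupoids -/

variable (𝒢) in
/-- A `VB`-groupoid over `G ⇉ M` with side bundle `E`: a vector bundle `bun → G` with a Lie groupoid
structure on its total space over the total space of `E`, such that source and target are morphisms
of vector bundles (over `s` and `t`), the bundle projections form a morphism of Lie groupoids, and
the interchange law holds. -/
structure VBGroupoid (E : VecBun.{v} J M) where
  bun : VecBun.{v} I G
  gpd : LieGroupoid bun.tModel bun.Tot E.tModel E.Tot
  srcL : ∀ g, bun.fiber g →ₗ[ℝ] E.fiber (𝒢.src g)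
  tgtL : ∀ g, bun.fiber g →ₗ[ℝ] E.fiber (𝒢.tgt g)
  src_eq : ∀ γ : bun.Tot, gpd.src γ = E.pt (𝒢.src γ.proj) (srcL γ.proj γ.snd)
  tgt_eq : ∀ γ : bun.Tot, gpd.tgt γ = E.pt (𝒢.tgt γ.proj) (tgtL γ.proj γ.snd)
  proj_mul : ∀ (γ₁ γ₂ : bun.Tot) (w : gpd.src γ₁ = gpd.tgt γ₂)
    (w' : 𝒢.src γ₁.proj = 𝒢.tgt γ₂.proj),
    (gpd.mul γ₁ γ₂ w).proj = 𝒢.mul γ₁.proj γ₂.proj w'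
  /-- `(γ₁ + γ₃)(γ₂ + γ₄) = γ₁γ₂ + γ₃γ₄`, where `b = γ₁γ₂` and `b' = γ₃γ₄`. -/
  interchange : ∀ (g₁ g₂ g : G) (γ₁ γ₃ : bun.fiber g₁) (γ₂ γ₄ : bun.fiber g₂) (b b' : bun.fiber g)
    (w₁ : gpd.src (bun.pt g₁ γ₁) = gpd.tgt (bun.pt g₂ γ₂))
    (w₃ : gpd.src (bun.pt g₁ γ₃) = gpd.tgt (bun.pt g₂ γ₄))
    (w : gpd.src (bun.pt g₁ (γ₁ + γ₃)) = gpd.tgt (bun.pt g₂ (γ₂ + γ₄))),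
    gpd.mul (bun.pt g₁ γ₁) (bun.pt g₂ γ₂) w₁ = bun.pt g b →
    gpd.mul (bun.pt g₁ γ₃) (bun.pt g₂ γ₄) w₃ = bun.pt g b' →
    gpd.mul (bun.pt g₁ (γ₁ + γ₃)) (bun.pt g₂ (γ₂ + γ₄)) w = bun.pt g (b + b')

section VB

variable {E E' E'' C : VecBun.{v} J M}

/-- An isomorphism of `VB`-groupoids over `G` (covering the identity of `G`). -/
structure VBGroupoidIso (Γ : VBGroupoid 𝒢 E) (Γ' : VBGroupoid 𝒢 E') where
  top : VecBunIso Γ.bun Γ'.bun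
  side : VecBunIso E E'
  map_src : ∀ γ, Γ'.gpd.src (top.total γ) = side.total (Γ.gpd.src γ)
  map_tgt : ∀ γ, Γ'.gpd.tgt (top.total γ) = side.total (Γ.gpd.tgt γ)
  map_mul : ∀ γ₁ γ₂ (w : Γ.gpd.src γ₁ = Γ.gpd.tgt γ₂)
    (w' : Γ'.gpd.src (top.total γ₁) = Γ'.gpd.tgt (top.total γ₂)),
    top.total (Γ.gpd.mul γ₁ γ₂ w) = Γ'.gpd.mul (top.total γ₁) (top.total γ₂) w'

/-- The identity. -/
def VBGroupoidIso.refl (Γ : VBGroupoid 𝒢 E) : VBGroupoidIso Γ Γ where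
  top := VecBunIso.refl _
  side := VecBunIso.refl _
  map_src _ := rfl
  map_tgt _ := rfl
  map_mul _ _ _ _ := rfl

/-- The inverse isomorphism. -/
def VBGroupoidIso.symm {Γ : VBGroupoid 𝒢 E} {Γ' : VBGroupoid 𝒢 E'} (Φ : VBGroupoidIso Γ Γ') :
    VBGroupoidIso Γ' Γ where
  top := Φ.top.symm
  side := Φ.side.symm
  map_src γ := by
    have h := Φ.map_src (Φ.top.symm.total γ)
    rw [VecBunIso.total_total_symm] at h
    rw [h, VecBunIso.total_symm_total]
  map_tgt γ := by
    have h := Φ.map_tgt (Φ.top.symm.total γ)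
    rw [VecBunIso.total_total_symm] at h
    rw [h, VecBunIso.total_symm_total]
  map_mul γ₁ γ₂ w w' := by
    have h := Φ.map_mul (Φ.top.symm.total γ₁) (Φ.top.symm.total γ₂) w'
      (by rw [VecBunIso.total_total_symm, VecBunIso.total_total_symm]; exact w)
    simp only [VecBunIso.total_total_symm] at h
    rw [← h, VecBunIso.total_symm_total]

/-- The composite isomorphism. -/
def VBGroupoidIso.trans {Γ : VBGroupoid 𝒢 E} {Γ' : VBGroupoid 𝒢 E'} {Γ'' : VBGroupoid 𝒢 E''}
    (Φ : VBGroupoidIso Γ Γ') (Ψ : VBGroupoidIso Γ' Γ'') : VBGroupoidIso Γ Γ'' where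
  top := Φ.top.trans Ψ.top
  side := Φ.side.trans Ψ.side
  map_src γ := by simp only [VecBunIso.total_trans, Ψ.map_src, Φ.map_src]
  map_tgt γ := by simp only [VecBunIso.total_trans, Ψ.map_tgt, Φ.map_tgt]
  map_mul γ₁ γ₂ w w' := by
    simp only [VecBunIso.total_trans]
    rw [Φ.map_mul γ₁ γ₂ w (by rw [Φ.map_src, Φ.map_tgt, w]), Ψ.map_mul]

/-- An identification of the vector bundle `C → M` with the (right-)core of `Γ`, the bundle whose
fibre at `x` is the kernel of the source map `Γ_{1_x} → E_x`: a smooth injective bundle map onto the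
core. -/
structure CoreIdent (Γ : VBGroupoid 𝒢 E) (C : VecBun.{v} J M) where
  incl : ∀ x, C.fiber x →ₗ[ℝ] Γ.bun.fiber (𝒢.one x)
  injective : ∀ x, Function.Injective (incl x)
  range_eq : ∀ x, LinearMap.range (incl x) = LinearMap.ker (Γ.srcL (𝒢.one x))
  smooth : ContMDiff C.tModel Γ.bun.tModel ∞
    (fun c : C.Tot => Γ.bun.pt (𝒢.one c.proj) (incl c.proj c.snd))

/-- A right-horizontal lift: a smooth bundle map `h : s^*E → Γ` over `G` which is a section of
`Γ → s^*E` and satisfies `h(e, 1_x) = 1_e`. -/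
structure HorLift (Γ : VBGroupoid 𝒢 E) where
  lift : ∀ g, E.fiber (𝒢.src g) →ₗ[ℝ] Γ.bun.fiber g
  src_lift : ∀ g e, Γ.srcL g (lift g e) = e
  lift_one : ∀ x (e : E.fiber (𝒢.src (𝒢.one x))),
    Γ.gpd.one (E.pt (𝒢.src (𝒢.one x)) e) = Γ.bun.pt (𝒢.one x) (lift (𝒢.one x) e)
  /-- Smoothness on the manifold `s^*E`, tested along smooth maps `ℝᵏ → s^*E`. -/
  smooth : ∀ (k : ℕ) (u : EuclideanSpace ℝ (Fin k) → G) (e : ∀ z, E.fiber (𝒢.src (u z))),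
    ContMDiff (𝓡 k) I ∞ u → ContMDiff (𝓡 k) E.tModel ∞ (fun z => E.pt (𝒢.src (u z)) (e z)) →
      ContMDiff (𝓡 k) Γ.bun.tModel ∞ (fun z => Γ.bun.pt (u z) (lift (u z) (e z)))

variable {Γ : VBGroupoid 𝒢 E}

/-- Composability in `Γ` implies composability in `G`. -/
theorem VBGroupoid.base_comp (Γ : VBGroupoid 𝒢 E) {γ₁ γ₂ : Γ.bun.Tot}
    (w : Γ.gpd.src γ₁ = Γ.gpd.tgt γ₂) : 𝒢.src γ₁.proj = 𝒢.tgt γ₂.proj := by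
  rw [Γ.src_eq, Γ.tgt_eq] at w
  exact congrArg Bundle.TotalSpace.proj w

/-- The product `γ₁ γ₂` as an element of the fibre of `Γ` at `g`, where `g` is the product of the
base points. -/
def VBGroupoid.mulAt (Γ : VBGroupoid 𝒢 E) (γ₁ γ₂ : Γ.bun.Tot)
    (w : Γ.gpd.src γ₁ = Γ.gpd.tgt γ₂) {g : G}
    (hg : 𝒢.mul γ₁.proj γ₂.proj (Γ.base_comp w) = g) : Γ.bun.fiber g :=
  Γ.bun.fiberAt (Γ.gpd.mul γ₁ γ₂ w) ((Γ.proj_mul γ₁ γ₂ w _).trans hg)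

theorem pt_zero_congr (E : VecBun.{v} J M) {x y : M} (h : x = y) : E.pt x 0 = E.pt y 0 := by
  subst h; rfl

theorem one_mul_of_eq (𝒢 : LieGroupoid I G J M) {g : G} {x : M} (h : 𝒢.tgt g = x)
    (w : 𝒢.src (𝒢.one x) = 𝒢.tgt g) : 𝒢.mul (𝒢.one x) g w = g := by
  subst h; exact 𝒢.one_mul g

theorem mul_one_of_eq (𝒢 : LieGroupoid I G J M) {g : G} {x : M} (h : 𝒢.src g = x)
    (w : 𝒢.src g = 𝒢.tgt (𝒢.one x)) : 𝒢.mul g (𝒢.one x) w = g := by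
  subst h; exact 𝒢.mul_one g

namespace CoreIdent

/-- A core element at `x` as an element of `Γ`. -/
def core (κ : CoreIdent Γ C) (x : M) (c : C.fiber x) : Γ.bun.Tot :=
  Γ.bun.pt (𝒢.one x) (κ.incl x c)

theorem src_core (κ : CoreIdent Γ C) (x : M) (c : C.fiber x) :
    Γ.gpd.src (κ.core x c) = E.pt x 0 := by
  have h : κ.incl x c ∈ LinearMap.ker (Γ.srcL (𝒢.one x)) := by
    rw [← κ.range_eq]; exact ⟨c, rfl⟩
  rw [Γ.src_eq]
  exact (congrArg (E.pt _) (LinearMap.mem_ker.1 h)).trans (pt_zero_congr E (𝒢.src_one x))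

/-- The element `c · 0_g` of the fibre of `Γ` at `g`, for `c` in the core at `t(g)`. -/
def mulZero (κ : CoreIdent Γ C) (g : G) (c : C.fiber (𝒢.tgt g)) : Γ.bun.fiber g :=
  Γ.mulAt (κ.core (𝒢.tgt g) c) (Γ.bun.pt g 0)
    (by rw [κ.src_core, Γ.tgt_eq]; simp) (𝒢.one_mul g)

/-- The core-anchor `∂ : C → E`, `∂c = t(c)`. -/
def anchor (κ : CoreIdent Γ C) (x : M) (c : C.fiber x) : E.fiber x :=
  E.fiberAt (Γ.gpd.tgt (κ.core x c)) (by rw [Γ.tgt_eq]; exact 𝒢.tgt_one x)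

end CoreIdent

namespace HorLift

/-- The horizontal lift of `e` at `g` as an element of `Γ`. -/
def hor (h : HorLift Γ) (g : G) (e : E.fiber (𝒢.src g)) : Γ.bun.Tot := Γ.bun.pt g (h.lift g e)

theorem src_hor (h : HorLift Γ) (g : G) (e : E.fiber (𝒢.src g)) :
    Γ.gpd.src (h.hor g e) = E.pt (𝒢.src g) e := by
  rw [Γ.src_eq]; exact congrArg (E.pt _) (h.src_lift g e)

/-- The side quasi-action `Δ^E_g e = t(h_g(e))`. -/
def sideAct (h : HorLift Γ) (g : G) (e : E.fiber (𝒢.src g)) : E.fiber (𝒢.tgt g) :=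
  Γ.tgtL g (h.lift g e)

/-- The element `h_g(∂c) · c` of the fibre of `Γ` at `g`, for `c` in the core at `s(g)`. -/
def mulCore (h : HorLift Γ) (κ : CoreIdent Γ C) (g : G) (c : C.fiber (𝒢.src g)) : Γ.bun.fiber g :=
  Γ.mulAt (h.hor g (κ.anchor _ c)) (κ.core _ c)
    (by rw [h.src_hor]; exact E.pt_fiberAt _ _) (𝒢.mul_one g)

/-- The element `h_{g₁}(Δ^E_{g₂} e) · h_{g₂}(e)` of the fibre of `Γ` at `g₁g₂`. -/
def mulHor (h : HorLift Γ) (g₁ g₂ : G) (w : 𝒢.src g₁ = 𝒢.tgt g₂) (e : E.fiber (𝒢.src g₂)) :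
    Γ.bun.fiber (𝒢.mul g₁ g₂ w) :=
  Γ.mulAt (h.hor g₁ (E.fiberAt (E.pt _ (h.sideAct g₂ e)) w.symm)) (h.hor g₂ e)
    (by rw [h.src_hor, Γ.tgt_eq]; exact E.pt_fiberAt _ _) rfl

/-- The lift `h_{g₁g₂}(e)`, for `e` in the fibre of `E` at `s(g₂)`. -/
def liftMul (h : HorLift Γ) (g₁ g₂ : G) (w : 𝒢.src g₁ = 𝒢.tgt g₂) (e : E.fiber (𝒢.src g₂)) :
    Γ.bun.fiber (𝒢.mul g₁ g₂ w) :=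
  h.lift _ (E.fiberAt (E.pt _ e) (𝒢.src_mul g₁ g₂ w).symm)

end HorLift

/-- `D` is the representation up to homotopy `D_h` of `Γ` and the horizontal lift `h`, where `C` is
identified with the core of `Γ` by `κ`. Its components `(Δ^C, Δ^E, ∂, Ω)`, which are read off from
the action of `D` on the sections `ε` of `E` and `α` of `C`,
`Dε = (Δ^E_g ε_{s(g)} - ε_{t(g)}) + Ω_{g₁,g₂} ε_{s(g₂)}` and
`Dα = ∂α + (α_{t(g)} - Δ^C_g α_{s(g)})`, are
`∂c = t(c)`, `Δ^E_g e = t(h_g(e))`, `Δ^C_g c = h_g(∂c) · c · 0_{g⁻¹}` and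
`Ω_{g₁,g₂} e = (h_{g₁g₂}(e) - h_{g₁}(Δ^E_{g₂} e) · h_{g₂}(e)) · 0_{(g₁g₂)⁻¹}`.
In the last two formulas `0_{g⁻¹}` is moved to the other side: right multiplication by `0_g` is a
bijection from the core at `t(g)` to the kernel of the source map on the fibre at `g`. -/
structure IsInduced (κ : CoreIdent Γ C) (h : HorLift Γ) (D : RepHtpy 𝒢 E C) : Prop where
  core_anchor : ∀ (α : Cochain 𝒢 C 0) (x : M),
    atPoint ((D.op (inC α)).1 0) x = κ.anchor x (atPoint α x)
  core_act : ∀ (α : Cochain 𝒢 C 0) (g : G),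
    κ.mulZero g (atPoint α (𝒢.tgt g) - atEdge ((D.op (inC α)).2 1) g) =
      h.mulCore κ g (atPoint α (𝒢.src g))
  side_act : ∀ (ε : Cochain 𝒢 E 0) (g : G),
    atEdge ((D.op (inE ε)).1 1) g + atPoint ε (𝒢.tgt g) = h.sideAct g (atPoint ε (𝒢.src g))
  omega : ∀ (ε : Cochain 𝒢 E 0) (g₁ g₂ : G) (w : 𝒢.src g₁ = 𝒢.tgt g₂),
    κ.mulZero (𝒢.mul g₁ g₂ w) (atPair ((D.op (inE ε)).2 2) g₁ g₂ w) =
      h.liftMul g₁ g₂ w (atPoint ε (𝒢.src g₂)) - h.mulHor g₁ g₂ w (atPoint ε (𝒢.src g₂))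

variable (𝒢 E C) in
/-- A `VB`-groupoid over `G` with side bundle `E` and core identified with `C`. -/
structure FramedVBGroupoid where
  vb : VBGroupoid 𝒢 E
  core : CoreIdent vb C

variable (𝒢 E C) in
/-- Isomorphism of `VB`-groupoids with side bundle `E` and core `C`: an isomorphism of
`VB`-groupoids over `G` that induces the identity on `E` and on `C`. -/
def framedSetoid : Setoid (FramedVBGroupoid 𝒢 E C) where
  r Γ Γ' := ∃ Φ : VBGroupoidIso Γ.vb Γ'.vb, (∀ e, Φ.side.total e = e) ∧
    ∀ x c, Φ.top.total (Γ.core.core x c) = Γ'.core.core x c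
  iseqv :=
    { refl := fun _ => ⟨VBGroupoidIso.refl _, fun _ => rfl, fun _ _ => rfl⟩
      symm := by
        rintro Γ Γ' ⟨Φ, hs, hc⟩
        refine ⟨Φ.symm, fun e => ?_, fun x c => ?_⟩
        · have := Φ.side.total_symm_total e
          rwa [hs] at this
        · rw [← hc]; exact Φ.top.total_symm_total _
      trans := by
        rintro Γ Γ' Γ'' ⟨Φ, hs, hc⟩ ⟨Ψ, hs', hc'⟩
        refine ⟨Φ.trans Ψ, fun e => ?_, fun x c => ?_⟩
        · exact (congrArg _ (hs e)).trans (hs' e)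
        · exact (congrArg _ (hc x c)).trans (hc' x c) }

variable (𝒢) in
/-- A `VB`-groupoid over `G`, with an arbitrary side bundle. -/
structure SomeVBGroupoid where
  E : VecBun.{v} J M
  vb : VBGroupoid 𝒢 E

variable (𝒢) in
/-- Isomorphism of `VB`-groupoids over `G`. -/
def vbSetoid : Setoid (SomeVBGroupoid.{v} 𝒢) where
  r Γ Γ' := Nonempty (VBGroupoidIso Γ.vb Γ'.vb)
  iseqv :=
    { refl := fun _ => ⟨VBGroupoidIso.refl _⟩
      symm := fun ⟨Φ⟩ => ⟨Φ.symm⟩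
      trans := fun ⟨Φ⟩ ⟨Ψ⟩ => ⟨Φ.trans Ψ⟩ }

end VB

end Groupoids

end

end VBG

/-! A horizontal lift h splits a `VB`-groupoid. Every element over an arrow g from x to y is a · 0_g
+ h_g(e) for a unique pair (a, e) in C_y × E_x, because the elements of source zero are exactly the
products a · 0_g with a in the core. In these coordinates the source is e, the target is ∂a + Δ^E_g
e, and the interchange law forces the product (a₁, ∂a₂ + Δ^E_k e₂)(a₂, e₂) = (a₁ + Δ^C_g a₂ -
Ω_{g,k} e₂, e₂). So the groupoid is encoded by the four families ∂, Δ^E, Δ^C, Ω. The target of a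
product and the associativity law translate into four structure equations (`Comp.Flat`). Conversely,
four families that satisfy them and are normalized at the units define a `VB`-groupoid on t^*C ⊕
s^*E (`Comp.Flat.vb`).

The same four families describe a representation up to homotopy. By the Leibniz rule and continuity,
D is determined by its values on sections of E and C (`eq_of_leibniz`). For degree reasons each
value has two components. After an alternating sum of faces is subtracted where needed, each
component is linear over functions of the final vertex, hence given by fibrewise linear maps
(`RepHtpy.exists_comp`). Since δ² = 0, D² commutes with the action of functions, so D² = 0 has to be
tested on sections only, where it becomes the same four equations (`Comp.flat_iff`).

Isomorphisms correspond as well. In either setting an isomorphism amounts to bundle isomorphisms E ≅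
E' and C ≅ C' with a family τ_g : E_x → C'_y, normalized at units, subject to the same equations
(`CompIso`). For module maps τ is the off-diagonal component (`isomorphic_iff`); for `VB`-groupoids
it measures how far the isomorphism is from matching the chosen lifts
(`nonempty_vbGroupoidIso_iff`). A change of the lift of a fixed Γ is therefore a gauge
transformation, and every gauge-equivalent D arises by pulling back a lift
(`isInduced_of_gaugeEquivalent`).

What remains is existence. The source of Γ is a submersion of total spaces, and differentiation at a
zero vector shows that it is fibrewise surjective (`VBGroupoid.srcL_surjective`). So local lifts
exist and a partition of unity glues them (`exists_horLift`), and the core is a kernel of constant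
rank (`VBGroupoid.exists_coreIdent`). Smoothness on G⁽ᵖ⁾ and s^*E is tested along smooth maps from
ℝᵏ, and continuity of operators through smooth curves of cochains. -/

namespace VBG

noncomputable section

open Filter Topology

/-! ### Smooth families of vectors and local frames -/

section Families

variable {EB HB : Type*} [NormedAddCommGroup EB] [NormedSpace ℝ EB] [TopologicalSpace HB]
  {J : ModelWithCorners ℝ EB HB} {B : Type*} [TopologicalSpace B] [ChartedSpace HB B]
  {EN HN : Type*} [NormedAddCommGroup EN] [NormedSpace ℝ EN] [TopologicalSpace HN]
  {IN : ModelWithCorners ℝ EN HN} {N : Type*} [TopologicalSpace N] [ChartedSpace HN N]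

/-- Transport of vectors along an equality of base points. -/
def VecBun.tr (A : VecBun.{v} J B) {x y : B} (h : x = y) : A.fiber x ≃ₗ[ℝ] A.fiber y :=
  h ▸ LinearEquiv.refl ℝ _

theorem VecBun.pt_tr (A : VecBun.{v} J B) {x y : B} (h : x = y) (a : A.fiber x) :
    A.pt y (A.tr h a) = A.pt x a := by subst h; rfl

@[simp] theorem VecBun.tr_tr (A : VecBun.{v} J B) {x y z : B} (h : x = y) (k : y = z)
    (a : A.fiber x) : A.tr k (A.tr h a) = A.tr (h.trans k) a := by subst h; subst k; rfl

theorem VecBun.fiberAt_pt (A : VecBun.{v} J B) {x y : B} (h : x = y) (a : A.fiber x) :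
    A.fiberAt (A.pt x a) h = A.tr h a := by subst h; rfl

theorem VecBun.pt_inj (A : VecBun.{v} J B) {x : B} {a b : A.fiber x} :
    A.pt x a = A.pt x b ↔ a = b :=
  ⟨fun h => by simpa using h, fun h => h ▸ rfl⟩

theorem VecBun.smoothAt_add (A : VecBun.{v} J B) {x : N → B} {z : N}
    {a b : ∀ z, A.fiber (x z)}
    (ha : ContMDiffAt IN A.tModel ∞ (fun z => A.pt (x z) (a z)) z)
    (hb : ContMDiffAt IN A.tModel ∞ (fun z => A.pt (x z) (b z)) z) :
    ContMDiffAt IN A.tModel ∞ (fun z => A.pt (x z) (a z + b z)) z := by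
  have h1 := Bundle.contMDiffAt_totalSpace.1 ha
  have h2 := Bundle.contMDiffAt_totalSpace.1 hb
  refine Bundle.contMDiffAt_totalSpace.2 ⟨h1.1, (h1.2.add h2.2).congr_of_eventuallyEq ?_⟩
  have hx : ContinuousAt x z := h1.1.continuousAt
  filter_upwards [hx.preimage_mem_nhds ((trivializationAt A.model A.fiber (x z)).open_baseSet.mem_nhds
    (FiberBundle.mem_baseSet_trivializationAt A.model A.fiber (x z)))] with y hy
  exact ((trivializationAt A.model A.fiber (x z)).linear ℝ hy).map_add _ _

theorem VecBun.smoothAt_smul (A : VecBun.{v} J B) {x : N → B} {z : N}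
    {f : N → ℝ} {a : ∀ z, A.fiber (x z)} (hf : ContMDiffAt IN 𝓘(ℝ, ℝ) ∞ f z)
    (ha : ContMDiffAt IN A.tModel ∞ (fun z => A.pt (x z) (a z)) z) :
    ContMDiffAt IN A.tModel ∞ (fun z => A.pt (x z) (f z • a z)) z := by
  have h1 := Bundle.contMDiffAt_totalSpace.1 ha
  refine Bundle.contMDiffAt_totalSpace.2 ⟨h1.1, (hf.smul h1.2).congr_of_eventuallyEq ?_⟩
  have hx : ContinuousAt x z := h1.1.continuousAt
  filter_upwards [hx.preimage_mem_nhds ((trivializationAt A.model A.fiber (x z)).open_baseSet.mem_nhds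
    (FiberBundle.mem_baseSet_trivializationAt A.model A.fiber (x z)))] with y hy
  exact ((trivializationAt A.model A.fiber (x z)).linear ℝ hy).map_smul _ _

theorem VecBun.smoothAt_zero (A : VecBun.{v} J B) {x : N → B} {z : N}
    (hx : ContMDiffAt IN J ∞ x z) :
    ContMDiffAt IN A.tModel ∞ (fun z => A.pt (x z) 0) z :=
  ((Bundle.contMDiff_zeroSection ℝ A.fiber).contMDiffAt (x := x z)).comp z hx

theorem VecBun.smoothAt_neg (A : VecBun.{v} J B) {x : N → B} {z : N} {a : ∀ z, A.fiber (x z)}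
    (ha : ContMDiffAt IN A.tModel ∞ (fun z => A.pt (x z) (a z)) z) :
    ContMDiffAt IN A.tModel ∞ (fun z => A.pt (x z) (-a z)) z := by
  have := A.smoothAt_smul (contMDiffAt_const (c := (-1 : ℝ))) ha
  simpa using this

theorem VecBun.smoothAt_sub (A : VecBun.{v} J B) {x : N → B} {z : N}
    {a b : ∀ z, A.fiber (x z)}
    (ha : ContMDiffAt IN A.tModel ∞ (fun z => A.pt (x z) (a z)) z)
    (hb : ContMDiffAt IN A.tModel ∞ (fun z => A.pt (x z) (b z)) z) :
    ContMDiffAt IN A.tModel ∞ (fun z => A.pt (x z) (a z - b z)) z := by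
  simpa only [sub_eq_add_neg] using A.smoothAt_add ha (A.smoothAt_neg hb)

theorem VecBun.smoothAt_sum (A : VecBun.{v} J B) {ι : Type*} (s : Finset ι) {x : N → B} {z : N}
    {a : ι → ∀ z, A.fiber (x z)} (hx : ContMDiffAt IN J ∞ x z)
    (ha : ∀ i ∈ s, ContMDiffAt IN A.tModel ∞ (fun z => A.pt (x z) (a i z)) z) :
    ContMDiffAt IN A.tModel ∞ (fun z => A.pt (x z) (∑ i ∈ s, a i z)) z := by
  classical
  induction s using Finset.induction_on with
  | empty => simpa using A.smoothAt_zero hx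
  | insert i s hi ih =>
    simp only [Finset.sum_insert hi]
    exact A.smoothAt_add (ha i (Finset.mem_insert_self i s))
      (ih fun j hj => ha j (Finset.mem_insert_of_mem hj))

/-- Global sections and fibrewise linear functions which form dual frames near the point `x₀`. -/
structure VecBun.Frame (A : VecBun.{v} J B) (x₀ : B) where
  rank : ℕ
  sec : Fin rank → ∀ y, A.fiber y
  coord : Fin rank → ∀ y, A.fiber y →ₗ[ℝ] ℝ
  bump : B → ℝ
  smooth_sec : ∀ i, ContMDiff J A.tModel ∞ (fun y => A.pt y (sec i y))
  smooth_coord : ∀ i, ContMDiff A.tModel 𝓘(ℝ, ℝ) ∞ (fun a : A.Tot => coord i a.proj a.snd)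
  smooth_bump : ContMDiff J 𝓘(ℝ, ℝ) ∞ bump
  bump_eq : ∀ᶠ y in 𝓝 x₀, bump y = 1
  expand : ∀ y a, ∑ i, coord i y a • sec i y = bump y • a
  coord_sec : ∀ i j, coord i x₀ (sec j x₀) = if i = j then 1 else 0

/-- The local frame of a trivialization and its dual coordinates are multiplied by a bump function ψ
supported in the base set, so that both extend by zero to global smooth objects. Each contributes
one factor ψ, which is why `bump` is ψ² and vectors are reconstructed exactly only where ψ² = 1. -/
theorem VecBun.exists_frame [FiniteDimensional ℝ EB] [T2Space B] [IsManifold J ∞ B]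
    (A : VecBun.{v} J B) (x₀ : B) : ∃ F : A.Frame x₀, F.rank = Module.finrank ℝ A.model := by
  classical
  set e := trivializationAt A.model A.fiber x₀ with he
  have hx₀ : x₀ ∈ e.baseSet := FiberBundle.mem_baseSet_trivializationAt A.model A.fiber x₀
  let b := Module.finBasis ℝ A.model
  obtain ⟨ψ, -, hψ⟩ := (SmoothBumpFunction.nhds_basis_tsupport (I := J) x₀).mem_iff.1
    (e.open_baseSet.mem_nhds hx₀)
  -- Off the base set ψ vanishes on a whole neighbourhood, so the extensions by zero are trivially
  -- smooth there.
  have hoff : ∀ y, y ∉ e.baseSet → ∀ᶠ y' in 𝓝 y, ψ y' = 0 := fun y hy =>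
    notMem_tsupport_iff_eventuallyEq.1 fun h => hy (hψ h)
  have hrepr : ∀ y (hy : y ∈ e.baseSet) (a : A.fiber y),
      ∑ i, b.repr (e.linearMapAt ℝ y a) i • e.localFrame b i y = a := by
    intro y hy a
    have h1 := (e.basisAt b hy).sum_repr a
    refine Eq.trans (Finset.sum_congr rfl fun i _ => ?_) h1
    rw [e.localFrame_apply_of_mem_baseSet b hy]
    congr 1
    simp [Bundle.Trivialization.basisAt, Bundle.Trivialization.linearMapAt_apply, hy]
  refine ⟨{
    rank := Module.finrank ℝ A.model
    sec := fun i y => ψ y • e.localFrame b i y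
    coord := fun i y => ψ y • (b.coord i ∘ₗ e.linearMapAt ℝ y)
    bump := fun y => ψ y * ψ y
    smooth_sec := ?_
    smooth_coord := ?_
    smooth_bump := ψ.contMDiff.mul ψ.contMDiff
    bump_eq := ?_
    expand := ?_
    coord_sec := ?_ }, rfl⟩
  · intro i y
    by_cases hy : y ∈ e.baseSet
    · exact A.smoothAt_smul (ψ.contMDiff y) (contMDiffAt_localFrame_of_mem ∞ e b i hy)
    · refine (A.smoothAt_zero (x := fun y => y) contMDiffAt_id).congr_of_eventuallyEq ?_
      filter_upwards [hoff y hy] with y' hy'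
      simp [hy']
  · intro i a
    by_cases hy : a.proj ∈ e.baseSet
    · have h1 : ContMDiffAt A.tModel 𝓘(ℝ, A.model) ∞ (fun a : A.Tot => (e a).2) a :=
        ((Bundle.Trivialization.contMDiffAt_iff (e := e) (IB := J) (n := ∞) (f := fun a : A.Tot => a) (x₀ := a) (e.mem_source.2 hy)).1 contMDiffAt_id).2
      have h2 : ContMDiffAt A.tModel 𝓘(ℝ, ℝ) ∞ (fun a : A.Tot => b.coord i (e a).2) a := by
        have h3 : ContMDiffAt 𝓘(ℝ, A.model) 𝓘(ℝ, ℝ) ∞ (LinearMap.toContinuousLinearMap (b.coord i))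
            (e a).2 := (ContinuousLinearMap.contDiff _).contMDiff.contMDiffAt
        exact h3.comp a h1
      have h4 : ContMDiffAt A.tModel 𝓘(ℝ, ℝ) ∞ (fun a : A.Tot => ψ a.proj) a :=
        ψ.contMDiffAt.comp a (Bundle.contMDiff_proj A.fiber a)
      refine (h4.mul h2).congr_of_eventuallyEq ?_
      have hc : ContinuousAt (fun a : A.Tot => a.proj) a := (FiberBundle.continuous_proj A.model A.fiber).continuousAt
      filter_upwards [hc.preimage_mem_nhds (e.open_baseSet.mem_nhds hy)] with a' ha'
      have : e.linearMapAt ℝ a'.proj a'.snd = (e a').2 := by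
        rw [e.linearMapAt_apply, if_pos (show a'.proj ∈ e.baseSet from ha')]
      simp [this]
    · refine (contMDiffAt_const (c := (0 : ℝ))).congr_of_eventuallyEq ?_
      have hc : ContinuousAt (fun a : A.Tot => a.proj) a := (FiberBundle.continuous_proj A.model A.fiber).continuousAt
      filter_upwards [hc.eventually (hoff _ hy)] with a' ha'
      simp [ha']
  · filter_upwards [ψ.eventuallyEq_one] with y hy
    simp [hy]
  · intro y a
    by_cases hy : y ∈ e.baseSet
    · have := hrepr y hy a
      conv_rhs => rw [← this]
      rw [Finset.smul_sum]
      refine Finset.sum_congr rfl fun i _ => ?_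
      simp only [LinearMap.smul_apply, LinearMap.comp_apply, Module.Basis.coord_apply, smul_eq_mul, smul_smul]
      ring_nf
    · have : ψ y = 0 := (hoff y hy).self_of_nhds
      simp [this]
  · intro i j
    have h1 : ψ x₀ = 1 := ψ.eq_one
    simp only [h1, one_smul, LinearMap.comp_apply, e.localFrame_apply_of_mem_baseSet b hx₀]
    simp [Bundle.Trivialization.basisAt, Finsupp.single_apply, hx₀, eq_comm]

theorem VecBun.Frame.smoothAt_coord {A : VecBun.{v} J B} {x₀ : B} (F : A.Frame x₀) (i : Fin F.rank)
    {x : N → B} {z : N} {a : ∀ z, A.fiber (x z)}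
    (ha : ContMDiffAt IN A.tModel ∞ (fun z => A.pt (x z) (a z)) z) :
    ContMDiffAt IN 𝓘(ℝ, ℝ) ∞ (fun z => F.coord i (x z) (a z)) z :=
  ((F.smooth_coord i).contMDiffAt (x := A.pt (x z) (a z))).comp z ha

theorem VecBun.Frame.smoothAt_sec {A : VecBun.{v} J B} {x₀ : B} (F : A.Frame x₀) (i : Fin F.rank)
    {x : N → B} {z : N} (hx : ContMDiffAt IN J ∞ x z) :
    ContMDiffAt IN A.tModel ∞ (fun z => A.pt (x z) (F.sec i (x z))) z :=
  ((F.smooth_sec i).contMDiffAt (x := x z)).comp z hx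

theorem VecBun.Frame.eventually_expand {A : VecBun.{v} J B} {x₀ : B} (F : A.Frame x₀)
    {x : N → B} {z : N} (hx : ContinuousAt x z) (h₀ : x z = x₀) :
    ∀ᶠ z in 𝓝 z, ∀ a : A.fiber (x z), ∑ i, F.coord i (x z) a • F.sec i (x z) = a := by
  subst h₀
  filter_upwards [hx.eventually F.bump_eq] with y hy a
  rw [F.expand, hy, one_smul]

theorem VecBun.Frame.expand_self {A : VecBun.{v} J B} {x₀ : B} (F : A.Frame x₀) (a : A.fiber x₀) :
    ∑ i, F.coord i x₀ a • F.sec i x₀ = a := by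
  rw [F.expand, F.bump_eq.self_of_nhds, one_smul]

/-- A family of vectors is smooth if its coordinates in a frame are. -/
theorem VecBun.Frame.smoothAt_of_coord {A : VecBun.{v} J B} {x₀ : B} (F : A.Frame x₀)
    {x : N → B} {z : N} {a : ∀ z, A.fiber (x z)} (h₀ : x z = x₀) (hx : ContMDiffAt IN J ∞ x z)
    (ha : ∀ i, ContMDiffAt IN 𝓘(ℝ, ℝ) ∞ (fun z => F.coord i (x z) (a z)) z) :
    ContMDiffAt IN A.tModel ∞ (fun z => A.pt (x z) (a z)) z := by
  refine (A.smoothAt_sum Finset.univ hx fun i _ =>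
    A.smoothAt_smul (ha i) (F.smoothAt_sec i hx)).congr_of_eventuallyEq ?_
  filter_upwards [F.eventually_expand hx.continuousAt h₀] with y hy
  rw [hy]

theorem contMDiffAt_det {n : ℕ} {W : N → Matrix (Fin n) (Fin n) ℝ} {z : N}
    (hW : ∀ i j, ContMDiffAt IN 𝓘(ℝ, ℝ) ∞ (fun z => W z i j) z) :
    ContMDiffAt IN 𝓘(ℝ, ℝ) ∞ (fun z => (W z).det) z := by
  simp only [Matrix.det_apply']
  exact ContMDiffAt.sum fun σ _ => ContMDiffAt.mul contMDiffAt_const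
    (contMDiffAt_finsetProd fun i _ => hW (σ i) i)

/-- Inverses of smooth families of matrices are smooth. -/
theorem contMDiffAt_matrix_inv {n : ℕ} {W : N → Matrix (Fin n) (Fin n) ℝ} {z : N}
    (hW : ∀ i j, ContMDiffAt IN 𝓘(ℝ, ℝ) ∞ (fun z => W z i j) z) (h₀ : (W z).det ≠ 0) (i j : Fin n) :
    ContMDiffAt IN 𝓘(ℝ, ℝ) ∞ (fun z => (W z)⁻¹ i j) z := by
  have hd := contMDiffAt_det hW
  -- Cramer's rule: the entries of the inverse are cofactors divided by the determinant, and all of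
  -- these are polynomial in the entries.
  simp only [Matrix.inv_def, Matrix.smul_apply, smul_eq_mul, Ring.inverse_eq_inv', Matrix.adjugate_apply]
  refine ContMDiffAt.mul ?_ (contMDiffAt_det fun k l => ?_)
  · have h1 : ContMDiffAt 𝓘(ℝ, ℝ) 𝓘(ℝ, ℝ) ∞ (fun r : ℝ => r⁻¹) (W z).det :=
      (contDiffAt_inv ℝ h₀).contMDiffAt
    exact h1.comp z hd
  · simp only [Matrix.updateRow_apply]
    split_ifs
    · exact contMDiffAt_const
    · exact hW _ _

theorem eventually_det_ne_zero {n : ℕ} {W : N → Matrix (Fin n) (Fin n) ℝ} {z : N}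
    (hW : ∀ i j, ContMDiffAt IN 𝓘(ℝ, ℝ) ∞ (fun z => W z i j) z) (h₀ : (W z).det ≠ 0) :
    ∀ᶠ z in 𝓝 z, (W z).det ≠ 0 :=
  (contMDiffAt_det hW).continuousAt.eventually_ne h₀

/-- Smooth families of injective linear maps reflect smoothness. -/
theorem VecBun.smoothAt_of_injective [FiniteDimensional ℝ EB] [T2Space B] [IsManifold J ∞ B]
    {EB' HB' : Type*} [NormedAddCommGroup EB'] [NormedSpace ℝ EB'] [TopologicalSpace HB']
    {J' : ModelWithCorners ℝ EB' HB'} {B' : Type*} [TopologicalSpace B'] [ChartedSpace HB' B']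
    [FiniteDimensional ℝ EB'] [T2Space B'] [IsManifold J' ∞ B']
    (A : VecBun.{v} J B) (A' : VecBun.{v} J' B') {x : N → B} {y : N → B'} {z₀ : N}
    (ψ : ∀ z, A.fiber (x z) →ₗ[ℝ] A'.fiber (y z)) (hinj : Function.Injective (ψ z₀))
    (hψ : ∀ s : ∀ b, A.fiber b, ContMDiff J A.tModel ∞ (fun b => A.pt b (s b)) →
      ContMDiffAt IN A'.tModel ∞ (fun z => A'.pt (y z) (ψ z (s (x z)))) z₀)
    (hx : ContMDiffAt IN J ∞ x z₀) {a : ∀ z, A.fiber (x z)}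
    (ha : ContMDiffAt IN A'.tModel ∞ (fun z => A'.pt (y z) (ψ z (a z))) z₀) :
    ContMDiffAt IN A.tModel ∞ (fun z => A.pt (x z) (a z)) z₀ := by
  classical
  obtain ⟨F, -⟩ := A.exists_frame (x z₀)
  obtain ⟨F', -⟩ := A'.exists_frame (y z₀)
  -- The matrix of ψ in frames around x z₀ and y z₀. Injectivity is known at z₀ only, so a left
  -- inverse is fixed there and corrected nearby.
  let K : N → Matrix (Fin F'.rank) (Fin F.rank) ℝ := fun z i j =>
    F'.coord i (y z) (ψ z (F.sec j (x z)))
  have hK : ∀ i j, ContMDiffAt IN 𝓘(ℝ, ℝ) ∞ (fun z => K z i j) z₀ := fun i j =>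
    F'.smoothAt_coord i (hψ _ (F.smooth_sec j))
  have hKa : ∀ᶠ z in 𝓝 z₀, ∀ i, ∑ j, K z i j * F.coord j (x z) (a z) =
      F'.coord i (y z) (ψ z (a z)) := by
    filter_upwards [F.eventually_expand hx.continuousAt rfl] with z hz i
    conv_rhs => rw [← hz (a z)]
    simp [K, map_sum, mul_comm]
  obtain ⟨L, hL⟩ : ∃ L : Matrix (Fin F.rank) (Fin F'.rank) ℝ, L * K z₀ = 1 := by
    have hi : Function.Injective (Matrix.toLin' (K z₀)) := by
      rw [← LinearMap.ker_eq_bot, LinearMap.ker_eq_bot']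
      intro w hw
      have h1 : ∀ i, F'.coord i (y z₀) (ψ z₀ (∑ j, w j • F.sec j (x z₀))) = 0 := by
        intro i
        have h0 : ∑ j, K z₀ i j * w j = 0 := congrFun hw i
        simpa [K, mul_comm] using h0
      have h2 : ψ z₀ (∑ j, w j • F.sec j (x z₀)) = 0 := by
        rw [← F'.expand_self (ψ z₀ _)]
        simp only [h1, zero_smul, Finset.sum_const_zero]
      have h3 : ∑ j, w j • F.sec j (x z₀) = 0 := hinj (by rw [h2, map_zero])
      funext i
      have h4 := congrArg (F.coord i (x z₀)) h3
      simpa [F.coord_sec] using h4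
    obtain ⟨L, hL⟩ := (Matrix.toLin' (K z₀)).exists_leftInverse_of_injective
      (LinearMap.ker_eq_bot.2 hi)
    refine ⟨LinearMap.toMatrix' L, ?_⟩
    rw [← LinearMap.toMatrix'_toLin' (K z₀), ← LinearMap.toMatrix'_comp, hL, LinearMap.toMatrix'_id]
  -- W is the identity at z₀, hence invertible nearby, and W⁻¹ L is then a smooth family of left
  -- inverses of K.
  let W : N → Matrix (Fin F.rank) (Fin F.rank) ℝ := fun z => L * K z
  have hW : ∀ i j, ContMDiffAt IN 𝓘(ℝ, ℝ) ∞ (fun z => W z i j) z₀ := fun i j => by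
    simp only [W, Matrix.mul_apply]
    exact ContMDiffAt.sum fun k _ => contMDiffAt_const.mul (hK k j)
  have hW₀ : (W z₀).det ≠ 0 := by simp [W, hL]
  refine F.smoothAt_of_coord rfl hx fun i => ?_
  have h5 : ContMDiffAt IN 𝓘(ℝ, ℝ) ∞ (fun z => ∑ j, ((W z)⁻¹ * L) i j *
      F'.coord j (y z) (ψ z (a z))) z₀ := by
    refine ContMDiffAt.sum fun j _ => ContMDiffAt.mul ?_ (F'.smoothAt_coord j ha)
    simp only [Matrix.mul_apply]
    exact ContMDiffAt.sum fun k _ => (contMDiffAt_matrix_inv hW hW₀ i k).mul contMDiffAt_const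
  refine h5.congr_of_eventuallyEq ?_
  filter_upwards [hKa, eventually_det_ne_zero hW hW₀] with z hz hdet
  have h6 : (fun j => F'.coord j (y z) (ψ z (a z))) =
      (K z).mulVec fun j => F.coord j (x z) (a z) := by
    funext j; rw [← hz j]; rfl
  have h7 : ((W z)⁻¹ * L).mulVec ((K z).mulVec fun j => F.coord j (x z) (a z)) =
      fun j => F.coord j (x z) (a z) := by
    rw [Matrix.mulVec_mulVec, Matrix.mul_assoc]
    change ((W z)⁻¹ * W z).mulVec _ = _
    rw [Matrix.nonsing_inv_mul _ (isUnit_iff_ne_zero.2 hdet), Matrix.one_mulVec]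
  rw [← h6] at h7
  exact (congrFun h7 i).symm

end Families

/-! ### Parametrizations by ℝᵏ and local sections of submersions -/

section Plots

variable {EN HN : Type*} [NormedAddCommGroup EN] [NormedSpace ℝ EN] [TopologicalSpace HN]
  {IN : ModelWithCorners ℝ EN HN} {N : Type*} [TopologicalSpace N] [ChartedSpace HN N]
  {EN' HN' : Type*} [NormedAddCommGroup EN'] [NormedSpace ℝ EN'] [TopologicalSpace HN']
  {IN' : ModelWithCorners ℝ EN' HN'} {N' : Type*} [TopologicalSpace N'] [ChartedSpace HN' N']

/-- A smooth map with a smooth local section through `p` has a surjective derivative at `p`. -/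
theorem surjective_mfderiv_of_section {f : N → N'} (hf : ContMDiff IN IN' ∞ f) (p : N)
    {σ : N' → N} (hσ : ContMDiffAt IN' IN ∞ σ (f p)) (hp : σ (f p) = p)
    (h : ∀ᶠ y in 𝓝 (f p), f (σ y) = y) : Function.Surjective (mfderiv IN IN' f p) := by
  have hone : (∞ : WithTop ℕ∞) ≠ 0 := by simp
  have h1 : mfderiv IN' IN' (fun y => f (σ y)) (f p) = ContinuousLinearMap.id ℝ _ := by
    rw [Filter.EventuallyEq.mfderiv_eq (f := id) h]; exact mfderiv_id
  have h2 : mfderiv IN' IN' (fun y => f (σ y)) (f p) =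
      (mfderiv IN IN' f (σ (f p))).comp (mfderiv IN' IN σ (f p)) :=
    mfderiv_comp (I' := IN) (g := f) (f p) (hf.mdifferentiableAt hone) (hσ.mdifferentiableAt hone)
  intro t
  have h3 := congrArg (fun D => D t) (h2.symm.trans h1)
  have h4 : (mfderiv IN IN' f (σ (f p))) (mfderiv IN' IN σ (f p) t) = t := h3
  revert h4
  generalize mfderiv IN' IN σ (f p) t = w
  revert w
  rw [hp]
  exact fun w hw => ⟨w, hw⟩

variable [FiniteDimensional ℝ EN] [IN.Boundaryless] [IsManifold IN ∞ N]

variable (IN) in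
/-- Each point of a manifold lies in the image of a global smooth parametrization `ℝᵏ → N` which is
locally invertible. -/
theorem exists_plot (p : N) : ∃ (k : ℕ) (u : EuclideanSpace ℝ (Fin k) → N)
    (w : N → EuclideanSpace ℝ (Fin k)), ContMDiff (𝓡 k) IN ∞ u ∧ ContMDiffAt IN (𝓡 k) ∞ w p ∧
      w p = 0 ∧ (∀ᶠ q in 𝓝 p, u (w q) = q) ∧ ∀ᶠ z in 𝓝 0, w (u z) = z := by
  let φ := extChartAt IN p
  let L : EN ≃L[ℝ] EuclideanSpace ℝ (Fin (Module.finrank ℝ EN)) :=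
    toEuclidean (E := EN)
  have hopen : IsOpen (L.symm ⁻¹' φ.target) := (isOpen_extChartAt_target p).preimage L.symm.continuous
  set c := L (φ p) with hc
  obtain ⟨r, hr, hball⟩ := Metric.isOpen_iff.1 hopen c (by simp [hc, φ])
  -- A diffeomorphism from all of ℝᵏ onto a ball inside the chart target; it turns the inverse chart
  -- into a globally defined parametrization.
  let β := OpenPartialHomeomorph.univBall c r
  have hβ : ∀ z, β z ∈ Metric.ball c r := fun z => by
    have := β.map_source (x := z) (by simp [β])
    rwa [OpenPartialHomeomorph.univBall_target c hr] at this
  have hL : ContMDiff 𝓘(ℝ, EN) (𝓡 (Module.finrank ℝ EN)) ∞ L := L.contDiff.contMDiff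
  have hL' : ContMDiff (𝓡 (Module.finrank ℝ EN)) 𝓘(ℝ, EN) ∞ L.symm := L.symm.contDiff.contMDiff
  have hβs : ContMDiff (𝓡 (Module.finrank ℝ EN)) (𝓡 (Module.finrank ℝ EN)) ∞ β :=
    OpenPartialHomeomorph.contDiff_univBall.contMDiff
  have hβi : ContMDiffAt (𝓡 (Module.finrank ℝ EN)) (𝓡 (Module.finrank ℝ EN)) ∞ β.symm c :=
    (OpenPartialHomeomorph.contDiffOn_univBall_symm.contDiffAt (Metric.ball_mem_nhds c hr)).contMDiffAt
  have hφ : ContMDiffAt IN 𝓘(ℝ, EN) ∞ φ p := contMDiffAt_extChartAt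
  have hφc : ContinuousAt φ p := continuousAt_extChartAt p
  refine ⟨_, fun z => φ.symm (L.symm (β z)), fun q => β.symm (L (φ q)), ?_, ?_, ?_, ?_, ?_⟩
  · intro z
    have h1 : ContMDiffAt 𝓘(ℝ, EN) IN ∞ φ.symm (L.symm (β z)) :=
      (contMDiffOn_extChartAt_symm p).contMDiffAt
        ((isOpen_extChartAt_target p).mem_nhds (hball (hβ z)))
    exact h1.comp z (hL'.comp hβs).contMDiffAt
  · exact ContMDiffAt.comp p (g := β.symm) hβi (hL.contMDiffAt.comp p hφ)
  · simp only [← hc, β, OpenPartialHomeomorph.univBall_symm_apply_center]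
  · have h2 : ∀ᶠ q in 𝓝 p, L (φ q) ∈ Metric.ball c r :=
      (L.continuous.continuousAt.comp hφc).eventually (Metric.ball_mem_nhds c hr)
    filter_upwards [h2, extChartAt_source_mem_nhds (I := IN) p] with q hq hq'
    rw [β.right_inv (by rwa [OpenPartialHomeomorph.univBall_target c hr]), L.symm_apply_apply]
    exact φ.left_inv hq'
  · refine .of_forall fun z => ?_
    change β.symm (L (φ (φ.symm (L.symm (β z))))) = z
    rw [φ.right_inv (hball (hβ z)), L.apply_symm_apply]
    exact β.left_inv (by simp [β])

/-- A map is smooth at a point if its composites with smooth maps from `ℝᵏ` are. -/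
theorem contMDiff_of_plots {f : N → N'}
    (hf : ∀ (k : ℕ) (u : EuclideanSpace ℝ (Fin k) → N), ContMDiff (𝓡 k) IN ∞ u →
      ContMDiff (𝓡 k) IN' ∞ (fun z => f (u z))) : ContMDiff IN IN' ∞ f := by
  intro p
  obtain ⟨k, u, w, hu, hw, -, h1, -⟩ := exists_plot IN p
  refine ((hf k u hu).contMDiffAt.comp p hw).congr_of_eventuallyEq ?_
  filter_upwards [h1] with q hq
  simp [hq]

variable [FiniteDimensional ℝ EN'] [IN'.Boundaryless] [IsManifold IN' ∞ N']

/-- Composed with the affine map w ↦ a + R w, where R is a linear right inverse of the derivative, f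
has the identity as its derivative at 0. The inverse function theorem then provides the section. -/
theorem exists_section_of_surjective_fderiv {k l : ℕ}
    {f : EuclideanSpace ℝ (Fin k) → EuclideanSpace ℝ (Fin l)} {a : EuclideanSpace ℝ (Fin k)}
    (hf : ContDiffAt ℝ ∞ f a) (hs : Function.Surjective (fderiv ℝ f a)) :
    ∃ σ : EuclideanSpace ℝ (Fin l) → EuclideanSpace ℝ (Fin k), ContDiffAt ℝ ∞ σ (f a) ∧
      σ (f a) = a ∧ ∀ᶠ y in 𝓝 (f a), f (σ y) = y := by
  obtain ⟨R, hR⟩ := (fderiv ℝ f a).toLinearMap.exists_rightInverse_of_surjective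
    (LinearMap.range_eq_top.2 hs)
  let R' := LinearMap.toContinuousLinearMap R
  let g := fun w => f (a + R' w)
  have hin : ContDiff ℝ ∞ (fun w => a + R' w) := contDiff_const.add R'.contDiff
  have ha : a + R' 0 = a := by simp
  have hg : ContDiffAt ℝ ∞ g 0 := by
    refine ContDiffAt.comp (g := f) 0 ?_ hin.contDiffAt
    rwa [ha]
  have hg' : HasFDerivAt g ((ContinuousLinearEquiv.refl ℝ (EuclideanSpace ℝ (Fin l)) :
      EuclideanSpace ℝ (Fin l) ≃L[ℝ] EuclideanSpace ℝ (Fin l)) :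
      EuclideanSpace ℝ (Fin l) →L[ℝ] EuclideanSpace ℝ (Fin l)) 0 := by
    have h1 : HasFDerivAt f (fderiv ℝ f a) (a + R' 0) := by
      rw [ha]; exact (hf.differentiableAt (by simp)).hasFDerivAt
    have h2 : HasFDerivAt (fun w => a + R' w) R' 0 := R'.hasFDerivAt.const_add a
    have h3 := h1.comp (0 : EuclideanSpace ℝ (Fin l)) h2
    have h4 : (ContinuousLinearEquiv.refl ℝ (EuclideanSpace ℝ (Fin l)) :
      EuclideanSpace ℝ (Fin l) →L[ℝ] EuclideanSpace ℝ (Fin l)) = (fderiv ℝ f a).comp R' :=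
      ContinuousLinearMap.ext fun w => (LinearMap.congr_fun hR w).symm
    rw [h4]
    exact h3
  have hg0 : g 0 = f a := by simp [g]
  refine ⟨fun y => a + R' (hg.localInverse hg' (by simp) y), ?_, ?_, ?_⟩
  · rw [← hg0]
    exact hin.contDiffAt.comp _ (hg.to_localInverse hg' (by simp))
  · rw [← hg0]
    change a + R' (hg.localInverse hg' (by simp) (g 0)) = a
    rw [hg.localInverse_apply_image]; simp
  · rw [← hg0]
    exact (hg.hasStrictFDerivAt' hg' (by simp)).eventually_right_inverse

/-- A smooth map whose derivative at `p` is onto has a smooth local section through `p`. -/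
theorem exists_section_of_surjective_mfderiv {f : N → N'} (hf : ContMDiff IN IN' ∞ f) (p : N)
    (hs : Function.Surjective (mfderiv IN IN' f p)) :
    ∃ σ : N' → N, ContMDiffAt IN' IN ∞ σ (f p) ∧ σ (f p) = p ∧ ∀ᶠ y in 𝓝 (f p), f (σ y) = y := by
  obtain ⟨k, u, w, hu, hw, hwp, huw, hwu⟩ := exists_plot IN p
  obtain ⟨l, u', w', hu', hw', hwp', huw', hwu'⟩ := exists_plot IN' (f p)
  have hup : u 0 = p := by rw [← hwp]; exact huw.self_of_nhds
  have hup' : u' 0 = f p := by rw [← hwp']; exact huw'.self_of_nhds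
  -- The map f read in parametrizations centred at p and at f p.
  let g := fun z => w' (f (u z))
  have hfu : ContMDiffAt (𝓡 k) IN' ∞ (fun z => f (u z)) 0 := (hf.comp hu).contMDiffAt
  have hg : ContMDiffAt (𝓡 k) (𝓡 l) ∞ g 0 :=
    ContMDiffAt.comp (g := w') 0 (by rwa [hup]) hfu
  have hg0 : g 0 = 0 := by simp [g, hup, hwp']
  have hone : (∞ : WithTop ℕ∞) ≠ 0 := by simp
  have hsurj : Function.Surjective (fderiv ℝ g 0) := by
    rw [← mfderiv_eq_fderiv]
    have e1 : mfderiv (𝓡 k) (𝓡 l) g 0 = (mfderiv IN' (𝓡 l) w' (f (u 0))).comp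
        ((mfderiv IN IN' f (u 0)).comp (mfderiv (𝓡 k) IN u 0)) := by
      rw [← mfderiv_comp (I' := IN) 0 (hf.mdifferentiableAt hone) (hu.mdifferentiableAt hone)]
      exact mfderiv_comp (I' := IN') (g := w') 0 ((by rwa [hup] : ContMDiffAt IN' (𝓡 l) ∞ w' (f (u 0))).mdifferentiableAt hone) (hfu.mdifferentiableAt hone)
    -- Since u ∘ w is the identity near p, the derivative of u at 0 is onto.
    have s1 : Function.Surjective (mfderiv (𝓡 k) IN u 0) := by
      have h1 : mfderiv IN IN (fun q => u (w q)) p = ContinuousLinearMap.id ℝ _ := by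
        rw [Filter.EventuallyEq.mfderiv_eq (f := id) huw]; exact mfderiv_id
      have h2 : mfderiv IN IN (fun q => u (w q)) p =
          (mfderiv (𝓡 k) IN u (w p)).comp (mfderiv IN (𝓡 k) w p) :=
        mfderiv_comp (I' := 𝓡 k) (g := u) p (hu.mdifferentiableAt hone) (hw.mdifferentiableAt hone)
      rw [hwp] at h2
      subst hup
      intro t
      refine ⟨mfderiv IN (𝓡 k) w (u 0) t, ?_⟩
      have := congrArg (fun D => D t) (h2.symm.trans h1)
      exact this
    -- Since w' ∘ u' is the identity near 0, the derivative of w' at f p is onto.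
    have s2 : Function.Surjective (mfderiv IN' (𝓡 l) w' (f (u 0))) := by
      have h1 : mfderiv (𝓡 l) (𝓡 l) (fun z => w' (u' z)) 0 = ContinuousLinearMap.id ℝ _ := by
        rw [Filter.EventuallyEq.mfderiv_eq (f := id) hwu']; exact mfderiv_id
      have h2 : mfderiv (𝓡 l) (𝓡 l) (fun z => w' (u' z)) 0 =
          (mfderiv IN' (𝓡 l) w' (u' 0)).comp (mfderiv (𝓡 l) IN' u' 0) :=
        mfderiv_comp (I' := IN') (g := w') 0 ((by rwa [hup'] : ContMDiffAt IN' (𝓡 l) ∞ w' (u' 0)).mdifferentiableAt hone) (hu'.mdifferentiableAt hone)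
      rw [hup, ← hup']
      intro t
      refine ⟨mfderiv (𝓡 l) IN' u' 0 t, ?_⟩
      have := congrArg (fun D => D t) (h2.symm.trans h1)
      exact this
    rw [e1]
    have s3 : Function.Surjective (mfderiv IN IN' f (u 0)) := by rw [hup]; exact hs
    exact s2.comp (s3.comp s1)
  obtain ⟨σ, h1, h2, h3⟩ := exists_section_of_surjective_fderiv
    (contMDiffAt_iff_contDiffAt.1 hg) hsurj
  rw [hg0] at h1 h2 h3
  refine ⟨fun y => u (σ (w' y)), ?_, ?_, ?_⟩
  · have : ContMDiffAt IN' (𝓡 k) ∞ (fun y => σ (w' y)) (f p) :=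
      ContMDiffAt.comp (g := σ) (f p) (by rw [hwp']; exact h1.contMDiffAt) hw'
    exact hu.contMDiffAt.comp (f p) this
  · simp [hwp', h2, hup]
  · have c1 : ContinuousAt w' (f p) := hw'.continuousAt
    have c2 : ContinuousAt (fun y => f (u (σ (w' y)))) (f p) := by
      refine (hf.continuous.comp hu.continuous).continuousAt.comp ?_
      refine ContinuousAt.comp (g := σ) ?_ c1
      rw [hwp']; exact h1.continuousAt
    have c3 : f (u (σ (w' (f p)))) = f p := by simp [hwp', h2, hup]
    have c2 : Tendsto (fun y => f (u (σ (w' y)))) (𝓝 (f p)) (𝓝 (f p)) := by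
      conv_rhs => rw [← c3]
      exact c2
    have c1 : Tendsto w' (𝓝 (f p)) (𝓝 0) := by
      rw [← hwp']; exact c1
    filter_upwards [c1.eventually h3, huw', c2.eventually huw'] with y a1 a2 a3
    rw [← a3]
    change u' (g (σ (w' y))) = y
    rw [a1, a2]

end Plots

end

end VBG

namespace VBG

noncomputable section

open Filter Topology

/-! ### Arrows with end points, simplices of the nerve and the simplicial identities -/

section Nerves

variable {EG HG EM HM : Type*} [NormedAddCommGroup EG] [NormedSpace ℝ EG] [TopologicalSpace HG]
  [NormedAddCommGroup EM] [NormedSpace ℝ EM] [TopologicalSpace HM]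
  {I : ModelWithCorners ℝ EG HG} {G : Type*} [TopologicalSpace G] [ChartedSpace HG G]
  {J : ModelWithCorners ℝ EM HM} {M : Type*} [TopologicalSpace M] [ChartedSpace HM M]
  {𝒢 : LieGroupoid I G J M}

theorem LieGroupoid.mul_congr (𝒢 : LieGroupoid I G J M) {a a' b b' : G} (ha : a = a') (hb : b = b')
    (w : 𝒢.src a = 𝒢.tgt b) (w' : 𝒢.src a' = 𝒢.tgt b') : 𝒢.mul a b w = 𝒢.mul a' b' w' := by
  subst ha; subst hb; rfl

/-- The arrows of a groupoid from `x` to `y`. -/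
@[ext]
structure LieGroupoid.Hom (𝒢 : LieGroupoid I G J M) (x y : M) where
  val : G
  src_val : 𝒢.src val = x
  tgt_val : 𝒢.tgt val = y

namespace LieGroupoid.Hom

/-- The unit at `x`. -/
def one (𝒢 : LieGroupoid I G J M) (x : M) : 𝒢.Hom x x := ⟨𝒢.one x, 𝒢.src_one x, 𝒢.tgt_one x⟩

/-- The composite of two arrows. -/
def comp {x y z : M} (g : 𝒢.Hom y z) (h : 𝒢.Hom x y) : 𝒢.Hom x z :=
  ⟨𝒢.mul g.val h.val (g.src_val.trans h.tgt_val.symm), (𝒢.src_mul _ _ _).trans h.src_val,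
    (𝒢.tgt_mul _ _ _).trans g.tgt_val⟩

/-- The inverse arrow. -/
def inv {x y : M} (g : 𝒢.Hom x y) : 𝒢.Hom y x :=
  ⟨𝒢.inv g.val, (𝒢.src_inv _).trans g.tgt_val, (𝒢.tgt_inv _).trans g.src_val⟩

/-- An arrow with its own source and target. -/
def mk' (𝒢 : LieGroupoid I G J M) (g : G) : 𝒢.Hom (𝒢.src g) (𝒢.tgt g) := ⟨g, rfl, rfl⟩

theorem comp_assoc {x y z w : M} (g : 𝒢.Hom z w) (h : 𝒢.Hom y z) (k : 𝒢.Hom x y) :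
    (g.comp h).comp k = g.comp (h.comp k) :=
  Hom.ext (𝒢.mul_assoc _ _ _ _ _)

@[simp] theorem one_comp {x y : M} (g : 𝒢.Hom x y) : (one 𝒢 y).comp g = g :=
  Hom.ext (one_mul_of_eq 𝒢 g.tgt_val _)

@[simp] theorem comp_one {x y : M} (g : 𝒢.Hom x y) : g.comp (one 𝒢 x) = g :=
  Hom.ext (mul_one_of_eq 𝒢 g.src_val _)

@[simp] theorem inv_comp {x y : M} (g : 𝒢.Hom x y) : g.inv.comp g = one 𝒢 x := by
  obtain ⟨g, rfl, rfl⟩ := g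
  exact Hom.ext (𝒢.inv_mul g)

@[simp] theorem comp_inv {x y : M} (g : 𝒢.Hom x y) : g.comp g.inv = one 𝒢 y := by
  obtain ⟨g, rfl, rfl⟩ := g
  exact Hom.ext (𝒢.mul_inv g)

theorem eq_one_of_comp_self {x : M} (g : 𝒢.Hom x x) (h : g.comp g = g) : g = one 𝒢 x := by
  have h1 := congrArg (fun k => g.inv.comp k) h
  simpa only [← comp_assoc, inv_comp, one_comp] using h1

theorem eq_inv_of_comp_eq_one {x y : M} {g : 𝒢.Hom x y} {h : 𝒢.Hom y x}
    (k : h.comp g = one 𝒢 x) : h = g.inv := by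
  have h1 := congrArg (fun k => k.comp g.inv) k
  simpa only [comp_assoc, comp_inv, one_comp, comp_one] using h1

end LieGroupoid.Hom

open LieGroupoid (Hom)

namespace Nerve

theorem ext' {p : ℕ} {σ τ : Nerve 𝒢 p} (hv : ∀ i, σ.vert i = τ.vert i)
    (ha : ∀ i, σ.arr i = τ.arr i) : σ = τ := by
  cases σ; cases τ
  simp only [Nerve.mk.injEq]
  exact ⟨funext hv, funext ha⟩

/-- The final vertex. -/
def last {p : ℕ} (σ : Nerve 𝒢 p) : M := σ.vert (Fin.last p)

/-- The `i`-th arrow of a simplex with its end points. -/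
def hom {p : ℕ} (σ : Nerve 𝒢 p) (i : ℕ) (hi : i < p) :
    𝒢.Hom (σ.vert ⟨i + 1, by omega⟩) (σ.vert ⟨i, by omega⟩) :=
  ⟨σ.arr ⟨i, hi⟩, σ.src_arr ⟨i, hi⟩, σ.tgt_arr ⟨i, hi⟩⟩

/-- An arrow as a `1`-simplex. -/
def ofHom {x y : M} (g : 𝒢.Hom x y) : Nerve 𝒢 1 where
  vert := ![y, x]
  arr := ![g.val]
  tgt_arr i := by fin_cases i; exact g.tgt_val
  src_arr i := by fin_cases i; exact g.src_val

/-- A composable pair of arrows as a `2`-simplex. -/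
def ofPair {x y z : M} (g : 𝒢.Hom y z) (h : 𝒢.Hom x y) : Nerve 𝒢 2 where
  vert := ![z, y, x]
  arr := ![g.val, h.val]
  tgt_arr i := by fin_cases i; exacts [g.tgt_val, h.tgt_val]
  src_arr i := by fin_cases i; exacts [g.src_val, h.src_val]

/-- A composable triple of arrows as a `3`-simplex. -/
def ofTriple {x y z w : M} (g : 𝒢.Hom z w) (h : 𝒢.Hom y z) (k : 𝒢.Hom x y) : Nerve 𝒢 3 where
  vert := ![w, z, y, x]
  arr := ![g.val, h.val, k.val]
  tgt_arr i := by fin_cases i; exacts [g.tgt_val, h.tgt_val, k.tgt_val]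
  src_arr i := by fin_cases i; exacts [g.src_val, h.src_val, k.src_val]

theorem exists_point (σ : Nerve 𝒢 0) : ∃ x, σ = Nerve.point 𝒢 x :=
  ⟨σ.vert 0, ext' (fun i => by fin_cases i; rfl) fun i => i.elim0⟩

theorem exists_ofHom (σ : Nerve 𝒢 1) : ∃ (x y : M) (g : 𝒢.Hom x y), σ = ofHom g :=
  ⟨_, _, σ.hom 0 (by omega), ext' (fun i => by fin_cases i <;> rfl) fun i => by fin_cases i; rfl⟩

theorem exists_ofPair (σ : Nerve 𝒢 2) :
    ∃ (x y z : M) (g : 𝒢.Hom y z) (h : 𝒢.Hom x y), σ = ofPair g h :=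
  ⟨_, _, _, σ.hom 0 (by omega), σ.hom 1 (by omega),
    ext' (fun i => by fin_cases i <;> rfl) fun i => by fin_cases i <;> rfl⟩

theorem exists_ofTriple (σ : Nerve 𝒢 3) : ∃ (x y z w : M) (g : 𝒢.Hom z w) (h : 𝒢.Hom y z)
    (k : 𝒢.Hom x y), σ = ofTriple g h k :=
  ⟨_, _, _, _, σ.hom 0 (by omega), σ.hom 1 (by omega), σ.hom 2 (by omega),
    ext' (fun i => by fin_cases i <;> rfl) fun i => by fin_cases i <;> rfl⟩

/-- The front `p`-face of an `n`-simplex. -/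
def frontN {p q n : ℕ} (h : p + q = n) (σ : Nerve 𝒢 n) : Nerve 𝒢 p where
  vert i := σ.vert ⟨i.1, by omega⟩
  arr i := σ.arr ⟨i.1, by omega⟩
  tgt_arr i := σ.tgt_arr ⟨i.1, by omega⟩
  src_arr i := σ.src_arr ⟨i.1, by omega⟩

/-- The back `q`-face of an `n`-simplex. -/
def backN {p q n : ℕ} (h : p + q = n) (σ : Nerve 𝒢 n) : Nerve 𝒢 q where
  vert i := σ.vert ⟨p + i.1, by omega⟩
  arr i := σ.arr ⟨p + i.1, by omega⟩
  tgt_arr i := σ.tgt_arr ⟨p + i.1, by omega⟩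
  src_arr i := σ.src_arr ⟨p + i.1, by omega⟩

theorem SmoothMap.frontN {p q n k : ℕ} (h : p + q = n) {u : EuclideanSpace ℝ (Fin k) → Nerve 𝒢 n}
    (hu : SmoothMap u) : SmoothMap (fun z => (u z).frontN h) := ⟨fun _ => hu.1 _, fun _ => hu.2 _⟩

theorem SmoothMap.backN {p q n k : ℕ} (h : p + q = n) {u : EuclideanSpace ℝ (Fin k) → Nerve 𝒢 n}
    (hu : SmoothMap u) : SmoothMap (fun z => (u z).backN h) := ⟨fun _ => hu.1 _, fun _ => hu.2 _⟩

@[simp] theorem frontN_base {p q n : ℕ} (h : p + q = n) (σ : Nerve 𝒢 n) :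
    (σ.frontN h).base = σ.base := rfl

theorem smoothMap_point {k : ℕ} {x : EuclideanSpace ℝ (Fin k) → M} (hx : ContMDiff (𝓡 k) J ∞ x) :
    SmoothMap (fun z => Nerve.point 𝒢 (x z)) := ⟨fun _ => hx, fun i => i.elim0⟩

theorem smoothMap_ofHom {k : ℕ} {x y : EuclideanSpace ℝ (Fin k) → M} {g : ∀ z, 𝒢.Hom (x z) (y z)}
    (hg : ContMDiff (𝓡 k) I ∞ (fun z => (g z).val)) : SmoothMap (fun z => ofHom (g z)) := by
  refine ⟨fun i => ?_, fun i => ?_⟩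
  · fin_cases i
    · exact (𝒢.smooth_tgt.comp hg).congr fun z => ((g z).tgt_val).symm
    · exact (𝒢.smooth_src.comp hg).congr fun z => ((g z).src_val).symm
  · fin_cases i; exact hg

theorem smoothMap_ofPair {k : ℕ} {x y w : EuclideanSpace ℝ (Fin k) → M}
    {g : ∀ z, 𝒢.Hom (y z) (w z)} {h : ∀ z, 𝒢.Hom (x z) (y z)}
    (hg : ContMDiff (𝓡 k) I ∞ (fun z => (g z).val))
    (hh : ContMDiff (𝓡 k) I ∞ (fun z => (h z).val)) :
    SmoothMap (fun z => ofPair (g z) (h z)) := by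
  refine ⟨fun i => ?_, fun i => ?_⟩
  · fin_cases i
    · exact (𝒢.smooth_tgt.comp hg).congr fun z => ((g z).tgt_val).symm
    · exact (𝒢.smooth_src.comp hg).congr fun z => ((g z).src_val).symm
    · exact (𝒢.smooth_src.comp hh).congr fun z => ((h z).src_val).symm
  · fin_cases i
    exacts [hg, hh]

theorem face_vert {p : ℕ} (i : Fin (p + 2)) (σ : Nerve 𝒢 (p + 1)) (j : Fin (p + 1)) :
    (σ.face i).vert j = σ.vert ⟨if j.1 < i.1 then j.1 else j.1 + 1, by split_ifs <;> omega⟩ := by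
  change σ.vert (i.succAbove j) = _
  congr 1
  ext
  simp only [Fin.succAbove, Fin.lt_def, Fin.val_castSucc]
  split_ifs <;> simp

theorem face_base_pos {p : ℕ} (i : Fin (p + 2)) (hi : 0 < i.1) (σ : Nerve 𝒢 (p + 1)) :
    (σ.face i).base = σ.base := by
  rw [base, face_vert]
  simp only [hi, if_true]
  rfl

theorem face_arr_lt {p : ℕ} {i : Fin (p + 2)} (σ : Nerve 𝒢 (p + 1)) {k : ℕ} (hk : k < p)
    (h : k + 1 < i.1) : (σ.face i).arr ⟨k, hk⟩ = σ.arr ⟨k, by omega⟩ := by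
  change faceArr i σ _ = _
  rw [faceArr, if_pos h]; rfl

theorem face_arr_eq {p : ℕ} {i : Fin (p + 2)} (σ : Nerve 𝒢 (p + 1)) {k : ℕ} (hk : k < p)
    (h : k + 1 = i.1) : (σ.face i).arr ⟨k, hk⟩ =
      𝒢.mul (σ.arr ⟨k, by omega⟩) (σ.arr ⟨k + 1, by omega⟩)
        ((σ.src_arr ⟨k, by omega⟩).trans (σ.tgt_arr ⟨k + 1, by omega⟩).symm) := by
  change faceArr i σ _ = _
  rw [faceArr, if_neg (by simp [h]), if_pos h]; rfl

theorem face_arr_gt {p : ℕ} {i : Fin (p + 2)} (σ : Nerve 𝒢 (p + 1)) {k : ℕ} (hk : k < p)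
    (h : i.1 < k + 1) : (σ.face i).arr ⟨k, hk⟩ = σ.arr ⟨k + 1, by omega⟩ := by
  change faceArr i σ _ = _
  rw [faceArr, if_neg (by simp; omega), if_neg (by simp; omega)]; rfl

/-- Deleting two vertices does not depend on the order, up to the index shift. On arrows the
groupoid law enters only for i = j = k + 1, where three consecutive arrows are multiplied and
associativity is needed; in the other cases the two products involve different pairs of arrows. -/
theorem face_face {p : ℕ} (σ : Nerve 𝒢 (p + 2)) {i j : ℕ} (hij : i ≤ j) (hj : j < p + 2) :
    (σ.face ⟨j + 1, by omega⟩).face ⟨i, by omega⟩ =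
      (σ.face ⟨i, by omega⟩).face ⟨j, hj⟩ := by
  refine ext' (fun k => ?_) fun ⟨k, hk⟩ => ?_
  · simp only [face_vert]
    congr 1
    ext
    dsimp only
    split_ifs <;> omega
  · rcases lt_trichotomy (k + 1) i with h | h | h
    · rw [face_arr_lt _ _ h, face_arr_lt _ _ (by dsimp; omega), face_arr_lt _ _ (by dsimp; omega),
        face_arr_lt _ _ (by dsimp; omega)]
    · rw [face_arr_eq _ _ h]
      rcases hij.eq_or_lt with h' | h'
      · subst h'
        have R := face_arr_eq (i := ⟨i, hj⟩) (σ.face ⟨i, by omega⟩) hk h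
        refine Eq.trans ?_ R.symm
        refine (𝒢.mul_congr (face_arr_lt σ (i := ⟨i + 1, by omega⟩) (k := k) (by omega)
          (by dsimp; omega)) (face_arr_eq σ (i := ⟨i + 1, by omega⟩) (k := k + 1) (by omega)
          (by dsimp; omega)) _ (by rw [𝒢.tgt_mul, σ.src_arr, σ.tgt_arr]; rfl)).trans ?_
        refine Eq.trans ?_ (𝒢.mul_congr (face_arr_eq σ (i := ⟨i, by omega⟩) (k := k) (by omega) h)
          (face_arr_gt σ (i := ⟨i, by omega⟩) (k := k + 1) (by omega) (by dsimp; omega)) _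
          (by rw [𝒢.src_mul, σ.src_arr, σ.tgt_arr]; rfl)).symm
        exact (𝒢.mul_assoc _ _ _ _ _).symm
      · have R := face_arr_lt (i := ⟨j, hj⟩) (σ.face ⟨i, by omega⟩) hk (by dsimp; omega)
        refine Eq.trans ?_ (R.trans (face_arr_eq (i := ⟨i, by omega⟩) σ (by omega) h)).symm
        exact 𝒢.mul_congr (face_arr_lt _ _ (by dsimp; omega)) (face_arr_lt _ _ (by dsimp; omega)) _ _
    · rw [face_arr_gt _ _ h]
      rcases lt_trichotomy (k + 1) j with h' | h' | h'
      · rw [face_arr_lt _ _ (by dsimp; omega), face_arr_lt _ _ h', face_arr_gt _ _ h]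
      · rw [face_arr_eq _ _ (by dsimp; omega), face_arr_eq _ _ h']
        exact 𝒢.mul_congr (face_arr_gt _ _ (by dsimp; omega)).symm
          (face_arr_gt _ _ (by dsimp; omega)).symm _ _
      · rw [face_arr_gt _ _ (by dsimp; omega), face_arr_gt _ _ h', face_arr_gt _ _ (by dsimp; omega)]

/-- The two faces of a simplex at a degenerate arrow agree. -/
theorem face_eq_face_of_unit {p : ℕ} (σ : Nerve 𝒢 (p + 1)) {j : ℕ} (hj : j < p + 1) {x : M}
    (h : σ.arr ⟨j, hj⟩ = 𝒢.one x) :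
    σ.face ⟨j, by omega⟩ = σ.face ⟨j + 1, by omega⟩ := by
  have hs := σ.src_arr ⟨j, hj⟩
  have ht := σ.tgt_arr ⟨j, hj⟩
  rw [h, 𝒢.src_one] at hs
  rw [h, 𝒢.tgt_one] at ht
  have hv : σ.vert ⟨j, by omega⟩ = σ.vert ⟨j + 1, by omega⟩ := ht.symm.trans hs
  refine ext' (fun k => ?_) fun ⟨k, hk⟩ => ?_
  · simp only [face_vert]
    rcases eq_or_ne k.1 j with hkj | hkj
    · simp only [hkj, lt_irrefl, if_false, Nat.lt_succ_self, if_true]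
      exact hv.symm
    · congr 1
      ext
      dsimp only
      split_ifs <;> omega
  · rcases lt_trichotomy (k + 1) j with h' | h' | h'
    · rw [face_arr_lt _ _ h', face_arr_lt _ _ (by dsimp; omega)]
    · rw [face_arr_eq _ _ h', face_arr_lt _ _ (by dsimp; omega)]
      subst h'
      have h3 : 𝒢.src (σ.arr ⟨k, by omega⟩) = x := (σ.src_arr ⟨k, by omega⟩).trans ht.symm
      rw [𝒢.mul_congr rfl h _ (h3.trans (𝒢.tgt_one x).symm)]
      exact mul_one_of_eq 𝒢 h3 _
    · rw [face_arr_gt _ _ h']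
      rcases eq_or_ne k j with hkj | hkj
      · subst hkj
        have h3 : 𝒢.tgt (σ.arr ⟨k + 1, by omega⟩) = x := (σ.tgt_arr ⟨k + 1, by omega⟩).trans hs.symm
        rw [face_arr_eq _ _ rfl, 𝒢.mul_congr h rfl _ ((𝒢.src_one x).trans h3.symm)]
        exact (one_mul_of_eq 𝒢 h3 _).symm
      · rw [face_arr_gt _ _ (by dsimp; omega)]

/-- The faces away from a degenerate arrow have a degenerate arrow. -/
theorem exists_unit_face {p : ℕ} (σ : Nerve 𝒢 (p + 1)) {j : ℕ} (hj : j < p + 1) {x : M}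
    (h : σ.arr ⟨j, hj⟩ = 𝒢.one x) (i : Fin (p + 2)) (h1 : i.1 ≠ j) (h2 : i.1 ≠ j + 1) :
    ∃ k x, (σ.face i).arr k = 𝒢.one x := by
  rcases lt_or_gt_of_ne h1 with h1 | h1
  · obtain ⟨j, rfl⟩ : ∃ j', j = j' + 1 := ⟨j - 1, by omega⟩
    exact ⟨⟨j, by omega⟩, x, by rw [face_arr_gt _ _ (by omega), h]⟩
  · exact ⟨⟨j, by omega⟩, x, by rw [face_arr_lt _ _ (by omega), h]⟩

section Leibniz

variable {p q n : ℕ} (h : p + q = n) (σ : Nerve 𝒢 (n + 1))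

/-- Deleting a vertex i ≤ p affects only the front of a simplex, deleting a vertex p + j with j > 0
only its back. This lemma and the following three sort the faces of a simplex for the proof of the
Leibniz rule. -/
theorem frontN_face_le {i : ℕ} (hi : i ≤ p) :
    (σ.face ⟨i, by omega⟩).frontN h =
      (σ.frontN (p := p + 1) (q := q) (by omega)).face ⟨i, by omega⟩ := by
  refine ext' (fun k => ?_) fun ⟨k, hk⟩ => ?_
  · rw [face_vert]
    change (σ.face _).vert _ = σ.vert _
    rw [face_vert]
  · change (σ.face _).arr ⟨k, _⟩ = _
    rcases lt_trichotomy (k + 1) i with h' | h' | h'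
    · rw [face_arr_lt _ _ h', face_arr_lt _ _ h']; rfl
    · rw [face_arr_eq _ _ h', face_arr_eq _ _ h']; rfl
    · rw [face_arr_gt _ _ h', face_arr_gt _ _ h']; rfl

theorem backN_face_le {i : ℕ} (hi : i ≤ p) :
    (σ.face ⟨i, by omega⟩).backN h = σ.backN (p := p + 1) (q := q) (by omega) := by
  refine ext' (fun k => ?_) fun ⟨k, hk⟩ => ?_
  · change (σ.face _).vert _ = σ.vert _
    rw [face_vert]
    congr 1
    ext
    dsimp only
    split_ifs <;> omega
  · change (σ.face _).arr ⟨p + k, _⟩ = σ.arr _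
    rw [face_arr_gt _ _ (by dsimp; omega)]
    congr 1
    ext
    dsimp only
    omega

theorem frontN_face_gt {j : ℕ} (hj : j < q + 2) (hj' : 0 < j) :
    (σ.face ⟨p + j, by omega⟩).frontN h = σ.frontN (p := p) (q := q + 1) (by omega) := by
  refine ext' (fun k => ?_) fun ⟨k, hk⟩ => ?_
  · change (σ.face _).vert _ = σ.vert _
    rw [face_vert]
    congr 1
    ext
    dsimp only
    split_ifs <;> omega
  · change (σ.face _).arr ⟨k, _⟩ = σ.arr _
    rw [face_arr_lt _ _ (by dsimp; omega)]

theorem backN_face_gt {j : ℕ} (hj : j < q + 2) (_ : 0 < j) :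
    (σ.face ⟨p + j, by omega⟩).backN h =
      (σ.backN (p := p) (q := q + 1) (by omega)).face ⟨j, hj⟩ := by
  refine ext' (fun k => ?_) fun ⟨k, hk⟩ => ?_
  · rw [face_vert]
    change (σ.face _).vert _ = σ.vert _
    rw [face_vert]
    congr 1
    ext
    dsimp only
    split_ifs <;> omega
  · change (σ.face _).arr ⟨p + k, _⟩ = _
    rcases lt_trichotomy (k + 1) j with h' | h' | h'
    · rw [face_arr_lt _ _ (by dsimp; omega), face_arr_lt _ _ h']; rfl
    · rw [face_arr_eq _ _ (by dsimp; omega), face_arr_eq _ _ h']; rfl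
    · rw [face_arr_gt _ _ (by dsimp; omega), face_arr_gt _ _ h']; rfl

/-- Needed, together with `face_zero_backN`, for the two terms of the Leibniz rule that come from no
face of σ: dropping the last vertex of the front (p + 1)-simplex and dropping the first vertex of
the back (q + 1)-simplex lead to the same pair of simplices, so these terms cancel. -/
theorem face_last_frontN :
    (σ.frontN (p := p + 1) (q := q) (by omega)).face ⟨p + 1, by omega⟩ =
      σ.frontN (p := p) (q := q + 1) (by omega) := by
  refine ext' (fun k => ?_) fun ⟨k, hk⟩ => ?_
  · rw [face_vert]
    change σ.vert _ = σ.vert _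
    congr 1
    ext
    dsimp only
    split_ifs <;> omega
  · rw [face_arr_lt _ _ (by dsimp; omega)]; rfl

theorem face_zero_backN :
    (σ.backN (p := p) (q := q + 1) (by omega)).face ⟨0, by omega⟩ =
      σ.backN (p := p + 1) (q := q) (by omega) := by
  refine ext' (fun k => ?_) fun ⟨k, hk⟩ => ?_
  · rw [face_vert]
    change σ.vert _ = σ.vert _
    congr 1
    ext
    dsimp only
    split_ifs <;> omega
  · rw [face_arr_gt _ _ (by dsimp; omega)]
    change σ.arr _ = σ.arr _
    congr 1
    ext
    dsimp only
    omega

end Leibniz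

theorem face_one_ofPair {x y z : M} (g : 𝒢.Hom y z) (h : 𝒢.Hom x y) :
    (ofPair g h).face 1 = ofHom (g.comp h) :=
  ext' (fun i => by fin_cases i <;> rfl) fun i => by fin_cases i; rfl

theorem face_two_ofPair {x y z : M} (g : 𝒢.Hom y z) (h : 𝒢.Hom x y) :
    (ofPair g h).face 2 = ofHom g :=
  ext' (fun i => by fin_cases i <;> rfl) fun i => by fin_cases i; rfl

theorem face_one_ofTriple {x y z w : M} (g : 𝒢.Hom z w) (h : 𝒢.Hom y z) (k : 𝒢.Hom x y) :
    (ofTriple g h k).face 1 = ofPair (g.comp h) k :=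
  ext' (fun i => by fin_cases i <;> rfl) fun i => by fin_cases i <;> rfl

theorem face_two_ofTriple {x y z w : M} (g : 𝒢.Hom z w) (h : 𝒢.Hom y z) (k : 𝒢.Hom x y) :
    (ofTriple g h k).face 2 = ofPair g (h.comp k) :=
  ext' (fun i => by fin_cases i <;> rfl) fun i => by fin_cases i <;> rfl

theorem face_three_ofTriple {x y z w : M} (g : 𝒢.Hom z w) (h : 𝒢.Hom y z) (k : 𝒢.Hom x y) :
    (ofTriple g h k).face 3 = ofPair g h :=
  ext' (fun i => by fin_cases i <;> rfl) fun i => by fin_cases i <;> rfl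

theorem face_one_ofHom {x y : M} (g : 𝒢.Hom x y) : (ofHom g).face 1 = Nerve.point 𝒢 y :=
  ext' (fun i => by fin_cases i; rfl) fun i => i.elim0

end Nerve

/-- The involution that exchanges (i, j), for i ≤ j, with (j + 1, i) has no fixed points, preserves
F by hypothesis and changes the parity of i + j. This is the combinatorial part of δ² = 0. -/
theorem sum_range_alternating {R : Type*} [CommRing R] (n : ℕ) (F : ℕ → ℕ → R)
    (hF : ∀ i j, i ≤ j → j < n + 1 → F (j + 1) i = F i j) :
    ∑ i ∈ Finset.range (n + 2), ∑ j ∈ Finset.range (n + 1), (-1) ^ (i + j) * F i j = 0 := by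
  rw [← Finset.sum_product']
  refine Finset.sum_involution
    (fun a _ => if a.1 ≤ a.2 then (a.2 + 1, a.1) else (a.2, a.1 - 1)) ?_ ?_ ?_ ?_
  · rintro ⟨i, j⟩ h
    simp only [Finset.mem_product, Finset.mem_range] at h
    dsimp only
    split_ifs with hij
    · rw [hF i j hij h.2]; ring
    · obtain ⟨i, rfl⟩ : ∃ i', i = i' + 1 := ⟨i - 1, by omega⟩
      simp only [Nat.add_sub_cancel]
      rw [hF j i (by omega) (by omega)]; ring
  · rintro ⟨i, j⟩ h _
    dsimp only
    split_ifs with hij <;> simp only [ne_eq, Prod.mk.injEq, not_and] <;> omega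
  · rintro ⟨i, j⟩ h
    simp only [Finset.mem_product, Finset.mem_range] at h ⊢
    split_ifs with hij <;> dsimp only <;> omega
  · rintro ⟨i, j⟩ h
    dsimp only
    by_cases hij : i ≤ j
    · simp only [hij, if_true, show ¬ (j + 1 ≤ i) by omega, if_false, Nat.add_sub_cancel]
    · simp only [hij, if_false, show j ≤ i - 1 by omega, if_true, show i - 1 + 1 = i by omega]

theorem delta_delta {p : ℕ} (f : FunCochain 𝒢 p) : delta (delta f) = 0 := by
  refine Subtype.ext (funext fun σ => ?_)
  change ∑ i : Fin (p + 1 + 2), (-1 : ℝ) ^ i.1 *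
    ∑ j : Fin (p + 2), (-1 : ℝ) ^ j.1 * f.1 ((σ.face i).face j) = 0
  let F : ℕ → ℕ → ℝ := fun i j => if h : i < p + 3 ∧ j < p + 2 then
    f.1 ((σ.face ⟨i, h.1⟩).face ⟨j, h.2⟩) else 0
  have h := sum_range_alternating (p + 1) F fun i j hij hj => by
    simp only [F]
    rw [dif_pos ⟨by omega, by omega⟩, dif_pos ⟨by omega, by omega⟩, Nerve.face_face σ hij (by omega)]
  rw [Finset.sum_range] at h
  simp only [Finset.sum_range] at h
  rw [← h]
  refine Finset.sum_congr rfl fun i _ => ?_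
  rw [Finset.mul_sum]
  refine Finset.sum_congr rfl fun j _ => ?_
  simp only [F]
  rw [dif_pos ⟨i.2, j.2⟩, pow_add, mul_assoc]

end Nerves

end

end VBG

namespace VBG

noncomputable section

open Filter Topology

open LieGroupoid (Hom)

/-! ### Operators on cochains, the Leibniz rule and normalization -/

section Cochains

variable {EG HG EM HM : Type*} [NormedAddCommGroup EG] [NormedSpace ℝ EG] [TopologicalSpace HG]
  [NormedAddCommGroup EM] [NormedSpace ℝ EM] [TopologicalSpace HM]
  {I : ModelWithCorners ℝ EG HG} {G : Type*} [TopologicalSpace G] [ChartedSpace HG G]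
  {J : ModelWithCorners ℝ EM HM} {M : Type*} [TopologicalSpace M] [ChartedSpace HM M]
  {𝒢 : LieGroupoid I G J M} {E E' E'' C C' : VecBun.{v} J M}

/-- The value of a cochain at a simplex with initial vertex `x`. -/
def evalAt {p : ℕ} (σ : Nerve 𝒢 p) {x : M} (h : σ.base = x) : Cochain 𝒢 E p →ₗ[ℝ] E.fiber x :=
  (E.tr h).toLinearMap ∘ₗ (LinearMap.proj σ) ∘ₗ (Cochain 𝒢 E p).subtype

theorem evalAt_congr {p : ℕ} {σ τ : Nerve 𝒢 p} (k : σ = τ) {x : M} (h : σ.base = x)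
    (h' : τ.base = x) (η : Cochain 𝒢 E p) : evalAt σ h η = evalAt τ h' η := by
  subst k; rfl

theorem pt_evalAt {p : ℕ} (σ : Nerve 𝒢 p) {x : M} (h : σ.base = x) (η : Cochain 𝒢 E p) :
    E.pt x (evalAt σ h η) = E.pt σ.base (η.1 σ) := E.pt_tr h _

@[ext] theorem Cochain.ext' {p : ℕ} {η η' : Cochain 𝒢 E p} (h : ∀ σ, η.1 σ = η'.1 σ) : η = η' :=
  Subtype.ext (funext h)

variable (𝒢) in
/-- A smooth family of linear maps from the fibre over the final vertex of a `p`-simplex to the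
fibre over its initial vertex. -/
structure Fam (E E' : VecBun.{v} J M) (p : ℕ) where
  toFun : ∀ σ : Nerve 𝒢 p, E.fiber σ.last →ₗ[ℝ] E'.fiber σ.base
  smooth : ∀ (k : ℕ) (u : EuclideanSpace ℝ (Fin k) → Nerve 𝒢 p)
    (e : ∀ z, E.fiber (u z).last), Nerve.SmoothMap u →
      ContMDiff (𝓡 k) E.tModel ∞ (fun z => E.pt (u z).last (e z)) →
        ContMDiff (𝓡 k) E'.tModel ∞ (fun z => E'.pt (u z).base (toFun (u z) (e z)))

/-- A linear map between spaces of cochains preserves smooth families. -/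
def PreservesFamilies {p q : ℕ} (L : Cochain 𝒢 E p →ₗ[ℝ] Cochain 𝒢 E' q) : Prop :=
  ∀ η : ℝ → Cochain 𝒢 E p, IsSmoothFamily η → IsSmoothFamily fun r => L (η r)

/-- A family of linear maps on the front face of a simplex. -/
def Fam.app {p q n : ℕ} (l : Fam 𝒢 E E' p) (h : p + q = n) (σ : Nerve 𝒢 n) :
    E.fiber (σ.backN h).base →ₗ[ℝ] E'.fiber σ.base := l.toFun (σ.frontN h)

/-- The operator on cochains that applies a family of linear maps. -/
def Fam.hat {p q n : ℕ} (l : Fam 𝒢 E E' p) (h : p + q = n) :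
    Cochain 𝒢 E q →ₗ[ℝ] Cochain 𝒢 E' n where
  toFun η := ⟨fun σ => l.app h σ (η.1 (σ.backN h)), fun k u hu =>
    l.smooth k (fun z => (u z).frontN h) (fun z => η.1 ((u z).backN h)) (hu.frontN h)
      (η.2 k _ (hu.backN h))⟩
  map_add' _ _ := Cochain.ext' fun σ => map_add (l.app h σ) _ _
  map_smul' _ _ := Cochain.ext' fun σ => map_smul (l.app h σ) _ _

theorem Fam.hat_apply {p q n : ℕ} (l : Fam 𝒢 E E' p) (h : p + q = n) (η : Cochain 𝒢 E q)
    (σ : Nerve 𝒢 n) : (l.hat h η).1 σ = l.app h σ (η.1 (σ.backN h)) := rfl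

theorem Fam.preservesFamilies_hat {p q n : ℕ} (l : Fam 𝒢 E E' p) (h : p + q = n) :
    PreservesFamilies (l.hat h) := fun η hη k r u hr hu =>
  l.smooth k (fun z => (u z).frontN h) (fun z => (η (r z)).1 ((u z).backN h)) (hu.frontN h)
    (hη k r _ hr (hu.backN h))

theorem isSmoothFamily_add {p : ℕ} {η η' : ℝ → Cochain 𝒢 E p} (h : IsSmoothFamily η)
    (h' : IsSmoothFamily η') : IsSmoothFamily fun r => η r + η' r := fun k r u hr hu =>
  E.smooth_add (h k r u hr hu) (h' k r u hr hu)

theorem isSmoothFamily_sub {p : ℕ} {η η' : ℝ → Cochain 𝒢 E p} (h : IsSmoothFamily η)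
    (h' : IsSmoothFamily η') : IsSmoothFamily fun r => η r - η' r := fun k r u hr hu z =>
  E.smoothAt_sub (h k r u hr hu z) (h' k r u hr hu z)

theorem isSmoothFamily_zero {p : ℕ} : IsSmoothFamily fun _ : ℝ => (0 : Cochain 𝒢 E p) :=
  fun _ _ _ _ hu => E.smooth_zero (hu.1 _)

variable (𝒢 E) in
/-- The alternating sum over all faces but the initial one. -/
def tail (p : ℕ) : Cochain 𝒢 E p →ₗ[ℝ] Cochain 𝒢 E (p + 1) where
  toFun η := ⟨fun σ => ∑ i : Fin (p + 1), (-1 : ℝ) ^ (i.1 + 1) •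
      evalAt (σ.face i.succ) (σ.face_base_pos _ (by simp)) η, fun k u hu z =>
    E.smoothAt_sum _ (hu.1 _ z) fun i _ => E.smoothAt_smul contMDiffAt_const (by
      simp only [pt_evalAt]
      exact η.2 k _ (hu.face _) z)⟩
  map_add' η η' := Cochain.ext' fun σ => by
    simp only [map_add, smul_add, Finset.sum_add_distrib]
    rfl
  map_smul' c η := Cochain.ext' fun σ => by
    simp only [map_smul, smul_comm _ c, ← Finset.smul_sum]
    rfl

theorem tail_apply {p : ℕ} (η : Cochain 𝒢 E p) (σ : Nerve 𝒢 (p + 1)) :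
    (tail 𝒢 E p η).1 σ = ∑ i : Fin (p + 1), (-1 : ℝ) ^ (i.1 + 1) •
      evalAt (σ.face i.succ) (σ.face_base_pos _ (by simp)) η := rfl

theorem preservesFamilies_tail (p : ℕ) : PreservesFamilies (tail 𝒢 E p) := fun η hη k r u hr hu z =>
  E.smoothAt_sum (x := fun z => (u z).base) Finset.univ (hu.1 _ z)
    (a := fun (i : Fin (p + 1)) z => (-1 : ℝ) ^ (i.1 + 1) •
      evalAt ((u z).face i.succ) ((u z).face_base_pos _ (by simp)) (η (r z)))
    fun i _ => E.smoothAt_smul contMDiffAt_const (by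
      simp only [pt_evalAt]
      exact hη k r _ hr (hu.face _) z)

/-- The coboundary twisted by a family of linear maps along arrows. -/
def Fam.cobound (l : Fam 𝒢 E E 1) (p : ℕ) : Cochain 𝒢 E p →ₗ[ℝ] Cochain 𝒢 E (p + 1) :=
  l.hat (Nat.add_comm 1 p) + tail 𝒢 E p

theorem Fam.preservesFamilies_cobound (l : Fam 𝒢 E E 1) (p : ℕ) :
    PreservesFamilies (l.cobound p) := fun η hη =>
  isSmoothFamily_add (l.preservesFamilies_hat _ η hη) (preservesFamilies_tail p η hη)

/-- The right module structure, as a map into cochains of degree `n = p + q`. -/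
def starN {p q n : ℕ} (h : p + q = n) (f : FunCochain 𝒢 q) : Cochain 𝒢 E p →ₗ[ℝ] Cochain 𝒢 E n where
  toFun η := ⟨fun σ => f.1 (σ.backN h) • evalAt (σ.frontN h) (σ.frontN_base h) η,
    fun k u hu => E.smooth_smul (f.2 k _ (hu.backN h)) (η.2 k _ (hu.frontN h))⟩
  map_add' _ _ := Cochain.ext' fun _ => smul_add _ _ _
  map_smul' c η := Cochain.ext' fun σ => by
    change f.1 (σ.backN h) • evalAt (σ.frontN h) (σ.frontN_base h) (c • η) =
      c • (f.1 (σ.backN h) • evalAt (σ.frontN h) (σ.frontN_base h) η)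
    rw [map_smul, smul_comm]

theorem starN_apply {p q n : ℕ} (h : p + q = n) (f : FunCochain 𝒢 q) (η : Cochain 𝒢 E p)
    (σ : Nerve 𝒢 n) : (starN h f η).1 σ =
      f.1 (σ.backN h) • evalAt (σ.frontN h) (σ.frontN_base h) η := rfl

theorem star_eq_starN {p q : ℕ} (f : FunCochain 𝒢 q) : star E f p = starN rfl f := rfl

/-- The family sees only the first r arrows and the function only the last q arrows, so the two
operations do not interfere. -/
theorem Fam.hat_starN {p q r n m s : ℕ} (l : Fam 𝒢 E E' r) (f : FunCochain 𝒢 q)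
    (h : p + q = n) (h' : r + n = m) (k : r + p = s) (k' : s + q = m) (η : Cochain 𝒢 E p) :
    l.hat h' (starN h f η) = starN k' f (l.hat k η) := by
  subst k h h'
  refine Cochain.ext' fun σ => ?_
  simp only [Fam.hat_apply, starN_apply]
  have e1 : (σ.backN (p := r) rfl).backN (p := p) (q := q) rfl = σ.backN k' :=
    Nerve.ext' (fun i => congrArg σ.vert (Fin.ext (Nat.add_assoc _ _ _).symm))
      fun i => congrArg σ.arr (Fin.ext (Nat.add_assoc _ _ _).symm)
  rw [e1]
  exact map_smul (l.app rfl σ) _ _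

theorem evalAt_starN {p q n : ℕ} (h : p + q = n) (f : FunCochain 𝒢 q) (η : Cochain 𝒢 E p)
    (σ : Nerve 𝒢 n) {x : M} (hx : σ.base = x) {τ : Nerve 𝒢 p} (hτ : σ.frontN h = τ)
    {ρ : Nerve 𝒢 q} (hρ : σ.backN h = ρ) :
    evalAt σ hx (starN h f η) =
      f.1 ρ • evalAt τ (by rw [← hτ]; exact hx) η := by
  subst hτ hρ hx
  rfl

/-- The faces 1, …, p of σ act on η and the remaining ones on f. The right-hand side has two further
terms, from the last face of the front simplex and the initial face of the back simplex; they agree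
up to sign and cancel. -/
theorem tail_starN {p q n : ℕ} (h : p + q = n) (f : FunCochain 𝒢 q) (η : Cochain 𝒢 E p) :
    tail 𝒢 E n (starN h f η) = starN (by omega) f (tail 𝒢 E p η) +
      (-1 : ℝ) ^ p • starN (by omega) (delta f) η := by
  refine Cochain.ext' fun σ => ?_
  have h1 : p + 1 + q = n + 1 := by omega
  have h2 : p + (q + 1) = n + 1 := by omega
  change _ = f.1 (σ.backN h1) • evalAt (σ.frontN h1) (σ.frontN_base h1) (tail 𝒢 E p η) +
    (-1 : ℝ) ^ p • ((delta f).1 (σ.backN h2) • evalAt (σ.frontN h2) (σ.frontN_base h2) η)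
  have hb : (σ.frontN (p := p) (q := q + 1) (by omega)).base = σ.base := rfl
  rw [tail_apply]
  set a := evalAt (σ.frontN (p := p) (q := q + 1) (by omega)) hb η with ha
  -- The terms of the left-hand side (A), of the tail of η (B) and of δf (D), extended by zero to
  -- all natural numbers so that the range of summation can be split at p.
  let A : ℕ → E.fiber σ.base := fun i => if hi : i < n + 1 then (-1 : ℝ) ^ (i + 1) •
    evalAt (σ.face ⟨i + 1, by omega⟩) (σ.face_base_pos _ (by simp)) (starN h f η) else 0
  let B : ℕ → E.fiber σ.base := fun i => if hi : i < p + 1 then f.1 (σ.backN (by omega)) •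
    (-1 : ℝ) ^ (i + 1) • evalAt (x := σ.base)
      ((σ.frontN (p := p + 1) (q := q) (by omega)).face ⟨i + 1, by omega⟩)
      ((Nerve.face_base_pos _ (by simp) _).trans (σ.frontN_base h1)) η else 0
  let D : ℕ → ℝ := fun j => if hj : j < q + 2 then (-1 : ℝ) ^ j *
    f.1 ((σ.backN (p := p) (q := q + 1) (by omega)).face ⟨j, hj⟩) else 0
  have e1 : ∑ i : Fin (n + 1), (-1 : ℝ) ^ (i.1 + 1) •
      evalAt (σ.face i.succ) (σ.face_base_pos _ (by simp)) (starN h f η) =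
      ∑ i ∈ Finset.range (n + 1), A i := by
    rw [Finset.sum_range]
    refine Finset.sum_congr rfl fun i _ => ?_
    simp only [A]
    rw [dif_pos i.2]; rfl
  have e2 : f.1 (σ.backN h1) • evalAt (σ.frontN h1) (σ.frontN_base h1) (tail 𝒢 E p η) =
      ∑ i ∈ Finset.range (p + 1), B i := by
    have : evalAt (σ.frontN h1) (σ.frontN_base h1) (tail 𝒢 E p η) =
        ∑ i : Fin (p + 1), (-1 : ℝ) ^ (i.1 + 1) • evalAt (x := σ.base) ((σ.frontN h1).face i.succ)
          ((Nerve.face_base_pos _ (by simp) _).trans (σ.frontN_base h1)) η := rfl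
    rw [this, Finset.sum_range, Finset.smul_sum]
    refine Finset.sum_congr rfl fun i _ => ?_
    simp only [B]
    rw [dif_pos i.2]; rfl
  have e3 : (delta f).1 (σ.backN h2) = ∑ j ∈ Finset.range (q + 2), D j := by
    rw [Finset.sum_range]
    change ∑ j : Fin (q + 2), _ = _
    refine Finset.sum_congr rfl fun i _ => ?_
    simp only [D]
    rw [dif_pos i.2]
  have e4 : ∀ i < p, A i = B i := by
    intro i hi
    simp only [A, B]
    rw [dif_pos (by omega), dif_pos (by omega), smul_comm (f.1 _),
      evalAt_starN h f η _ _ (Nerve.frontN_face_le h σ (i := i + 1) (by omega))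
        (Nerve.backN_face_le h σ (i := i + 1) (by omega))]
  -- The surplus term of the tail of η is the negative of the surplus term D 0 of δf.
  have e5 : B p = -((-1 : ℝ) ^ p • D 0 • a) := by
    simp only [B, D]
    rw [dif_pos (by omega), dif_pos (by omega),
      evalAt_congr (Nerve.face_last_frontN h σ) _ hb, Nerve.face_zero_backN h σ, pow_zero, one_mul,
      smul_comm (f.1 _), pow_succ, mul_neg_one, neg_smul]
  have e6 : ∀ j < q + 1, A (p + j) = (-1 : ℝ) ^ p • D (j + 1) • a := by
    intro j hj
    simp only [A, D]
    rw [dif_pos (by omega), dif_pos (by omega),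
      evalAt_starN h f η (σ.face ⟨p + j + 1, by omega⟩) _
        (Nerve.frontN_face_gt h σ (j := j + 1) (by omega) (by omega))
        (Nerve.backN_face_gt h σ (j := j + 1) (by omega) (by omega)), ← mul_smul, ← mul_smul]
    congr 1
    rw [← mul_assoc, ← pow_add, Nat.add_assoc]
  rw [e1, e2, e3]
  have hn : Finset.range (n + 1) = Finset.range (p + (q + 1)) := by congr 1; omega
  rw [hn, Finset.sum_range_add, Finset.sum_range_succ B, Finset.sum_range_succ' D, add_smul, smul_add,
    e5, Finset.sum_smul, Finset.smul_sum]
  rw [Finset.sum_congr rfl fun i hi => e4 i (Finset.mem_range.1 hi),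
    Finset.sum_congr rfl fun j hj => e6 j (Finset.mem_range.1 hj)]
  abel

/-- The Leibniz rule for twisted coboundaries. -/
theorem Fam.cobound_starN {p q n : ℕ} (l : Fam 𝒢 E E 1) (h : p + q = n) (f : FunCochain 𝒢 q)
    (η : Cochain 𝒢 E p) :
    l.cobound n (starN h f η) = starN (by omega) f (l.cobound p η) +
      (-1 : ℝ) ^ p • starN (by omega) (delta f) η := by
  simp only [Fam.cobound, LinearMap.add_apply, map_add, tail_starN]
  rw [l.hat_starN f h (Nat.add_comm 1 n) (Nat.add_comm 1 p) (by omega) η]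
  exact (add_assoc _ _ _).symm

/-- A unit among the first p arrows kills the family, a unit among the others kills η. -/
theorem isNormalized_hat {p q n : ℕ} (l : Fam 𝒢 E E' p) (h : p + q = n)
    (hl : ∀ σ : Nerve 𝒢 p, (∃ i x, σ.arr i = 𝒢.one x) → l.toFun σ = 0) {η : Cochain 𝒢 E q}
    (hη : IsNormalized η) : IsNormalized (l.hat h η) := by
  rintro σ ⟨i, x, hi⟩
  rw [Fam.hat_apply]
  by_cases hip : i.1 < p
  · have : l.app h σ = 0 := hl (σ.frontN h) ⟨⟨i.1, hip⟩, x, hi⟩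
    rw [this]; rfl
  · have : η.1 (σ.backN h) = 0 := hη _ ⟨⟨i.1 - p, by omega⟩, x, by
      rw [← hi]
      change σ.arr _ = _
      congr 1
      ext
      dsimp only
      omega⟩
    rw [this, map_zero]

/-- If the arrow i is a unit, the faces i and i + 1 coincide and enter with opposite signs, while
every other face still contains a unit. For i = 0 the initial face is replaced by the action of l,
which is why l has to be the identity along units. -/
theorem isNormalized_cobound {p : ℕ} (l : Fam 𝒢 E E 1)
    (hl : ∀ (x : M) (e : E.fiber x), l.toFun (Nerve.ofHom (Hom.one 𝒢 x)) e = e)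
    {η : Cochain 𝒢 E p} (hη : IsNormalized η) : IsNormalized (l.cobound p η) := by
  rintro σ ⟨⟨i, hi⟩, x, hx⟩
  change l.app (Nat.add_comm 1 p) σ (η.1 (σ.backN _)) + (tail 𝒢 E p η).1 σ = 0
  rw [tail_apply]
  have hz : ∀ (k : Fin (p + 1)), k.1 + 1 ≠ i → k.1 ≠ i → (-1 : ℝ) ^ (k.1 + 1) •
      evalAt (σ.face k.succ) (σ.face_base_pos _ (by simp)) η = 0 := by
    intro k h1 h2
    obtain ⟨j, y, hj⟩ := σ.exists_unit_face hi hx k.succ (by simpa using h1) (by simpa using h2)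
    have : η.1 (σ.face k.succ) = 0 := hη _ ⟨j, y, hj⟩
    rw [show evalAt (σ.face k.succ) (σ.face_base_pos k.succ (by simp)) η =
      E.tr (σ.face_base_pos k.succ (by simp)) (η.1 (σ.face k.succ)) from rfl,
      this, map_zero, smul_zero]
  rcases Nat.eq_zero_or_pos i with h0 | h0
  · subst h0
    rw [Finset.sum_eq_single (⟨0, by omega⟩ : Fin (p + 1))]
    · have hx0 : σ.vert ⟨0, by omega⟩ = x := by
        rw [← 𝒢.tgt_one x, ← hx]; exact (σ.tgt_arr ⟨0, hi⟩).symm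
      have hx1 : σ.vert ⟨1, by omega⟩ = x := by
        rw [← 𝒢.src_one x, ← hx]; exact (σ.src_arr ⟨0, hi⟩).symm
      have hf : σ.frontN (Nat.add_comm 1 p) = Nerve.ofHom (Hom.one 𝒢 x) :=
        Nerve.ext' (fun i => by fin_cases i; exacts [hx0, hx1]) fun i => by fin_cases i; exact hx
      have hb : σ.backN (Nat.add_comm 1 p) = σ.face ⟨0 + 1, by omega⟩ := by
        rw [← σ.face_eq_face_of_unit hi hx]
        refine (Nerve.face_zero_backN (p := 0) (q := p) (Nat.zero_add p) σ).symm.trans ?_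
        congr 1
        exact Nerve.ext' (fun i => congrArg σ.vert (Fin.ext (Nat.zero_add _)))
          fun i => congrArg σ.arr (Fin.ext (Nat.zero_add _))
      have key : ∀ (τ : Nerve 𝒢 1) (e : E.fiber τ.last), τ = Nerve.ofHom (Hom.one 𝒢 x) →
          ∀ (k : τ.last = τ.base), l.toFun τ e = E.tr k e := by
        rintro τ e rfl k
        exact hl x e
      have h2 : l.app (Nat.add_comm 1 p) σ (η.1 (σ.backN (Nat.add_comm 1 p))) =
          evalAt (σ.face ⟨0 + 1, by omega⟩) (σ.face_base_pos _ (by simp)) η :=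
        (key _ _ hf (by rw [hf]; rfl)).trans
          (evalAt_congr hb (by rw [hb]; exact σ.face_base_pos _ (by simp)) _ η)
      rw [h2]
      simp only [zero_add, pow_one, neg_smul, one_smul]
      exact add_neg_cancel _
    · intro k _ hk
      exact hz k (by omega) fun h => hk (Fin.ext h)
    · simp
  -- For i > 0 the unit survives in the back simplex, so the term transported by l vanishes.
  · have hb0 : l.app (Nat.add_comm 1 p) σ (η.1 (σ.backN (Nat.add_comm 1 p))) = 0 := by
      have : η.1 (σ.backN (Nat.add_comm 1 p)) = 0 := hη _ ⟨⟨i - 1, by omega⟩, x, by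
        rw [← hx]
        change σ.arr _ = _
        congr 1
        ext
        dsimp only
        omega⟩
      rw [this, map_zero]
    rw [hb0, zero_add]
    obtain ⟨i, rfl⟩ : ∃ j, i = j + 1 := ⟨i - 1, by omega⟩
    rw [Finset.sum_eq_add_of_mem (⟨i, by omega⟩ : Fin (p + 1)) ⟨i + 1, hi⟩ (Finset.mem_univ _)
      (Finset.mem_univ _) (by simp)]
    · have hb := σ.face_eq_face_of_unit hi hx
      have h3 : evalAt (σ.face (⟨i, by omega⟩ : Fin (p + 1)).succ) (σ.face_base_pos _ (by simp)) η =
          evalAt (σ.face (⟨i + 1, hi⟩ : Fin (p + 1)).succ) (σ.face_base_pos _ (by simp)) η :=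
        evalAt_congr hb _ _ η
      rw [h3, ← add_smul]
      simp only [pow_succ]
      ring_nf
      exact zero_smul _ _
    · intro k _ hk
      exact hz k (fun h => hk.1 (Fin.ext (by dsimp only; omega))) fun h => hk.2 (Fin.ext h)

end Cochains

end

end VBG

namespace VBG

noncomputable section

open Filter Topology

open LieGroupoid (Hom)

/-! ### Cochains are generated by sections; function-linear maps are families of linear maps -/

section Generation

variable {EG HG EM HM : Type*} [NormedAddCommGroup EG] [NormedSpace ℝ EG] [TopologicalSpace HG]
  [NormedAddCommGroup EM] [NormedSpace ℝ EM] [TopologicalSpace HM]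
  {I : ModelWithCorners ℝ EG HG} {G : Type*} [TopologicalSpace G] [ChartedSpace HG G]
  {J : ModelWithCorners ℝ EM HM} {M : Type*} [TopologicalSpace M] [ChartedSpace HM M]
  {𝒢 : LieGroupoid I G J M} {E E' E'' C C' : VecBun.{v} J M}

/-- A smooth section as a `0`-cochain. -/
def ofSection (s : ∀ x, E.fiber x) (hs : ContMDiff J E.tModel ∞ (fun x => E.pt x (s x))) :
    Cochain 𝒢 E 0 :=
  ⟨fun σ => s σ.base, fun _ _ hu => hs.comp (hu.1 _)⟩

/-- A smooth function as a `0`-cochain. -/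
def ofFunction (φ : M → ℝ) (hφ : ContMDiff J 𝓘(ℝ, ℝ) ∞ φ) : FunCochain 𝒢 0 :=
  ⟨fun σ => φ σ.base, fun _ _ hu => hφ.comp (hu.1 _)⟩

/-- The coordinate of a cochain in a frame. -/
def VecBun.Frame.coordCochain {x₀ : M} (F : E.Frame x₀) (i : Fin F.rank) {p : ℕ}
    (η : Cochain 𝒢 E p) : FunCochain 𝒢 p :=
  ⟨fun σ => F.coord i σ.base (η.1 σ), fun k u hu => (F.smooth_coord i).comp (η.2 k u hu)⟩

/-- A function of the initial vertex as a cochain. -/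
def baseFunction (φ : M → ℝ) (hφ : ContMDiff J 𝓘(ℝ, ℝ) ∞ φ) (p : ℕ) : FunCochain 𝒢 p :=
  ⟨fun σ => φ σ.base, fun _ _ hu => hφ.comp (hu.1 _)⟩

/-- Pointwise multiplication of cochains by functions of the same degree. -/
def FunCochain.smulCochain {p : ℕ} (f : FunCochain 𝒢 p) (η : Cochain 𝒢 E p) : Cochain 𝒢 E p :=
  ⟨fun σ => f.1 σ • η.1 σ, fun k u hu => E.smooth_smul (f.2 k u hu) (η.2 k u hu)⟩

/-- Pointwise multiplication of functions. -/
def FunCochain.mul {p : ℕ} (f g : FunCochain 𝒢 p) : FunCochain 𝒢 p :=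
  ⟨fun σ => f.1 σ * g.1 σ, fun k u hu => (f.2 k u hu).mul (g.2 k u hu)⟩

theorem starN_zero_left {p : ℕ} (f : FunCochain 𝒢 p) (s : ∀ x, E.fiber x)
    (hs : ContMDiff J E.tModel ∞ (fun x => E.pt x (s x))) (σ : Nerve 𝒢 p) :
    (starN (Nat.zero_add p) f (ofSection s hs)).1 σ = f.1 σ • s σ.base := by
  have h : σ.backN (Nat.zero_add p) = σ :=
    Nerve.ext' (fun i => congrArg σ.vert (Fin.ext (Nat.zero_add _)))
      fun i => congrArg σ.arr (Fin.ext (Nat.zero_add _))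
  rw [starN_apply, h]
  rfl

variable [FiniteDimensional ℝ EM] [T2Space M] [IsManifold J ∞ M]

variable (𝒢) in
theorem exists_section_eq (x : M) (e : E.fiber x) : ∃ ε : Cochain 𝒢 E 0, atPoint ε x = e := by
  obtain ⟨F, -⟩ := E.exists_frame x
  refine ⟨∑ i, F.coord i x e • ofSection (F.sec i) (F.smooth_sec i), ?_⟩
  have h : ∀ (s : Finset (Fin F.rank)), atPoint (∑ i ∈ s, F.coord i x e •
      (ofSection (F.sec i) (F.smooth_sec i) : Cochain 𝒢 E 0)) x =
      ∑ i ∈ s, F.coord i x e • F.sec i x := by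
    intro s
    change evalAt (Nerve.point 𝒢 x) rfl _ = _
    rw [map_sum]
    refine Finset.sum_congr rfl fun i _ => ?_
    rw [map_smul]
    rfl
  rw [h, F.expand_self]

/-- A continuous module map out of the cochains is determined by its values on sections. -/
theorem eq_zero_of_starN [SigmaCompactSpace M] {p n : ℕ} (S : Cochain 𝒢 E p →ₗ[ℝ] Cochain 𝒢 E' n)
    (hS : PreservesFamilies S)
    (h : ∀ (f : FunCochain 𝒢 p) (ε : Cochain 𝒢 E 0), S (starN (Nat.zero_add p) f ε) = 0) :
    S = 0 := by
  classical
  refine LinearMap.ext fun α => Cochain.ext' fun σ => ?_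
  choose F _ using fun x₀ : M => E.exists_frame x₀
  -- The partition is subordinate to the open sets on which the frames reconstruct vectors exactly.
  obtain ⟨ρ, hρ⟩ := SmoothPartitionOfUnity.exists_isSubordinate J (s := Set.univ) isClosed_univ
    (fun x₀ : M => interior {y | (F x₀).bump y = 1}) (fun _ => isOpen_interior)
    (fun x _ => Set.mem_iUnion.2 ⟨x, mem_interior_iff_mem_nhds.2 (F x).bump_eq⟩)
  -- Each piece ρ i • α is a finite combination of multiples of frame sections, so S kills it. But α
  -- may be an infinite sum of pieces, so linearity alone does not finish the proof.
  have hpiece : ∀ i, S (FunCochain.smulCochain (baseFunction (ρ i) (ρ i).contMDiff p) α) = 0 := by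
    intro i
    have e : FunCochain.smulCochain (baseFunction (ρ i) (ρ i).contMDiff p) α =
        ∑ j, starN (Nat.zero_add p)
          (FunCochain.mul (baseFunction (ρ i) (ρ i).contMDiff p) ((F i).coordCochain j α))
          (ofSection ((F i).sec j) ((F i).smooth_sec j)) := by
      refine Cochain.ext' fun σ => ?_
      have hsum : ∀ (s : Finset (Fin (F i).rank)) (η : Fin (F i).rank → Cochain 𝒢 E p),
          (∑ j ∈ s, η j).1 σ = ∑ j ∈ s, (η j).1 σ := by
        intro s η
        exact map_sum (evalAt σ rfl) η s
      rw [hsum]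
      simp only [starN_zero_left]
      change ρ i σ.base • α.1 σ = ∑ j, (ρ i σ.base * (F i).coord j σ.base (α.1 σ)) • _
      simp only [mul_smul, ← Finset.smul_sum]
      rw [(F i).expand]
      by_cases hi : ρ i σ.base = 0
      · rw [hi, zero_smul, zero_smul]
      · have : (F i).bump σ.base = 1 :=
          interior_subset (s := {y | (F i).bump y = 1})
            (hρ i (subset_tsupport _ (Function.mem_support.2 hi)))
        rw [this, one_smul]
    rw [e, map_sum]
    exact Finset.sum_eq_zero fun j _ => h _ _
  let T : M → Set M := fun i => Function.support (ρ i)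
  have hlf : LocallyFinite T := ρ.locallyFinite
  -- By σ-compactness a locally finite family has only countably many nonempty members, so the
  -- nonzero pieces can be numbered.
  have hct : {i | (T i).Nonempty}.Countable := by
    have h1 : LocallyFinite fun i : {i // (T i).Nonempty} => T i :=
      hlf.comp_injective Subtype.coe_injective
    have h2 := h1.countable_univ fun i => i.2
    have h3 := h2.image (Subtype.val : {i // (T i).Nonempty} → M)
    refine h3.mono fun i hi => ?_
    exact (Set.mem_image _ _ _).2 ⟨(⟨i, hi⟩ : {i // (T i).Nonempty}), Set.mem_univ _, rfl⟩
  obtain ⟨num, hnum⟩ := Set.countable_iff_exists_injOn.1 hct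
  let θ := Real.smoothTransition
  -- The weight of the i-th piece is 0 at r = 0 and is 1 as soon as `num i * r` is at least 1. Hence
  -- the curve r ↦ g(r) • α starts at 0, and for each r > 0 it differs from α by finitely many
  -- pieces.
  let g : ℝ → M → ℝ := fun r x => ∑ᶠ i, θ (num i * r) * ρ i x
  have hg : ∀ (k : ℕ) (r : EuclideanSpace ℝ (Fin k) → ℝ) (x : EuclideanSpace ℝ (Fin k) → M),
      ContMDiff (𝓡 k) 𝓘(ℝ, ℝ) ∞ r → ContMDiff (𝓡 k) J ∞ x →
        ContMDiff (𝓡 k) 𝓘(ℝ, ℝ) ∞ (fun z => g (r z) (x z)) := by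
    intro k r x hr hx
    refine contMDiff_finsum (fun i => ?_) ?_
    · refine ContMDiff.mul ?_ ((ρ i).contMDiff.comp hx)
      exact (Real.smoothTransition.contDiff (n := ⊤)).contMDiff.comp (contMDiff_const.mul hr)
    · refine (hlf.preimage_continuous hx.continuous).subset fun i z hz => ?_
      exact fun h0 => hz (by simp [h0])
  have hconst : ∀ r, ContMDiff J 𝓘(ℝ, ℝ) ∞ (g r) := fun r => by
    refine contMDiff_finsum (fun i => contMDiff_const.mul (ρ i).contMDiff) ?_
    refine hlf.subset fun i z hz => ?_
    exact fun h0 => hz (by simp [h0])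
  let X : ℝ → Cochain 𝒢 E p := fun r => FunCochain.smulCochain (baseFunction (g r) (hconst r) p) α
  have hX : IsSmoothFamily X := fun k r u hr hu =>
    E.smooth_smul (hg k r _ hr (hu.1 _)) (α.2 k u hu)
  have hX0 : X 0 = 0 := Cochain.ext' fun σ => by
    change g 0 σ.base • α.1 σ = 0
    have : g 0 σ.base = 0 := by
      simp only [g, mul_zero]
      exact finsum_eq_zero_of_forall_eq_zero fun i => by
        rw [show θ 0 = 0 from Real.smoothTransition.zero_of_nonpos le_rfl, zero_mul]
    rw [this, zero_smul]
  have hXN : ∀ N : ℕ, S (X (1 / ((N : ℝ) + 1))) = S α := by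
    intro N
    set r : ℝ := 1 / ((N : ℝ) + 1) with hr
    have hrN : r * ((N : ℝ) + 1) = 1 := by rw [hr]; field_simp
    have hr0 : 0 < r := by positivity
    -- Exactly these pieces may have weight less than 1 at r = 1 / (N + 1), since `num i * r` ≥ 1
    -- once `num i` exceeds N.
    have hfin : {i | (T i).Nonempty ∧ num i ≤ N}.Finite := by
      refine Set.Finite.of_finite_image (f := num) ((Set.finite_le_nat N).subset ?_)
        (hnum.mono fun i hi => hi.1)
      rintro _ ⟨i, hi, rfl⟩
      exact hi.2
    have e : α = X r + ∑ i ∈ hfin.toFinset, (1 - θ (num i * r)) •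
        (FunCochain.smulCochain (baseFunction (ρ i) (ρ i).contMDiff p) α) := by
      refine Cochain.ext' fun σ => ?_
      have hsum : ∀ (s : Finset M) (η : M → Cochain 𝒢 E p),
          (∑ j ∈ s, η j).1 σ = ∑ j ∈ s, (η j).1 σ := by
        intro s η
        exact map_sum (evalAt σ rfl) η s
      change α.1 σ = g r σ.base • α.1 σ + (∑ i ∈ hfin.toFinset, (1 - θ (num i * r)) •
        (FunCochain.smulCochain (baseFunction (ρ i) (ρ i).contMDiff p) α)).1 σ
      rw [hsum]
      change α.1 σ = g r σ.base • α.1 σ + ∑ i ∈ hfin.toFinset, (1 - θ (num i * r)) •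
        (ρ i σ.base • α.1 σ)
      simp only [← mul_smul]
      rw [← Finset.sum_smul, ← add_smul]
      have hfx : {i | ρ i σ.base ≠ 0}.Finite := hlf.point_finite σ.base
      have hone : ∑ᶠ i, ρ i σ.base = 1 := ρ.sum_eq_one (Set.mem_univ _)
      have h3 : ∑ i ∈ hfin.toFinset, (1 - θ (num i * r)) * ρ i σ.base =
          ∑ᶠ i, (1 - θ (num i * r)) * ρ i σ.base := by
        refine (finsum_eq_sum_of_support_subset _ fun i hi => ?_).symm
        simp only [Set.Finite.coe_toFinset, Set.mem_ofPred_eq]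
        have hi1 : ρ i σ.base ≠ 0 := fun h0 => hi (by simp [h0])
        refine ⟨⟨σ.base, hi1⟩, ?_⟩
        by_contra! hN
        refine hi ?_
        have : θ (num i * r) = 1 := Real.smoothTransition.one_of_one_le (by
          have h4 : (N : ℝ) + 1 ≤ num i := by exact_mod_cast hN
          nlinarith)
        simp [this]
      have h5 : g r σ.base + ∑ i ∈ hfin.toFinset, (1 - θ (num i * r)) * ρ i σ.base = 1 := by
        rw [h3, ← finsum_add_distrib]
        · refine (finsum_congr fun i => ?_).trans hone
          change θ (num i * r) * ρ i σ.base + (1 - θ (num i * r)) * ρ i σ.base = ρ i σ.base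
          ring
        · exact hfx.subset fun i hi h0 => hi (by simp [h0])
        · exact hfx.subset fun i hi h0 => hi (by simp [h0])
      rw [h5, one_smul]
    conv_rhs => rw [e]
    rw [map_add, map_sum, Finset.sum_eq_zero, add_zero]
    intro i _
    rw [map_smul, hpiece, smul_zero]
  -- S maps the curve to a smooth family that equals S α at every r = 1 / (N + 1) and vanishes at r
  -- = 0; comparing the limit gives S α = 0.
  have hSX := hS X hX
  obtain ⟨F', -⟩ := E'.exists_frame σ.base
  have hc := hSX 1 (fun z => z 0) (fun _ => σ) (by
    exact (EuclideanSpace.proj (𝕜 := ℝ) (0 : Fin 1)).contDiff.contMDiff)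
    ⟨fun _ => contMDiff_const, fun _ => contMDiff_const⟩
  have hzero : ∀ j, F'.coord j σ.base ((S α).1 σ) = 0 := by
    intro j
    have hcj : Continuous fun z : EuclideanSpace ℝ (Fin 1) =>
        F'.coord j σ.base ((S (X (z 0))).1 σ) := ((F'.smooth_coord j).comp hc).continuous
    have hlim : Tendsto (fun N : ℕ => EuclideanSpace.single (0 : Fin 1) (1 / ((N : ℝ) + 1)))
        atTop (𝓝 0) := by
      have h1 : Continuous fun t : ℝ => (EuclideanSpace.single (0 : Fin 1) t : EuclideanSpace ℝ (Fin 1)) := by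
        refine (PiLp.continuous_toLp 2 _).comp (continuous_pi fun i => ?_)
        simpa [Subsingleton.elim i 0] using (continuous_id' : Continuous fun a : ℝ => a)
      have h2 := (h1.tendsto 0).comp (tendsto_one_div_add_atTop_nhds_zero_nat (𝕜 := ℝ))
      rwa [show EuclideanSpace.single (0 : Fin 1) (0 : ℝ) = 0 by simp] at h2
    have h3 := (hcj.tendsto 0).comp hlim
    have h4 : (fun N : ℕ => F'.coord j σ.base ((S α).1 σ)) =
        (fun z : EuclideanSpace ℝ (Fin 1) => F'.coord j σ.base ((S (X (z 0))).1 σ)) ∘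
        fun N : ℕ => EuclideanSpace.single (0 : Fin 1) (1 / ((N : ℝ) + 1)) := by
      funext N
      simp only [Function.comp_apply]
      rw [show (EuclideanSpace.single (0 : Fin 1) (1 / ((N : ℝ) + 1))) 0 = 1 / ((N : ℝ) + 1) by simp,
        hXN]
    rw [← h4] at h3
    have h5 := tendsto_nhds_unique h3 tendsto_const_nhds
    rw [← h5]
    change F'.coord j σ.base ((S (X ((0 : EuclideanSpace ℝ (Fin 1)) 0))).1 σ) = 0
    rw [show (0 : EuclideanSpace ℝ (Fin 1)) 0 = 0 from rfl, hX0, map_zero]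
    exact map_zero _
  change (S α).1 σ = 0
  rw [← F'.expand_self ((S α).1 σ)]
  simp only [hzero, zero_smul, Finset.sum_const_zero]

/-- A linear map on sections that is linear over functions at the final vertex is given by a family
of linear maps. -/
theorem exists_fam {p : ℕ} (L : Cochain 𝒢 E 0 →ₗ[ℝ] Cochain 𝒢 E' p)
    (hL : ∀ (φ : FunCochain 𝒢 0) (ε : Cochain 𝒢 E 0) (σ : Nerve 𝒢 p),
      (L (starN (Nat.zero_add 0) φ ε)).1 σ = φ.1 (Nerve.point 𝒢 σ.last) • (L ε).1 σ) :
    ∃ l : Fam 𝒢 E E' p, ∀ (ε : Cochain 𝒢 E 0) (σ : Nerve 𝒢 p),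
      (L ε).1 σ = l.toFun σ (atPoint ε σ.last) := by
  choose F _ using fun x₀ : M => E.exists_frame x₀
  let sec : ∀ x₀ : M, Fin (F x₀).rank → Cochain 𝒢 E 0 := fun x₀ i =>
    ofSection ((F x₀).sec i) ((F x₀).smooth_sec i)
  let l : ∀ σ : Nerve 𝒢 p, E.fiber σ.last →ₗ[ℝ] E'.fiber σ.base := fun σ =>
    ∑ i, ((F σ.last).coord i σ.last).smulRight ((L (sec σ.last i)).1 σ)
  have hsum : ∀ {A : VecBun.{v} J M} {q : ℕ} (σ : Nerve 𝒢 q) {ι : Type} (s : Finset ι)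
      (η : ι → Cochain 𝒢 A q), (∑ j ∈ s, η j).1 σ = ∑ j ∈ s, (η j).1 σ := by
    intro A q σ ι s η
    exact map_sum (evalAt σ rfl) η s
  have hl : ∀ (ε : Cochain 𝒢 E 0) (σ : Nerve 𝒢 p), (L ε).1 σ = l σ (atPoint ε σ.last) := by
    intro ε σ
    let Fx := F σ.last
    -- Cut off by the bump function, ε is a combination of frame sections with its coordinates as
    -- coefficients. The bump function is 1 at the final vertex, so L ε at σ depends on the value of
    -- ε there only.
    have e : starN (Nat.zero_add 0) (ofFunction Fx.bump Fx.smooth_bump) ε =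
        ∑ i, starN (Nat.zero_add 0) (Fx.coordCochain i ε) (sec σ.last i) := by
      refine Cochain.ext' fun τ => ?_
      rw [hsum]
      simp only [sec, starN_zero_left]
      change _ = ∑ i, Fx.coord i τ.base (ε.1 τ) • Fx.sec i τ.base
      rw [Fx.expand]
      obtain ⟨x, rfl⟩ := τ.exists_point
      rfl
    have h1 := congrArg (fun η => (L η).1 σ) e
    simp only [map_sum] at h1
    rw [hsum, hL] at h1
    simp only [hL] at h1
    have h2 : (ofFunction Fx.bump Fx.smooth_bump : FunCochain 𝒢 0).1 (Nerve.point 𝒢 σ.last) = 1 :=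
      Fx.bump_eq.self_of_nhds
    rw [h2, one_smul] at h1
    rw [h1]
    simp only [l, LinearMap.sum_apply, LinearMap.smulRight_apply]
    rfl
  refine ⟨⟨l, fun k u e hu he z₀ => ?_⟩, hl⟩
  have hlast : ContMDiff (𝓡 k) J ∞ (fun z => (u z).last) := hu.1 _
  -- The frame in the definition of `l` varies with the simplex. Smoothness at z₀ is proved with the
  -- single frame chosen at the final vertex of u z₀, which computes the same maps nearby.
  have h1 : ContMDiffAt (𝓡 k) E'.tModel ∞ (fun z => E'.pt (u z).base
      (∑ i, (F (u z₀).last).coord i (u z).last (e z) • (L (sec (u z₀).last i)).1 (u z))) z₀ :=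
    E'.smoothAt_sum _ (hu.1 _ z₀) fun i _ => E'.smoothAt_smul
      ((F (u z₀).last).smoothAt_coord i (he z₀)) ((L (sec (u z₀).last i)).2 k u hu z₀)
  refine h1.congr_of_eventuallyEq ?_
  filter_upwards [(F (u z₀).last).eventually_expand hlast.continuous.continuousAt rfl] with z hz
  congr 1
  conv_lhs => rw [← hz (e z)]
  rw [map_sum]
  refine Finset.sum_congr rfl fun i _ => ?_
  rw [map_smul, hl]
  rfl

end Generation

end

end VBG

namespace VBG

noncomputable section

open Filter Topology

open LieGroupoid (Hom)

/-! ### Evaluation on small simplices and operators on the graded module -/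

section Graded

variable {EG HG EM HM : Type*} [NormedAddCommGroup EG] [NormedSpace ℝ EG] [TopologicalSpace HG]
  [NormedAddCommGroup EM] [NormedSpace ℝ EM] [TopologicalSpace HM]
  {I : ModelWithCorners ℝ EG HG} {G : Type*} [TopologicalSpace G] [ChartedSpace HG G]
  {J : ModelWithCorners ℝ EM HM} {M : Type*} [TopologicalSpace M] [ChartedSpace HM M]
  {𝒢 : LieGroupoid I G J M} {E E' E'' C C' C'' : VecBun.{v} J M}

/-! ### Values on small simplices -/

/-- The value of a `0`-cochain at a point. -/
def ev0 (x : M) : Cochain 𝒢 E 0 →ₗ[ℝ] E.fiber x := evalAt (Nerve.point 𝒢 x) rfl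

/-- The value of a `1`-cochain at an arrow. -/
def ev1 {x y : M} (g : 𝒢.Hom x y) : Cochain 𝒢 E 1 →ₗ[ℝ] E.fiber y := evalAt (Nerve.ofHom g) rfl

/-- The value of a `2`-cochain at a pair of arrows. -/
def ev2 {x y z : M} (g : 𝒢.Hom y z) (h : 𝒢.Hom x y) : Cochain 𝒢 E 2 →ₗ[ℝ] E.fiber z :=
  evalAt (Nerve.ofPair g h) rfl

/-- The value of a `3`-cochain at a triple of arrows. -/
def ev3 {x y z w : M} (g : 𝒢.Hom z w) (h : 𝒢.Hom y z) (k : 𝒢.Hom x y) :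
    Cochain 𝒢 E 3 →ₗ[ℝ] E.fiber w :=
  evalAt (Nerve.ofTriple g h k) rfl

theorem ext_ev0 {η η' : Cochain 𝒢 E 0} (h : ∀ x, ev0 x η = ev0 x η') : η = η' :=
  Cochain.ext' fun σ => by obtain ⟨x, rfl⟩ := σ.exists_point; exact h x

theorem ext_ev1 {η η' : Cochain 𝒢 E 1} (h : ∀ {x y : M} (g : 𝒢.Hom x y), ev1 g η = ev1 g η') :
    η = η' :=
  Cochain.ext' fun σ => by obtain ⟨x, y, g, rfl⟩ := σ.exists_ofHom; exact h g

theorem ext_ev2 {η η' : Cochain 𝒢 E 2}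
    (h : ∀ {x y z : M} (g : 𝒢.Hom y z) (k : 𝒢.Hom x y), ev2 g k η = ev2 g k η') : η = η' :=
  Cochain.ext' fun σ => by obtain ⟨x, y, z, g, k, rfl⟩ := σ.exists_ofPair; exact h g k

theorem ext_ev3 {η η' : Cochain 𝒢 E 3} (h : ∀ {x y z w : M} (f : 𝒢.Hom z w) (g : 𝒢.Hom y z)
    (k : 𝒢.Hom x y), ev3 f g k η = ev3 f g k η') : η = η' :=
  Cochain.ext' fun σ => by obtain ⟨x, y, z, w, f, g, k, rfl⟩ := σ.exists_ofTriple; exact h f g k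

/-- A degree `0` family at a point. -/
def Fam.f0 (l : Fam 𝒢 E E' 0) (x : M) : E.fiber x →ₗ[ℝ] E'.fiber x := l.toFun (Nerve.point 𝒢 x)

/-- A degree `1` family at an arrow. -/
def Fam.f1 (l : Fam 𝒢 E E' 1) {x y : M} (g : 𝒢.Hom x y) : E.fiber x →ₗ[ℝ] E'.fiber y :=
  l.toFun (Nerve.ofHom g)

/-- A degree `2` family at a pair of arrows. -/
def Fam.f2 (l : Fam 𝒢 E E' 2) {x y z : M} (g : 𝒢.Hom y z) (h : 𝒢.Hom x y) :
    E.fiber x →ₗ[ℝ] E'.fiber z :=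
  l.toFun (Nerve.ofPair g h)

theorem Fam.eval_hat {p q n : ℕ} (l : Fam 𝒢 E E' p) (h : p + q = n) (η : Cochain 𝒢 E q)
    {σ : Nerve 𝒢 n} {τ : Nerve 𝒢 p} {ρ : Nerve 𝒢 q} (hτ : σ.frontN h = τ) (hρ : σ.backN h = ρ)
    (k : ρ.base = τ.last) (k' : σ.base = τ.base) :
    evalAt σ k' (l.hat h η) = l.toFun τ (evalAt ρ k η) := by
  subst hτ hρ; rfl

theorem Fam.ev0_hat (l : Fam 𝒢 E E' 0) (h : 0 + 0 = 0) (η : Cochain 𝒢 E 0) (x : M) :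
    ev0 x (l.hat h η) = l.f0 x (ev0 x η) := rfl

theorem Fam.ev1_hat0 (l : Fam 𝒢 E E' 0) (h : 0 + 1 = 1) (η : Cochain 𝒢 E 1) {x y : M}
    (g : 𝒢.Hom x y) : ev1 g (l.hat h η) = l.f0 y (ev1 g η) :=
  l.eval_hat h η (σ := Nerve.ofHom g) (τ := Nerve.point 𝒢 y) (ρ := Nerve.ofHom g)
    (Nerve.ext' (fun i => by fin_cases i; rfl) fun i => i.elim0)
    (Nerve.ext' (fun i => by fin_cases i <;> rfl) fun i => by fin_cases i; rfl) rfl rfl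

theorem Fam.ev2_hat0 (l : Fam 𝒢 E E' 0) (h : 0 + 2 = 2) (η : Cochain 𝒢 E 2) {x y z : M}
    (g : 𝒢.Hom y z) (k : 𝒢.Hom x y) : ev2 g k (l.hat h η) = l.f0 z (ev2 g k η) :=
  l.eval_hat h η (σ := Nerve.ofPair g k) (τ := Nerve.point 𝒢 z) (ρ := Nerve.ofPair g k)
    (Nerve.ext' (fun i => by fin_cases i; rfl) fun i => i.elim0)
    (Nerve.ext' (fun i => by fin_cases i <;> rfl) fun i => by fin_cases i <;> rfl) rfl rfl

theorem Fam.ev1_hat (l : Fam 𝒢 E E' 1) (h : 1 + 0 = 1) (η : Cochain 𝒢 E 0) {x y : M}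
    (g : 𝒢.Hom x y) : ev1 g (l.hat h η) = l.f1 g (ev0 x η) :=
  l.eval_hat h η (σ := Nerve.ofHom g) (τ := Nerve.ofHom g) (ρ := Nerve.point 𝒢 x)
    (Nerve.ext' (fun i => by fin_cases i <;> rfl) fun i => by fin_cases i; rfl)
    (Nerve.ext' (fun i => by fin_cases i; rfl) fun i => i.elim0) rfl rfl

theorem Fam.ev2_hat1 (l : Fam 𝒢 E E' 1) (h : 1 + 1 = 2) (η : Cochain 𝒢 E 1) {x y z : M}
    (g : 𝒢.Hom y z) (k : 𝒢.Hom x y) : ev2 g k (l.hat h η) = l.f1 g (ev1 k η) :=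
  l.eval_hat h η (σ := Nerve.ofPair g k) (τ := Nerve.ofHom g) (ρ := Nerve.ofHom k)
    (Nerve.ext' (fun i => by fin_cases i <;> rfl) fun i => by fin_cases i; rfl)
    (Nerve.ext' (fun i => by fin_cases i <;> rfl) fun i => by fin_cases i; rfl) rfl rfl

theorem Fam.ev3_hat1 (l : Fam 𝒢 E E' 1) (h : 1 + 2 = 3) (η : Cochain 𝒢 E 2) {x y z w : M}
    (f : 𝒢.Hom z w) (g : 𝒢.Hom y z) (k : 𝒢.Hom x y) :
    ev3 f g k (l.hat h η) = l.f1 f (ev2 g k η) :=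
  l.eval_hat h η (σ := Nerve.ofTriple f g k) (τ := Nerve.ofHom f) (ρ := Nerve.ofPair g k)
    (Nerve.ext' (fun i => by fin_cases i <;> rfl) fun i => by fin_cases i; rfl)
    (Nerve.ext' (fun i => by fin_cases i <;> rfl) fun i => by fin_cases i <;> rfl) rfl rfl

theorem Fam.ev2_hat (l : Fam 𝒢 E E' 2) (h : 2 + 0 = 2) (η : Cochain 𝒢 E 0) {x y z : M}
    (g : 𝒢.Hom y z) (k : 𝒢.Hom x y) : ev2 g k (l.hat h η) = l.f2 g k (ev0 x η) :=
  l.eval_hat h η (σ := Nerve.ofPair g k) (τ := Nerve.ofPair g k) (ρ := Nerve.point 𝒢 x)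
    (Nerve.ext' (fun i => by fin_cases i <;> rfl) fun i => by fin_cases i <;> rfl)
    (Nerve.ext' (fun i => by fin_cases i; rfl) fun i => i.elim0) rfl rfl

theorem Fam.ev3_hat (l : Fam 𝒢 E E' 2) (h : 2 + 1 = 3) (η : Cochain 𝒢 E 1) {x y z w : M}
    (f : 𝒢.Hom z w) (g : 𝒢.Hom y z) (k : 𝒢.Hom x y) :
    ev3 f g k (l.hat h η) = l.f2 f g (ev1 k η) :=
  l.eval_hat h η (σ := Nerve.ofTriple f g k) (τ := Nerve.ofPair f g) (ρ := Nerve.ofHom k)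
    (Nerve.ext' (fun i => by fin_cases i <;> rfl) fun i => by fin_cases i <;> rfl)
    (Nerve.ext' (fun i => by fin_cases i <;> rfl) fun i => by fin_cases i; rfl) rfl rfl

theorem Fam.ev1_cobound (l : Fam 𝒢 E E 1) (η : Cochain 𝒢 E 0) {x y : M} (g : 𝒢.Hom x y) :
    ev1 g (l.cobound 0 η) = l.f1 g (ev0 x η) - ev0 y η := by
  have h : ev1 g (tail 𝒢 E 0 η) = -ev0 y η := by
    change ∑ i : Fin 1, (-1 : ℝ) ^ (i.1 + 1) • evalAt (x := y) ((Nerve.ofHom g).face i.succ) _ η = _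
    rw [Fin.sum_univ_one]
    simp only [Fin.val_zero, zero_add, pow_one, neg_smul, one_smul]
    exact congrArg Neg.neg (evalAt_congr (Nerve.face_one_ofHom g) _ _ η)
  rw [sub_eq_add_neg, ← h, ← l.ev1_hat rfl η g]
  rfl

theorem Fam.ev2_cobound (l : Fam 𝒢 E E 1) (η : Cochain 𝒢 E 1) {x y z : M} (g : 𝒢.Hom y z)
    (k : 𝒢.Hom x y) :
    ev2 g k (l.cobound 1 η) = l.f1 g (ev1 k η) - ev1 (g.comp k) η + ev1 g η := by
  have h : ev2 g k (tail 𝒢 E 1 η) = -ev1 (g.comp k) η + ev1 g η := by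
    change ∑ i : Fin 2, (-1 : ℝ) ^ (i.1 + 1) •
      evalAt (x := z) ((Nerve.ofPair g k).face i.succ) _ η = _
    rw [Fin.sum_univ_two]
    simp only [Fin.val_zero, Fin.val_one, zero_add, pow_one, neg_smul, one_smul, one_add_one_eq_two,
      neg_one_sq]
    exact congrArg₂ (fun a b => -a + b) (evalAt_congr (Nerve.face_one_ofPair g k) _ _ η)
      (evalAt_congr (Nerve.face_two_ofPair g k) _ _ η)
  rw [sub_add, sub_eq_add_neg, neg_sub', sub_neg_eq_add, ← h, ← l.ev2_hat1 rfl η g k]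
  rfl

theorem Fam.ev3_cobound (l : Fam 𝒢 E E 1) (η : Cochain 𝒢 E 2) {x y z w : M} (f : 𝒢.Hom z w)
    (g : 𝒢.Hom y z) (k : 𝒢.Hom x y) :
    ev3 f g k (l.cobound 2 η) =
      l.f1 f (ev2 g k η) - ev2 (f.comp g) k η + ev2 f (g.comp k) η - ev2 f g η := by
  have hs : ∀ a b c : E.fiber w, (-1 : ℝ) ^ (0 + 1) • a + (-1 : ℝ) ^ (1 + 1) • b +
      (-1 : ℝ) ^ (2 + 1) • c = -a + b + -c := fun a b c => by
    norm_num
  have h : ev3 f g k (tail 𝒢 E 2 η) =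
      -ev2 (f.comp g) k η + ev2 f (g.comp k) η + -ev2 f g η := by
    change ∑ i : Fin 3, (-1 : ℝ) ^ (i.1 + 1) •
      evalAt (x := w) ((Nerve.ofTriple f g k).face i.succ) _ η = _
    rw [Fin.sum_univ_three]
    have e1 := evalAt_congr (Nerve.face_one_ofTriple f g k) (Nerve.face_base_pos _ (by simp) _) rfl η
    have e2 := evalAt_congr (Nerve.face_two_ofTriple f g k) (Nerve.face_base_pos _ (by simp) _) rfl η
    have e3 := evalAt_congr (Nerve.face_three_ofTriple f g k) (Nerve.face_base_pos _ (by simp) _)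
      rfl η
    refine (congrArg₂ (· + ·) (congrArg₂ (· + ·) (congrArg _ e1) (congrArg _ e2))
      (congrArg _ e3)).trans ?_
    exact hs _ _ _
  have h2 : ev3 f g k (l.cobound 2 η) = l.f1 f (ev2 g k η) + ev3 f g k (tail 𝒢 E 2 η) := by
    rw [← l.ev3_hat1 rfl η f g k]; rfl
  rw [h2, h]
  abel

/-! ### Operators on the graded module -/

/-- The operator on a direct sum with components that raise the cochain degree by `s`. -/
def shift (s : ℕ) (L : ∀ p, Cochain 𝒢 E p →ₗ[ℝ] Cochain 𝒢 E' (p + s)) :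
    (⨁ p, Cochain 𝒢 E p) →ₗ[ℝ] ⨁ p, Cochain 𝒢 E' p :=
  DirectSum.toModule ℝ ℕ _ fun p => DirectSum.lof ℝ ℕ (fun q => Cochain 𝒢 E' q) (p + s) ∘ₗ L p

theorem shift_lof (s : ℕ) (L : ∀ p, Cochain 𝒢 E p →ₗ[ℝ] Cochain 𝒢 E' (p + s)) (p : ℕ)
    (η : Cochain 𝒢 E p) :
    shift s L (DirectSum.lof ℝ ℕ (fun q => Cochain 𝒢 E q) p η) =
      DirectSum.lof ℝ ℕ (fun q => Cochain 𝒢 E' q) (p + s) (L p η) :=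
  DirectSum.toModule_lof ..

theorem lof_apply_self (p : ℕ) (η : Cochain 𝒢 E p) :
    (DirectSum.lof ℝ ℕ (fun q => Cochain 𝒢 E q) p η) p = η := DirectSum.of_eq_same ..

theorem lof_apply_ne {p q : ℕ} (h : q ≠ p) (η : Cochain 𝒢 E p) :
    (DirectSum.lof ℝ ℕ (fun q => Cochain 𝒢 E q) p η) q = 0 :=
  DirectSum.of_eq_of_ne _ _ _ h

theorem shift_apply_add (s : ℕ) (L : ∀ p, Cochain 𝒢 E p →ₗ[ℝ] Cochain 𝒢 E' (p + s))
    (x : ⨁ p, Cochain 𝒢 E p) (p : ℕ) : shift s L x (p + s) = L p (x p) := by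
  have : DirectSum.component ℝ ℕ (fun q => Cochain 𝒢 E' q) (p + s) ∘ₗ shift s L =
      L p ∘ₗ DirectSum.component ℝ ℕ (fun q => Cochain 𝒢 E q) p := by
    refine DirectSum.linearMap_ext ℝ fun q => LinearMap.ext fun η => ?_
    change (shift s L (DirectSum.lof ℝ ℕ (fun q => Cochain 𝒢 E q) q η)) (p + s) =
      L p ((DirectSum.lof ℝ ℕ (fun q => Cochain 𝒢 E q) q η) p)
    rw [shift_lof]
    by_cases h : p = q
    · subst h; rw [lof_apply_self, lof_apply_self]
    · rw [lof_apply_ne h, lof_apply_ne (by omega), map_zero]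
  exact LinearMap.congr_fun this x

theorem shift_apply_lt (s : ℕ) (L : ∀ p, Cochain 𝒢 E p →ₗ[ℝ] Cochain 𝒢 E' (p + s))
    (x : ⨁ p, Cochain 𝒢 E p) {n : ℕ} (hn : n < s) : shift s L x n = 0 := by
  have : DirectSum.component ℝ ℕ (fun q => Cochain 𝒢 E' q) n ∘ₗ shift s L = 0 := by
    refine DirectSum.linearMap_ext ℝ fun q => LinearMap.ext fun η => ?_
    change (shift s L (DirectSum.lof ℝ ℕ (fun q => Cochain 𝒢 E q) q η)) n = 0
    rw [shift_lof, lof_apply_ne (by omega)]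
  exact LinearMap.congr_fun this x

theorem lof_starN {p q n : ℕ} (h : p + q = n) (f : FunCochain 𝒢 q) (η : Cochain 𝒢 E p) :
    DirectSum.lof ℝ ℕ (fun q => Cochain 𝒢 E q) (p + q) (star E f p η) =
      DirectSum.lof ℝ ℕ (fun q => Cochain 𝒢 E q) n (starN h f η) := by
  subst h; rfl

/-- A shifted operator with components that preserve smooth families does so. -/
theorem shift_family (s : ℕ) {L : ∀ p, Cochain 𝒢 E p →ₗ[ℝ] Cochain 𝒢 E' (p + s)}
    (hL : ∀ p, PreservesFamilies (L p)) {x : ℝ → ⨁ p, Cochain 𝒢 E p}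
    (hx : ∀ q, IsSmoothFamily fun r => x r q) (q : ℕ) :
    IsSmoothFamily fun r => shift s L (x r) q := by
  by_cases h : q < s
  · simp only [shift_apply_lt s L _ h]
    exact isSmoothFamily_zero
  · obtain ⟨p, rfl⟩ : ∃ p, q = p + s := ⟨q - s, by omega⟩
    simp only [shift_apply_add]
    exact hL p _ (hx p)

theorem shift_eq_zero {s : ℕ} (L : ∀ p, Cochain 𝒢 E p →ₗ[ℝ] Cochain 𝒢 E' (p + s))
    {x : ⨁ p, Cochain 𝒢 E p} {n : ℕ} (h : ∀ p, p + s = n → x p = 0) : shift s L x n = 0 := by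
  by_cases hn : n < s
  · exact shift_apply_lt s L _ hn
  · obtain ⟨p, rfl⟩ : ∃ p, n = p + s := ⟨n - s, by omega⟩
    rw [shift_apply_add, h p rfl, map_zero]

theorem shift_normalized (s : ℕ) {L : ∀ p, Cochain 𝒢 E p →ₗ[ℝ] Cochain 𝒢 E' (p + s)}
    (hL : ∀ p η, IsNormalized η → IsNormalized (L p η)) {x : ⨁ p, Cochain 𝒢 E p}
    (hx : ∀ q, IsNormalized (x q)) (q : ℕ) : IsNormalized (shift s L x q) := by
  by_cases h : q < s
  · rw [shift_apply_lt s L _ h]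
    exact fun _ _ => rfl
  · obtain ⟨p, rfl⟩ : ∃ p, q = p + s := ⟨q - s, by omega⟩
    rw [shift_apply_add]
    exact hL p _ (hx p)

/-- The action of functions, as a shifted operator. -/
theorem act_eq {q : ℕ} (f : FunCochain 𝒢 q) (x : GrCochain 𝒢 E C) :
    act f x = (shift q (star E f) x.1, shift q (star C f) x.2) := rfl

theorem shift_star (s : ℕ) (L : ∀ p, Cochain 𝒢 E p →ₗ[ℝ] Cochain 𝒢 E' (p + s)) {q : ℕ}
    (f : FunCochain 𝒢 q)
    (hL : ∀ p η, L (p + q) (starN rfl f η) = starN (Nat.add_right_comm p s q) f (L p η))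
    (x : ⨁ p, Cochain 𝒢 E p) :
    shift s L (shift q (star E f) x) = shift q (star E' f) (shift s L x) := by
  have : shift s L ∘ₗ shift q (star E f) = shift q (star E' f) ∘ₗ shift s L := by
    refine DirectSum.linearMap_ext ℝ fun p => LinearMap.ext fun η => ?_
    simp only [LinearMap.comp_apply, shift_lof]
    rw [star_eq_starN, hL, lof_starN (Nat.add_right_comm p s q)]
  exact LinearMap.congr_fun this x

theorem isSmoothFamily_lof {p : ℕ} {η : ℝ → Cochain 𝒢 E p} (h : IsSmoothFamily η) (q : ℕ) :
    IsSmoothFamily fun r => (DirectSum.lof ℝ ℕ (fun q => Cochain 𝒢 E q) p (η r)) q := by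
  by_cases hq : q = p
  · subst hq; simpa only [lof_apply_self] using h
  · simp only [lof_apply_ne hq]; exact isSmoothFamily_zero

/-- A continuous operator is determined by its values on the multiples of sections. -/
theorem eq_of_act [FiniteDimensional ℝ EM] [T2Space M] [IsManifold J ∞ M] [SigmaCompactSpace M]
    {T S : GrCochain 𝒢 E C →ₗ[ℝ] GrCochain 𝒢 E' C'} (hT : IsContinuousOp T) (hS : IsContinuousOp S)
    (hE : ∀ (q : ℕ) (f : FunCochain 𝒢 q) (ε : Cochain 𝒢 E 0),
      T (act f (inE ε)) = S (act f (inE ε)))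
    (hC : ∀ (q : ℕ) (f : FunCochain 𝒢 q) (α : Cochain 𝒢 C 0),
      T (act f (inC α)) = S (act f (inC α))) : T = S := by
  have eE : ∀ (p : ℕ) (f : FunCochain 𝒢 p) (ε : Cochain 𝒢 E 0),
      (act f (inE ε) : GrCochain 𝒢 E C) =
        (DirectSum.lof ℝ ℕ (fun q => Cochain 𝒢 E q) p (starN (Nat.zero_add p) f ε), 0) := by
    intro p f ε
    rw [act_eq]
    refine Prod.ext ?_ (map_zero _)
    exact (shift_lof ..).trans (lof_starN _ _ _)
  have eC : ∀ (p : ℕ) (f : FunCochain 𝒢 p) (α : Cochain 𝒢 C 0),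
      (act f (inC α) : GrCochain 𝒢 E C) =
        (0, DirectSum.lof ℝ ℕ (fun q => Cochain 𝒢 C q) p (starN (Nat.zero_add p) f α)) := by
    intro p f ε
    rw [act_eq]
    refine Prod.ext (map_zero _) ?_
    exact (shift_lof ..).trans (lof_starN _ _ _)
  -- Applied to every pair of components: the difference preserves smooth families and kills all
  -- multiples of sections, so `eq_zero_of_starN` applies.
  have key : ∀ {A B : VecBun.{v} J M} {p n : ℕ} (L L' : Cochain 𝒢 A p →ₗ[ℝ] Cochain 𝒢 B n),
      PreservesFamilies L → PreservesFamilies L' →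
      (∀ (f : FunCochain 𝒢 p) (ε : Cochain 𝒢 A 0),
        L (starN (Nat.zero_add p) f ε) = L' (starN (Nat.zero_add p) f ε)) → ∀ η, L η = L' η := by
    intro A B p n L L' hL hL' h η
    have h0 := eq_zero_of_starN (L - L') (fun η hη => isSmoothFamily_sub (hL η hη) (hL' η hη))
      fun f ε => by rw [LinearMap.sub_apply, h, sub_self]
    exact sub_eq_zero.1 (LinearMap.congr_fun h0 η)
  refine LinearMap.prod_ext ?_ ?_
  · refine DirectSum.linearMap_ext ℝ fun p => LinearMap.ext fun η => ?_
    let i : Cochain 𝒢 E p →ₗ[ℝ] GrCochain 𝒢 E C :=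
      LinearMap.inl ℝ _ _ ∘ₗ DirectSum.lof ℝ ℕ (fun q => Cochain 𝒢 E q) p
    have hi : ∀ η, IsSmoothFamily η → (∀ q, IsSmoothFamily fun r => (i (η r)).1 q) ∧
        ∀ q, IsSmoothFamily fun r => (i (η r)).2 q := fun η hη =>
      ⟨isSmoothFamily_lof hη, fun _ => isSmoothFamily_zero⟩
    change T (i η) = S (i η)
    refine Prod.ext (DFinsupp.ext fun n => ?_) (DFinsupp.ext fun n => ?_)
    · exact key (DirectSum.component ℝ ℕ (fun q => Cochain 𝒢 E' q) n ∘ₗ LinearMap.fst ℝ _ _ ∘ₗ T ∘ₗ i)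
        (DirectSum.component ℝ ℕ (fun q => Cochain 𝒢 E' q) n ∘ₗ LinearMap.fst ℝ _ _ ∘ₗ S ∘ₗ i)
        (fun η hη => (hT _ (hi η hη)).1 n) (fun η hη => (hS _ (hi η hη)).1 n)
        (fun f ε => congrArg (fun x : GrCochain 𝒢 E' C' => x.1 n)
          ((congrArg T (eE p f ε)).symm.trans ((hE p f ε).trans (congrArg S (eE p f ε))))) η
    · exact key (DirectSum.component ℝ ℕ (fun q => Cochain 𝒢 C' q) n ∘ₗ LinearMap.snd ℝ _ _ ∘ₗ T ∘ₗ i)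
        (DirectSum.component ℝ ℕ (fun q => Cochain 𝒢 C' q) n ∘ₗ LinearMap.snd ℝ _ _ ∘ₗ S ∘ₗ i)
        (fun η hη => (hT _ (hi η hη)).2 n) (fun η hη => (hS _ (hi η hη)).2 n)
        (fun f ε => congrArg (fun x : GrCochain 𝒢 E' C' => x.2 n)
          ((congrArg T (eE p f ε)).symm.trans ((hE p f ε).trans (congrArg S (eE p f ε))))) η
  · refine DirectSum.linearMap_ext ℝ fun p => LinearMap.ext fun η => ?_
    let i : Cochain 𝒢 C p →ₗ[ℝ] GrCochain 𝒢 E C :=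
      LinearMap.inr ℝ _ _ ∘ₗ DirectSum.lof ℝ ℕ (fun q => Cochain 𝒢 C q) p
    have hi : ∀ η, IsSmoothFamily η → (∀ q, IsSmoothFamily fun r => (i (η r)).1 q) ∧
        ∀ q, IsSmoothFamily fun r => (i (η r)).2 q := fun η hη =>
      ⟨fun _ => isSmoothFamily_zero, isSmoothFamily_lof hη⟩
    change T (i η) = S (i η)
    refine Prod.ext (DFinsupp.ext fun n => ?_) (DFinsupp.ext fun n => ?_)
    · exact key (DirectSum.component ℝ ℕ (fun q => Cochain 𝒢 E' q) n ∘ₗ LinearMap.fst ℝ _ _ ∘ₗ T ∘ₗ i)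
        (DirectSum.component ℝ ℕ (fun q => Cochain 𝒢 E' q) n ∘ₗ LinearMap.fst ℝ _ _ ∘ₗ S ∘ₗ i)
        (fun η hη => (hT _ (hi η hη)).1 n) (fun η hη => (hS _ (hi η hη)).1 n)
        (fun f ε => congrArg (fun x : GrCochain 𝒢 E' C' => x.1 n)
          ((congrArg T (eC p f ε)).symm.trans ((hC p f ε).trans (congrArg S (eC p f ε))))) η
    · exact key (DirectSum.component ℝ ℕ (fun q => Cochain 𝒢 C' q) n ∘ₗ LinearMap.snd ℝ _ _ ∘ₗ T ∘ₗ i)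
        (DirectSum.component ℝ ℕ (fun q => Cochain 𝒢 C' q) n ∘ₗ LinearMap.snd ℝ _ _ ∘ₗ S ∘ₗ i)
        (fun η hη => (hT _ (hi η hη)).2 n) (fun η hη => (hS _ (hi η hη)).2 n)
        (fun f ε => congrArg (fun x : GrCochain 𝒢 E' C' => x.2 n)
          ((congrArg T (eC p f ε)).symm.trans ((hC p f ε).trans (congrArg S (eC p f ε))))) η

end Graded

end

end VBG

namespace VBG

noncomputable section

open Filter Topology

open LieGroupoid (Hom)

/-! ### Operators given by components and the structure equations -/

section Components

variable {EG HG EM HM : Type*} [NormedAddCommGroup EG] [NormedSpace ℝ EG] [TopologicalSpace HG]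
  [NormedAddCommGroup EM] [NormedSpace ℝ EM] [TopologicalSpace HM]
  {I : ModelWithCorners ℝ EG HG} {G : Type*} [TopologicalSpace G] [ChartedSpace HG G]
  {J : ModelWithCorners ℝ EM HM} {M : Type*} [TopologicalSpace M] [ChartedSpace HM M]
  {𝒢 : LieGroupoid I G J M} {E E' E'' C C' C'' : VecBun.{v} J M}

variable (𝒢 E C) in
/-- The components `(∂, Δ^E, Δ^C, Ω)` of an operator on `C(G; E ⊕ C[1])`. -/
structure Comp where
  an : Fam 𝒢 C E 0
  dE : Fam 𝒢 E E 1
  dC : Fam 𝒢 C C 1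
  om : Fam 𝒢 E C 2
  dE_one : ∀ x e, dE.f1 (Hom.one 𝒢 x) e = e
  dC_one : ∀ x c, dC.f1 (Hom.one 𝒢 x) c = c
  om_one_left : ∀ {x y : M} (g : 𝒢.Hom x y) e, om.f2 (Hom.one 𝒢 y) g e = 0
  om_one_right : ∀ {x y : M} (g : 𝒢.Hom x y) e, om.f2 g (Hom.one 𝒢 x) e = 0

/-- The structure equations of a representation up to homotopy. -/
structure Comp.Flat (c : Comp 𝒢 E C) : Prop where
  an_dC : ∀ {x y : M} (g : 𝒢.Hom x y) (a : C.fiber x),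
    c.an.f0 y (c.dC.f1 g a) = c.dE.f1 g (c.an.f0 x a)
  dE_comp : ∀ {x y z : M} (g : 𝒢.Hom y z) (h : 𝒢.Hom x y) (e : E.fiber x),
    c.dE.f1 g (c.dE.f1 h e) - c.dE.f1 (g.comp h) e + c.an.f0 z (c.om.f2 g h e) = 0
  dC_comp : ∀ {x y z : M} (g : 𝒢.Hom y z) (h : 𝒢.Hom x y) (a : C.fiber x),
    c.dC.f1 g (c.dC.f1 h a) - c.dC.f1 (g.comp h) a + c.om.f2 g h (c.an.f0 x a) = 0
  om_comp : ∀ {x y z w : M} (f : 𝒢.Hom z w) (g : 𝒢.Hom y z) (h : 𝒢.Hom x y) (e : E.fiber x),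
    c.dC.f1 f (c.om.f2 g h e) - c.om.f2 (f.comp g) h e + c.om.f2 f (g.comp h) e
      - c.om.f2 f g (c.dE.f1 h e) = 0

namespace Comp

variable (c : Comp 𝒢 E C)

/-- The operator with the given components. -/
def op : GrCochain 𝒢 E C →ₗ[ℝ] GrCochain 𝒢 E C :=
  { toFun := fun x => (shift 1 c.dE.cobound x.1 + shift 0 (fun p => c.an.hat (Nat.zero_add p)) x.2,
      -- Cochains in C^q(G; C) have total degree q - 1, which accounts for the minus sign in front
      -- of their coboundary.
      shift 2 (fun p => c.om.hat (Nat.add_comm 2 p)) x.1 - shift 1 c.dC.cobound x.2)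
    map_add' := fun x y => Prod.ext
      (by simp only [Prod.fst_add, Prod.snd_add, map_add]; abel)
      (by simp only [Prod.fst_add, Prod.snd_add, map_add]; abel)
    map_smul' := fun r x => Prod.ext
      (by simp only [Prod.smul_fst, Prod.smul_snd, map_smul, RingHom.id_apply, smul_add])
      (by simp only [Prod.smul_fst, Prod.smul_snd, map_smul, RingHom.id_apply, smul_sub]) }

theorem op_fst (x : GrCochain 𝒢 E C) : (c.op x).1 =
    shift 1 c.dE.cobound x.1 + shift 0 (fun p => c.an.hat (Nat.zero_add p)) x.2 := rfl

theorem op_snd (x : GrCochain 𝒢 E C) : (c.op x).2 =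
    shift 2 (fun p => c.om.hat (Nat.add_comm 2 p)) x.1 - shift 1 c.dC.cobound x.2 := rfl

theorem op_continuous : IsContinuousOp c.op := fun x hx =>
  ⟨fun q => isSmoothFamily_add (shift_family 1 c.dE.preservesFamilies_cobound hx.1 q)
      (shift_family 0 (fun _ => c.an.preservesFamilies_hat _) hx.2 q),
    fun q => isSmoothFamily_sub (shift_family 2 (fun _ => c.om.preservesFamilies_hat _) hx.1 q)
      (shift_family 1 c.dC.preservesFamilies_cobound hx.2 q)⟩

theorem op_degree (x : GrCochain 𝒢 E C) (p : ℤ) (hx : HasDegree x p) :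
    HasDegree (c.op x) (p + 1) := by
  refine ⟨fun q hq => ?_, fun q hq => ?_⟩
  · change shift 1 c.dE.cobound x.1 q + shift 0 (fun p => c.an.hat (Nat.zero_add p)) x.2 q = 0
    rw [shift_eq_zero _ fun n hn => hx.1 n (by omega), shift_eq_zero _ fun n hn => hx.2 n (by omega),
      add_zero]
  · change shift 2 (fun p => c.om.hat (Nat.add_comm 2 p)) x.1 q - shift 1 c.dC.cobound x.2 q = 0
    rw [shift_eq_zero _ fun n hn => hx.1 n (by omega), shift_eq_zero _ fun n hn => hx.2 n (by omega),
      sub_zero]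

theorem op_normalized (x : GrCochain 𝒢 E C) (hx : IsNormalizedGr x) : IsNormalizedGr (c.op x) := by
  have hadd : ∀ {A : VecBun.{v} J M} {q : ℕ} {η η' : Cochain 𝒢 A q}, IsNormalized η →
      IsNormalized η' → IsNormalized (η + η') := fun {A q η η'} h h' σ hσ => by
    change η.1 σ + η'.1 σ = (0 : A.fiber σ.base)
    rw [h σ hσ, h' σ hσ, add_zero]
  have hsub : ∀ {A : VecBun.{v} J M} {q : ℕ} {η η' : Cochain 𝒢 A q}, IsNormalized η →
      IsNormalized η' → IsNormalized (η - η') := fun {A q η η'} h h' σ hσ => by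
    change η.1 σ - η'.1 σ = (0 : A.fiber σ.base)
    rw [h σ hσ, h' σ hσ, sub_zero]
  refine ⟨fun q => hadd (shift_normalized 1 (fun p η => isNormalized_cobound _ c.dE_one) hx.1 q)
    (shift_normalized 0 (fun p η => isNormalized_hat _ _ ?_) hx.2 q), fun q => hsub
    (shift_normalized 2 (fun p η => isNormalized_hat _ _ ?_) hx.1 q)
    (shift_normalized 1 (fun p η => isNormalized_cobound _ c.dC_one) hx.2 q)⟩
  · rintro σ ⟨i, -⟩
    exact i.elim0
  · rintro σ ⟨i, x, hi⟩
    obtain ⟨a, b, d, g, h, rfl⟩ := σ.exists_ofPair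
    fin_cases i
    · have h1 : d = x := by rw [← g.tgt_val, ← 𝒢.tgt_one x]; exact congrArg 𝒢.tgt hi
      have h2 : b = x := by rw [← g.src_val, ← 𝒢.src_one x]; exact congrArg 𝒢.src hi
      subst h1 h2
      obtain rfl : g = Hom.one 𝒢 _ := Hom.ext hi
      exact LinearMap.ext fun e => c.om_one_left h e
    · have h1 : b = x := by rw [← h.tgt_val, ← 𝒢.tgt_one x]; exact congrArg 𝒢.tgt hi
      have h2 : a = x := by rw [← h.src_val, ← 𝒢.src_one x]; exact congrArg 𝒢.src hi
      subst h1 h2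
      obtain rfl : h = Hom.one 𝒢 _ := Hom.ext hi
      exact LinearMap.ext fun e => c.om_one_right g e

end Comp

theorem shift_cobound_act (l : Fam 𝒢 E E 1) {q : ℕ} (f : FunCochain 𝒢 q) {p : ℕ}
    (η : Cochain 𝒢 E p) :
    shift 1 l.cobound (shift q (star E f) (DirectSum.lof ℝ ℕ (fun q => Cochain 𝒢 E q) p η)) =
      shift q (star E f) (shift 1 l.cobound (DirectSum.lof ℝ ℕ (fun q => Cochain 𝒢 E q) p η)) +
      (-1 : ℝ) ^ p • shift (q + 1) (star E (delta f))
        (DirectSum.lof ℝ ℕ (fun q => Cochain 𝒢 E q) p η) := by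
  simp only [shift_lof]
  rw [star_eq_starN, l.cobound_starN rfl f η, map_add, map_smul, lof_starN (Nat.add_right_comm p 1 q)]
  rfl

theorem eq_lof_of_forall_ne {x : ⨁ p, Cochain 𝒢 E p} {p : ℕ} (h : ∀ q, q ≠ p → x q = 0) :
    x = DirectSum.lof ℝ ℕ (fun q => Cochain 𝒢 E q) p (x p) := by
  refine DFinsupp.ext fun q => ?_
  by_cases hq : q = p
  · subst hq; exact (lof_apply_self ..).symm
  · exact (h q hq).trans (lof_apply_ne hq _).symm

/-- A homogeneous x is a single cochain if p ≥ 0 and is zero otherwise. This passes from the cochain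
degree, a natural number, to the integral degrees in which the Leibniz rule is stated. -/
theorem shift_cobound_act' (l : Fam 𝒢 E E 1) {q : ℕ} (f : FunCochain 𝒢 q) {p : ℤ}
    {x : ⨁ p, Cochain 𝒢 E p} (hx : ∀ q : ℕ, (q : ℤ) ≠ p → x q = 0) :
    shift 1 l.cobound (shift q (star E f) x) = shift q (star E f) (shift 1 l.cobound x) +
      (-1 : ℝ) ^ p • shift (q + 1) (star E (delta f)) x := by
  by_cases hp : 0 ≤ p
  · lift p to ℕ using hp
    rw [eq_lof_of_forall_ne (p := p) (fun q hq => hx q (by omega)), shift_cobound_act, zpow_natCast]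
  · obtain rfl : x = 0 := DFinsupp.ext fun q => hx q (by omega)
    simp only [map_zero, smul_zero, add_zero]

theorem neg_one_zpow_add_one_smul (p : ℤ) (x : ⨁ p, Cochain 𝒢 E p) :
    (-1 : ℝ) ^ (p + 1) • x = -((-1 : ℝ) ^ p • x) := DFinsupp.ext fun q => Cochain.ext' fun σ => by
  change (-1 : ℝ) ^ (p + 1) • (x q).1 σ = -((-1 : ℝ) ^ p • (x q).1 σ)
  rw [zpow_add_one₀ (by norm_num), mul_neg_one, neg_smul]

theorem lof_sub {p : ℕ} (η η' : Cochain 𝒢 E p) :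
    DirectSum.lof ℝ ℕ (fun q => Cochain 𝒢 E q) p (η - η') =
      DirectSum.lof ℝ ℕ (fun q => Cochain 𝒢 E q) p η -
        DirectSum.lof ℝ ℕ (fun q => Cochain 𝒢 E q) p η' :=
  DFinsupp.ext fun q => by
    change _ = (DirectSum.lof ℝ ℕ (fun q => Cochain 𝒢 E q) p η) q -
      (DirectSum.lof ℝ ℕ (fun q => Cochain 𝒢 E q) p η') q
    by_cases hq : q = p
    · subst hq; simp only [lof_apply_self]
    · simp only [lof_apply_ne hq, sub_zero]

theorem Comp.op_leibniz (c : Comp 𝒢 E C) (x : GrCochain 𝒢 E C) (p : ℤ) (q : ℕ)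
    (f : FunCochain 𝒢 q) (hx : HasDegree x p) :
    c.op (act f x) = act f (c.op x) + (-1 : ℝ) ^ p • act (delta f) x := by
  refine Prod.ext ?_ ?_
  · change shift 1 c.dE.cobound (shift q (star E f) x.1) +
      shift 0 (fun p => c.an.hat (Nat.zero_add p)) (shift q (star C f) x.2) =
      shift q (star E f) (shift 1 c.dE.cobound x.1 +
        shift 0 (fun p => c.an.hat (Nat.zero_add p)) x.2) +
      (-1 : ℝ) ^ p • shift (q + 1) (star E (delta f)) x.1
    rw [shift_cobound_act' _ f hx.1, map_add, shift_star 0 (fun p => c.an.hat (Nat.zero_add p)) f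
      fun p η => c.an.hat_starN f rfl _ _ _ _]
    abel
  · change shift 2 (fun p => c.om.hat (Nat.add_comm 2 p)) (shift q (star E f) x.1) -
      shift 1 c.dC.cobound (shift q (star C f) x.2) =
      shift q (star C f) (shift 2 (fun p => c.om.hat (Nat.add_comm 2 p)) x.1 -
        shift 1 c.dC.cobound x.2) +
      (-1 : ℝ) ^ p • shift (q + 1) (star C (delta f)) x.2
    -- In total degree p the C-part has cochain degree p + 1; the resulting change of sign is undone
    -- by the minus sign in `Comp.op`.
    rw [shift_cobound_act' (p := p + 1) _ f fun n hn => hx.2 n (by omega), map_sub,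
      shift_star 2 (fun p => c.om.hat (Nat.add_comm 2 p)) f
      fun p η => c.om.hat_starN f rfl _ _ _ _, neg_one_zpow_add_one_smul]
    abel

theorem Comp.op_inE (c : Comp 𝒢 E C) (ε : Cochain 𝒢 E 0) : c.op (inE ε) =
    (DirectSum.lof ℝ ℕ (fun q => Cochain 𝒢 E q) 1 (c.dE.cobound 0 ε),
      DirectSum.lof ℝ ℕ (fun q => Cochain 𝒢 C q) 2 (c.om.hat rfl ε)) := by
  refine Prod.ext ?_ ?_
  · rw [op_fst, inE, shift_lof, map_zero, add_zero]
  · rw [op_snd, inE, shift_lof, map_zero, sub_zero]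

theorem Comp.op_inC (c : Comp 𝒢 E C) (α : Cochain 𝒢 C 0) : c.op (inC α) =
    (DirectSum.lof ℝ ℕ (fun q => Cochain 𝒢 E q) 0 (c.an.hat rfl α),
      -DirectSum.lof ℝ ℕ (fun q => Cochain 𝒢 C q) 1 (c.dC.cobound 0 α)) := by
  refine Prod.ext ?_ ?_
  · rw [op_fst, inC, shift_lof, map_zero, zero_add]
  · rw [op_snd, inC, shift_lof, map_zero, zero_sub]

theorem Comp.op_op_inE (c : Comp 𝒢 E C) (ε : Cochain 𝒢 E 0) : c.op (c.op (inE ε)) =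
    (DirectSum.lof ℝ ℕ (fun q => Cochain 𝒢 E q) 2
        (c.dE.cobound 1 (c.dE.cobound 0 ε) + c.an.hat rfl (c.om.hat rfl ε)),
      DirectSum.lof ℝ ℕ (fun q => Cochain 𝒢 C q) 3
        (c.om.hat rfl (c.dE.cobound 0 ε) - c.dC.cobound 2 (c.om.hat rfl ε))) := by
  rw [c.op_inE]
  refine Prod.ext ?_ ?_
  · rw [op_fst, shift_lof, shift_lof]; exact (map_add _ _ _).symm
  · rw [op_snd, shift_lof, shift_lof]; exact (lof_sub _ _).symm

theorem Comp.op_op_inC (c : Comp 𝒢 E C) (α : Cochain 𝒢 C 0) : c.op (c.op (inC α)) =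
    (DirectSum.lof ℝ ℕ (fun q => Cochain 𝒢 E q) 1
        (c.dE.cobound 0 (c.an.hat rfl α) - c.an.hat rfl (c.dC.cobound 0 α)),
      DirectSum.lof ℝ ℕ (fun q => Cochain 𝒢 C q) 2
        (c.om.hat rfl (c.an.hat rfl α) + c.dC.cobound 1 (c.dC.cobound 0 α))) := by
  rw [c.op_inC]
  refine Prod.ext ?_ ?_
  · rw [op_fst, map_neg, shift_lof, shift_lof, ← sub_eq_add_neg]; exact (lof_sub _ _).symm
  · rw [op_snd, map_neg, shift_lof, shift_lof, sub_neg_eq_add]; exact (map_add _ _ _).symm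

theorem lof_eq_zero_iff {p : ℕ} {η : Cochain 𝒢 E p} :
    DirectSum.lof ℝ ℕ (fun q => Cochain 𝒢 E q) p η = 0 ↔ η = 0 :=
  ⟨fun h => by rw [← lof_apply_self p η, h]; rfl, fun h => by rw [h, map_zero]⟩

theorem hasDegree_inE (ε : Cochain 𝒢 E 0) : HasDegree (inE ε : GrCochain 𝒢 E C) 0 :=
  ⟨fun q hq => lof_apply_ne (by exact_mod_cast hq) _, fun _ _ => rfl⟩

theorem hasDegree_inC (α : Cochain 𝒢 C 0) : HasDegree (inC α : GrCochain 𝒢 E C) (-1) :=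
  ⟨fun _ _ => rfl, fun q hq => lof_apply_ne (by omega) _⟩

theorem IsContinuousOp.comp {T : GrCochain 𝒢 E' C' →ₗ[ℝ] GrCochain 𝒢 E'' C''}
    {S : GrCochain 𝒢 E C →ₗ[ℝ] GrCochain 𝒢 E' C'} (hT : IsContinuousOp T) (hS : IsContinuousOp S) :
    IsContinuousOp (T ∘ₗ S) := fun x hx => hT _ (hS x hx)

section Flat

variable [FiniteDimensional ℝ EM] [T2Space M] [IsManifold J ∞ M]

variable (𝒢) in
theorem exists_ev0 (x : M) (e : E.fiber x) : ∃ ε : Cochain 𝒢 E 0, ev0 x ε = e :=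
  exists_section_eq 𝒢 x e

/-- Applied to a section, the square of the operator has two components for E and two for C.
Evaluated on simplices with one, two or three arrows they depend only on the value of the section at
the final vertex, and every vector is such a value, so their vanishing is the four equations of
`Comp.Flat`. -/
theorem Comp.flat_iff (c : Comp 𝒢 E C) : c.Flat ↔
    (∀ ε : Cochain 𝒢 E 0, c.op (c.op (inE ε)) = 0) ∧
      ∀ α : Cochain 𝒢 C 0, c.op (c.op (inC α)) = 0 := by
  simp only [Comp.op_op_inE, Comp.op_op_inC, Prod.mk_eq_zero, lof_eq_zero_iff]
  have e1 : ∀ (α : Cochain 𝒢 C 0) {x y : M} (g : 𝒢.Hom x y),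
      ev1 g (c.dE.cobound 0 (c.an.hat rfl α) - c.an.hat rfl (c.dC.cobound 0 α)) =
        c.dE.f1 g (c.an.f0 x (ev0 x α)) - c.an.f0 y (c.dC.f1 g (ev0 x α)) := by
    intro α x y g
    rw [map_sub, Fam.ev1_cobound, Fam.ev0_hat, Fam.ev0_hat, Fam.ev1_hat0, Fam.ev1_cobound, map_sub]
    abel
  have e2 : ∀ (α : Cochain 𝒢 C 0) {x y z : M} (g : 𝒢.Hom y z) (h : 𝒢.Hom x y),
      ev2 g h (c.om.hat rfl (c.an.hat rfl α) + c.dC.cobound 1 (c.dC.cobound 0 α)) =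
        c.dC.f1 g (c.dC.f1 h (ev0 x α)) - c.dC.f1 (g.comp h) (ev0 x α) +
          c.om.f2 g h (c.an.f0 x (ev0 x α)) := by
    intro α x y z g h
    rw [map_add, Fam.ev2_hat, Fam.ev0_hat, Fam.ev2_cobound, Fam.ev1_cobound, Fam.ev1_cobound,
      Fam.ev1_cobound, map_sub]
    abel
  have e3 : ∀ (ε : Cochain 𝒢 E 0) {x y z : M} (g : 𝒢.Hom y z) (h : 𝒢.Hom x y),
      ev2 g h (c.dE.cobound 1 (c.dE.cobound 0 ε) + c.an.hat rfl (c.om.hat rfl ε)) =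
        c.dE.f1 g (c.dE.f1 h (ev0 x ε)) - c.dE.f1 (g.comp h) (ev0 x ε) +
          c.an.f0 z (c.om.f2 g h (ev0 x ε)) := by
    intro α x y z g h
    rw [map_add, Fam.ev2_hat0, Fam.ev2_hat, Fam.ev2_cobound, Fam.ev1_cobound, Fam.ev1_cobound,
      Fam.ev1_cobound, map_sub]
    abel
  have e4 : ∀ (ε : Cochain 𝒢 E 0) {x y z w : M} (f : 𝒢.Hom z w) (g : 𝒢.Hom y z) (h : 𝒢.Hom x y),
      ev3 f g h (c.om.hat rfl (c.dE.cobound 0 ε) - c.dC.cobound 2 (c.om.hat rfl ε)) =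
        -(c.dC.f1 f (c.om.f2 g h (ev0 x ε)) - c.om.f2 (f.comp g) h (ev0 x ε) +
          c.om.f2 f (g.comp h) (ev0 x ε) - c.om.f2 f g (c.dE.f1 h (ev0 x ε))) := by
    intro α x y z w f g h
    rw [map_sub, Fam.ev3_hat, Fam.ev1_cobound, Fam.ev3_cobound, Fam.ev2_hat, Fam.ev2_hat,
      Fam.ev2_hat, Fam.ev2_hat, map_sub]
    abel
  constructor
  · intro H
    refine ⟨fun ε => ⟨ext_ev2 fun g h => ?_, ext_ev3 fun f g h => ?_⟩,
      fun α => ⟨ext_ev1 fun g => ?_, ext_ev2 fun g h => ?_⟩⟩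
    · rw [e3, H.dE_comp, map_zero]
    · rw [e4, H.om_comp, neg_zero, map_zero]
    · rw [e1, H.an_dC, sub_self, map_zero]
    · rw [e2, H.dC_comp, map_zero]
  · rintro ⟨HE, HC⟩
    constructor
    · intro x y g a
      obtain ⟨α, rfl⟩ := exists_ev0 𝒢 x a
      rw [eq_comm, ← sub_eq_zero, ← e1, (HC α).1, map_zero]
    · intro x y z g h e
      obtain ⟨ε, rfl⟩ := exists_ev0 𝒢 x e
      rw [← e3, (HE ε).1, map_zero]
    · intro x y z g h a
      obtain ⟨α, rfl⟩ := exists_ev0 𝒢 x a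
      rw [← e2, (HC α).2, map_zero]
    · intro x y z w f g h e
      obtain ⟨ε, rfl⟩ := exists_ev0 𝒢 x e
      rw [← neg_eq_zero, ← e4, (HE ε).2, map_zero]

/-- Two continuous operators that satisfy the same Leibniz rule and agree on sections are equal. -/
theorem eq_of_leibniz [SigmaCompactSpace M] {T S : GrCochain 𝒢 E C →ₗ[ℝ] GrCochain 𝒢 E' C'}
    (hT : IsContinuousOp T) (hS : IsContinuousOp S)
    (h : ∀ (x : GrCochain 𝒢 E C) (p : ℤ) (q : ℕ) (f : FunCochain 𝒢 q), HasDegree x p →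
      T x = S x → T (act f x) = S (act f x))
    (hE : ∀ ε : Cochain 𝒢 E 0, T (inE ε) = S (inE ε))
    (hC : ∀ α : Cochain 𝒢 C 0, T (inC α) = S (inC α)) : T = S :=
  eq_of_act hT hS (fun q f ε => h _ _ _ _ (hasDegree_inE ε) (hE ε))
    fun q f α => h _ _ _ _ (hasDegree_inC α) (hC α)

/-- When the Leibniz rule is applied twice, the mixed terms cancel because their signs differ by the
degree of the operator, and the last term contains δ² = 0. So the square commutes with the action of
functions and vanishes once it vanishes on sections. -/
theorem Comp.Flat.sq_zero [SigmaCompactSpace M] {c : Comp 𝒢 E C} (hc : c.Flat) :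
    c.op ∘ₗ c.op = 0 := by
  obtain ⟨HE, HC⟩ := c.flat_iff.1 hc
  refine eq_of_leibniz (c.op_continuous.comp c.op_continuous)
    (fun _ _ => ⟨fun _ => isSmoothFamily_zero, fun _ => isSmoothFamily_zero⟩)
    (fun x p q f hx h0 => ?_) HE HC
  have hd : act (delta (delta f)) x = 0 := by
    rw [delta_delta]
    have h0 : ∀ (A : VecBun.{v} J M) (p : ℕ), star A (0 : FunCochain 𝒢 (q + 1 + 1)) p = 0 :=
      fun A p => LinearMap.ext fun η => Cochain.ext' fun σ => zero_smul ℝ _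
    refine Prod.ext ?_ ?_
    · change shift _ (star E 0) x.1 = 0
      refine DFinsupp.ext fun n => ?_
      by_cases hn : n < q + 1 + 1
      · exact shift_apply_lt _ _ _ hn
      · obtain ⟨p, rfl⟩ : ∃ p, n = p + (q + 1 + 1) := ⟨n - (q + 1 + 1), by omega⟩
        rw [shift_apply_add, h0]; rfl
    · change shift _ (star C 0) x.2 = 0
      refine DFinsupp.ext fun n => ?_
      by_cases hn : n < q + 1 + 1
      · exact shift_apply_lt _ _ _ hn
      · obtain ⟨p, rfl⟩ : ∃ p, n = p + (q + 1 + 1) := ⟨n - (q + 1 + 1), by omega⟩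
        rw [shift_apply_add, h0]; rfl
  rw [LinearMap.comp_apply] at h0 ⊢
  rw [LinearMap.zero_apply] at h0 ⊢
  rw [c.op_leibniz x p q f hx, map_add, map_smul, c.op_leibniz _ _ _ _ (c.op_degree x p hx),
    c.op_leibniz x p _ _ hx, hd, h0, map_zero]
  refine Prod.ext ?_ ?_
  · change (0 + (-1 : ℝ) ^ (p + 1) • (act (delta f) (c.op x)).1) +
      (-1 : ℝ) ^ p • ((act (delta f) (c.op x)).1 + (-1 : ℝ) ^ p • 0) = 0
    rw [neg_one_zpow_add_one_smul, smul_zero, add_zero, zero_add]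
    exact neg_add_cancel _
  · change (0 + (-1 : ℝ) ^ (p + 1) • (act (delta f) (c.op x)).2) +
      (-1 : ℝ) ^ p • ((act (delta f) (c.op x)).2 + (-1 : ℝ) ^ p • 0) = 0
    rw [neg_one_zpow_add_one_smul, smul_zero, add_zero, zero_add]
    exact neg_add_cancel _

/-- The representation up to homotopy with the given components. -/
def Comp.rep [SigmaCompactSpace M] (c : Comp 𝒢 E C) (hc : c.Flat) : RepHtpy 𝒢 E C where
  op := c.op
  continuous := c.op_continuous
  degree := c.op_degree
  leibniz := c.op_leibniz
  normalized := c.op_normalized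
  sq_zero := hc.sq_zero

end Flat

end Components

end

end VBG

namespace VBG

noncomputable section

open Filter Topology

open LieGroupoid (Hom)

/-! ### The components of a representation up to homotopy -/

section Extraction

variable {EG HG EM HM : Type*} [NormedAddCommGroup EG] [NormedSpace ℝ EG] [TopologicalSpace HG]
  [NormedAddCommGroup EM] [NormedSpace ℝ EM] [TopologicalSpace HM]
  {I : ModelWithCorners ℝ EG HG} {G : Type*} [TopologicalSpace G] [ChartedSpace HG G]
  {J : ModelWithCorners ℝ EM HM} {M : Type*} [TopologicalSpace M] [ChartedSpace HM M]
  {𝒢 : LieGroupoid I G J M} {E E' E'' C C' C'' : VecBun.{v} J M}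

theorem starN_zero_right {p : ℕ} (φ : FunCochain 𝒢 0) (η : Cochain 𝒢 E p) (σ : Nerve 𝒢 p) :
    (starN (Nat.add_zero p) φ η).1 σ = φ.1 (Nerve.point 𝒢 σ.last) • η.1 σ := by
  have h : σ.backN (Nat.add_zero p) = Nerve.point 𝒢 σ.last :=
    Nerve.ext' (fun i => by fin_cases i; rfl) fun i => i.elim0
  rw [starN_apply, h]
  rfl

theorem act_fst_apply (φ : FunCochain 𝒢 0) (x : GrCochain 𝒢 E C) (p : ℕ) :
    (act φ x).1 p = starN (Nat.add_zero p) φ (x.1 p) := shift_apply_add 0 (star E φ) x.1 p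

theorem act_snd_apply (φ : FunCochain 𝒢 0) (x : GrCochain 𝒢 E C) (p : ℕ) :
    (act φ x).2 p = starN (Nat.add_zero p) φ (x.2 p) := shift_apply_add 0 (star C φ) x.2 p

theorem act_inE {q : ℕ} (f : FunCochain 𝒢 q) (ε : Cochain 𝒢 E 0) :
    (act f (inE ε) : GrCochain 𝒢 E C) =
      (DirectSum.lof ℝ ℕ (fun q => Cochain 𝒢 E q) q (starN (Nat.zero_add q) f ε), 0) := by
  rw [act_eq]
  refine Prod.ext ?_ (map_zero _)
  exact (shift_lof ..).trans (lof_starN _ _ _)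

theorem act_inC {q : ℕ} (f : FunCochain 𝒢 q) (α : Cochain 𝒢 C 0) :
    (act f (inC α) : GrCochain 𝒢 E C) =
      (0, DirectSum.lof ℝ ℕ (fun q => Cochain 𝒢 C q) q (starN (Nat.zero_add q) f α)) := by
  rw [act_eq]
  refine Prod.ext (map_zero _) ?_
  exact (shift_lof ..).trans (lof_starN _ _ _)

/-- The inclusion of the sections of `E`, as a linear map. -/
def inEL : Cochain 𝒢 E 0 →ₗ[ℝ] GrCochain 𝒢 E C :=
  LinearMap.inl ℝ _ _ ∘ₗ DirectSum.lof ℝ ℕ (fun q => Cochain 𝒢 E q) 0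

/-- The inclusion of the sections of `C`, as a linear map. -/
def inCL : Cochain 𝒢 C 0 →ₗ[ℝ] GrCochain 𝒢 E C :=
  LinearMap.inr ℝ _ _ ∘ₗ DirectSum.lof ℝ ℕ (fun q => Cochain 𝒢 C q) 0

/-- The component in `C^p(G; E)`. -/
def compE (p : ℕ) : GrCochain 𝒢 E C →ₗ[ℝ] Cochain 𝒢 E p :=
  DirectSum.component ℝ ℕ (fun q => Cochain 𝒢 E q) p ∘ₗ LinearMap.fst ℝ _ _

/-- The component in `C^p(G; C)`. -/
def compC (p : ℕ) : GrCochain 𝒢 E C →ₗ[ℝ] Cochain 𝒢 C p :=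
  DirectSum.component ℝ ℕ (fun q => Cochain 𝒢 C q) p ∘ₗ LinearMap.snd ℝ _ _

theorem isNormalizedGr_inE (ε : Cochain 𝒢 E 0) : IsNormalizedGr (inE ε : GrCochain 𝒢 E C) := by
  refine ⟨fun q => ?_, fun q _ _ => rfl⟩
  rintro σ ⟨i, -⟩
  have : (inE ε : GrCochain 𝒢 E C).1 q = 0 := lof_apply_ne (fun h => by subst h; exact i.elim0) ε
  rw [this]; rfl

theorem isNormalizedGr_inC (α : Cochain 𝒢 C 0) : IsNormalizedGr (inC α : GrCochain 𝒢 E C) := by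
  refine ⟨fun q _ _ => rfl, fun q => ?_⟩
  rintro σ ⟨i, -⟩
  have : (inC α : GrCochain 𝒢 E C).2 q = 0 := lof_apply_ne (fun h => by subst h; exact i.elim0) α
  rw [this]; rfl

variable [FiniteDimensional ℝ EM] [T2Space M] [IsManifold J ∞ M]

/-- Right multiplication by a function on M evaluates it at the final vertex, so `exists_fam`
applies to right linear maps. -/
theorem exists_fam_hat {p : ℕ} (L : Cochain 𝒢 E 0 →ₗ[ℝ] Cochain 𝒢 E' p)
    (hL : ∀ (φ : FunCochain 𝒢 0) (ε : Cochain 𝒢 E 0),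
      L (starN (Nat.zero_add 0) φ ε) = starN (Nat.add_zero p) φ (L ε)) :
    ∃ l : Fam 𝒢 E E' p, ∀ ε, L ε = l.hat (Nat.add_zero p) ε := by
  obtain ⟨l, hl⟩ := exists_fam L fun φ ε σ => by rw [hL, starN_zero_right]
  refine ⟨l, fun ε => Cochain.ext' fun σ => ?_⟩
  rw [hl]
  exact (l.eval_hat (Nat.add_zero p) ε (σ := σ) (τ := σ) (ρ := Nerve.point 𝒢 σ.last) rfl
    (Nerve.ext' (fun i => by fin_cases i; rfl) fun i => i.elim0) rfl rfl).symm

/-- Every representation up to homotopy is given by components. -/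
theorem RepHtpy.exists_comp [SigmaCompactSpace M] (D : RepHtpy 𝒢 E C) :
    ∃ c : Comp 𝒢 E C, c.Flat ∧ D.op = c.op := by
  have hact : ∀ (x : GrCochain 𝒢 E C) (p : ℤ) (φ : FunCochain 𝒢 0), HasDegree x p →
      D.op (act φ x) = act φ (D.op x) + (-1 : ℝ) ^ p • act (delta φ) x :=
    fun x p φ hx => D.leibniz x p 0 φ hx
  -- The Leibniz rule for functions on M: linearity fails only by the term with δφ, which lies in
  -- C^1(G; E).
  have hE : ∀ (φ : FunCochain 𝒢 0) (ε : Cochain 𝒢 E 0),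
      D.op (inEL (starN (Nat.zero_add 0) φ ε)) = act φ (D.op (inE ε)) +
        (DirectSum.lof ℝ ℕ (fun q => Cochain 𝒢 E q) 1 (starN rfl (delta φ) ε), 0) := by
    intro φ ε
    have h1 : inEL (starN (Nat.zero_add 0) φ ε) = (act φ (inE ε) : GrCochain 𝒢 E C) :=
      (act_inE φ ε).symm
    rw [h1, hact _ _ _ (hasDegree_inE ε), act_inE (delta φ), zpow_zero]
    congr 1
    exact one_smul ℝ _
  -- Sections of C have total degree -1, hence the negative sign of the δφ term.
  have hC : ∀ (φ : FunCochain 𝒢 0) (α : Cochain 𝒢 C 0),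
      D.op (inCL (starN (Nat.zero_add 0) φ α)) = act φ (D.op (inC α)) +
        (0, DirectSum.lof ℝ ℕ (fun q => Cochain 𝒢 C q) 1 (-starN rfl (delta φ) α)) := by
    intro φ α
    have h1 : inCL (starN (Nat.zero_add 0) φ α) = (act φ (inC α) : GrCochain 𝒢 E C) :=
      (act_inC φ α).symm
    rw [h1, hact _ _ _ (hasDegree_inC α), act_inC (delta φ)]
    congr 1
    have h2 : (-1 : ℝ) ^ (-1 : ℤ) • starN (Nat.zero_add (0 + 1)) (delta φ) α =
        -starN rfl (delta φ) α := Cochain.ext' fun σ => by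
      change (-1 : ℝ) ^ (-1 : ℤ) • (starN (Nat.zero_add (0 + 1)) (delta φ) α).1 σ =
        -(starN (Nat.zero_add (0 + 1)) (delta φ) α).1 σ
      rw [zpow_neg_one, inv_neg_one, neg_one_smul]
    rw [← h2]
    exact Prod.ext (smul_zero _) (map_smul _ _ _).symm
  -- The alternating sum over the non-initial faces obeys a Leibniz rule with the same δφ term, so
  -- the difference is linear over functions and comes from a family.
  obtain ⟨dE, hdE⟩ := exists_fam_hat (compE 1 ∘ₗ D.op ∘ₗ inEL - tail 𝒢 E 0) (by
    intro φ ε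
    have h1 : compE 1 (D.op (inEL (starN (Nat.zero_add 0) φ ε))) =
        starN (Nat.add_zero 1) φ (compE 1 (D.op (inEL ε))) + starN rfl (delta φ) ε := by
      rw [hE]
      change (act φ (D.op (inE ε))).1 1 + (DirectSum.lof ℝ ℕ (fun q => Cochain 𝒢 E q) 1 _) 1 = _
      rw [act_fst_apply, lof_apply_self]; rfl
    simp only [LinearMap.sub_apply, LinearMap.comp_apply, map_sub]
    rw [h1, tail_starN, pow_zero, one_smul]
    abel)
  obtain ⟨om, hom⟩ := exists_fam_hat (compC 2 ∘ₗ D.op ∘ₗ inEL) (by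
    intro φ ε
    simp only [LinearMap.comp_apply]
    rw [hE]
    change (act φ (D.op (inE ε))).2 2 + 0 = _
    rw [act_snd_apply, add_zero]; rfl)
  obtain ⟨an, han⟩ := exists_fam_hat (compE 0 ∘ₗ D.op ∘ₗ inCL) (by
    intro φ ε
    simp only [LinearMap.comp_apply]
    rw [hC]
    change (act φ (D.op (inC ε))).1 0 + 0 = _
    rw [act_fst_apply, add_zero]; rfl)
  obtain ⟨dC, hdC⟩ := exists_fam_hat (-(compC 1 ∘ₗ D.op ∘ₗ inCL) - tail 𝒢 C 0) (by
    intro φ α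
    have h1 : compC 1 (D.op (inCL (starN (Nat.zero_add 0) φ α))) =
        starN (Nat.add_zero 1) φ (compC 1 (D.op (inCL α))) - starN rfl (delta φ) α := by
      rw [hC]
      change (act φ (D.op (inC α))).2 1 + (DirectSum.lof ℝ ℕ (fun q => Cochain 𝒢 C q) 1 _) 1 = _
      rw [act_snd_apply, lof_apply_self, sub_eq_add_neg]; rfl
    simp only [LinearMap.sub_apply, LinearMap.neg_apply, LinearMap.comp_apply, map_sub, map_neg]
    rw [h1, tail_starN, pow_zero, one_smul]
    abel)
  have cE1 : ∀ ε, (D.op (inE ε)).1 1 = dE.cobound 0 ε := fun ε => by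
    have := hdE ε
    rw [LinearMap.sub_apply, sub_eq_iff_eq_add] at this
    exact this
  have cE2 : ∀ ε, (D.op (inE ε)).2 2 = om.hat rfl ε := hom
  have cC0 : ∀ α, (D.op (inC α)).1 0 = an.hat rfl α := han
  have cC1 : ∀ α, (D.op (inC α)).2 1 = -dC.cobound 0 α := fun α => by
    have := hdC α
    rw [LinearMap.sub_apply, LinearMap.neg_apply, sub_eq_iff_eq_add, neg_eq_iff_eq_neg] at this
    exact this
  have nE : ∀ ε : Cochain 𝒢 E 0, IsNormalizedGr (D.op (inE ε)) :=
    fun ε => D.normalized _ (isNormalizedGr_inE ε)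
  have nC : ∀ α : Cochain 𝒢 C 0, IsNormalizedGr (D.op (inC α)) :=
    fun α => D.normalized _ (isNormalizedGr_inC α)
  -- The conditions at units come from normalization: a section has no arrows as arguments, so it is
  -- normalized, and therefore so is its image.
  let c : Comp 𝒢 E C :=
    { an := an, dE := dE, dC := dC, om := om
      dE_one := fun x e => by
        obtain ⟨ε, rfl⟩ := exists_ev0 𝒢 x e
        have h := (nE ε).1 1 (Nerve.ofHom (Hom.one 𝒢 x)) ⟨0, x, rfl⟩
        rw [cE1] at h
        rw [← sub_eq_zero, ← dE.ev1_cobound]; exact h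
      dC_one := fun x e => by
        obtain ⟨α, rfl⟩ := exists_ev0 𝒢 x e
        have h := (nC α).2 1 (Nerve.ofHom (Hom.one 𝒢 x)) ⟨0, x, rfl⟩
        rw [cC1] at h
        rw [← sub_eq_zero, ← dC.ev1_cobound]; exact neg_eq_zero.1 h
      om_one_left := fun {x y} g e => by
        obtain ⟨ε, rfl⟩ := exists_ev0 𝒢 x e
        have h := (nE ε).2 2 (Nerve.ofPair (Hom.one 𝒢 y) g) ⟨0, y, rfl⟩
        rw [cE2] at h
        rw [← om.ev2_hat rfl]; exact h
      om_one_right := fun {x y} g e => by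
        obtain ⟨ε, rfl⟩ := exists_ev0 𝒢 x e
        have h := (nE ε).2 2 (Nerve.ofPair g (Hom.one 𝒢 x)) ⟨1, x, rfl⟩
        rw [cE2] at h
        rw [← om.ev2_hat rfl]; exact h }
  -- Both operators satisfy the same Leibniz rule, and by degree the images of sections have no
  -- components besides those just found.
  have hop : D.op = c.op := by
    refine eq_of_leibniz D.continuous c.op_continuous (fun x p q f hx h0 => ?_) (fun ε => ?_)
      fun α => ?_
    · rw [D.leibniz x p q f hx, c.op_leibniz x p q f hx, h0]
    · have hd := D.degree _ _ (hasDegree_inE (C := C) ε)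
      rw [c.op_inE]
      refine Prod.ext ?_ ?_
      · rw [eq_lof_of_forall_ne (p := 1) fun q hq => hd.1 q (by omega), cE1]
      · rw [eq_lof_of_forall_ne (p := 2) fun q hq => hd.2 q (by omega), cE2]
    · have hd := D.degree _ _ (hasDegree_inC (E := E) α)
      rw [c.op_inC]
      refine Prod.ext ?_ ?_
      · rw [eq_lof_of_forall_ne (p := 0) fun q hq => hd.1 q (by omega), cC0]
      · rw [eq_lof_of_forall_ne (p := 1) fun q hq => hd.2 q (by omega), cC1]
        rw [← zero_sub, lof_sub, map_zero]; exact zero_sub _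
  refine ⟨c, c.flat_iff.2 ⟨fun ε => ?_, fun α => ?_⟩, hop⟩
  · rw [← hop]; exact LinearMap.congr_fun D.sq_zero _
  · rw [← hop]; exact LinearMap.congr_fun D.sq_zero _

end Extraction

end

end VBG

namespace VBG

noncomputable section

open Filter Topology

open LieGroupoid (Hom)

/-! ### Module maps and isomorphisms in components -/

section Morphisms

variable {EG HG EM HM : Type*} [NormedAddCommGroup EG] [NormedSpace ℝ EG] [TopologicalSpace HG]
  [NormedAddCommGroup EM] [NormedSpace ℝ EM] [TopologicalSpace HM]
  {I : ModelWithCorners ℝ EG HG} {G : Type*} [TopologicalSpace G] [ChartedSpace HG G]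
  {J : ModelWithCorners ℝ EM HM} {M : Type*} [TopologicalSpace M] [ChartedSpace HM M]
  {𝒢 : LieGroupoid I G J M} {E E' E'' C C' C'' : VecBun.{v} J M}

variable (𝒢) in
/-- The components of a module map `C(G; E ⊕ C[1]) → C(G; E' ⊕ C'[1])` of degree `0`. -/
structure MorComp (E C E' C' : VecBun.{v} J M) where
  side : Fam 𝒢 E E' 0
  core : Fam 𝒢 C C' 0
  tau : Fam 𝒢 E C' 1
  tau_one : ∀ x e, tau.f1 (Hom.one 𝒢 x) e = 0

namespace MorComp

/-- The module map with the given components. -/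
def op (m : MorComp 𝒢 E C E' C') : GrCochain 𝒢 E C →ₗ[ℝ] GrCochain 𝒢 E' C' :=
  { toFun := fun x => (shift 0 (fun p => m.side.hat (Nat.zero_add p)) x.1,
      shift 0 (fun p => m.core.hat (Nat.zero_add p)) x.2 +
        shift 1 (fun p => m.tau.hat (Nat.add_comm 1 p)) x.1)
    map_add' := fun x y => Prod.ext
      (by simp only [Prod.fst_add, Prod.snd_add, map_add])
      (by simp only [Prod.fst_add, Prod.snd_add, map_add]; abel)
    map_smul' := fun r x => Prod.ext
      (by simp only [Prod.smul_fst, Prod.smul_snd, map_smul, RingHom.id_apply])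
      (by simp only [Prod.smul_fst, Prod.smul_snd, map_smul, RingHom.id_apply, smul_add]) }

theorem op_fst (m : MorComp 𝒢 E C E' C') (x : GrCochain 𝒢 E C) :
    (m.op x).1 = shift 0 (fun p => m.side.hat (Nat.zero_add p)) x.1 := rfl

theorem op_snd (m : MorComp 𝒢 E C E' C') (x : GrCochain 𝒢 E C) :
    (m.op x).2 = shift 0 (fun p => m.core.hat (Nat.zero_add p)) x.2 +
        shift 1 (fun p => m.tau.hat (Nat.add_comm 1 p)) x.1 := rfl

theorem op_continuous (m : MorComp 𝒢 E C E' C') : IsContinuousOp m.op := fun _ hx =>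
  ⟨fun q => shift_family 0 (fun _ => m.side.preservesFamilies_hat _) hx.1 q,
    fun q => isSmoothFamily_add (shift_family 0 (fun _ => m.core.preservesFamilies_hat _) hx.2 q)
      (shift_family 1 (fun _ => m.tau.preservesFamilies_hat _) hx.1 q)⟩

theorem op_degree (m : MorComp 𝒢 E C E' C') (x : GrCochain 𝒢 E C) (p : ℤ) (hx : HasDegree x p) :
    HasDegree (m.op x) p := by
  refine ⟨fun q hq => ?_, fun q hq => ?_⟩
  · exact shift_eq_zero _ fun n hn => hx.1 n (by omega)
  · change shift 0 (fun p => m.core.hat (Nat.zero_add p)) x.2 q +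
      shift 1 (fun p => m.tau.hat (Nat.add_comm 1 p)) x.1 q = 0
    rw [shift_eq_zero _ fun n hn => hx.1 n (by omega), shift_eq_zero _ fun n hn => hx.2 n (by omega),
      add_zero]

theorem op_act (m : MorComp 𝒢 E C E' C') (x : GrCochain 𝒢 E C) (q : ℕ) (f : FunCochain 𝒢 q) :
    m.op (act f x) = act f (m.op x) := by
  refine Prod.ext ?_ ?_
  · exact shift_star 0 (fun p => m.side.hat (Nat.zero_add p)) f
      (fun p η => m.side.hat_starN f rfl _ _ _ _) _
  · change shift 0 (fun p => m.core.hat (Nat.zero_add p)) (shift q (star C f) x.2) +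
      shift 1 (fun p => m.tau.hat (Nat.add_comm 1 p)) (shift q (star E f) x.1) =
      shift q (star C' f) (shift 0 (fun p => m.core.hat (Nat.zero_add p)) x.2 +
        shift 1 (fun p => m.tau.hat (Nat.add_comm 1 p)) x.1)
    rw [map_add, shift_star 0 (fun p => m.core.hat (Nat.zero_add p)) f
      (fun p η => m.core.hat_starN f rfl _ _ _ _) _,
      shift_star 1 (fun p => m.tau.hat (Nat.add_comm 1 p)) f
      (fun p η => m.tau.hat_starN f rfl _ _ _ _) _]

theorem op_normalized (m : MorComp 𝒢 E C E' C') (x : GrCochain 𝒢 E C) (hx : IsNormalizedGr x) :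
    IsNormalizedGr (m.op x) := by
  refine ⟨shift_normalized 0 (fun p η => isNormalized_hat _ _ ?_) hx.1, fun q => ?_⟩
  · rintro σ ⟨i, -⟩
    exact i.elim0
  · have h1 := shift_normalized 0 (L := fun p => m.core.hat (Nat.zero_add p))
      (fun p η => isNormalized_hat _ _ (by rintro σ ⟨i, -⟩; exact i.elim0)) hx.2 q
    have h2 := shift_normalized 1 (L := fun p => m.tau.hat (Nat.add_comm 1 p))
      (fun p η => isNormalized_hat _ _ (by
        rintro σ ⟨i, x, hi⟩
        obtain ⟨a, b, g, rfl⟩ := σ.exists_ofHom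
        fin_cases i
        have h1 : b = x := by rw [← g.tgt_val, ← 𝒢.tgt_one x]; exact congrArg 𝒢.tgt hi
        have h2 : a = x := by rw [← g.src_val, ← 𝒢.src_one x]; exact congrArg 𝒢.src hi
        subst h1 h2
        obtain rfl : g = Hom.one 𝒢 _ := Hom.ext hi
        exact LinearMap.ext fun e => m.tau_one _ e)) hx.1 q
    intro σ hσ
    change (shift 0 (fun p => m.core.hat (Nat.zero_add p)) x.2 q).1 σ +
      (shift 1 (fun p => m.tau.hat (Nat.add_comm 1 p)) x.1 q).1 σ = 0
    rw [h1 σ hσ, h2 σ hσ, add_zero]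

theorem op_inE (m : MorComp 𝒢 E C E' C') (ε : Cochain 𝒢 E 0) : m.op (inE ε) =
    (DirectSum.lof ℝ ℕ (fun q => Cochain 𝒢 E' q) 0 (m.side.hat rfl ε),
      DirectSum.lof ℝ ℕ (fun q => Cochain 𝒢 C' q) 1 (m.tau.hat rfl ε)) := by
  refine Prod.ext ?_ ?_
  · rw [op_fst, inE, shift_lof]
  · rw [op_snd, inE, shift_lof, map_zero, zero_add]

theorem op_inC (m : MorComp 𝒢 E C E' C') (α : Cochain 𝒢 C 0) :
    m.op (inC α) = inC (m.core.hat rfl α) := by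
  refine Prod.ext ?_ ?_
  · rw [op_fst, inC, map_zero]; rfl
  · rw [op_snd, inC, shift_lof, map_zero, add_zero]; rfl

end MorComp

section Intertwining

variable [FiniteDimensional ℝ EM] [T2Space M] [IsManifold J ∞ M]

/-- Every continuous module map of degree `0` that preserves normalized cochains is given by
components. -/
theorem exists_morComp [SigmaCompactSpace M] (T : GrCochain 𝒢 E C →ₗ[ℝ] GrCochain 𝒢 E' C')
    (hT : IsContinuousOp T) (hdeg : ∀ x p, HasDegree x p → HasDegree (T x) p)
    (hact : ∀ (x : GrCochain 𝒢 E C) (q : ℕ) (f : FunCochain 𝒢 q), T (act f x) = act f (T x))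
    (hn : ∀ x, IsNormalizedGr x → IsNormalizedGr (T x)) :
    ∃ m : MorComp 𝒢 E C E' C', T = m.op := by
  have hE : ∀ (φ : FunCochain 𝒢 0) (ε : Cochain 𝒢 E 0),
      T (inEL (starN (Nat.zero_add 0) φ ε)) = act φ (T (inE ε)) := by
    intro φ ε
    rw [← hact, act_inE]; rfl
  have hC : ∀ (φ : FunCochain 𝒢 0) (α : Cochain 𝒢 C 0),
      T (inCL (starN (Nat.zero_add 0) φ α)) = act φ (T (inC α)) := by
    intro φ α
    rw [← hact, act_inC]; rfl
  -- A map of degree 0 sends sections of E to C^0(G; E') ⊕ C^1(G; C') and sections of C to C^0(G;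
  -- C'), so exactly three components have to be extracted. There is no δφ term here.
  obtain ⟨A, hA⟩ := exists_fam_hat (compE 0 ∘ₗ T ∘ₗ inEL) (by
    intro φ ε
    simp only [LinearMap.comp_apply]
    rw [hE]
    exact act_fst_apply φ (T (inE ε)) 0)
  obtain ⟨τ, hτ⟩ := exists_fam_hat (compC 1 ∘ₗ T ∘ₗ inEL) (by
    intro φ ε
    simp only [LinearMap.comp_apply]
    rw [hE]
    exact act_snd_apply φ (T (inE ε)) 1)
  obtain ⟨B, hB⟩ := exists_fam_hat (compC 0 ∘ₗ T ∘ₗ inCL) (by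
    intro φ ε
    simp only [LinearMap.comp_apply]
    rw [hC]
    exact act_snd_apply φ (T (inC ε)) 0)
  have cA : ∀ ε, (T (inE ε)).1 0 = A.hat rfl ε := hA
  have cτ : ∀ ε, (T (inE ε)).2 1 = τ.hat rfl ε := hτ
  have cB : ∀ α, (T (inC α)).2 0 = B.hat rfl α := hB
  let m : MorComp 𝒢 E C E' C' :=
    { side := A, core := B, tau := τ
      tau_one := fun x e => by
        obtain ⟨ε, rfl⟩ := exists_ev0 𝒢 x e
        have h := (hn _ (isNormalizedGr_inE ε)).2 1 (Nerve.ofHom (Hom.one 𝒢 x)) ⟨0, x, rfl⟩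
        rw [cτ] at h
        rw [← τ.ev1_hat rfl]; exact h }
  refine ⟨m, eq_of_leibniz hT m.op_continuous (fun x p q f hx h0 => ?_) (fun ε => ?_) fun α => ?_⟩
  · rw [hact, m.op_act, h0]
  · have hd := hdeg _ _ (hasDegree_inE (C := C) ε)
    rw [m.op_inE]
    refine Prod.ext ?_ ?_
    · rw [eq_lof_of_forall_ne (p := 0) fun q hq => hd.1 q (by omega), cA]
    · rw [eq_lof_of_forall_ne (p := 1) fun q hq => hd.2 q (by omega), cτ]
  · have hd := hdeg _ _ (hasDegree_inC (E := E) α)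
    rw [m.op_inC]
    refine Prod.ext (DFinsupp.ext fun q => hd.1 q (by omega)) ?_
    rw [eq_lof_of_forall_ne (p := 0) fun q hq => hd.2 q (by omega), cB]; rfl

/-- The equations for a module map to intertwine two operators. -/
structure MorComp.Intertwines (m : MorComp 𝒢 E C E' C') (c : Comp 𝒢 E C) (c' : Comp 𝒢 E' C') :
    Prop where
  an : ∀ (x : M) (a : C.fiber x), m.side.f0 x (c.an.f0 x a) = c'.an.f0 x (m.core.f0 x a)
  dE : ∀ {x y : M} (g : 𝒢.Hom x y) (e : E.fiber x), m.side.f0 y (c.dE.f1 g e) =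
    c'.dE.f1 g (m.side.f0 x e) + c'.an.f0 y (m.tau.f1 g e)
  dC : ∀ {x y : M} (g : 𝒢.Hom x y) (a : C.fiber x), m.core.f0 y (c.dC.f1 g a) =
    c'.dC.f1 g (m.core.f0 x a) + m.tau.f1 g (c.an.f0 x a)
  om : ∀ {x y z : M} (g : 𝒢.Hom y z) (h : 𝒢.Hom x y) (e : E.fiber x),
    m.tau.f1 g (c.dE.f1 h e) + m.core.f0 z (c.om.f2 g h e) =
      c'.om.f2 g h (m.side.f0 x e) - c'.dC.f1 g (m.tau.f1 h e) + m.tau.f1 (g.comp h) e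

theorem lof_inj {p : ℕ} {η η' : Cochain 𝒢 E p} :
    DirectSum.lof ℝ ℕ (fun q => Cochain 𝒢 E q) p η =
      DirectSum.lof ℝ ℕ (fun q => Cochain 𝒢 E q) p η' ↔ η = η' :=
  ⟨fun h => by rw [← lof_apply_self p η, h, lof_apply_self], fun h => by rw [h]⟩

theorem MorComp.op_op_inE (m : MorComp 𝒢 E C E' C') (c : Comp 𝒢 E C) (ε : Cochain 𝒢 E 0) :
    m.op (c.op (inE ε)) =
      (DirectSum.lof ℝ ℕ (fun q => Cochain 𝒢 E' q) 1 (m.side.hat rfl (c.dE.cobound 0 ε)),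
        DirectSum.lof ℝ ℕ (fun q => Cochain 𝒢 C' q) 2
          (m.core.hat rfl (c.om.hat rfl ε) + m.tau.hat rfl (c.dE.cobound 0 ε))) := by
  rw [c.op_inE]
  refine Prod.ext ?_ ?_
  · rw [op_fst, shift_lof]
  · rw [op_snd, shift_lof, shift_lof]; exact (map_add _ _ _).symm

theorem MorComp.op_op_inC (m : MorComp 𝒢 E C E' C') (c : Comp 𝒢 E C) (α : Cochain 𝒢 C 0) :
    m.op (c.op (inC α)) =
      (DirectSum.lof ℝ ℕ (fun q => Cochain 𝒢 E' q) 0 (m.side.hat rfl (c.an.hat rfl α)),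
        DirectSum.lof ℝ ℕ (fun q => Cochain 𝒢 C' q) 1
          (m.tau.hat rfl (c.an.hat rfl α) - m.core.hat rfl (c.dC.cobound 0 α))) := by
  rw [c.op_inC]
  refine Prod.ext ?_ ?_
  · rw [op_fst, shift_lof]
  · rw [op_snd, map_neg, shift_lof, shift_lof, lof_sub, sub_eq_add_neg, add_comm]

theorem MorComp.comp_op_inE (m : MorComp 𝒢 E C E' C') (c : Comp 𝒢 E' C') (ε : Cochain 𝒢 E 0) :
    c.op (m.op (inE ε)) =
      (DirectSum.lof ℝ ℕ (fun q => Cochain 𝒢 E' q) 1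
          (c.dE.cobound 0 (m.side.hat rfl ε) + c.an.hat rfl (m.tau.hat rfl ε)),
        DirectSum.lof ℝ ℕ (fun q => Cochain 𝒢 C' q) 2
          (c.om.hat rfl (m.side.hat rfl ε) - c.dC.cobound 1 (m.tau.hat rfl ε))) := by
  rw [m.op_inE]
  refine Prod.ext ?_ ?_
  · rw [Comp.op_fst, shift_lof, shift_lof]; exact (map_add _ _ _).symm
  · rw [Comp.op_snd, shift_lof, shift_lof]; exact (lof_sub _ _).symm

/-- Both composites satisfy the same Leibniz rule, so it suffices to compare them on sections.
Evaluation on small simplices gives the equations at the final vertex; the terms that involve the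
section at another vertex are the same on both sides. -/
theorem MorComp.intertwines_iff [SigmaCompactSpace M] (m : MorComp 𝒢 E C E' C') (c : Comp 𝒢 E C)
    (c' : Comp 𝒢 E' C') : m.Intertwines c c' ↔ ∀ x, m.op (c.op x) = c'.op (m.op x) := by
  have hsec : (∀ x, m.op (c.op x) = c'.op (m.op x)) ↔
      (∀ ε : Cochain 𝒢 E 0, m.op (c.op (inE ε)) = c'.op (m.op (inE ε))) ∧
        ∀ α : Cochain 𝒢 C 0, m.op (c.op (inC α)) = c'.op (m.op (inC α)) := by
    refine ⟨fun h => ⟨fun ε => h _, fun α => h _⟩, fun ⟨hE, hC⟩ => LinearMap.congr_fun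
      (f := m.op ∘ₗ c.op) (g := c'.op ∘ₗ m.op) (eq_of_leibniz
        (m.op_continuous.comp c.op_continuous) (c'.op_continuous.comp m.op_continuous)
        (fun x p q f hx h0 => ?_) hE hC)⟩
    rw [LinearMap.comp_apply, LinearMap.comp_apply] at h0 ⊢
    rw [c.op_leibniz x p q f hx, m.op_act, c'.op_leibniz _ p q f (m.op_degree x p hx), map_add,
      map_smul, m.op_act, m.op_act, h0]
  rw [hsec]
  simp only [m.op_op_inE, m.op_op_inC, m.comp_op_inE, m.op_inC, c'.op_inC, Prod.mk.injEq, lof_inj]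
  have hneg : ∀ α : Cochain 𝒢 C 0, DirectSum.lof ℝ ℕ (fun q => Cochain 𝒢 C' q) 1
      (m.tau.hat rfl (c.an.hat rfl α) - m.core.hat rfl (c.dC.cobound 0 α)) =
      -DirectSum.lof ℝ ℕ (fun q => Cochain 𝒢 C' q) 1 (c'.dC.cobound 0 (m.core.hat rfl α)) ↔
      m.core.hat (p := 0) (q := 1) rfl (c.dC.cobound 0 α) = c'.dC.cobound 0 (m.core.hat rfl α) +
        m.tau.hat (p := 1) (q := 0) rfl (c.an.hat rfl α) := by
    intro α
    rw [show -DirectSum.lof ℝ ℕ (fun q => Cochain 𝒢 C' q) 1 (c'.dC.cobound 0 (m.core.hat rfl α)) =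
      DirectSum.lof ℝ ℕ (fun q => Cochain 𝒢 C' q) 1 (-c'.dC.cobound 0 (m.core.hat rfl α)) by
        rw [← zero_sub (c'.dC.cobound 0 _), lof_sub, map_zero]; exact (zero_sub _).symm, lof_inj,
      sub_eq_iff_eq_add, neg_add_eq_sub, eq_sub_iff_add_eq, add_comm, eq_comm]
  simp only [hneg]
  have e1 : ∀ (ε : Cochain 𝒢 E 0) {x y : M} (g : 𝒢.Hom x y),
      ev1 g (m.side.hat rfl (c.dE.cobound 0 ε)) =
        m.side.f0 y (c.dE.f1 g (ev0 x ε)) - m.side.f0 y (ev0 y ε) := by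
    intro ε x y g
    rw [Fam.ev1_hat0, Fam.ev1_cobound, map_sub]
  have e1' : ∀ (ε : Cochain 𝒢 E 0) {x y : M} (g : 𝒢.Hom x y),
      ev1 g (c'.dE.cobound 0 (m.side.hat rfl ε) + c'.an.hat rfl (m.tau.hat rfl ε)) =
        c'.dE.f1 g (m.side.f0 x (ev0 x ε)) + c'.an.f0 y (m.tau.f1 g (ev0 x ε)) -
          m.side.f0 y (ev0 y ε) := by
    intro ε x y g
    rw [map_add, Fam.ev1_cobound, Fam.ev0_hat, Fam.ev0_hat, Fam.ev1_hat0, Fam.ev1_hat]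
    abel
  have e2 : ∀ (ε : Cochain 𝒢 E 0) {x y z : M} (g : 𝒢.Hom y z) (h : 𝒢.Hom x y),
      ev2 g h (m.core.hat rfl (c.om.hat rfl ε) + m.tau.hat rfl (c.dE.cobound 0 ε)) =
        m.tau.f1 g (c.dE.f1 h (ev0 x ε)) + m.core.f0 z (c.om.f2 g h (ev0 x ε)) -
          m.tau.f1 g (ev0 y ε) := by
    intro ε x y z g h
    rw [map_add, Fam.ev2_hat0, Fam.ev2_hat, Fam.ev2_hat1, Fam.ev1_cobound, map_sub]
    abel
  have e2' : ∀ (ε : Cochain 𝒢 E 0) {x y z : M} (g : 𝒢.Hom y z) (h : 𝒢.Hom x y),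
      ev2 g h (c'.om.hat rfl (m.side.hat rfl ε) - c'.dC.cobound 1 (m.tau.hat rfl ε)) =
        c'.om.f2 g h (m.side.f0 x (ev0 x ε)) - c'.dC.f1 g (m.tau.f1 h (ev0 x ε)) +
          m.tau.f1 (g.comp h) (ev0 x ε) - m.tau.f1 g (ev0 y ε) := by
    intro ε x y z g h
    rw [map_sub, Fam.ev2_hat, Fam.ev0_hat, Fam.ev2_cobound, Fam.ev1_hat, Fam.ev1_hat, Fam.ev1_hat]
    abel
  have e3 : ∀ (α : Cochain 𝒢 C 0) {x y : M} (g : 𝒢.Hom x y),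
      ev1 g (m.core.hat rfl (c.dC.cobound 0 α)) =
        m.core.f0 y (c.dC.f1 g (ev0 x α)) - m.core.f0 y (ev0 y α) := by
    intro ε x y g
    rw [Fam.ev1_hat0, Fam.ev1_cobound, map_sub]
  have e3' : ∀ (α : Cochain 𝒢 C 0) {x y : M} (g : 𝒢.Hom x y),
      ev1 g (c'.dC.cobound 0 (m.core.hat rfl α) + m.tau.hat rfl (c.an.hat rfl α)) =
        c'.dC.f1 g (m.core.f0 x (ev0 x α)) + m.tau.f1 g (c.an.f0 x (ev0 x α)) -
          m.core.f0 y (ev0 y α) := by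
    intro ε x y g
    rw [map_add, Fam.ev1_cobound, Fam.ev0_hat, Fam.ev0_hat, Fam.ev1_hat, Fam.ev0_hat]
    abel
  constructor
  · intro H
    refine ⟨fun ε => ⟨ext_ev1 fun g => ?_, ext_ev2 fun g h => ?_⟩,
      fun α => ⟨ext_ev0 fun x => ?_, ext_ev1 fun g => ?_⟩⟩
    · rw [e1, e1', H.dE]
    · rw [e2, e2', H.om]
    · rw [Fam.ev0_hat, Fam.ev0_hat, Fam.ev0_hat, Fam.ev0_hat, H.an]
    · rw [e3, e3', H.dC]
  · rintro ⟨HE, HC⟩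
    constructor
    · intro x a
      obtain ⟨α, rfl⟩ := exists_ev0 𝒢 x a
      have := congrArg (ev0 x) (HC α).1
      rwa [Fam.ev0_hat, Fam.ev0_hat, Fam.ev0_hat, Fam.ev0_hat] at this
    · intro x y g e
      obtain ⟨ε, rfl⟩ := exists_ev0 𝒢 x e
      have := congrArg (ev1 g) (HE ε).1
      rw [e1, e1'] at this
      exact sub_left_injective this
    · intro x y g e
      obtain ⟨ε, rfl⟩ := exists_ev0 𝒢 x e
      have := congrArg (ev1 g) (HC ε).2
      rw [e3, e3'] at this
      exact sub_left_injective this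
    · intro x y z g h e
      obtain ⟨ε, rfl⟩ := exists_ev0 𝒢 x e
      have := congrArg (ev2 g h) (HE ε).2
      rw [e2, e2'] at this
      exact sub_left_injective this

end Intertwining

/-- A bundle isomorphism as a family of linear maps. -/
def Fam.ofIso (φ : VecBunIso E E') : Fam 𝒢 E E' 0 where
  toFun σ := (φ.equiv σ.base).toLinearMap
  smooth _ _ _ _ he := φ.smooth_toFun.comp he

/-- An isomorphism between the components of two representations up to homotopy. -/
structure CompIso (c : Comp 𝒢 E C) (c' : Comp 𝒢 E' C') where
  side : VecBunIso E E'
  core : VecBunIso C C'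
  tau : Fam 𝒢 E C' 1
  tau_one : ∀ x e, tau.f1 (Hom.one 𝒢 x) e = 0
  an : ∀ (x : M) (a : C.fiber x), side.equiv x (c.an.f0 x a) = c'.an.f0 x (core.equiv x a)
  dE : ∀ {x y : M} (g : 𝒢.Hom x y) (e : E.fiber x), side.equiv y (c.dE.f1 g e) =
    c'.dE.f1 g (side.equiv x e) + c'.an.f0 y (tau.f1 g e)
  dC : ∀ {x y : M} (g : 𝒢.Hom x y) (a : C.fiber x), core.equiv y (c.dC.f1 g a) =
    c'.dC.f1 g (core.equiv x a) + tau.f1 g (c.an.f0 x a)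
  om : ∀ {x y z : M} (g : 𝒢.Hom y z) (h : 𝒢.Hom x y) (e : E.fiber x),
    tau.f1 g (c.dE.f1 h e) + core.equiv z (c.om.f2 g h e) =
      c'.om.f2 g h (side.equiv x e) - c'.dC.f1 g (tau.f1 h e) + tau.f1 (g.comp h) e

/-- The inverse of the off-diagonal component. -/
def Fam.conjInv (φ : VecBunIso E E') (ψ : VecBunIso C C') (τ : Fam 𝒢 E C' 1) : Fam 𝒢 E' C 1 where
  -- The module map is block triangular with diagonal φ, ψ and off-diagonal entry τ; this is the
  -- off-diagonal entry of the inverse matrix.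
  toFun σ := -((ψ.equiv σ.base).symm.toLinearMap ∘ₗ τ.toFun σ ∘ₗ (φ.equiv σ.last).symm.toLinearMap)
  smooth k u _ hu he z := C.smoothAt_neg ((ψ.smooth_invFun.comp
    (τ.smooth k u _ hu (φ.smooth_invFun.comp he))) z)

theorem backN_zero {p : ℕ} (σ : Nerve 𝒢 p) : σ.backN (Nat.zero_add p) = σ :=
  Nerve.ext' (fun i => congrArg σ.vert (Fin.ext (Nat.zero_add _)))
    fun i => congrArg σ.arr (Fin.ext (Nat.zero_add _))

theorem Fam.ofIso_hat (φ : VecBunIso E E') {p : ℕ} (η : Cochain 𝒢 E p) (σ : Nerve 𝒢 p) :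
    ((Fam.ofIso φ : Fam 𝒢 E E' 0).hat (Nat.zero_add p) η).1 σ = φ.equiv σ.base (η.1 σ) :=
  (Fam.ofIso φ).eval_hat (Nat.zero_add p) η (σ := σ) (τ := Nerve.point 𝒢 σ.base) (ρ := σ)
    (Nerve.ext' (fun i => by fin_cases i; rfl) fun i => i.elim0) (backN_zero σ) rfl rfl

/-- The module map of an isomorphism. -/
def CompIso.mor {c : Comp 𝒢 E C} {c' : Comp 𝒢 E' C'} (i : CompIso c c') : MorComp 𝒢 E C E' C' :=
  ⟨Fam.ofIso i.side, Fam.ofIso i.core, i.tau, i.tau_one⟩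

/-- The module map of the inverse of an isomorphism. -/
def CompIso.invMor {c : Comp 𝒢 E C} {c' : Comp 𝒢 E' C'} (i : CompIso c c') :
    MorComp 𝒢 E' C' E C :=
  ⟨Fam.ofIso i.side.symm, Fam.ofIso i.core.symm, Fam.conjInv i.side i.core i.tau, fun x e => by
    have h := i.tau_one x ((i.side.equiv x).symm e)
    change -((i.core.equiv x).symm (i.tau.f1 (Hom.one 𝒢 x) ((i.side.equiv x).symm e))) = 0
    rw [h, map_zero, neg_zero]⟩

theorem MorComp.op_lof_fst (m : MorComp 𝒢 E C E' C') {p : ℕ} (η : Cochain 𝒢 E p) :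
    m.op (DirectSum.lof ℝ ℕ (fun q => Cochain 𝒢 E q) p η, 0) =
      (DirectSum.lof ℝ ℕ (fun q => Cochain 𝒢 E' q) p (m.side.hat (Nat.zero_add p) η),
        DirectSum.lof ℝ ℕ (fun q => Cochain 𝒢 C' q) (p + 1) (m.tau.hat (Nat.add_comm 1 p) η)) := by
  refine Prod.ext ?_ ?_
  · rw [op_fst, shift_lof]; rfl
  · rw [op_snd, shift_lof, map_zero, zero_add]

theorem MorComp.op_lof_snd (m : MorComp 𝒢 E C E' C') {p : ℕ} (η : Cochain 𝒢 C p) :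
    m.op (0, DirectSum.lof ℝ ℕ (fun q => Cochain 𝒢 C q) p η) =
      (0, DirectSum.lof ℝ ℕ (fun q => Cochain 𝒢 C' q) p (m.core.hat (Nat.zero_add p) η)) := by
  refine Prod.ext ?_ ?_
  · rw [op_fst, map_zero]
  · rw [op_snd, shift_lof, map_zero, add_zero]; rfl

/-- Two module maps with `B A = 1` and `τ' A + B τ = 0` compose to the identity. -/
theorem MorComp.op_comp_op_eq_id (m : MorComp 𝒢 E C E' C') (m' : MorComp 𝒢 E' C' E C)
    (hE : ∀ {p : ℕ} (η : Cochain 𝒢 E p),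
      m'.side.hat (Nat.zero_add p) (m.side.hat (Nat.zero_add p) η) = η)
    (hC : ∀ {p : ℕ} (η : Cochain 𝒢 C p),
      m'.core.hat (Nat.zero_add p) (m.core.hat (Nat.zero_add p) η) = η)
    (hτ : ∀ {p : ℕ} (η : Cochain 𝒢 E p),
      m'.core.hat (Nat.zero_add (p + 1)) (m.tau.hat (Nat.add_comm 1 p) η) +
        m'.tau.hat (Nat.add_comm 1 p) (m.side.hat (Nat.zero_add p) η) = 0) :
    m'.op ∘ₗ m.op = LinearMap.id := by
  refine LinearMap.prod_ext ?_ ?_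
  · refine DirectSum.linearMap_ext ℝ fun p => LinearMap.ext fun η => ?_
    change m'.op (m.op (DirectSum.lof ℝ ℕ (fun q => Cochain 𝒢 E q) p η, 0)) =
      (DirectSum.lof ℝ ℕ (fun q => Cochain 𝒢 E q) p η, 0)
    rw [m.op_lof_fst]
    refine Prod.ext ?_ ?_
    · rw [op_fst, shift_lof]
      change DirectSum.lof ℝ ℕ (fun q => Cochain 𝒢 E q) p _ = _
      rw [hE]
    · rw [op_snd, shift_lof, shift_lof]
      refine (map_add (DirectSum.lof ℝ ℕ (fun q => Cochain 𝒢 C q) (p + 1)) _ _).symm.trans ?_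
      rw [hτ, map_zero]
  · refine DirectSum.linearMap_ext ℝ fun p => LinearMap.ext fun η => ?_
    change m'.op (m.op (0, DirectSum.lof ℝ ℕ (fun q => Cochain 𝒢 C q) p η)) =
      (0, DirectSum.lof ℝ ℕ (fun q => Cochain 𝒢 C q) p η)
    rw [m.op_lof_snd, m'.op_lof_snd, hC]

theorem CompIso.invMor_mor {c : Comp 𝒢 E C} {c' : Comp 𝒢 E' C'} (i : CompIso c c') :
    i.invMor.op ∘ₗ i.mor.op = LinearMap.id := by
  refine i.mor.op_comp_op_eq_id i.invMor (fun η => Cochain.ext' fun σ => ?_)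
    (fun η => Cochain.ext' fun σ => ?_) fun {p} η => Cochain.ext' fun σ => ?_
  · refine (Fam.ofIso_hat _ _ _).trans ?_
    refine (congrArg _ (Fam.ofIso_hat _ _ _)).trans ?_
    exact (i.side.equiv σ.base).symm_apply_apply _
  · refine (Fam.ofIso_hat _ _ _).trans ?_
    refine (congrArg _ (Fam.ofIso_hat _ _ _)).trans ?_
    exact (i.core.equiv σ.base).symm_apply_apply _
  · change _ + _ = (0 : C.fiber σ.base)
    have h1 := Fam.ofIso_hat i.core.symm (i.tau.hat (Nat.add_comm 1 p) η) σ
    have h2 : (i.invMor.tau.hat (Nat.add_comm 1 p) (i.mor.side.hat (Nat.zero_add p) η)).1 σ =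
        -(i.core.equiv σ.base).symm ((i.tau.hat (Nat.add_comm 1 p) η).1 σ) := by
      have h3 := Fam.ofIso_hat (𝒢 := 𝒢) i.side η (σ.backN (Nat.add_comm 1 p))
      refine congrArg (fun e => -((i.core.equiv σ.base).symm
        (i.tau.toFun (σ.frontN (Nat.add_comm 1 p)) ((i.side.equiv _).symm e)))) h3 |>.trans ?_
      exact congrArg (fun e => -((i.core.equiv σ.base).symm
        (i.tau.toFun (σ.frontN (Nat.add_comm 1 p)) e)))
        ((i.side.equiv (σ.backN (Nat.add_comm 1 p)).base).symm_apply_apply _)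
    refine (congrArg₂ (· + ·) h1 h2).trans ?_
    exact add_neg_cancel _

theorem CompIso.mor_invMor {c : Comp 𝒢 E C} {c' : Comp 𝒢 E' C'} (i : CompIso c c') :
    i.mor.op ∘ₗ i.invMor.op = LinearMap.id := by
  refine i.invMor.op_comp_op_eq_id i.mor (fun η => Cochain.ext' fun σ => ?_)
    (fun η => Cochain.ext' fun σ => ?_) fun {p} η => Cochain.ext' fun σ => ?_
  · refine (Fam.ofIso_hat _ _ _).trans ?_
    refine (congrArg _ (Fam.ofIso_hat _ _ _)).trans ?_
    exact (i.side.equiv σ.base).apply_symm_apply _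
  · refine (Fam.ofIso_hat _ _ _).trans ?_
    refine (congrArg _ (Fam.ofIso_hat _ _ _)).trans ?_
    exact (i.core.equiv σ.base).apply_symm_apply _
  · change _ + _ = (0 : C'.fiber σ.base)
    have h0 : ∀ e, i.invMor.tau.toFun (σ.frontN (Nat.add_comm 1 p)) e =
      -((i.core.equiv σ.base).symm (i.tau.toFun (σ.frontN (Nat.add_comm 1 p))
        ((i.side.equiv _).symm e))) := fun e => rfl
    have h1 : (i.mor.core.hat (Nat.zero_add (p + 1)) (i.invMor.tau.hat (Nat.add_comm 1 p) η)).1 σ =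
        -(i.tau.toFun (σ.frontN (Nat.add_comm 1 p)) ((i.side.equiv _).symm
          (η.1 (σ.backN (Nat.add_comm 1 p))))) := by
      refine (Fam.ofIso_hat i.core _ σ).trans ?_
      refine (congrArg (i.core.equiv σ.base) (h0 _)).trans ?_
      refine (map_neg (i.core.equiv σ.base) _).trans ?_
      exact congrArg Neg.neg ((i.core.equiv σ.base).apply_symm_apply _)
    have h2 : (i.mor.tau.hat (Nat.add_comm 1 p) (i.invMor.side.hat (Nat.zero_add p) η)).1 σ =
        i.tau.toFun (σ.frontN (Nat.add_comm 1 p)) ((i.side.equiv _).symm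
          (η.1 (σ.backN (Nat.add_comm 1 p)))) :=
      congrArg (i.tau.toFun (σ.frontN (Nat.add_comm 1 p)))
        (Fam.ofIso_hat (𝒢 := 𝒢) i.side.symm η (σ.backN (Nat.add_comm 1 p)))
    refine (congrArg₂ (· + ·) h1 h2).trans ?_
    exact neg_add_cancel _

/-- The linear isomorphism of graded modules. -/
def CompIso.linearEquiv {c : Comp 𝒢 E C} {c' : Comp 𝒢 E' C'} (i : CompIso c c') :
    GrCochain 𝒢 E C ≃ₗ[ℝ] GrCochain 𝒢 E' C' :=
  LinearEquiv.ofLinearMap i.mor.op i.invMor.op i.mor_invMor i.invMor_mor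

theorem CompIso.isModuleIso {c : Comp 𝒢 E C} {c' : Comp 𝒢 E' C'} (i : CompIso c c') :
    IsModuleIso i.linearEquiv where
  continuous := i.mor.op_continuous
  continuous_symm := i.invMor.op_continuous
  degree x p := ⟨fun h => by
    have := i.invMor.op_degree _ p h
    rwa [show i.invMor.op (i.linearEquiv x) = x from LinearMap.congr_fun i.invMor_mor x] at this,
    i.mor.op_degree x p⟩
  act := i.mor.op_act
  normalized x := ⟨fun h => by
    have := i.invMor.op_normalized _ h
    rwa [show i.invMor.op (i.linearEquiv x) = x from LinearMap.congr_fun i.invMor_mor x] at this,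
    i.mor.op_normalized x⟩

end Morphisms

/-! ### Isomorphism and gauge equivalence in terms of components -/

section IsoIff

variable {EG HG EM HM : Type*} [NormedAddCommGroup EG] [NormedSpace ℝ EG] [TopologicalSpace HG]
  [NormedAddCommGroup EM] [NormedSpace ℝ EM] [TopologicalSpace HM]
  {I : ModelWithCorners ℝ EG HG} {G : Type*} [TopologicalSpace G] [ChartedSpace HG G]
  {J : ModelWithCorners ℝ EM HM} {M : Type*} [TopologicalSpace M] [ChartedSpace HM M]
  {𝒢 : LieGroupoid I G J M} {E E' C C' : VecBun.{v} J M}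
  [FiniteDimensional ℝ EM] [T2Space M] [IsManifold J ∞ M] [J.Boundaryless]

/-- Mutually inverse families at points form a bundle isomorphism. -/
def VecBunIso.ofFams (A : Fam 𝒢 E E' 0) (B : Fam 𝒢 E' E 0) (hBA : ∀ x e, B.f0 x (A.f0 x e) = e)
    (hAB : ∀ x e, A.f0 x (B.f0 x e) = e) : VecBunIso E E' where
  equiv x := LinearEquiv.ofLinearMap (A.f0 x) (B.f0 x) (LinearMap.ext (hAB x)) (LinearMap.ext (hBA x))
  smooth_toFun := contMDiff_of_plots fun k u hu =>
    A.smooth k (fun z => Nerve.point 𝒢 (u z).proj) (fun z => (u z).snd)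
      (Nerve.smoothMap_point ((Bundle.contMDiff_proj E.fiber).comp hu)) hu
  smooth_invFun := contMDiff_of_plots fun k u hu =>
    B.smooth k (fun z => Nerve.point 𝒢 (u z).proj) (fun z => (u z).snd)
      (Nerve.smoothMap_point ((Bundle.contMDiff_proj E'.fiber).comp hu)) hu

/-- Both T and its inverse are continuous module maps, so both have components. Triangularity makes
the diagonal components mutually inverse, hence bundle isomorphisms. -/
theorem exists_compIso [SigmaCompactSpace M] {c : Comp 𝒢 E C} {c' : Comp 𝒢 E' C'}
    {T : GrCochain 𝒢 E C ≃ₗ[ℝ] GrCochain 𝒢 E' C'} (hT : IsModuleIso T)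
    (h : ∀ x, T (c.op x) = c'.op (T x)) :
    ∃ i : CompIso c c', (∀ ε : Cochain 𝒢 E 0, ∀ x, ev0 x ((T (inE ε)).1 0) = i.side.equiv x (ev0 x ε)) ∧
      ∀ α : Cochain 𝒢 C 0, ∀ x, ev0 x ((T (inC α)).2 0) = i.core.equiv x (ev0 x α) := by
  obtain ⟨m, hm⟩ := exists_morComp T.toLinearMap hT.continuous (fun x p => (hT.degree x p).2)
    hT.act fun x => (hT.normalized x).2
  obtain ⟨m', hm'⟩ := exists_morComp T.symm.toLinearMap hT.continuous_symm
    (fun x p => (hT.symm.degree x p).2) hT.symm.act fun x => (hT.symm.normalized x).2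
  have hm1 : ∀ x, T x = m.op x := LinearMap.congr_fun hm
  have hm1' : ∀ x, T.symm x = m'.op x := LinearMap.congr_fun hm'
  have h1 : ∀ x, m'.op (m.op x) = x := fun x => by rw [← hm1, ← hm1', T.symm_apply_apply]
  have h2 : ∀ x, m.op (m'.op x) = x := fun x => by rw [← hm1', ← hm1, T.apply_symm_apply]
  have key : ∀ {E E' C C' : VecBun.{v} J M} (m : MorComp 𝒢 E C E' C') (m' : MorComp 𝒢 E' C' E C),
      (∀ x, m'.op (m.op x) = x) → (∀ x e, m'.side.f0 x (m.side.f0 x e) = e) ∧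
        ∀ x e, m'.core.f0 x (m.core.f0 x e) = e := by
    intro E E' C C' m m' h1
    constructor
    · intro x e
      obtain ⟨ε, rfl⟩ := exists_ev0 𝒢 x e
      have h3 := congrArg (fun y : GrCochain 𝒢 E C => ev0 x (y.1 0)) (h1 (inE ε))
      simp only [m.op_inE, MorComp.op_fst, shift_lof] at h3
      simp only [inE] at h3
      rw [lof_apply_self] at h3
      refine Eq.trans ?_ h3
      exact (congrArg (ev0 x) (lof_apply_self 0 (m'.side.hat rfl (m.side.hat rfl ε)))).symm
    · intro x e
      obtain ⟨α, rfl⟩ := exists_ev0 𝒢 x e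
      have h3 := congrArg (fun y : GrCochain 𝒢 E C => ev0 x (y.2 0)) (h1 (inC α))
      simp only [MorComp.op_inC] at h3
      simp only [inC] at h3
      rw [lof_apply_self, lof_apply_self] at h3
      exact h3
  obtain ⟨k1, k2⟩ := key m m' h1
  obtain ⟨k3, k4⟩ := key m' m h2
  have hi : m.Intertwines c c' := (m.intertwines_iff c c').2 fun x => by
    rw [← hm1, ← hm1, h]
  refine ⟨⟨VecBunIso.ofFams m.side m'.side k1 k3, VecBunIso.ofFams m.core m'.core k2 k4, m.tau,
    m.tau_one, hi.an, hi.dE, hi.dC, hi.om⟩, fun ε x => ?_, fun α x => ?_⟩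
  · rw [hm1, m.op_inE, lof_apply_self]; rfl
  · rw [hm1, m.op_inC]
    exact congrArg (ev0 x) (lof_apply_self 0 (m.core.hat rfl α))

theorem isomorphic_iff [SigmaCompactSpace M] {c : Comp 𝒢 E C} {c' : Comp 𝒢 E' C'}
    {D : RepHtpy 𝒢 E C} {D' : RepHtpy 𝒢 E' C'} (hD : D.op = c.op) (hD' : D'.op = c'.op) :
    D.Isomorphic D' ↔ Nonempty (CompIso c c') := by
  constructor
  · rintro ⟨T, hT, h⟩
    rw [hD, hD'] at h
    obtain ⟨i, -⟩ := exists_compIso hT h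
    exact ⟨i⟩
  · rintro ⟨i⟩
    refine ⟨i.linearEquiv, i.isModuleIso, fun x => ?_⟩
    rw [hD, hD']
    exact (i.mor.intertwines_iff c c').1 ⟨i.an, i.dE, i.dC, i.om⟩ x

/-- The quotient μ sees only cochain degree 0, where the off-diagonal component τ does not
contribute. So μ ∘ T = μ says exactly that both diagonal components are the identity. -/
theorem gaugeEquivalent_iff [SigmaCompactSpace M] {c c' : Comp 𝒢 E C} {D D' : RepHtpy 𝒢 E C}
    (hD : D.op = c.op) (hD' : D'.op = c'.op) :
    D.GaugeEquivalent D' ↔ ∃ i : CompIso c c', (∀ x e, i.side.equiv x e = e) ∧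
      ∀ x a, i.core.equiv x a = a := by
  constructor
  · rintro ⟨T, hT, hmu, h⟩
    rw [hD, hD'] at h
    obtain ⟨i, h1, h2⟩ := exists_compIso hT h
    refine ⟨i, fun x e => ?_, fun x a => ?_⟩
    · obtain ⟨ε, rfl⟩ := exists_ev0 𝒢 x e
      have h3 : (T (inE ε)).1 0 = ε := (congrArg Prod.fst (hmu (inE ε))).trans (lof_apply_self 0 ε)
      rw [← h1, h3]
    · obtain ⟨α, rfl⟩ := exists_ev0 𝒢 x a
      have h3 : (T (inC α)).2 0 = α := (congrArg Prod.snd (hmu (inC α))).trans (lof_apply_self 0 α)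
      rw [← h2, h3]
  · rintro ⟨i, h1, h2⟩
    refine ⟨i.linearEquiv, i.isModuleIso, fun x => ?_, fun x => ?_⟩
    · refine Prod.ext ?_ ?_
      · change shift 0 (fun p => i.mor.side.hat (Nat.zero_add p)) x.1 0 = x.1 0
        rw [shift_apply_add 0 _ _ 0]
        exact ext_ev0 fun y => h1 y _
      · change shift 0 (fun p => i.mor.core.hat (Nat.zero_add p)) x.2 0 +
          shift 1 (fun p => i.mor.tau.hat (Nat.add_comm 1 p)) x.1 0 = x.2 0
        rw [shift_apply_lt 1 _ _ Nat.one_pos, shift_apply_add 0 _ _ 0, add_zero]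
        exact ext_ev0 fun y => h2 y _
    · rw [hD, hD']
      exact (i.mor.intertwines_iff c c').1 ⟨i.an, i.dE, i.dC, i.om⟩ x

end IsoIff

end

end VBG

namespace VBG

noncomputable section

open Filter Topology

open LieGroupoid (Hom)

/-! ### Calculus with products in a `VB`-groupoid -/

section Calculus

variable {EG HG EM HM : Type*} [NormedAddCommGroup EG] [NormedSpace ℝ EG] [TopologicalSpace HG]
  [NormedAddCommGroup EM] [NormedSpace ℝ EM] [TopologicalSpace HM]
  {I : ModelWithCorners ℝ EG HG} {G : Type*} [TopologicalSpace G] [ChartedSpace HG G]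
  {J : ModelWithCorners ℝ EM HM} {M : Type*} [TopologicalSpace M] [ChartedSpace HM M]
  {𝒢 : LieGroupoid I G J M} {E E' C C' : VecBun.{v} J M}

namespace VBGroupoid

variable (Γ : VBGroupoid 𝒢 E)

/-- The source map on the fibre over an arrow. -/
def sr {x y : M} (g : 𝒢.Hom x y) : Γ.bun.fiber g.val →ₗ[ℝ] E.fiber x :=
  (E.tr g.src_val).toLinearMap ∘ₗ Γ.srcL g.val

/-- The target map on the fibre over an arrow. -/
def tg {x y : M} (g : 𝒢.Hom x y) : Γ.bun.fiber g.val →ₗ[ℝ] E.fiber y :=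
  (E.tr g.tgt_val).toLinearMap ∘ₗ Γ.tgtL g.val

theorem src_pt {x y : M} (g : 𝒢.Hom x y) (a : Γ.bun.fiber g.val) :
    Γ.gpd.src (Γ.bun.pt g.val a) = E.pt x (Γ.sr g a) :=
  (Γ.src_eq _).trans (E.pt_tr g.src_val _).symm

theorem tgt_pt {x y : M} (g : 𝒢.Hom x y) (a : Γ.bun.fiber g.val) :
    Γ.gpd.tgt (Γ.bun.pt g.val a) = E.pt y (Γ.tg g a) :=
  (Γ.tgt_eq _).trans (E.pt_tr g.tgt_val _).symm

/-- `c` is the product of `a` and `b`. -/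
def R {x y z : M} (g : 𝒢.Hom y z) (h : 𝒢.Hom x y) (k : 𝒢.Hom x z) (a : Γ.bun.fiber g.val)
    (b : Γ.bun.fiber h.val) (c : Γ.bun.fiber k.val) : Prop :=
  ∃ w, Γ.gpd.mul (Γ.bun.pt g.val a) (Γ.bun.pt h.val b) w = Γ.bun.pt k.val c

variable {Γ}

theorem comp_iff {x y z : M} {g : 𝒢.Hom y z} {h : 𝒢.Hom x y} {a : Γ.bun.fiber g.val}
    {b : Γ.bun.fiber h.val} :
    Γ.gpd.src (Γ.bun.pt g.val a) = Γ.gpd.tgt (Γ.bun.pt h.val b) ↔ Γ.sr g a = Γ.tg h b := by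
  rw [src_pt, tgt_pt, E.pt_inj]

theorem exists_R {x y z : M} {g : 𝒢.Hom y z} {h : 𝒢.Hom x y} {k : 𝒢.Hom x z}
    (hk : g.comp h = k) {a : Γ.bun.fiber g.val} {b : Γ.bun.fiber h.val} (w : Γ.sr g a = Γ.tg h b) :
    ∃ c, Γ.R g h k a b c := by
  subst hk
  exact ⟨Γ.bun.fiberAt _ (Γ.proj_mul _ _ (comp_iff.2 w) (g.src_val.trans h.tgt_val.symm)),
    comp_iff.2 w, (Γ.bun.pt_fiberAt _ _).symm⟩

namespace R

section

variable {x y z t : M} {g : 𝒢.Hom y z} {h : 𝒢.Hom x y} {k : 𝒢.Hom x z}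
  {a a' : Γ.bun.fiber g.val} {b b' : Γ.bun.fiber h.val} {c c' : Γ.bun.fiber k.val}

theorem comp_eq (r : Γ.R g h k a b c) : g.comp h = k := by
  obtain ⟨w, hw⟩ := r
  exact Hom.ext ((Γ.proj_mul _ _ w (g.src_val.trans h.tgt_val.symm)).symm.trans
    (congrArg Bundle.TotalSpace.proj hw))

theorem sr_eq_tg (r : Γ.R g h k a b c) : Γ.sr g a = Γ.tg h b := comp_iff.1 r.1

theorem sr_eq (r : Γ.R g h k a b c) : Γ.sr k c = Γ.sr h b := by
  obtain ⟨w, hw⟩ := r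
  rw [← E.pt_inj, ← src_pt, ← src_pt, ← hw, Γ.gpd.src_mul]

theorem tg_eq (r : Γ.R g h k a b c) : Γ.tg k c = Γ.tg g a := by
  obtain ⟨w, hw⟩ := r
  rw [← E.pt_inj, ← tgt_pt, ← tgt_pt, ← hw, Γ.gpd.tgt_mul]

theorem unique (r : Γ.R g h k a b c) (r' : Γ.R g h k a b c') : c = c' := by
  obtain ⟨w, hw⟩ := r
  obtain ⟨w', hw'⟩ := r'
  exact Γ.bun.pt_inj.1 (hw.symm.trans hw')

theorem add (r : Γ.R g h k a b c) (r' : Γ.R g h k a' b' c') :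
    Γ.R g h k (a + a') (b + b') (c + c') :=
  ⟨comp_iff.2 (by rw [map_add, map_add, r.sr_eq_tg, r'.sr_eq_tg]),
    Γ.interchange g.val h.val k.val a a' b b' c c' r.1 r'.1 _ r.2 r'.2⟩

variable (g h) in
-- By the interchange law the product of two zero vectors equals its own double.
theorem zero (hk : g.comp h = k) : Γ.R g h k 0 0 0 := by
  obtain ⟨c, hc⟩ := exists_R (Γ := Γ) hk (a := 0) (b := 0) (by rw [map_zero, map_zero])
  have h2 := hc.add hc
  rw [add_zero, add_zero] at h2
  have : c = 0 := by simpa using hc.unique h2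
  rwa [this] at hc

theorem assoc {f : 𝒢.Hom z t} {fg : 𝒢.Hom y t} {l : 𝒢.Hom x t} {d : Γ.bun.fiber f.val}
    {da : Γ.bun.fiber fg.val} {e : Γ.bun.fiber l.val} (r : Γ.R f g fg d a da)
    (s : Γ.R g h k a b c) (q : Γ.R fg h l da b e) : Γ.R f k l d c e := by
  obtain ⟨w, hw⟩ := r
  obtain ⟨w', hw'⟩ := s
  obtain ⟨u, hu⟩ := q
  refine ⟨?_, ?_⟩
  · rw [← hw', Γ.gpd.tgt_mul]; exact w
  · refine Eq.trans ?_ hu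
    refine (Γ.gpd.mul_congr rfl hw'.symm _ (by rw [Γ.gpd.tgt_mul]; exact w)).trans ?_
    refine (Γ.gpd.mul_assoc _ _ _ w w').symm.trans ?_
    exact Γ.gpd.mul_congr hw rfl _ _

theorem assoc' {f : 𝒢.Hom z t} {fg : 𝒢.Hom y t} {l : 𝒢.Hom x t} {d : Γ.bun.fiber f.val}
    {da : Γ.bun.fiber fg.val} {e : Γ.bun.fiber l.val} (r : Γ.R f g fg d a da)
    (s : Γ.R g h k a b c) (q : Γ.R f k l d c e) : Γ.R fg h l da b e := by
  have hl : fg.comp h = l := by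
    rw [← r.comp_eq, ← q.comp_eq, ← s.comp_eq, Hom.comp_assoc]
  obtain ⟨e', he'⟩ := exists_R (Γ := Γ) hl (a := da) (b := b) (by rw [r.sr_eq, s.sr_eq_tg])
  have := (r.assoc s he').unique q
  rwa [this] at he'

end

end R

/-- A unit of Γ is idempotent, so it projects to an idempotent arrow of G, and in a groupoid such an
arrow is a unit. That the bundle projection preserves units thus follows from its compatibility with
products. -/
theorem gpd_one_eq (x : M) (e : E.fiber x) :
    ∃ a : Γ.bun.fiber (𝒢.one x), Γ.gpd.one (E.pt x e) = Γ.bun.pt (𝒢.one x) a := by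
  set γ := Γ.gpd.one (E.pt x e) with hγ
  have hs : Γ.gpd.src γ = E.pt x e := Γ.gpd.src_one _
  have ht : Γ.gpd.tgt γ = E.pt x e := Γ.gpd.tgt_one _
  have hs' : 𝒢.src γ.proj = x := by rw [Γ.src_eq] at hs; exact congrArg Bundle.TotalSpace.proj hs
  have ht' : 𝒢.tgt γ.proj = x := by rw [Γ.tgt_eq] at ht; exact congrArg Bundle.TotalSpace.proj ht
  have hm : Γ.gpd.mul γ γ (hs.trans ht.symm) = γ :=
    one_mul_of_eq Γ.gpd (g := γ) (x := E.pt x e) ht _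
  have hp := (Γ.proj_mul γ γ (hs.trans ht.symm) (hs'.trans ht'.symm)).symm.trans
    (congrArg Bundle.TotalSpace.proj hm)
  have h1 : (⟨γ.proj, hs', ht'⟩ : 𝒢.Hom x x) = Hom.one 𝒢 x :=
    Hom.eq_one_of_comp_self _ (Hom.ext hp)
  have h2 : γ.proj = 𝒢.one x := congrArg Hom.val h1
  exact ⟨Γ.bun.fiberAt γ h2, (Γ.bun.pt_fiberAt γ h2).symm⟩

/-- The unit at `e`. -/
def unFun (Γ : VBGroupoid 𝒢 E) (x : M) (e : E.fiber x) : Γ.bun.fiber (Hom.one 𝒢 x).val :=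
  (gpd_one_eq (Γ := Γ) x e).choose

theorem gpd_one (x : M) (e : E.fiber x) :
    Γ.gpd.one (E.pt x e) = Γ.bun.pt (Hom.one 𝒢 x).val (Γ.unFun x e) :=
  (gpd_one_eq (Γ := Γ) x e).choose_spec

theorem sr_unFun (x : M) (e : E.fiber x) : Γ.sr (Hom.one 𝒢 x) (Γ.unFun x e) = e := by
  rw [← E.pt_inj, ← src_pt, ← gpd_one, Γ.gpd.src_one]

theorem tg_unFun (x : M) (e : E.fiber x) : Γ.tg (Hom.one 𝒢 x) (Γ.unFun x e) = e := by
  rw [← E.pt_inj, ← tgt_pt, ← gpd_one, Γ.gpd.tgt_one]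

theorem R_unFun_left {x y : M} (g : 𝒢.Hom x y) (a : Γ.bun.fiber g.val) :
    Γ.R (Hom.one 𝒢 y) g g (Γ.unFun y (Γ.tg g a)) a a := by
  have h := one_mul_of_eq Γ.gpd (g := Γ.bun.pt g.val a) (x := E.pt y (Γ.tg g a)) (tgt_pt Γ g a)
    (by rw [gpd_one]; exact comp_iff.2 (sr_unFun _ _))
  exact ⟨comp_iff.2 (sr_unFun _ _), (Γ.gpd.mul_congr (gpd_one _ _).symm rfl _ _).trans h⟩

theorem R_unFun_right {x y : M} (g : 𝒢.Hom x y) (a : Γ.bun.fiber g.val) :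
    Γ.R g (Hom.one 𝒢 x) g a (Γ.unFun x (Γ.sr g a)) a := by
  have h := mul_one_of_eq Γ.gpd (g := Γ.bun.pt g.val a) (x := E.pt x (Γ.sr g a)) (src_pt Γ g a)
    (by rw [gpd_one]; exact comp_iff.2 (tg_unFun _ _).symm)
  exact ⟨comp_iff.2 (tg_unFun _ _).symm, (Γ.gpd.mul_congr rfl (gpd_one _ _).symm _ _).trans h⟩

/-- The inverse of an element over g projects to a left inverse of g, which can only be the inverse
arrow. -/
theorem exists_inv {x y : M} (g : 𝒢.Hom x y) (a : Γ.bun.fiber g.val) :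
    ∃ a' : Γ.bun.fiber g.inv.val,
      Γ.gpd.inv (Γ.bun.pt g.val a) = Γ.bun.pt g.inv.val a' ∧
      Γ.R g.inv g (Hom.one 𝒢 x) a' a (Γ.unFun x (Γ.sr g a)) ∧
      Γ.R g g.inv (Hom.one 𝒢 y) a a' (Γ.unFun y (Γ.tg g a)) := by
  set γ := Γ.gpd.inv (Γ.bun.pt g.val a) with hγ
  have hs : Γ.gpd.src γ = E.pt y (Γ.tg g a) := (Γ.gpd.src_inv _).trans (tgt_pt Γ g a)
  have ht : Γ.gpd.tgt γ = E.pt x (Γ.sr g a) := (Γ.gpd.tgt_inv _).trans (src_pt Γ g a)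
  have hs' : 𝒢.src γ.proj = y := by rw [Γ.src_eq] at hs; exact congrArg Bundle.TotalSpace.proj hs
  have ht' : 𝒢.tgt γ.proj = x := by rw [Γ.tgt_eq] at ht; exact congrArg Bundle.TotalSpace.proj ht
  have hm : Γ.gpd.mul γ (Γ.bun.pt g.val a) (Γ.gpd.src_inv _) =
      Γ.bun.pt (Hom.one 𝒢 x).val (Γ.unFun x (Γ.sr g a)) := by
    rw [← gpd_one, ← src_pt]; exact Γ.gpd.inv_mul _
  have hm' : Γ.gpd.mul (Γ.bun.pt g.val a) γ (Γ.gpd.tgt_inv _).symm =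
      Γ.bun.pt (Hom.one 𝒢 y).val (Γ.unFun y (Γ.tg g a)) := by
    rw [← gpd_one, ← tgt_pt]; exact Γ.gpd.mul_inv _
  have hp := (Γ.proj_mul γ (Γ.bun.pt g.val a) (Γ.gpd.src_inv _) (hs'.trans g.tgt_val.symm)).symm.trans
    (congrArg Bundle.TotalSpace.proj hm)
  have h1 : (⟨γ.proj, hs', ht'⟩ : 𝒢.Hom y x) = g.inv :=
    Hom.eq_inv_of_comp_eq_one (Hom.ext hp)
  have h2 : γ.proj = g.inv.val := congrArg Hom.val h1
  have h3 := Γ.bun.pt_fiberAt γ h2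
  refine ⟨Γ.bun.fiberAt γ h2, h3.symm, ⟨?_, ?_⟩, ?_, ?_⟩
  · rw [h3]; exact Γ.gpd.src_inv _
  · exact (Γ.gpd.mul_congr h3 rfl _ _).trans hm
  · rw [h3]; exact (Γ.gpd.tgt_inv _).symm
  · exact (Γ.gpd.mul_congr rfl h3 _ _).trans hm'

theorem R.cancel_right {x y z : M} {g : 𝒢.Hom y z} {h : 𝒢.Hom x y} {k : 𝒢.Hom x z}
    {a a' : Γ.bun.fiber g.val} {b : Γ.bun.fiber h.val} {c : Γ.bun.fiber k.val}
    (r : Γ.R g h k a b c) (r' : Γ.R g h k a' b c) : a = a' := by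
  obtain ⟨b', -, -, hb⟩ := exists_inv h b
  have h1 := R_unFun_right g a
  have h2 := R_unFun_right g a'
  rw [r.sr_eq_tg] at h1
  rw [r'.sr_eq_tg] at h2
  exact (r.assoc' hb h1).unique (r'.assoc' hb h2)

/-- Cancellation makes every idempotent a unit. With the interchange law this is what shows that the
unit map is linear and that isomorphisms preserve units. -/
theorem eq_unFun_of_R_self {x : M} {a : Γ.bun.fiber (Hom.one 𝒢 x).val}
    (r : Γ.R (Hom.one 𝒢 x) (Hom.one 𝒢 x) (Hom.one 𝒢 x) a a a) :
    a = Γ.unFun x (Γ.sr (Hom.one 𝒢 x) a) := by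
  rw [r.sr_eq_tg]
  exact r.cancel_right (R_unFun_left _ a)

theorem R_unFun_self (x : M) (e : E.fiber x) : Γ.R (Hom.one 𝒢 x) (Hom.one 𝒢 x) (Hom.one 𝒢 x)
    (Γ.unFun x e) (Γ.unFun x e) (Γ.unFun x e) := by
  have := R_unFun_left (Hom.one 𝒢 x) (Γ.unFun x e)
  rwa [tg_unFun] at this

theorem R.smoothPlot {n : ℕ} {x y z : EuclideanSpace ℝ (Fin n) → M}
    {g : ∀ t, 𝒢.Hom (y t) (z t)} {h : ∀ t, 𝒢.Hom (x t) (y t)} {k : ∀ t, 𝒢.Hom (x t) (z t)}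
    {a : ∀ t, Γ.bun.fiber (g t).val} {b : ∀ t, Γ.bun.fiber (h t).val}
    {c : ∀ t, Γ.bun.fiber (k t).val} (r : ∀ t, Γ.R (g t) (h t) (k t) (a t) (b t) (c t))
    (ha : ContMDiff (𝓡 n) Γ.bun.tModel ∞ (fun t => Γ.bun.pt (g t).val (a t)))
    (hb : ContMDiff (𝓡 n) Γ.bun.tModel ∞ (fun t => Γ.bun.pt (h t).val (b t))) :
    ContMDiff (𝓡 n) Γ.bun.tModel ∞ (fun t => Γ.bun.pt (k t).val (c t)) :=
  (Γ.gpd.smooth_mul n _ _ (fun t => (r t).1) ha hb).congr fun t => (r t).2.symm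

theorem smooth_sr {n : ℕ} {x y : EuclideanSpace ℝ (Fin n) → M} {g : ∀ t, 𝒢.Hom (x t) (y t)}
    {a : ∀ t, Γ.bun.fiber (g t).val}
    (ha : ContMDiff (𝓡 n) Γ.bun.tModel ∞ (fun t => Γ.bun.pt (g t).val (a t))) :
    ContMDiff (𝓡 n) E.tModel ∞ (fun t => E.pt (x t) (Γ.sr (g t) (a t))) :=
  (Γ.gpd.smooth_src.comp ha).congr fun t => (src_pt Γ (g t) (a t)).symm

theorem smooth_tg {n : ℕ} {x y : EuclideanSpace ℝ (Fin n) → M} {g : ∀ t, 𝒢.Hom (x t) (y t)}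
    {a : ∀ t, Γ.bun.fiber (g t).val}
    (ha : ContMDiff (𝓡 n) Γ.bun.tModel ∞ (fun t => Γ.bun.pt (g t).val (a t))) :
    ContMDiff (𝓡 n) E.tModel ∞ (fun t => E.pt (y t) (Γ.tg (g t) (a t))) :=
  (Γ.gpd.smooth_tgt.comp ha).congr fun t => (tgt_pt Γ (g t) (a t)).symm

section Linear

variable [FiniteDimensional ℝ EG] [T2Space G] [IsManifold I ∞ G]

/-- The interchange law gives additivity only. The product of s • a and s • b is additive in s and,
by smoothness of the multiplication, continuous in s, hence real linear. -/
theorem R.smul {x y z : M} {g : 𝒢.Hom y z} {h : 𝒢.Hom x y} {k : 𝒢.Hom x z}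
    {a : Γ.bun.fiber g.val} {b : Γ.bun.fiber h.val} {c : Γ.bun.fiber k.val}
    (r : Γ.R g h k a b c) (s : ℝ) : Γ.R g h k (s • a) (s • b) (s • c) := by
  have hex : ∀ s : ℝ, ∃ d, Γ.R g h k (s • a) (s • b) d := fun s =>
    exists_R r.comp_eq (by rw [map_smul, map_smul, r.sr_eq_tg])
  choose d hd using hex
  have hadd : ∀ s t, d (s + t) = d s + d t := fun s t => by
    have h1 := hd (s + t)
    rw [add_smul, add_smul] at h1
    exact h1.unique ((hd s).add (hd t))
  have hone : d 1 = c := by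
    have h1 := hd 1
    rw [one_smul, one_smul] at h1
    exact h1.unique r
  have hsm : ContMDiff (𝓡 1) Γ.bun.tModel ∞
      (fun t : EuclideanSpace ℝ (Fin 1) => Γ.bun.pt k.val (d (t 0))) := by
    have h0 : ContMDiff (𝓡 1) 𝓘(ℝ, ℝ) ∞ (fun t : EuclideanSpace ℝ (Fin 1) => t 0) :=
      (EuclideanSpace.proj (𝕜 := ℝ) (0 : Fin 1)).contDiff.contMDiff
    exact R.smoothPlot (fun t => hd (t 0))
      (Γ.bun.smooth_smul h0 contMDiff_const) (Γ.bun.smooth_smul h0 contMDiff_const)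
  obtain ⟨F, -⟩ := Γ.bun.exists_frame k.val
  have hco : ∀ i, F.coord i k.val (d s) = s * F.coord i k.val c := by
    intro i
    -- A coordinate of the product as a function of s: a continuous additive map ℝ → ℝ, so it is
    -- multiplication by its value at 1.
    let φ : ℝ →+ ℝ := AddMonoidHom.mk' (fun t => F.coord i k.val (d t)) fun s t => by
      rw [hadd, map_add]
    have hφ : Continuous φ := by
      have h1 : Continuous fun t : EuclideanSpace ℝ (Fin 1) => F.coord i k.val (d (t 0)) :=
        ((F.smooth_coord i).comp hsm).continuous
      have h2 : Continuous fun t : ℝ => (EuclideanSpace.single (0 : Fin 1) t :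
          EuclideanSpace ℝ (Fin 1)) := by
        refine (PiLp.continuous_toLp 2 _).comp (continuous_pi fun i => ?_)
        simpa [Subsingleton.elim i 0] using (continuous_id' : Continuous fun a : ℝ => a)
      refine (h1.comp h2).congr fun t => ?_
      simp [φ]
    have h3 := (φ.toRealLinearMap hφ).map_smul s 1
    rw [smul_eq_mul, mul_one, smul_eq_mul] at h3
    rw [← hone]
    exact h3
  have : d s = s • c := by
    rw [← F.expand_self (d s), ← F.expand_self (s • c)]
    simp only [hco, map_smul, smul_eq_mul]
  rw [← this]
  exact hd s

variable (Γ) in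
/-- The unit map, on the fibres. -/
def un (x : M) : E.fiber x →ₗ[ℝ] Γ.bun.fiber (Hom.one 𝒢 x).val where
  toFun := Γ.unFun x
  map_add' e e' := by
    -- The sum of two units is idempotent, hence a unit, and its source tells which one.
    have h := eq_unFun_of_R_self ((R_unFun_self (Γ := Γ) x e).add (R_unFun_self x e'))
    rw [h, map_add, sr_unFun, sr_unFun]
  map_smul' s e := by
    have h := eq_unFun_of_R_self ((R_unFun_self (Γ := Γ) x e).smul s)
    rw [RingHom.id_apply, h, map_smul, sr_unFun]

@[simp] theorem sr_un (x : M) (e : E.fiber x) : Γ.sr (Hom.one 𝒢 x) (Γ.un x e) = e := sr_unFun x e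

@[simp] theorem tg_un (x : M) (e : E.fiber x) : Γ.tg (Hom.one 𝒢 x) (Γ.un x e) = e := tg_unFun x e

theorem R_un_left {x y : M} (g : 𝒢.Hom x y) (a : Γ.bun.fiber g.val) :
    Γ.R (Hom.one 𝒢 y) g g (Γ.un y (Γ.tg g a)) a a := R_unFun_left g a

theorem R_un_right {x y : M} (g : 𝒢.Hom x y) (a : Γ.bun.fiber g.val) :
    Γ.R g (Hom.one 𝒢 x) g a (Γ.un x (Γ.sr g a)) a := R_unFun_right g a

/-- `a ↦ a · 0_h` on the kernel of the source map, as a relation. -/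
theorem R_zero_right {x y : M} (g : 𝒢.Hom x y) {a : Γ.bun.fiber g.val} (ha : Γ.sr g a = 0) :
    Γ.R g (Hom.one 𝒢 x) g a 0 a := by
  have := R_un_right g a
  rwa [ha, map_zero] at this

end Linear

end VBGroupoid

end Calculus

end

end VBG

namespace VBG

noncomputable section

open Filter Topology

open LieGroupoid (Hom)

/-! ### The splitting of a `VB`-groupoid by a horizontal lift -/

section Splitting

variable {EG HG EM HM : Type*} [NormedAddCommGroup EG] [NormedSpace ℝ EG] [TopologicalSpace HG]
  [NormedAddCommGroup EM] [NormedSpace ℝ EM] [TopologicalSpace HM]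
  {I : ModelWithCorners ℝ EG HG} {G : Type*} [TopologicalSpace G] [ChartedSpace HG G]
  {J : ModelWithCorners ℝ EM HM} {M : Type*} [TopologicalSpace M] [ChartedSpace HM M]
  {𝒢 : LieGroupoid I G J M} {E E' C C' : VecBun.{v} J M} {Γ : VBGroupoid 𝒢 E}

namespace HorLift

/-- The horizontal lift along an arrow with given end points. -/
def hl (h : HorLift Γ) {x y : M} (g : 𝒢.Hom x y) : E.fiber x →ₗ[ℝ] Γ.bun.fiber g.val :=
  h.lift g.val ∘ₗ (E.tr g.src_val.symm).toLinearMap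

@[simp] theorem sr_hl (h : HorLift Γ) {x y : M} (g : 𝒢.Hom x y) (e : E.fiber x) :
    Γ.sr g (h.hl g e) = e := by
  obtain ⟨g, rfl, rfl⟩ := g
  exact h.src_lift g e

theorem pt_hl_one (h : HorLift Γ) (x : M) (e : E.fiber x) :
    Γ.gpd.one (E.pt x e) = Γ.bun.pt (Hom.one 𝒢 x).val (h.hl (Hom.one 𝒢 x) e) := by
  have h1 := h.lift_one x (E.tr (𝒢.src_one x).symm e)
  rw [E.pt_tr] at h1
  exact h1

theorem smooth_hl (h : HorLift Γ) {n : ℕ} {x y : EuclideanSpace ℝ (Fin n) → M}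
    {g : ∀ t, 𝒢.Hom (x t) (y t)} {e : ∀ t, E.fiber (x t)}
    (hg : ContMDiff (𝓡 n) I ∞ (fun t => (g t).val))
    (he : ContMDiff (𝓡 n) E.tModel ∞ (fun t => E.pt (x t) (e t))) :
    ContMDiff (𝓡 n) Γ.bun.tModel ∞ (fun t => Γ.bun.pt (g t).val (h.hl (g t) (e t))) :=
  h.smooth n _ _ hg (he.congr fun t => E.pt_tr (g t).src_val.symm (e t))

end HorLift

namespace CoreIdent

/-- The inclusion of the core into the fibre over a unit. -/
def cor (κ : CoreIdent Γ C) (x : M) : C.fiber x →ₗ[ℝ] Γ.bun.fiber (Hom.one 𝒢 x).val := κ.incl x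

@[simp] theorem sr_cor (κ : CoreIdent Γ C) (x : M) (a : C.fiber x) :
    Γ.sr (Hom.one 𝒢 x) (κ.cor x a) = 0 := by
  rw [← E.pt_inj, ← Γ.src_pt]; exact κ.src_core x a

theorem exists_cor (κ : CoreIdent Γ C) {x : M} {b : Γ.bun.fiber (Hom.one 𝒢 x).val}
    (hb : Γ.sr (Hom.one 𝒢 x) b = 0) : ∃ a, κ.cor x a = b := by
  have h1 : Γ.srcL (𝒢.one x) b = 0 := (E.tr (𝒢.src_one x)).map_eq_zero_iff.1 hb
  have h2 : b ∈ LinearMap.range (κ.incl x) := by rw [κ.range_eq]; exact h1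
  exact h2

theorem smooth_cor (κ : CoreIdent Γ C) {n : ℕ} {x : EuclideanSpace ℝ (Fin n) → M}
    {a : ∀ t, C.fiber (x t)} (ha : ContMDiff (𝓡 n) C.tModel ∞ (fun t => C.pt (x t) (a t))) :
    ContMDiff (𝓡 n) Γ.bun.tModel ∞ (fun t => Γ.bun.pt (Hom.one 𝒢 (x t)).val (κ.cor (x t) (a t))) :=
  κ.smooth.comp ha

theorem exists_zFun (κ : CoreIdent Γ C) {x y : M} (g : 𝒢.Hom x y) (a : C.fiber y) :
    ∃ b, Γ.R (Hom.one 𝒢 y) g g (κ.cor y a) 0 b :=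
  VBGroupoid.exists_R (Hom.one_comp g) (by rw [κ.sr_cor, map_zero])

end CoreIdent

variable [FiniteDimensional ℝ EG] [T2Space G] [IsManifold I ∞ G]

theorem HorLift.hl_one (h : HorLift Γ) (x : M) (e : E.fiber x) :
    h.hl (Hom.one 𝒢 x) e = Γ.un x e :=
  Γ.bun.pt_inj.1 ((h.pt_hl_one x e).symm.trans (VBGroupoid.gpd_one x e))

namespace CoreIdent

/-- The map `a ↦ a · 0_g` from the core to the kernel of the source map. -/
def Z (κ : CoreIdent Γ C) {x y : M} (g : 𝒢.Hom x y) : C.fiber y →ₗ[ℝ] Γ.bun.fiber g.val where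
  toFun a := (κ.exists_zFun g a).choose
  map_add' a b := by
    have h := (κ.exists_zFun g a).choose_spec.add (κ.exists_zFun g b).choose_spec
    rw [add_zero, ← map_add] at h
    exact (κ.exists_zFun g (a + b)).choose_spec.unique h
  map_smul' s a := by
    have h := (κ.exists_zFun g a).choose_spec.smul s
    rw [smul_zero, ← map_smul] at h
    exact (κ.exists_zFun g (s • a)).choose_spec.unique h

variable (κ : CoreIdent Γ C)

theorem R_Z {x y : M} (g : 𝒢.Hom x y) (a : C.fiber y) :
    Γ.R (Hom.one 𝒢 y) g g (κ.cor y a) 0 (κ.Z g a) := (κ.exists_zFun g a).choose_spec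

@[simp] theorem sr_Z {x y : M} (g : 𝒢.Hom x y) (a : C.fiber y) : Γ.sr g (κ.Z g a) = 0 := by
  rw [(κ.R_Z g a).sr_eq, map_zero]

theorem tg_Z {x y : M} (g : 𝒢.Hom x y) (a : C.fiber y) :
    Γ.tg g (κ.Z g a) = Γ.tg (Hom.one 𝒢 y) (κ.cor y a) := (κ.R_Z g a).tg_eq

theorem Z_injective {x y : M} (g : 𝒢.Hom x y) : Function.Injective (κ.Z g) := fun a b h => by
  have h1 := κ.R_Z g a
  rw [h] at h1
  exact κ.injective y (h1.cancel_right (κ.R_Z g b))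

@[simp] theorem Z_inj {x y : M} (g : 𝒢.Hom x y) {a b : C.fiber y} : κ.Z g a = κ.Z g b ↔ a = b :=
  (κ.Z_injective g).eq_iff

theorem Z_one (x : M) (a : C.fiber x) : κ.Z (Hom.one 𝒢 x) a = κ.cor x a :=
  (κ.R_Z (Hom.one 𝒢 x) a).unique (VBGroupoid.R_zero_right _ (κ.sr_cor x a))

/-- Multiplication by the zero vector over the inverse arrow moves an element of source zero to the
fibre over a unit, where it lies in the core; multiplication by 0_g moves it back. -/
theorem exists_Z {x y : M} (g : 𝒢.Hom x y) {b : Γ.bun.fiber g.val} (hb : Γ.sr g b = 0) :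
    ∃ a, κ.Z g a = b := by
  obtain ⟨c, hc⟩ := VBGroupoid.exists_R (Γ := Γ) (Hom.comp_inv g) (a := b) (b := 0)
    (by rw [hb, map_zero])
  obtain ⟨a, rfl⟩ := κ.exists_cor (b := c) (by rw [hc.sr_eq, map_zero])
  refine ⟨a, (κ.R_Z g a).unique ?_⟩
  exact hc.assoc' (VBGroupoid.R.zero g.inv g (Hom.inv_comp g)) (VBGroupoid.R_zero_right g hb)

theorem smooth_Z {n : ℕ} {x y : EuclideanSpace ℝ (Fin n) → M}
    {g : ∀ t, 𝒢.Hom (x t) (y t)} {a : ∀ t, C.fiber (y t)}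
    (hg : ContMDiff (𝓡 n) I ∞ (fun t => (g t).val))
    (ha : ContMDiff (𝓡 n) C.tModel ∞ (fun t => C.pt (y t) (a t))) :
    ContMDiff (𝓡 n) Γ.bun.tModel ∞ (fun t => Γ.bun.pt (g t).val (κ.Z (g t) (a t))) :=
  VBGroupoid.R.smoothPlot (fun t => κ.R_Z (g t) (a t)) (κ.smooth_cor ha) (Γ.bun.smooth_zero hg)

/-- `Z` followed by a product on the left with another kernel element. -/
theorem R_Z_zero {x y z : M} (g : 𝒢.Hom y z) (k : 𝒢.Hom x y) (a : C.fiber z) :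
    Γ.R g k (g.comp k) (κ.Z g a) 0 (κ.Z (g.comp k) a) :=
  (κ.R_Z g a).assoc' (VBGroupoid.R.zero g k rfl) (κ.R_Z (g.comp k) a)

section

variable [FiniteDimensional ℝ EM] [T2Space M] [IsManifold J ∞ M]

/-- The maps `Z` form a smooth family of injective linear maps and therefore reflect smoothness. In
this way core elements that are defined only by an equation for a · 0_g are shown to depend smoothly
on their data. -/
theorem smooth_of_Z {n : ℕ} {x y : EuclideanSpace ℝ (Fin n) → M}
    {g : ∀ t, 𝒢.Hom (x t) (y t)} {a : ∀ t, C.fiber (y t)}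
    (hg : ContMDiff (𝓡 n) I ∞ (fun t => (g t).val))
    (ha : ContMDiff (𝓡 n) Γ.bun.tModel ∞ (fun t => Γ.bun.pt (g t).val (κ.Z (g t) (a t)))) :
    ContMDiff (𝓡 n) C.tModel ∞ (fun t => C.pt (y t) (a t)) := by
  have hy : ContMDiff (𝓡 n) J ∞ y := (𝒢.smooth_tgt.comp hg).congr fun t => ((g t).tgt_val).symm
  intro t₀
  exact C.smoothAt_of_injective Γ.bun (fun t => κ.Z (g t)) (κ.Z_injective _)
    (fun s hs => κ.smooth_Z hg (hs.comp hy) t₀) (hy t₀) (ha t₀)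

end

end CoreIdent

/-- `c` consists of the components of the representation up to homotopy of a horizontal lift. -/
structure IsCompOf (κ : CoreIdent Γ C) (h : HorLift Γ) (c : Comp 𝒢 E C) : Prop where
  an : ∀ (x : M) (a : C.fiber x), c.an.f0 x a = Γ.tg (Hom.one 𝒢 x) (κ.cor x a)
  dE : ∀ {x y : M} (g : 𝒢.Hom x y) (e : E.fiber x), c.dE.f1 g e = Γ.tg g (h.hl g e)
  dC : ∀ {x y : M} (g : 𝒢.Hom x y) (a : C.fiber x), Γ.R g (Hom.one 𝒢 x) g
    (h.hl g (c.an.f0 x a)) (κ.cor x a) (κ.Z g (c.dC.f1 g a))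
  om : ∀ {x y z : M} (g : 𝒢.Hom y z) (k : 𝒢.Hom x y) (e : E.fiber x), Γ.R g k (g.comp k)
    (h.hl g (c.dE.f1 k e)) (h.hl k e) (h.hl (g.comp k) e - κ.Z (g.comp k) (c.om.f2 g k e))

/-- The product formula: in the splitting of `Γ` by a horizontal lift, the product is
`(a₁, ∂a₂ + Δ^E_k e₂) · (a₂, e₂) = (a₁ + Δ^C_g a₂ - Ω_{g,k} e₂, e₂)`. -/
theorem IsCompOf.prod {κ : CoreIdent Γ C} {h : HorLift Γ} {c : Comp 𝒢 E C} (H : IsCompOf κ h c)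
    {x y z : M} (g : 𝒢.Hom y z) (k : 𝒢.Hom x y) (a₁ : C.fiber z) (a₂ : C.fiber y)
    (e₂ : E.fiber x) :
    Γ.R g k (g.comp k) (κ.Z g a₁ + h.hl g (c.an.f0 y a₂ + c.dE.f1 k e₂)) (κ.Z k a₂ + h.hl k e₂)
      (κ.Z (g.comp k) (a₁ + c.dC.f1 g a₂ - c.om.f2 g k e₂) + h.hl (g.comp k) e₂) := by
  -- By the interchange law the product is the sum of (a₁ · 0_g) · 0_k, of h_g(∂a₂) · (a₂ · 0_k) and
  -- of h_g(Δ^E_k e₂) · h_k(e₂).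
  have h1 := κ.R_Z_zero g k a₁
  have h2 : Γ.R g k (g.comp k) (h.hl g (c.an.f0 y a₂)) (κ.Z k a₂)
      (κ.Z (g.comp k) (c.dC.f1 g a₂)) :=
    (H.dC g a₂).assoc (κ.R_Z k a₂) (κ.R_Z_zero g k _)
  have h3 := (h1.add h2).add (H.om g k e₂)
  rw [zero_add, add_assoc, ← map_add (h.hl g), ← map_add (κ.Z (g.comp k)),
    show κ.Z (g.comp k) (a₁ + c.dC.f1 g a₂) + (h.hl (g.comp k) e₂ -
      κ.Z (g.comp k) (c.om.f2 g k e₂)) = κ.Z (g.comp k) (a₁ + c.dC.f1 g a₂ - c.om.f2 g k e₂) +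
        h.hl (g.comp k) e₂ by rw [map_sub (κ.Z (g.comp k))]; abel] at h3
  exact h3

theorem CoreIdent.split_inj (κ : CoreIdent Γ C) (h : HorLift Γ) {x y : M} {g : 𝒢.Hom x y}
    {a a' : C.fiber y} {e e' : E.fiber x} (H : κ.Z g a + h.hl g e = κ.Z g a' + h.hl g e') :
    a = a' ∧ e = e' := by
  have h1 := congrArg (Γ.sr g) H
  simp only [map_add, κ.sr_Z, h.sr_hl, zero_add] at h1
  subst h1
  exact ⟨(κ.Z_inj g).1 (add_right_cancel H), rfl⟩

/-- The difference of b and the lift of its source has source zero, so it is a core element times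
0_g. -/
theorem CoreIdent.exists_split (κ : CoreIdent Γ C) (h : HorLift Γ) {x y : M} (g : 𝒢.Hom x y)
    (b : Γ.bun.fiber g.val) : ∃ a, b = κ.Z g a + h.hl g (Γ.sr g b) := by
  obtain ⟨a, ha⟩ := κ.exists_Z g (b := b - h.hl g (Γ.sr g b)) (by rw [map_sub, h.sr_hl, sub_self])
  exact ⟨a, by rw [ha, sub_add_cancel]⟩

theorem IsCompOf.tg_split {κ : CoreIdent Γ C} {h : HorLift Γ} {c : Comp 𝒢 E C} (H : IsCompOf κ h c)
    {x y : M} (g : 𝒢.Hom x y) (a : C.fiber y) (e : E.fiber x) :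
    Γ.tg g (κ.Z g a + h.hl g e) = c.an.f0 y a + c.dE.f1 g e := by
  rw [map_add, κ.tg_Z, H.an, H.dE]

theorem VBGroupoid.R.of_eq {x y z : M} {g : 𝒢.Hom y z} {k : 𝒢.Hom x y} {l l' : 𝒢.Hom x z}
    (hl : l = l') {P : ∀ l : 𝒢.Hom x z, Γ.bun.fiber l.val} {a : Γ.bun.fiber g.val}
    {b : Γ.bun.fiber k.val} (r : Γ.R g k l a b (P l)) : Γ.R g k l' a b (P l') := by
  subst hl; exact r

/-- The groupoid axioms are read in the coordinates of the splitting. The target of a product yields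
the two equations with values in E, associativity the two with values in C; in each case they are
separated by setting a = 0, or by setting e = 0 and taking a unit as the last arrow. -/
theorem IsCompOf.flat {κ : CoreIdent Γ C} {h : HorLift Γ} {c : Comp 𝒢 E C} (H : IsCompOf κ h c) :
    c.Flat := by
  -- A product has the same target as its first factor.
  have hE : ∀ {x y z : M} (g : 𝒢.Hom y z) (k : 𝒢.Hom x y) (a : C.fiber y) (e : E.fiber x),
      c.an.f0 z (c.dC.f1 g a - c.om.f2 g k e) + c.dE.f1 (g.comp k) e =
        c.dE.f1 g (c.an.f0 y a + c.dE.f1 k e) := by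
    intro x y z g k a e
    have h1 := (H.prod g k 0 a e).tg_eq
    rwa [H.tg_split, H.tg_split, map_zero, zero_add, zero_add] at h1
  -- Associativity for two horizontal factors over f and g, followed by an arbitrary element (a, e)
  -- over k.
  have hC : ∀ {x y z w : M} (f : 𝒢.Hom z w) (g : 𝒢.Hom y z) (k : 𝒢.Hom x y) (a : C.fiber y)
      (e : E.fiber x), -c.om.f2 f g (c.an.f0 y a + c.dE.f1 k e) + c.dC.f1 (f.comp g) a
        - c.om.f2 (f.comp g) k e =
      c.dC.f1 f (c.dC.f1 g a - c.om.f2 g k e) - c.om.f2 f (g.comp k) e := by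
    intro x y z w f g k a e
    have r := H.prod f g 0 0 (c.an.f0 y a + c.dE.f1 k e)
    have s := H.prod g k 0 a e
    rw [map_zero, zero_add, map_zero, zero_add, map_zero, zero_add, map_zero, zero_add, zero_sub] at r
    rw [map_zero, zero_add, zero_add] at s
    have q := H.prod (f.comp g) k (-c.om.f2 f g (c.an.f0 y a + c.dE.f1 k e)) a e
    have q' := H.prod f (g.comp k) 0 (c.dC.f1 g a - c.om.f2 g k e) e
    rw [map_zero, zero_add, zero_add, hE] at q'
    have q'' := VBGroupoid.R.of_eq (Γ := Γ) (Hom.comp_assoc f g k).symm (P := fun l => κ.Z l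
      (c.dC.f1 f (c.dC.f1 g a - c.om.f2 g k e) - c.om.f2 f (g.comp k) e) + h.hl l e) q'
    exact (κ.split_inj h ((r.assoc s q).unique q'')).1
  constructor
  · intro x y g a
    have := hE g (Hom.one 𝒢 x) a 0
    simpa using this
  · intro x y z g k e
    have := hE g k 0 e
    simp only [map_zero, zero_sub, zero_add, map_neg] at this
    rw [← this]
    abel
  · intro x y z g k a
    have := hC g k (Hom.one 𝒢 x) a 0
    simp only [map_zero, add_zero, sub_zero] at this
    rw [← this]
    abel
  · intro x y z w f g k e
    have := hC f g k 0 e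
    simp only [map_zero, zero_add, add_zero, zero_sub, map_neg] at this
    have h2 := congrArg (fun t => c.dC.f1 f (c.om.f2 g k e) + c.om.f2 f (g.comp k) e + t) this
    beta_reduce at h2
    rw [show c.dC.f1 f (c.om.f2 g k e) + c.om.f2 f (g.comp k) e + (-c.dC.f1 f (c.om.f2 g k e) -
      c.om.f2 f (g.comp k) e) = 0 by abel] at h2
    rw [← h2]
    abel

theorem Fam.ext_f0 {l l' : Fam 𝒢 E E' 0} (h : ∀ x e, l.f0 x e = l'.f0 x e) : l = l' := by
  obtain ⟨f, hf⟩ := l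
  obtain ⟨f', hf'⟩ := l'
  congr
  funext σ
  obtain ⟨x, rfl⟩ := σ.exists_point
  exact LinearMap.ext (h x)

theorem Fam.ext_f1 {l l' : Fam 𝒢 E E' 1}
    (h : ∀ {x y : M} (g : 𝒢.Hom x y) e, l.f1 g e = l'.f1 g e) : l = l' := by
  obtain ⟨f, hf⟩ := l
  obtain ⟨f', hf'⟩ := l'
  congr
  funext σ
  obtain ⟨x, y, g, rfl⟩ := σ.exists_ofHom
  exact LinearMap.ext (h g)

theorem Fam.ext_f2 {l l' : Fam 𝒢 E E' 2}
    (h : ∀ {x y z : M} (g : 𝒢.Hom y z) (k : 𝒢.Hom x y) e, l.f2 g k e = l'.f2 g k e) : l = l' := by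
  obtain ⟨f, hf⟩ := l
  obtain ⟨f', hf'⟩ := l'
  congr
  funext σ
  obtain ⟨x, y, z, g, k, rfl⟩ := σ.exists_ofPair
  exact LinearMap.ext (h g k)

theorem Comp.ext_f {c c' : Comp 𝒢 E C} (h0 : ∀ x a, c.an.f0 x a = c'.an.f0 x a)
    (h1 : ∀ {x y : M} (g : 𝒢.Hom x y) e, c.dE.f1 g e = c'.dE.f1 g e)
    (h2 : ∀ {x y : M} (g : 𝒢.Hom x y) a, c.dC.f1 g a = c'.dC.f1 g a)
    (h3 : ∀ {x y z : M} (g : 𝒢.Hom y z) (k : 𝒢.Hom x y) e, c.om.f2 g k e = c'.om.f2 g k e) :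
    c = c' := by
  obtain ⟨an, dE, dC, om, _, _, _, _⟩ := c
  obtain ⟨an', dE', dC', om', _, _, _, _⟩ := c'
  obtain rfl : an = an' := Fam.ext_f0 h0
  obtain rfl : dE = dE' := Fam.ext_f1 h1
  obtain rfl : dC = dC' := Fam.ext_f1 h2
  obtain rfl : om = om' := Fam.ext_f2 h3
  rfl

theorem IsCompOf.unique {κ : CoreIdent Γ C} {h : HorLift Γ} {c c' : Comp 𝒢 E C}
    (H : IsCompOf κ h c) (H' : IsCompOf κ h c') : c = c' := by
  have h0 : ∀ x a, c.an.f0 x a = c'.an.f0 x a := fun x a => by rw [H.an, H'.an]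
  have h1 : ∀ {x y : M} (g : 𝒢.Hom x y) e, c.dE.f1 g e = c'.dE.f1 g e := fun g e => by
    rw [H.dE, H'.dE]
  refine Comp.ext_f h0 h1 (fun g a => ?_) fun g k e => ?_
  · have := H.dC g a
    rw [h0] at this
    exact (κ.Z_inj g).1 (this.unique (H'.dC g a))
  · have := H.om g k e
    rw [h1] at this
    exact (κ.Z_inj _).1 (sub_right_injective (this.unique (H'.om g k e)))

section Existence

variable [FiniteDimensional ℝ EM] [T2Space M] [IsManifold J ∞ M]

variable (𝒢) in
/-- A smooth family indexed by arrows. -/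
def Fam.mk1 (f : ∀ {x y : M}, 𝒢.Hom x y → E.fiber x →ₗ[ℝ] E'.fiber y)
    (hf : ∀ {n : ℕ} {x y : EuclideanSpace ℝ (Fin n) → M} {g : ∀ t, 𝒢.Hom (x t) (y t)}
      {e : ∀ t, E.fiber (x t)}, ContMDiff (𝓡 n) I ∞ (fun t => (g t).val) →
      ContMDiff (𝓡 n) E.tModel ∞ (fun t => E.pt (x t) (e t)) →
        ContMDiff (𝓡 n) E'.tModel ∞ (fun t => E'.pt (y t) (f (g t) (e t)))) : Fam 𝒢 E E' 1 where
  toFun σ := f (σ.hom 0 Nat.one_pos)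
  smooth _ u _ hu he := hf (g := fun t => (u t).hom 0 Nat.one_pos) (hu.2 _) he

variable (𝒢) in
/-- A smooth family indexed by pairs of arrows. -/
def Fam.mk2 (f : ∀ {x y z : M}, 𝒢.Hom y z → 𝒢.Hom x y → E.fiber x →ₗ[ℝ] E'.fiber z)
    (hf : ∀ {n : ℕ} {x y z : EuclideanSpace ℝ (Fin n) → M} {g : ∀ t, 𝒢.Hom (y t) (z t)}
      {k : ∀ t, 𝒢.Hom (x t) (y t)} {e : ∀ t, E.fiber (x t)},
      ContMDiff (𝓡 n) I ∞ (fun t => (g t).val) → ContMDiff (𝓡 n) I ∞ (fun t => (k t).val) →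
      ContMDiff (𝓡 n) E.tModel ∞ (fun t => E.pt (x t) (e t)) →
        ContMDiff (𝓡 n) E'.tModel ∞ (fun t => E'.pt (z t) (f (g t) (k t) (e t)))) :
    Fam 𝒢 E E' 2 where
  toFun σ := f (σ.hom 0 Nat.two_pos) (σ.hom 1 Nat.one_lt_two)
  smooth _ u _ hu he := hf (g := fun t => (u t).hom 0 Nat.two_pos)
    (k := fun t => (u t).hom 1 Nat.one_lt_two) (hu.2 _) (hu.2 _) he

/-- The product h_g(∂a) · a, and the difference of h_{gk}(e) and the product of lifts, have source
zero, so each is `Z` of a unique core element. Linearity of these elements comes from `R.add` and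
`R.smul`, smoothness from `smooth_of_Z`. -/
theorem exists_isCompOf (κ : CoreIdent Γ C) (h : HorLift Γ) : ∃ c, IsCompOf κ h c := by
  let A : ∀ x, C.fiber x →ₗ[ℝ] E.fiber x := fun x => Γ.tg (Hom.one 𝒢 x) ∘ₗ κ.cor x
  have hA : ∀ {n : ℕ} {x : EuclideanSpace ℝ (Fin n) → M} {a : ∀ t, C.fiber (x t)},
      ContMDiff (𝓡 n) C.tModel ∞ (fun t => C.pt (x t) (a t)) →
        ContMDiff (𝓡 n) E.tModel ∞ (fun t => E.pt (x t) (A (x t) (a t))) := fun ha =>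
    VBGroupoid.smooth_tg (g := fun t => Hom.one 𝒢 _) (κ.smooth_cor ha)
  let dE : ∀ {x y : M}, 𝒢.Hom x y → E.fiber x →ₗ[ℝ] E.fiber y := fun g => Γ.tg g ∘ₗ h.hl g
  have hdE : ∀ {n : ℕ} {x y : EuclideanSpace ℝ (Fin n) → M} {g : ∀ t, 𝒢.Hom (x t) (y t)}
      {e : ∀ t, E.fiber (x t)}, ContMDiff (𝓡 n) I ∞ (fun t => (g t).val) →
      ContMDiff (𝓡 n) E.tModel ∞ (fun t => E.pt (x t) (e t)) →
        ContMDiff (𝓡 n) E.tModel ∞ (fun t => E.pt (y t) (dE (g t) (e t))) := fun hg he =>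
    VBGroupoid.smooth_tg (h.smooth_hl hg he)
  have exC : ∀ {x y : M} (g : 𝒢.Hom x y) (a : C.fiber x),
      ∃ d, Γ.R g (Hom.one 𝒢 x) g (h.hl g (A x a)) (κ.cor x a) (κ.Z g d) := by
    intro x y g a
    obtain ⟨b, hb⟩ := VBGroupoid.exists_R (Γ := Γ) (Hom.comp_one g) (a := h.hl g (A x a))
      (b := κ.cor x a) (by rw [h.sr_hl]; rfl)
    obtain ⟨d, rfl⟩ := κ.exists_Z g (b := b) (by rw [hb.sr_eq, κ.sr_cor])
    exact ⟨d, hb⟩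
  choose dC hdC using @exC
  have exO : ∀ {x y z : M} (g : 𝒢.Hom y z) (k : 𝒢.Hom x y) (e : E.fiber x),
      ∃ o, Γ.R g k (g.comp k) (h.hl g (dE k e)) (h.hl k e)
        (h.hl (g.comp k) e - κ.Z (g.comp k) o) := by
    intro x y z g k e
    obtain ⟨b, hb⟩ := VBGroupoid.exists_R (Γ := Γ) (k := g.comp k) rfl (a := h.hl g (dE k e))
      (b := h.hl k e) (by rw [h.sr_hl]; rfl)
    obtain ⟨o, ho⟩ := κ.exists_Z (g.comp k) (b := h.hl (g.comp k) e - b)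
      (by rw [map_sub, hb.sr_eq, h.sr_hl, h.sr_hl, sub_self])
    refine ⟨o, ?_⟩
    rwa [ho, sub_sub_cancel]
  choose om hom using @exO
  let dCl : ∀ {x y : M}, 𝒢.Hom x y → C.fiber x →ₗ[ℝ] C.fiber y := fun {x y} g =>
    { toFun := dC g
      map_add' := fun a b => (κ.Z_inj g).1 (by
        have := (hdC g a).add (hdC g b)
        rw [← map_add, ← map_add, ← map_add, ← map_add] at this
        exact (hdC g (a + b)).unique this)
      map_smul' := fun s a => (κ.Z_inj g).1 (by
        have := (hdC g a).smul s
        rw [← map_smul, ← map_smul, ← map_smul, ← map_smul] at this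
        exact (hdC g (s • a)).unique this) }
  let oml : ∀ {x y z : M}, 𝒢.Hom y z → 𝒢.Hom x y → E.fiber x →ₗ[ℝ] C.fiber z := fun {x y z} g k =>
    { toFun := om g k
      map_add' := fun a b => (κ.Z_inj (g.comp k)).1 (by
        have h1 := (hom g k a).add (hom g k b)
        have h2 := hom g k (a + b)
        rw [← map_add, ← map_add, ← map_add] at h1
        have h3 := h2.unique h1
        rw [map_add (h.hl (g.comp k))] at h3
        rw [map_add]
        have h4 := congrArg (fun t => h.hl (g.comp k) a + h.hl (g.comp k) b - t) h3
        simp only [sub_sub_cancel] at h4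
        rw [h4]; abel)
      map_smul' := fun s a => (κ.Z_inj (g.comp k)).1 (by
        have h1 := (hom g k a).smul s
        have h2 := hom g k (s • a)
        rw [← map_smul, ← map_smul, ← map_smul, smul_sub, ← map_smul, ← map_smul (κ.Z _)] at h1
        exact sub_right_injective (h2.unique h1)) }
  refine ⟨{ an := ⟨fun σ => A σ.base, fun _ _ _ _ he => hA he⟩
            dE := Fam.mk1 𝒢 dE hdE
            dC := Fam.mk1 𝒢 dCl fun {n x y g e} hg he => ?_
            om := Fam.mk2 𝒢 oml fun {n x y z g k e} hg hk he => ?_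
            dE_one := fun x e => ?_
            dC_one := fun x a => ?_
            om_one_left := fun {x y} g e => ?_
            om_one_right := fun {x y} g e => ?_ }, fun _ _ => rfl, fun _ _ => rfl, hdC, hom⟩
  · refine κ.smooth_of_Z hg (VBGroupoid.R.smoothPlot (fun t => hdC (g t) (e t)) ?_ (κ.smooth_cor he))
    exact h.smooth_hl hg (hA he)
  · have hgk : ContMDiff (𝓡 n) I ∞ (fun t => ((g t).comp (k t)).val) :=
      𝒢.smooth_mul n _ _ _ hg hk
    refine κ.smooth_of_Z (g := fun t => (g t).comp (k t)) hgk ?_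
    have h1 := VBGroupoid.R.smoothPlot (fun t => hom (g t) (k t) (e t)) (h.smooth_hl hg (hdE hk he))
      (h.smooth_hl hk he)
    have h2 := h.smooth_hl hgk he
    intro t
    have := Γ.bun.smoothAt_sub (h2 t) (h1 t)
    simp only [sub_sub_cancel] at this
    exact this
  · change Γ.tg (Hom.one 𝒢 x) (h.hl (Hom.one 𝒢 x) e) = e
    rw [h.hl_one, VBGroupoid.tg_un]
  · refine (κ.Z_inj _).1 ((hdC (Hom.one 𝒢 x) a).unique ?_)
    rw [h.hl_one, κ.Z_one]
    exact VBGroupoid.R_un_left _ _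
  -- Over a unit the lift is the unit map, so the product of lifts is h_g(e) itself and Ω vanishes.
  · have h1 := hom (Hom.one 𝒢 y) g e
    rw [h.hl_one] at h1
    have h2 := VBGroupoid.R.of_eq (P := fun l => h.hl l e) (Hom.one_comp g).symm
      (VBGroupoid.R_un_left g (h.hl g e))
    have h3 := h1.unique h2
    rw [sub_eq_self] at h3
    exact (κ.Z_inj _).1 (h3.trans (map_zero _).symm)
  · have h1 := hom g (Hom.one 𝒢 x) e
    rw [show dE (Hom.one 𝒢 x) e = e by
      change Γ.tg (Hom.one 𝒢 x) (h.hl (Hom.one 𝒢 x) e) = e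
      rw [h.hl_one, VBGroupoid.tg_un], h.hl_one] at h1
    have h2 := VBGroupoid.R_un_right g (h.hl g e)
    rw [h.sr_hl] at h2
    have h3 := h1.unique (VBGroupoid.R.of_eq (P := fun l => h.hl l e) (Hom.comp_one g).symm h2)
    rw [sub_eq_self] at h3
    exact (κ.Z_inj _).1 (h3.trans (map_zero _).symm)

end Existence

end Splitting

end

end VBG

namespace VBG

noncomputable section

open Filter Topology

open LieGroupoid (Hom)

/-! ### The representation up to homotopy of a horizontal lift -/

section Induced

variable {EG HG EM HM : Type*} [NormedAddCommGroup EG] [NormedSpace ℝ EG] [TopologicalSpace HG]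
  [NormedAddCommGroup EM] [NormedSpace ℝ EM] [TopologicalSpace HM]
  {I : ModelWithCorners ℝ EG HG} {G : Type*} [TopologicalSpace G] [ChartedSpace HG G]
  {J : ModelWithCorners ℝ EM HM} {M : Type*} [TopologicalSpace M] [ChartedSpace HM M]
  {𝒢 : LieGroupoid I G J M} {E E' C C' : VecBun.{v} J M} {Γ : VBGroupoid 𝒢 E}

namespace Comp

variable (c : Comp 𝒢 E C)

theorem atPoint_op_inC (α : Cochain 𝒢 C 0) (x : M) :
    atPoint ((c.op (inC α)).1 0) x = c.an.f0 x (atPoint α x) := by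
  rw [c.op_inC, lof_apply_self]
  exact c.an.ev0_hat rfl α x

theorem atEdge_op_inC (α : Cochain 𝒢 C 0) (g : G) :
    atPoint α (𝒢.tgt g) - atEdge ((c.op (inC α)).2 1) g =
      c.dC.f1 (Hom.mk' 𝒢 g) (atPoint α (𝒢.src g)) := by
  have h1 : (c.op (inC α)).2 1 = -c.dC.cobound 0 α := by
    rw [c.op_inC]
    exact congrArg Neg.neg (lof_apply_self ..)
  have h2 := c.dC.ev1_cobound α (Hom.mk' 𝒢 g)
  have h3 : atEdge ((c.op (inC α)).2 1) g = -ev1 (Hom.mk' 𝒢 g) (c.dC.cobound 0 α) := by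
    rw [h1]; rfl
  rw [h3, h2, sub_neg_eq_add]
  exact add_sub_cancel _ _

theorem atEdge_op_inE (ε : Cochain 𝒢 E 0) (g : G) :
    atEdge ((c.op (inE ε)).1 1) g + atPoint ε (𝒢.tgt g) =
      c.dE.f1 (Hom.mk' 𝒢 g) (atPoint ε (𝒢.src g)) := by
  have h3 : atEdge ((c.op (inE ε)).1 1) g = ev1 (Hom.mk' 𝒢 g) (c.dE.cobound 0 ε) := by
    rw [c.op_inE, lof_apply_self]; rfl
  rw [h3, c.dE.ev1_cobound ε (Hom.mk' 𝒢 g)]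
  exact sub_add_cancel _ _

theorem atPair_op_inE (ε : Cochain 𝒢 E 0) (g k : G) (w : 𝒢.src g = 𝒢.tgt k) :
    atPair ((c.op (inE ε)).2 2) g k w = C.tr (𝒢.tgt_mul g k w).symm
      (c.om.f2 ⟨g, w, rfl⟩ (Hom.mk' 𝒢 k) (atPoint ε (𝒢.src k))) := by
  refine (C.fiberAt_pt _ _).trans (congrArg _ ?_)
  rw [c.op_inE, lof_apply_self]
  exact c.om.ev2_hat rfl ε ⟨g, w, rfl⟩ (Hom.mk' 𝒢 k)

end Comp

theorem VBGroupoid.R_mulAt {x y z : M} {g : 𝒢.Hom y z} {k : 𝒢.Hom x y} {l : 𝒢.Hom x z}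
    {a : Γ.bun.fiber g.val} {b : Γ.bun.fiber k.val}
    (w : Γ.gpd.src (Γ.bun.pt g.val a) = Γ.gpd.tgt (Γ.bun.pt k.val b))
    (hl : 𝒢.mul g.val k.val (Γ.base_comp w) = l.val) :
    Γ.R g k l a b (Γ.mulAt (Γ.bun.pt g.val a) (Γ.bun.pt k.val b) w hl) :=
  ⟨w, (Γ.bun.pt_fiberAt _ _).symm⟩

theorem VBGroupoid.R.congr {x y z : M} {g : 𝒢.Hom y z} {k : 𝒢.Hom x y} {l : 𝒢.Hom x z}
    {a : Γ.bun.fiber g.val} {b : Γ.bun.fiber k.val} {d d' : Γ.bun.fiber l.val}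
    (r : Γ.R g k l a b d) (hd : d = d') : Γ.R g k l a b d' := hd ▸ r

theorem CoreIdent.anchor_eq (κ : CoreIdent Γ C) (x : M) (a : C.fiber x) :
    κ.anchor x a = Γ.tg (Hom.one 𝒢 x) (κ.cor x a) :=
  E.pt_inj.1 ((E.pt_fiberAt _ _).trans (Γ.tgt_pt (Hom.one 𝒢 x) (κ.cor x a)))

theorem HorLift.mulCore_R (h : HorLift Γ) (κ : CoreIdent Γ C) (g : G) (a : C.fiber (𝒢.src g)) :
    Γ.R (Hom.mk' 𝒢 g) (Hom.one 𝒢 _) (Hom.mk' 𝒢 g)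
      (h.hl (Hom.mk' 𝒢 g) (Γ.tg (Hom.one 𝒢 _) (κ.cor _ a))) (κ.cor _ a) (h.mulCore κ g a) := by
  rw [← κ.anchor_eq]
  exact VBGroupoid.R_mulAt (g := Hom.mk' 𝒢 g) (k := Hom.one 𝒢 _) (l := Hom.mk' 𝒢 g) _ _

theorem HorLift.mulHor_R (h : HorLift Γ) (g k : G) (w : 𝒢.src g = 𝒢.tgt k)
    (e : E.fiber (𝒢.src k)) :
    Γ.R ⟨g, w, rfl⟩ (Hom.mk' 𝒢 k) (Hom.comp ⟨g, w, rfl⟩ (Hom.mk' 𝒢 k))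
      (h.hl ⟨g, w, rfl⟩ (Γ.tg (Hom.mk' 𝒢 k) (h.hl (Hom.mk' 𝒢 k) e))) (h.hl (Hom.mk' 𝒢 k) e)
      (h.mulHor g k w e) := by
  have h1 : h.hl ⟨g, w, rfl⟩ (Γ.tg (Hom.mk' 𝒢 k) (h.hl (Hom.mk' 𝒢 k) e)) =
      h.lift g (E.fiberAt (E.pt _ (h.sideAct k e)) w.symm) :=
    congrArg (h.lift g) (E.fiberAt_pt _ _).symm
  rw [h1]
  exact VBGroupoid.R_mulAt (g := ⟨g, w, rfl⟩) (k := Hom.mk' 𝒢 k)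
    (l := Hom.comp ⟨g, w, rfl⟩ (Hom.mk' 𝒢 k)) _ _

theorem HorLift.liftMul_eq (h : HorLift Γ) (g k : G) (w : 𝒢.src g = 𝒢.tgt k)
    (e : E.fiber (𝒢.src k)) :
    h.liftMul g k w e = h.hl (Hom.comp ⟨g, w, rfl⟩ (Hom.mk' 𝒢 k)) e :=
  congrArg (h.lift _) (E.fiberAt_pt _ _)

variable [FiniteDimensional ℝ EG] [T2Space G] [IsManifold I ∞ G]

theorem CoreIdent.mulZero_eq (κ : CoreIdent Γ C) {x y : M} (k : 𝒢.Hom x y) (a : C.fiber y) :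
    κ.mulZero k.val (C.tr k.tgt_val.symm a) = κ.Z k a := by
  obtain ⟨k, rfl, rfl⟩ := k
  have h1 : Γ.R (Hom.one 𝒢 _) (Hom.mk' 𝒢 k) (Hom.mk' 𝒢 k) (κ.cor _ a) 0 (κ.mulZero k a) :=
    VBGroupoid.R_mulAt (g := Hom.one 𝒢 _) (k := Hom.mk' 𝒢 k) (l := Hom.mk' 𝒢 k) _ _
  exact h1.unique (κ.R_Z _ a)

variable [FiniteDimensional ℝ EM] [T2Space M] [IsManifold J ∞ M]

/-- `IsInduced` speaks of sections and their values, `IsCompOf` of individual vectors. The two agree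
because every vector is the value of a section; the rest is a change between a product with 0_g and
the map `Z`. -/
theorem isInduced_iff {κ : CoreIdent Γ C} {h : HorLift Γ} {D : RepHtpy 𝒢 E C} {c : Comp 𝒢 E C}
    (hD : D.op = c.op) : IsInduced κ h D ↔ IsCompOf κ h c := by
  constructor
  · intro H
    have h0 : ∀ (x : M) (a : C.fiber x), c.an.f0 x a = Γ.tg (Hom.one 𝒢 x) (κ.cor x a) := by
      intro x a
      obtain ⟨α, rfl⟩ := exists_section_eq (𝒢 := 𝒢) x a
      have := H.core_anchor α x
      rw [hD, c.atPoint_op_inC, κ.anchor_eq] at this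
      exact this
    have h1 : ∀ {x y : M} (g : 𝒢.Hom x y) (e : E.fiber x), c.dE.f1 g e = Γ.tg g (h.hl g e) := by
      rintro _ _ ⟨g, rfl, rfl⟩ e
      obtain ⟨ε, rfl⟩ := exists_section_eq (𝒢 := 𝒢) _ e
      have := H.side_act ε g
      rw [hD, c.atEdge_op_inE] at this
      exact this
    refine ⟨h0, h1, ?_, ?_⟩
    · rintro _ _ ⟨g, rfl, rfl⟩ a
      obtain ⟨α, rfl⟩ := exists_section_eq (𝒢 := 𝒢) _ a
      have := H.core_act α g
      rw [hD, c.atEdge_op_inC] at this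
      rw [h0]
      have h2 := h.mulCore_R κ g (atPoint α (𝒢.src g))
      rw [← this] at h2
      exact h2.congr (κ.mulZero_eq (Hom.mk' 𝒢 g) (c.dC.f1 (Hom.mk' 𝒢 g) (atPoint α (𝒢.src g))))
    · rintro _ _ _ ⟨g, w, rfl⟩ ⟨k, rfl, rfl⟩ e
      obtain ⟨ε, rfl⟩ := exists_section_eq (𝒢 := 𝒢) _ e
      have := H.omega ε g k w
      rw [hD, c.atPair_op_inE] at this
      have h3 := κ.mulZero_eq (Hom.comp ⟨g, w, rfl⟩ (Hom.mk' 𝒢 k))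
        (c.om.f2 ⟨g, w, rfl⟩ (Hom.mk' 𝒢 k) (atPoint ε (𝒢.src k)))
      have h4 := h3.symm.trans this
      rw [h.liftMul_eq] at h4
      have h2 := h.mulHor_R g k w (atPoint ε (𝒢.src k))
      rw [h1]
      refine h2.congr ?_
      exact (sub_sub_cancel _ _).symm.trans (congrArg (fun t => h.hl _ _ - t) h4.symm)
  · intro H
    refine ⟨fun α x => ?_, fun α g => ?_, fun ε g => ?_, fun ε g k w => ?_⟩
    · rw [hD, c.atPoint_op_inC, κ.anchor_eq, H.an]
    · rw [hD, c.atEdge_op_inC]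
      refine (κ.mulZero_eq (Hom.mk' 𝒢 g) _).trans (VBGroupoid.R.unique ?_ (h.mulCore_R κ g _))
      rw [← H.an]
      exact H.dC (Hom.mk' 𝒢 g) _
    · rw [hD, c.atEdge_op_inE, H.dE]
      rfl
    · rw [hD, c.atPair_op_inE]
      refine (κ.mulZero_eq (Hom.comp ⟨g, w, rfl⟩ (Hom.mk' 𝒢 k)) _).trans ?_
      rw [h.liftMul_eq]
      have h1 := H.om ⟨g, w, rfl⟩ (Hom.mk' 𝒢 k) (atPoint ε (𝒢.src k))
      rw [H.dE] at h1
      have h2 := h1.unique (h.mulHor_R g k w _)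
      exact (sub_sub_cancel _ _).symm.trans (congrArg (fun t => h.hl _ _ - t) h2)

theorem RepHtpy.ext_op {D D' : RepHtpy 𝒢 E C} (h : D.op = D'.op) : D = D' := by
  cases D; cases D'; congr

variable [SigmaCompactSpace M]

theorem IsCompOf.isInduced_iff {κ : CoreIdent Γ C} {h : HorLift Γ} {D : RepHtpy 𝒢 E C}
    {c : Comp 𝒢 E C} (H : IsCompOf κ h c) : IsInduced κ h D ↔ D.op = c.op := by
  refine ⟨fun hi => ?_, fun hD => (VBG.isInduced_iff hD).2 H⟩
  obtain ⟨c', -, hc'⟩ := D.exists_comp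
  rw [hc', H.unique ((VBG.isInduced_iff hc').1 hi)]

/-- The components of the lift are flat, which gives existence. For uniqueness, any induced D has
components, and the lift determines them because `Z` is injective. -/
theorem existsUnique_isInduced (κ : CoreIdent Γ C) (h : HorLift Γ) :
    ∃! D : RepHtpy 𝒢 E C, IsInduced κ h D := by
  obtain ⟨c, hc⟩ := exists_isCompOf κ h
  exact ⟨c.rep hc.flat, hc.isInduced_iff.2 rfl,
    fun D hD => RepHtpy.ext_op (hc.isInduced_iff.1 hD)⟩

end Induced

end

end VBG

namespace VBG

noncomputable section

open Filter Topology

open LieGroupoid (Hom)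

/-! ### From isomorphisms of `VB`-groupoids to isomorphisms of components -/

section Isomorphisms

variable {EG HG EM HM : Type*} [NormedAddCommGroup EG] [NormedSpace ℝ EG] [TopologicalSpace HG]
  [NormedAddCommGroup EM] [NormedSpace ℝ EM] [TopologicalSpace HM]
  {I : ModelWithCorners ℝ EG HG} {G : Type*} [TopologicalSpace G] [ChartedSpace HG G]
  {J : ModelWithCorners ℝ EM HM} {M : Type*} [TopologicalSpace M] [ChartedSpace HM M]

theorem exists_linearMap_lift {U V W : Type*} [AddCommGroup U] [Module ℝ U] [AddCommGroup V]
    [Module ℝ V] [AddCommGroup W] [Module ℝ W] {Z : U →ₗ[ℝ] W} (hZ : Function.Injective Z)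
    (f : V →ₗ[ℝ] W) (h : ∀ v, ∃ u, Z u = f v) : ∃ L : V →ₗ[ℝ] U, ∀ v, Z (L v) = f v := by
  choose L hL using h
  refine ⟨⟨⟨L, fun v w => hZ ?_⟩, fun s v => hZ ?_⟩, hL⟩
  · rw [map_add, hL, hL, hL, map_add]
  · rw [RingHom.id_apply, map_smul, hL, hL, map_smul]

/-- A fibrewise bijective smooth bundle map is an isomorphism. -/
def VecBunIso.ofSmooth [FiniteDimensional ℝ EM] [T2Space M] [IsManifold J ∞ M] {A A' : VecBun.{v} J M}
    (equiv : ∀ x, A.fiber x ≃ₗ[ℝ] A'.fiber x)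
    (h : ContMDiff A.tModel A'.tModel ∞ (fun a : A.Tot => A'.pt a.proj (equiv a.proj a.snd))) :
    VecBunIso A A' where
  equiv := equiv
  smooth_toFun := h
  smooth_invFun := fun a₀ => by
    have hp : ContMDiff A'.tModel J ∞ (fun a : A'.Tot => a.proj) := Bundle.contMDiff_proj A'.fiber
    -- The fibrewise isomorphisms reflect smoothness, and they take the inverse family to the
    -- identity family.
    refine A.smoothAt_of_injective A' (x := fun a : A'.Tot => a.proj) (y := fun a => a.proj)
      (fun a => (equiv a.proj).toLinearMap) (equiv a₀.proj).injective
      (fun s hs => (h.comp (hs.comp hp)).contMDiffAt) hp.contMDiffAt ?_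
    refine contMDiffAt_id.congr_of_eventuallyEq (Eventually.of_forall fun a => ?_)
    exact congrArg (A'.pt a.proj) ((equiv a.proj).apply_symm_apply a.snd)

variable {𝒢 : LieGroupoid I G J M} {E E' C C' : VecBun.{v} J M} {Γ : VBGroupoid 𝒢 E}
  {Γ' : VBGroupoid 𝒢 E'}

namespace VBGroupoidIso

variable (Φ : VBGroupoidIso Γ Γ')

/-- The map between the fibres over an arrow. -/
def fib {x y : M} (g : 𝒢.Hom x y) : Γ.bun.fiber g.val ≃ₗ[ℝ] Γ'.bun.fiber g.val :=
  Φ.top.equiv g.val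

theorem sr_fib {x y : M} (g : 𝒢.Hom x y) (b : Γ.bun.fiber g.val) :
    Γ'.sr g (Φ.fib g b) = Φ.side.equiv x (Γ.sr g b) := by
  have h := Φ.map_src (Γ.bun.pt g.val b)
  rw [Γ.src_pt] at h
  exact E'.pt_inj.1 ((Γ'.src_pt g (Φ.fib g b)).symm.trans h)

theorem tg_fib {x y : M} (g : 𝒢.Hom x y) (b : Γ.bun.fiber g.val) :
    Γ'.tg g (Φ.fib g b) = Φ.side.equiv y (Γ.tg g b) := by
  have h := Φ.map_tgt (Γ.bun.pt g.val b)
  rw [Γ.tgt_pt] at h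
  exact E'.pt_inj.1 ((Γ'.tgt_pt g (Φ.fib g b)).symm.trans h)

theorem R_fib {x y z : M} {g : 𝒢.Hom y z} {k : 𝒢.Hom x y} {l : 𝒢.Hom x z}
    {a : Γ.bun.fiber g.val} {b : Γ.bun.fiber k.val} {d : Γ.bun.fiber l.val} (r : Γ.R g k l a b d) :
    Γ'.R g k l (Φ.fib g a) (Φ.fib k b) (Φ.fib l d) := by
  obtain ⟨w, hw⟩ := r
  have w' : Γ'.gpd.src (Φ.top.total (Γ.bun.pt g.val a)) =
      Γ'.gpd.tgt (Φ.top.total (Γ.bun.pt k.val b)) := by rw [Φ.map_src, Φ.map_tgt, w]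
  exact ⟨w', (Φ.map_mul _ _ w w').symm.trans (congrArg Φ.top.total hw)⟩

end VBGroupoidIso

variable [FiniteDimensional ℝ EG] [T2Space G] [IsManifold I ∞ G]
  [FiniteDimensional ℝ EM] [T2Space M] [IsManifold J ∞ M]

/-- An isomorphism intertwines the source maps, and is injective on the side bundle, so it
identifies the kernels over the units. -/
theorem VBGroupoidIso.exists_core [J.Boundaryless] (Φ : VBGroupoidIso Γ Γ') (κ : CoreIdent Γ C)
    (κ' : CoreIdent Γ' C') :
    ∃ ψ : VecBunIso C C', ∀ x a, κ'.cor x (ψ.equiv x a) = Φ.fib (Hom.one 𝒢 x) (κ.cor x a) := by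
  have h1 : ∀ x, ∃ L : C.fiber x →ₗ[ℝ] C'.fiber x,
      ∀ a, κ'.cor x (L a) = Φ.fib (Hom.one 𝒢 x) (κ.cor x a) := fun x =>
    exists_linearMap_lift (κ'.injective x) ((Φ.fib (Hom.one 𝒢 x)).toLinearMap ∘ₗ κ.cor x) fun a =>
      κ'.exists_cor (by
        refine (Φ.sr_fib _ _).trans ?_
        rw [κ.sr_cor, map_zero])
  choose L hL using h1
  have hbij : ∀ x, Function.Bijective (L x) := by
    refine fun x => ⟨fun a b hab => κ.injective x ?_, fun a' => ?_⟩
    · have := congrArg (κ'.cor x) hab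
      rw [hL, hL] at this
      exact (Φ.fib _).injective this
    · have h2 := Φ.sr_fib (Hom.one 𝒢 x) ((Φ.fib (Hom.one 𝒢 x)).symm (κ'.cor x a'))
      rw [LinearEquiv.apply_symm_apply, κ'.sr_cor] at h2
      obtain ⟨a, ha⟩ := κ.exists_cor ((Φ.side.equiv x).map_eq_zero_iff.1 h2.symm)
      refine ⟨a, κ'.injective x ?_⟩
      have h3 := hL x a
      rw [ha, LinearEquiv.apply_symm_apply] at h3
      exact h3
  refine ⟨VecBunIso.ofSmooth (fun x => LinearEquiv.ofBijective (L x) (hbij x))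
    (contMDiff_of_plots fun k u hu => ?_), hL⟩
  have hp : ContMDiff (𝓡 k) J ∞ (fun z => (u z).proj) := (Bundle.contMDiff_proj C.fiber).comp hu
  refine κ'.smooth_of_Z (g := fun z => Hom.one 𝒢 (u z).proj) (𝒢.smooth_one.comp hp) ?_
  refine (Φ.top.smooth_toFun.comp (κ.smooth_cor (a := fun z => (u z).snd) hu)).congr fun z => ?_
  refine congrArg (Γ'.bun.pt _) ?_
  rw [κ'.Z_one]
  exact hL _ _

/-- The difference of Φ(h_g(e)) and h'_g(Φ(e)) has source zero, so it is `Z` of an element τ_g(e) of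
C'. The equations follow when Φ is applied to the relations that define the components of h and the
result is compared with the product formula for h'. -/
theorem VBGroupoidIso.exists_compIso [J.Boundaryless] (Φ : VBGroupoidIso Γ Γ') {κ : CoreIdent Γ C}
    {κ' : CoreIdent Γ' C'} {h : HorLift Γ} {h' : HorLift Γ'} {c : Comp 𝒢 E C} {c' : Comp 𝒢 E' C'}
    (H : IsCompOf κ h c) (H' : IsCompOf κ' h' c') :
    ∃ i : CompIso c c', i.side = Φ.side ∧
      ∀ x a, κ'.cor x (i.core.equiv x a) = Φ.fib (Hom.one 𝒢 x) (κ.cor x a) := by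
  obtain ⟨ψ, hψ⟩ := Φ.exists_core κ κ'
  have h1 : ∀ {x y : M} (g : 𝒢.Hom x y), ∃ L : E.fiber x →ₗ[ℝ] C'.fiber y,
      ∀ e, κ'.Z g (L e) = Φ.fib g (h.hl g e) - h'.hl g (Φ.side.equiv x e) := fun {x y} g =>
    exists_linearMap_lift (κ'.Z_injective g) ((Φ.fib g).toLinearMap ∘ₗ h.hl g -
      h'.hl g ∘ₗ (Φ.side.equiv x).toLinearMap) fun e => κ'.exists_Z g (by
        change Γ'.sr g (Φ.fib g (h.hl g e) - h'.hl g (Φ.side.equiv x e)) = 0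
        rw [map_sub, Φ.sr_fib, h.sr_hl, h'.sr_hl, sub_self])
  choose T hT using @h1
  have hT' : ∀ {x y : M} (g : 𝒢.Hom x y) (e : E.fiber x),
      Φ.fib g (h.hl g e) = κ'.Z g (T g e) + h'.hl g (Φ.side.equiv x e) := fun g e => by
    rw [hT, sub_add_cancel]
  have hZ : ∀ {x y : M} (g : 𝒢.Hom x y) (a : C.fiber y),
      Φ.fib g (κ.Z g a) = κ'.Z g (ψ.equiv y a) := fun {x y} g a => by
    have r := Φ.R_fib (κ.R_Z g a)
    rw [map_zero, ← hψ] at r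
    exact r.unique (κ'.R_Z g _)
  have han : ∀ (x : M) (a : C.fiber x),
      Φ.side.equiv x (c.an.f0 x a) = c'.an.f0 x (ψ.equiv x a) := fun x a => by
    rw [H.an, H'.an, hψ, Φ.tg_fib]
  have hdE : ∀ {x y : M} (g : 𝒢.Hom x y) (e : E.fiber x), Φ.side.equiv y (c.dE.f1 g e) =
      c'.dE.f1 g (Φ.side.equiv x e) + c'.an.f0 y (T g e) := fun g e => by
    rw [H.dE, ← Φ.tg_fib, hT', H'.tg_split, add_comm]
  refine ⟨{ side := Φ.side
            core := ψ
            tau := Fam.mk1 𝒢 T fun {n x y g e} hg he => ?_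
            tau_one := fun x e => ?_
            an := han
            dE := hdE
            dC := fun {x y} g a => ?_
            om := fun {x y z} g k e => ?_ }, rfl, hψ⟩
  · refine κ'.smooth_of_Z hg ?_
    have h2 := Φ.top.smooth_toFun.comp (h.smooth_hl hg he)
    have h3 := h'.smooth_hl hg (Φ.side.smooth_toFun.comp he)
    intro t
    have := Γ'.bun.smoothAt_sub (h2 t) (h3 t)
    refine this.congr_of_eventuallyEq (Eventually.of_forall fun s => ?_)
    exact congrArg (Γ'.bun.pt _) (hT _ _)
  -- Φ maps idempotents to idempotents, hence units to units, and both lifts restrict to the unit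
  -- map; so τ vanishes at units.
  · refine (κ'.Z_inj (Hom.one 𝒢 x)).1 ((hT _ _).trans ?_)
    have r := Φ.R_fib (VBGroupoid.R_un_left (Hom.one 𝒢 x) (Γ.un x e))
    rw [VBGroupoid.tg_un] at r
    rw [map_zero, h.hl_one, h'.hl_one, VBGroupoid.eq_unFun_of_R_self r, Φ.sr_fib, VBGroupoid.sr_un]
    exact sub_self _
  · have r := Φ.R_fib (H.dC g a)
    rw [hT', hZ, ← hψ, han] at r
    have r1 := (VBGroupoid.R_zero_right g (κ'.sr_Z g (T g (c.an.f0 x a)))).add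
      (H'.dC g (ψ.equiv x a))
    rw [zero_add, ← map_add] at r1
    rw [add_comm]
    exact (κ'.Z_inj g).1 (r.unique r1)
  -- The image under Φ of h_g(Δ^E_k e) · h_k(e) is computed in two ways, and the core coordinates
  -- are compared.
  · have r := Φ.R_fib (H.om g k e)
    rw [hT', hT', hdE, map_sub, hT', hZ] at r
    have r1 := H'.prod g k (T g (c.dE.f1 k e)) (T k e) (Φ.side.equiv x e)
    rw [add_comm (c'.an.f0 y _)] at r1
    have r2 := r.unique r1
    rw [add_sub_right_comm, ← map_sub] at r2
    have r3 := (κ'.split_inj h' r2).1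
    change T g (c.dE.f1 k e) + ψ.equiv z (c.om.f2 g k e) = c'.om.f2 g k (Φ.side.equiv x e) -
      c'.dC.f1 g (T k e) + T (g.comp k) e
    rw [sub_eq_iff_eq_add.1 r3]
    abel

end Isomorphisms

end

end VBG

namespace VBG

noncomputable section

open Filter Topology

open LieGroupoid (Hom)

/-! ### From isomorphisms of components to isomorphisms of `VB`-groupoids -/

section Isomorphisms

variable {EG HG EM HM : Type*} [NormedAddCommGroup EG] [NormedSpace ℝ EG] [TopologicalSpace HG]
  [NormedAddCommGroup EM] [NormedSpace ℝ EM] [TopologicalSpace HM]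
  {I : ModelWithCorners ℝ EG HG} {G : Type*} [TopologicalSpace G] [ChartedSpace HG G]
  {J : ModelWithCorners ℝ EM HM} {M : Type*} [TopologicalSpace M] [ChartedSpace HM M]
  {𝒢 : LieGroupoid I G J M} {E E' C C' : VecBun.{v} J M} {Γ : VBGroupoid 𝒢 E}
  {Γ' : VBGroupoid 𝒢 E'}
  [FiniteDimensional ℝ EG] [T2Space G] [IsManifold I ∞ G]
  [FiniteDimensional ℝ EM] [T2Space M] [IsManifold J ∞ M]

theorem CoreIdent.exists_coord (κ : CoreIdent Γ C) (h : HorLift Γ) {x y : M} (g : 𝒢.Hom x y) :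
    ∃ L : Γ.bun.fiber g.val →ₗ[ℝ] C.fiber y, ∀ b, κ.Z g (L b) = b - h.hl g (Γ.sr g b) :=
  exists_linearMap_lift (κ.Z_injective g) (LinearMap.id - h.hl g ∘ₗ Γ.sr g) fun b =>
    κ.exists_Z g (by
      change Γ.sr g (b - h.hl g (Γ.sr g b)) = 0
      rw [map_sub, h.sr_hl, sub_self])

theorem CoreIdent.smooth_coord (κ : CoreIdent Γ C) (h : HorLift Γ) {n : ℕ}
    {x y : EuclideanSpace ℝ (Fin n) → M} {g : ∀ t, 𝒢.Hom (x t) (y t)}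
    {b : ∀ t, Γ.bun.fiber (g t).val} {a : ∀ t, C.fiber (y t)}
    (ha : ∀ t, κ.Z (g t) (a t) = b t - h.hl (g t) (Γ.sr (g t) (b t)))
    (hb : ContMDiff (𝓡 n) Γ.bun.tModel ∞ (fun t => Γ.bun.pt (g t).val (b t))) :
    ContMDiff (𝓡 n) C.tModel ∞ (fun t => C.pt (y t) (a t)) := by
  have hg : ContMDiff (𝓡 n) I ∞ (fun t => (g t).val) := (Bundle.contMDiff_proj Γ.bun.fiber).comp hb
  refine κ.smooth_of_Z hg ?_
  have h2 := h.smooth_hl hg (VBGroupoid.smooth_sr hb)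
  intro t
  refine (Γ.bun.smoothAt_sub (hb t) (h2 t)).congr_of_eventuallyEq (Eventually.of_forall fun s => ?_)
  exact congrArg (Γ.bun.pt _) (ha _)

/-- In the two splittings the map is triangular, with the isomorphisms of C and E on the diagonal
and τ off the diagonal, so it is bijective. -/
theorem CompIso.exists_fib {c : Comp 𝒢 E C} {c' : Comp 𝒢 E' C'} (i : CompIso c c')
    (κ : CoreIdent Γ C) (κ' : CoreIdent Γ' C') (h : HorLift Γ) (h' : HorLift Γ') {x y : M}
    (g : 𝒢.Hom x y) : ∃ φ : Γ.bun.fiber g.val ≃ₗ[ℝ] Γ'.bun.fiber g.val, ∀ a e,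
      φ (κ.Z g a + h.hl g e) =
        κ'.Z g (i.core.equiv y a + i.tau.f1 g e) + h'.hl g (i.side.equiv x e) := by
  obtain ⟨L, hL⟩ := κ.exists_coord h g
  have hL' : ∀ a e, L (κ.Z g a + h.hl g e) = a := fun a e => (κ.Z_injective g) (by
    rw [hL, map_add, κ.sr_Z, h.sr_hl, zero_add, add_sub_cancel_right])
  let φ : Γ.bun.fiber g.val →ₗ[ℝ] Γ'.bun.fiber g.val :=
    κ'.Z g ∘ₗ ((i.core.equiv y).toLinearMap ∘ₗ L + i.tau.f1 g ∘ₗ Γ.sr g) +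
      h'.hl g ∘ₗ (i.side.equiv x).toLinearMap ∘ₗ Γ.sr g
  have hφ : ∀ a e, φ (κ.Z g a + h.hl g e) =
      κ'.Z g (i.core.equiv y a + i.tau.f1 g e) + h'.hl g (i.side.equiv x e) := fun a e => by
    have hs : Γ.sr g (κ.Z g a + h.hl g e) = e := by rw [map_add, κ.sr_Z, h.sr_hl, zero_add]
    change κ'.Z g (i.core.equiv y (L _) + i.tau.f1 g (Γ.sr g _)) +
      h'.hl g (i.side.equiv x (Γ.sr g _)) = _
    rw [hL', hs]
  have hbij : Function.Bijective φ := by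
    refine ⟨fun b b' hb => ?_, fun b => ?_⟩
    · obtain ⟨a, ha⟩ := κ.exists_split h g b
      obtain ⟨a', ha'⟩ := κ.exists_split h g b'
      rw [ha, ha', hφ, hφ] at hb
      obtain ⟨h1, h2⟩ := κ'.split_inj h' hb
      have h3 := (i.side.equiv x).injective h2
      rw [h3] at h1
      have h4 := (i.core.equiv y).injective (add_right_cancel h1)
      rw [ha, ha', h3, h4]
    · obtain ⟨a, ha⟩ := κ'.exists_split h' g b
      refine ⟨κ.Z g ((i.core.equiv y).symm (a - i.tau.f1 g ((i.side.equiv x).symm (Γ'.sr g b)))) +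
        h.hl g ((i.side.equiv x).symm (Γ'.sr g b)), ?_⟩
      rw [hφ, LinearEquiv.apply_symm_apply, LinearEquiv.apply_symm_apply, sub_add_cancel, ← ha]
  exact ⟨LinearEquiv.ofBijective φ hbij, hφ⟩

/-- The fibrewise maps prescribed by `exists_fib` respect sources by construction. The equations
`an` and `dE` say that they respect targets; for products `dC` and `om` are needed as well. -/
theorem CompIso.exists_vbGroupoidIso [I.Boundaryless] {c : Comp 𝒢 E C} {c' : Comp 𝒢 E' C'}
    (i : CompIso c c') {κ : CoreIdent Γ C} {κ' : CoreIdent Γ' C'} {h : HorLift Γ} {h' : HorLift Γ'}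
    (H : IsCompOf κ h c) (H' : IsCompOf κ' h' c') :
    ∃ Φ : VBGroupoidIso Γ Γ', Φ.side = i.side ∧
      ∀ x a, κ'.cor x (i.core.equiv x a) = Φ.fib (Hom.one 𝒢 x) (κ.cor x a) := by
  have h1 := fun g => i.exists_fib κ κ' h h' (Hom.mk' 𝒢 g)
  choose φ hφ₀ using h1
  have hφ : ∀ {x y : M} (g : 𝒢.Hom x y) a e, φ g.val (κ.Z g a + h.hl g e) =
      κ'.Z g (i.core.equiv y a + i.tau.f1 g e) + h'.hl g (i.side.equiv x e) := by
    rintro _ _ ⟨g, rfl, rfl⟩ a e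
    exact hφ₀ g a e
  have hsr : ∀ {x y : M} (g : 𝒢.Hom x y) (b : Γ.bun.fiber g.val),
      Γ'.sr g (φ g.val b) = i.side.equiv x (Γ.sr g b) := fun g b => by
    obtain ⟨a, ha⟩ := κ.exists_split h g b
    generalize Γ.sr g b = e at ha
    rw [ha, hφ, map_add, κ'.sr_Z, h'.sr_hl, zero_add]
  have htg : ∀ {x y : M} (g : 𝒢.Hom x y) (b : Γ.bun.fiber g.val),
      Γ'.tg g (φ g.val b) = i.side.equiv y (Γ.tg g b) := fun g b => by
    obtain ⟨a, ha⟩ := κ.exists_split h g b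
    generalize Γ.sr g b = e at ha
    subst ha
    rw [hφ, H'.tg_split, H.tg_split, map_add, map_add, i.an, i.dE]
    abel
  have hR : ∀ {x y z : M} (g : 𝒢.Hom y z) (k : 𝒢.Hom x y) (a : Γ.bun.fiber g.val)
      (b : Γ.bun.fiber k.val) (d : Γ.bun.fiber (g.comp k).val), Γ.R g k (g.comp k) a b d →
      Γ'.R g k (g.comp k) (φ _ a) (φ _ b) (φ _ d) := fun {x y z} g k a b d r => by
    obtain ⟨a₁, ha⟩ := κ.exists_split h g a
    obtain ⟨a₂, hb⟩ := κ.exists_split h k b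
    have h2 := r.sr_eq_tg
    generalize Γ.sr k b = e at hb
    subst hb
    rw [h2, H.tg_split] at ha
    subst ha
    have h3 := r.unique (H.prod g k a₁ a₂ e)
    subst h3
    rw [hφ, hφ]
    have h4 := H'.prod g k (i.core.equiv z a₁ + i.tau.f1 g (c.an.f0 y a₂ + c.dE.f1 k e))
      (i.core.equiv y a₂ + i.tau.f1 k e) (i.side.equiv x e)
    have h5 : i.side.equiv y (c.an.f0 y a₂ + c.dE.f1 k e) =
        c'.an.f0 y (i.core.equiv y a₂ + i.tau.f1 k e) + c'.dE.f1 k (i.side.equiv x e) := by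
      rw [map_add, map_add, i.an, i.dE]; abel
    rw [h5]
    refine (h4.congr (congrArg (fun t => κ'.Z _ t + _) ?_)).congr (hφ (g.comp k) _ _).symm
    -- The second factors of the splittings agree; the core coordinates of the two products agree by
    -- `dC` and `om`.
    have h6 := eq_sub_of_add_eq' (i.om g k e)
    rw [map_sub, map_add, map_add, map_add, i.dC, h6]
    abel
  have hsm : ContMDiff Γ.bun.tModel Γ'.bun.tModel ∞
      (fun b : Γ.bun.Tot => Γ'.bun.pt b.proj (φ b.proj b.snd)) := by
    refine contMDiff_of_plots fun n u hu => ?_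
    have hg : ContMDiff (𝓡 n) I ∞ (fun t => (u t).proj) := (Bundle.contMDiff_proj Γ.bun.fiber).comp hu
    choose L hL using fun g => κ.exists_coord h (Hom.mk' 𝒢 g)
    -- Along a plot, both coordinates of the splitting are smooth, and the map is assembled from
    -- them by smooth families.
    have h2 := κ.smooth_coord h (g := fun t => Hom.mk' 𝒢 (u t).proj) (b := fun t => (u t).snd)
      (fun t => hL (u t).proj (u t).snd) hu
    have h3 := VBGroupoid.smooth_sr (Γ := Γ) (g := fun t => Hom.mk' 𝒢 (u t).proj)
      (a := fun t => (u t).snd) hu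
    have h4 := i.tau.smooth n (fun t => Nerve.ofHom (Hom.mk' 𝒢 (u t).proj)) _
      (Nerve.smoothMap_ofHom hg) h3
    have h5 := κ'.smooth_Z (g := fun t => Hom.mk' 𝒢 (u t).proj) hg
      (fun t => C'.smoothAt_add ((i.core.smooth_toFun.comp h2) t) (h4 t))
    have h6 := h'.smooth_hl (g := fun t => Hom.mk' 𝒢 (u t).proj) hg (i.side.smooth_toFun.comp h3)
    intro t
    refine (Γ'.bun.smoothAt_add (h5 t) (h6 t)).congr_of_eventuallyEq
      (Eventually.of_forall fun s => ?_)
    refine congrArg (Γ'.bun.pt _) ?_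
    have h7 := hφ (Hom.mk' 𝒢 (u s).proj) (L _ (u s).snd) (Γ.sr (Hom.mk' 𝒢 (u s).proj) (u s).snd)
    exact (congrArg (φ _) (sub_eq_iff_eq_add.1 (hL _ (u s).snd).symm)).trans h7
  refine ⟨{ top := VecBunIso.ofSmooth φ hsm
            side := i.side
            map_src := fun γ => ?_
            map_tgt := fun γ => ?_
            map_mul := fun γ₁ γ₂ w w' => ?_ }, rfl, fun x a => ?_⟩
  · refine (Γ'.src_pt (Hom.mk' 𝒢 γ.proj) (φ _ γ.snd)).trans ?_
    rw [show Γ.gpd.src γ = _ from Γ.src_pt (Hom.mk' 𝒢 γ.proj) γ.snd]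
    exact congrArg (E'.pt _) (hsr (Hom.mk' 𝒢 γ.proj) γ.snd)
  · refine (Γ'.tgt_pt (Hom.mk' 𝒢 γ.proj) (φ _ γ.snd)).trans ?_
    rw [show Γ.gpd.tgt γ = _ from Γ.tgt_pt (Hom.mk' 𝒢 γ.proj) γ.snd]
    exact congrArg (E'.pt _) (htg (Hom.mk' 𝒢 γ.proj) γ.snd)
  · obtain ⟨g, a⟩ := γ₁
    obtain ⟨k, b⟩ := γ₂
    have w₀ : 𝒢.src g = 𝒢.tgt k := Γ.base_comp w
    have r := VBGroupoid.R_mulAt (Γ := Γ) (g := ⟨g, w₀, rfl⟩) (k := Hom.mk' 𝒢 k)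
      (l := Hom.comp ⟨g, w₀, rfl⟩ (Hom.mk' 𝒢 k)) w rfl
    obtain ⟨w₁, h2⟩ := hR _ _ _ _ _ r
    obtain ⟨w₂, h3⟩ := r
    refine Eq.trans ?_ h2.symm
    exact congrArg (VecBunIso.total (VecBunIso.ofSmooth φ hsm)) h3
  · have h2 := hφ (Hom.one 𝒢 x) a 0
    rw [map_zero, map_zero, map_zero, map_zero, add_zero, add_zero, add_zero, κ.Z_one, κ'.Z_one] at h2
    exact h2.symm

theorem nonempty_vbGroupoidIso_iff [I.Boundaryless] [J.Boundaryless] {c : Comp 𝒢 E C}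
    {c' : Comp 𝒢 E' C'} {κ : CoreIdent Γ C} {κ' : CoreIdent Γ' C'} {h : HorLift Γ} {h' : HorLift Γ'}
    (H : IsCompOf κ h c) (H' : IsCompOf κ' h' c') :
    Nonempty (VBGroupoidIso Γ Γ') ↔ Nonempty (CompIso c c') :=
  ⟨fun ⟨Φ⟩ => ⟨(Φ.exists_compIso H H').choose⟩, fun ⟨i⟩ => ⟨(i.exists_vbGroupoidIso H H').choose⟩⟩

theorem framed_iff [I.Boundaryless] [J.Boundaryless] {c c' : Comp 𝒢 E C}
    {Γ Γ' : FramedVBGroupoid 𝒢 E C} {h : HorLift Γ.vb} {h' : HorLift Γ'.vb}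
    (H : IsCompOf Γ.core h c) (H' : IsCompOf Γ'.core h' c') :
    (framedSetoid 𝒢 E C).r Γ Γ' ↔ ∃ i : CompIso c c', (∀ x e, i.side.equiv x e = e) ∧
      ∀ x a, i.core.equiv x a = a := by
  constructor
  · rintro ⟨Φ, hs, hc⟩
    obtain ⟨i, h1, h2⟩ := Φ.exists_compIso H H'
    refine ⟨i, fun x e => ?_, fun x a => ?_⟩
    · rw [h1]
      exact E.pt_inj.1 (hs (E.pt x e))
    · exact Γ'.core.injective x ((h2 x a).trans (Γ'.vb.bun.pt_inj.1 (hc x a)))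
  · rintro ⟨i, hs, hc⟩
    obtain ⟨Φ, h1, h2⟩ := i.exists_vbGroupoidIso H H'
    refine ⟨Φ, fun e => ?_, fun x a => ?_⟩
    · rw [h1]
      exact congrArg (E.pt e.proj) (hs _ _)
    · refine congrArg (Γ'.vb.bun.pt _) ((h2 x a).symm.trans ?_)
      rw [hc]
      rfl

end Isomorphisms

end

end VBG

namespace VBG

noncomputable section

open Filter Topology

open LieGroupoid (Hom)

/-! ### Pullbacks and direct sums of vector bundles -/

section Semidirect

variable {EG HG EM HM : Type*} [NormedAddCommGroup EG] [NormedSpace ℝ EG] [TopologicalSpace HG]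
  [NormedAddCommGroup EM] [NormedSpace ℝ EM] [TopologicalSpace HM]
  {I : ModelWithCorners ℝ EG HG} {G : Type*} [TopologicalSpace G] [ChartedSpace HG G]
  {J : ModelWithCorners ℝ EM HM} {M : Type*} [TopologicalSpace M] [ChartedSpace HM M]

/-- The pullback of a vector bundle. -/
def VecBun.pullback (A : VecBun.{v} J M) (f : C^∞⟮I, G; J, M⟯) : VecBun.{v} I G where
  model := A.model
  fiber := f *ᵖ A.fiber
  addCommGroup x := A.addCommGroup (f x)
  module x := A.module (f x)
  topFiber x := A.topFiber (f x)
  topTotal := Pullback.TotalSpace.topologicalSpace A.model A.fiber f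
  fiberBundle := FiberBundle.pullback f
  vectorBundle := VectorBundle.pullback (f := f) ..
  smooth := ContMDiffVectorBundle.pullback (f := f) ..

/-- The direct sum of two vector bundles. -/
def VecBun.prod (A B : VecBun.{v} J M) : VecBun.{v} J M where
  model := A.model × B.model
  fiber := A.fiber ×ᵇ B.fiber

variable {EN HN : Type*} [NormedAddCommGroup EN] [NormedSpace ℝ EN] [TopologicalSpace HN]
  {IN : ModelWithCorners ℝ EN HN} {N : Type*} [TopologicalSpace N] [ChartedSpace HN N]

/-- The trivializations of the pullback are those of A composed with f, so the fibre coordinates of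
the two families coincide. -/
theorem VecBun.smoothAt_pullback (A : VecBun.{v} J M) (f : C^∞⟮I, G; J, M⟯) {g : N → G}
    {a : ∀ z, A.fiber (f (g z))} {z : N} :
    ContMDiffAt IN (A.pullback f).tModel ∞ (fun z => (A.pullback f).pt (g z) (a z)) z ↔
      ContMDiffAt IN I ∞ g z ∧ ContMDiffAt IN A.tModel ∞ (fun z => A.pt (f (g z)) (a z)) z := by
  rw [Bundle.contMDiffAt_totalSpace, Bundle.contMDiffAt_totalSpace]
  constructor
  · rintro ⟨h1, h2⟩
    exact ⟨h1, f.contMDiff.contMDiffAt.comp z h1, h2⟩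
  · rintro ⟨h1, -, h2⟩
    exact ⟨h1, h2⟩

theorem VecBun.smoothAt_prod (A B : VecBun.{v} J M) {x : N → M} {a : ∀ z, A.fiber (x z)}
    {b : ∀ z, B.fiber (x z)} {z : N} :
    ContMDiffAt IN (A.prod B).tModel ∞ (fun z => (A.prod B).pt (x z) (a z, b z)) z ↔
      ContMDiffAt IN A.tModel ∞ (fun z => A.pt (x z) (a z)) z ∧
        ContMDiffAt IN B.tModel ∞ (fun z => B.pt (x z) (b z)) z := by
  rw [Bundle.contMDiffAt_totalSpace, Bundle.contMDiffAt_totalSpace, Bundle.contMDiffAt_totalSpace]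
  constructor
  · rintro ⟨h1, h2⟩
    exact ⟨⟨h1, (contDiff_fst.contMDiff (E := A.model × B.model)).contMDiffAt.comp z h2⟩,
      ⟨h1, (contDiff_snd.contMDiff (E := A.model × B.model)).contMDiffAt.comp z h2⟩⟩
  · rintro ⟨⟨h1, h2⟩, ⟨-, h3⟩⟩
    exact ⟨h1, h2.prodMk_space h3⟩

end Semidirect

end

end VBG

namespace VBG

noncomputable section

open Filter Topology

open LieGroupoid (Hom)

/-! ### The groupoid operations on t^*C ⊕ s^*E -/

section Semidirect

variable {EG HG EM HM : Type*} [NormedAddCommGroup EG] [NormedSpace ℝ EG] [TopologicalSpace HG]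
  [NormedAddCommGroup EM] [NormedSpace ℝ EM] [TopologicalSpace HM]
  {I : ModelWithCorners ℝ EG HG} {G : Type*} [TopologicalSpace G] [ChartedSpace HG G]
  {J : ModelWithCorners ℝ EM HM} {M : Type*} [TopologicalSpace M] [ChartedSpace HM M]
  {𝒢 : LieGroupoid I G J M} {E C : VecBun.{v} J M}

variable (𝒢 E C) in
/-- The vector bundle `t^*C ⊕ s^*E` over `G`. -/
def semiBun : VecBun.{v} I G :=
  (C.pullback ⟨𝒢.tgt, 𝒢.smooth_tgt⟩).prod (E.pullback ⟨𝒢.src, 𝒢.smooth_src⟩)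

/-- The point of `t^*C ⊕ s^*E` with the given components. -/
def semiFib {x y : M} (g : 𝒢.Hom x y) : C.fiber y × E.fiber x →ₗ[ℝ] (semiBun 𝒢 E C).fiber g.val :=
  LinearMap.prodMap (C.tr g.tgt_val.symm).toLinearMap (E.tr g.src_val.symm).toLinearMap

/-- The point of the total space of `t^*C ⊕ s^*E` with the given components. -/
def semiPt {x y : M} (g : 𝒢.Hom x y) (a : C.fiber y) (e : E.fiber x) : (semiBun 𝒢 E C).Tot :=
  (semiBun 𝒢 E C).pt g.val (semiFib g (a, e))

variable {EN HN : Type*} [NormedAddCommGroup EN] [NormedSpace ℝ EN] [TopologicalSpace HN]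
  {IN : ModelWithCorners ℝ EN HN} {N : Type*} [TopologicalSpace N] [ChartedSpace HN N]

theorem smoothAt_semiPt {x y : N → M} {g : ∀ t, 𝒢.Hom (x t) (y t)} {a : ∀ t, C.fiber (y t)}
    {e : ∀ t, E.fiber (x t)} {z : N} :
    ContMDiffAt IN (semiBun 𝒢 E C).tModel ∞ (fun t => semiPt (g t) (a t) (e t)) z ↔
      ContMDiffAt IN I ∞ (fun t => (g t).val) z ∧
        ContMDiffAt IN C.tModel ∞ (fun t => C.pt (y t) (a t)) z ∧
          ContMDiffAt IN E.tModel ∞ (fun t => E.pt (x t) (e t)) z := by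
  have h1 := VecBun.smoothAt_prod (IN := IN) (C.pullback ⟨𝒢.tgt, 𝒢.smooth_tgt⟩)
    (E.pullback ⟨𝒢.src, 𝒢.smooth_src⟩) (x := fun t => (g t).val)
    (a := fun t => C.tr (g t).tgt_val.symm (a t)) (b := fun t => E.tr (g t).src_val.symm (e t))
    (z := z)
  have h2 := C.smoothAt_pullback (IN := IN) ⟨𝒢.tgt, 𝒢.smooth_tgt⟩ (g := fun t => (g t).val)
    (a := fun t => C.tr (g t).tgt_val.symm (a t)) (z := z)
  have h3 := E.smoothAt_pullback (IN := IN) ⟨𝒢.src, 𝒢.smooth_src⟩ (g := fun t => (g t).val)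
    (a := fun t => E.tr (g t).src_val.symm (e t)) (z := z)
  have h4 : (fun t => C.pt (𝒢.tgt (g t).val) (C.tr (g t).tgt_val.symm (a t))) =
    fun t => C.pt (y t) (a t) := funext fun t => C.pt_tr _ _
  have h5 : (fun t => E.pt (𝒢.src (g t).val) (E.tr (g t).src_val.symm (e t))) =
    fun t => E.pt (x t) (e t) := funext fun t => E.pt_tr _ _
  refine h1.trans ((and_congr h2 h3).trans ?_)
  change (_ ∧ ContMDiffAt IN C.tModel ∞
    (fun t => C.pt (𝒢.tgt (g t).val) (C.tr (g t).tgt_val.symm (a t))) z) ∧ (_ ∧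
    ContMDiffAt IN E.tModel ∞
      (fun t => E.pt (𝒢.src (g t).val) (E.tr (g t).src_val.symm (e t))) z) ↔ _
  rw [h4, h5]
  tauto

theorem semiPt_congr {x x' y y' : M} {g : 𝒢.Hom x y} {g' : 𝒢.Hom x' y'} {a : C.fiber y}
    {a' : C.fiber y'} {e : E.fiber x} {e' : E.fiber x'} (hg : g.val = g'.val)
    (ha : C.pt y a = C.pt y' a') (he : E.pt x e = E.pt x' e') : semiPt g a e = semiPt g' a' e' := by
  obtain ⟨g, rfl, rfl⟩ := g
  obtain ⟨g', rfl, rfl⟩ := g'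
  change g = g' at hg
  subst hg
  rw [C.pt_inj] at ha
  rw [E.pt_inj] at he
  rw [ha, he]

theorem exists_semiPt (γ : (semiBun 𝒢 E C).Tot) {x : M} (h : 𝒢.src γ.proj = x) :
    ∃ (y : M) (g : 𝒢.Hom x y) (a : C.fiber y) (e : E.fiber x), γ = semiPt g a e := by
  subst h
  exact ⟨_, Hom.mk' 𝒢 γ.proj, γ.snd.1, γ.snd.2, rfl⟩

theorem exists_eq_semiPt (γ : (semiBun 𝒢 E C).Tot) :
    ∃ (x y : M) (g : 𝒢.Hom x y) (a : C.fiber y) (e : E.fiber x), γ = semiPt g a e :=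
  ⟨_, exists_semiPt γ rfl⟩

/-- The component in `C` of a point of `t^*C ⊕ s^*E`. -/
def semiC (γ : (semiBun 𝒢 E C).Tot) : C.fiber (𝒢.tgt γ.proj) := γ.snd.1

/-- The component in `E` of a point of `t^*C ⊕ s^*E`. -/
def semiE (γ : (semiBun 𝒢 E C).Tot) : E.fiber (𝒢.src γ.proj) := γ.snd.2

namespace Comp

variable (c : Comp 𝒢 E C)

/-- The source map of the semidirect product. -/
def semiSrc (γ : (semiBun 𝒢 E C).Tot) : E.Tot := E.pt (𝒢.src γ.proj) (semiE γ)

/-- The target map of the semidirect product. -/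
def semiTgt (γ : (semiBun 𝒢 E C).Tot) : E.Tot :=
  E.pt (𝒢.tgt γ.proj) (c.an.f0 _ (semiC γ) + c.dE.f1 (Hom.mk' 𝒢 γ.proj) (semiE γ))

/-- The units of the semidirect product. -/
def semiOne (ε : E.Tot) : (semiBun 𝒢 E C).Tot := semiPt (Hom.one 𝒢 ε.proj) 0 ε.snd

/-- The inversion of the semidirect product. -/
def semiInv (γ : (semiBun 𝒢 E C).Tot) : (semiBun 𝒢 E C).Tot :=
  -- The core component a' solves a' + Δ^C_{g⁻¹} a - Ω_{g⁻¹,g} e = 0, so the left inverse law holds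
  -- by construction.
  semiPt (Hom.mk' 𝒢 γ.proj).inv (c.om.f2 (Hom.mk' 𝒢 γ.proj).inv (Hom.mk' 𝒢 γ.proj) (semiE γ) -
    c.dC.f1 (Hom.mk' 𝒢 γ.proj).inv (semiC γ))
    (c.an.f0 _ (semiC γ) + c.dE.f1 (Hom.mk' 𝒢 γ.proj) (semiE γ))

theorem semi_comp {γ₁ γ₂ : (semiBun 𝒢 E C).Tot} (w : semiSrc γ₁ = c.semiTgt γ₂) :
    𝒢.src γ₁.proj = 𝒢.tgt γ₂.proj := congrArg Bundle.TotalSpace.proj w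

/-- The product of the semidirect product. -/
def semiMul (γ₁ γ₂ : (semiBun 𝒢 E C).Tot) (w : semiSrc γ₁ = c.semiTgt γ₂) : (semiBun 𝒢 E C).Tot :=
  semiPt (Hom.comp ⟨γ₁.proj, c.semi_comp w, rfl⟩ (Hom.mk' 𝒢 γ₂.proj))
    (semiC γ₁ + c.dC.f1 ⟨γ₁.proj, c.semi_comp w, rfl⟩ (semiC γ₂) -
      c.om.f2 ⟨γ₁.proj, c.semi_comp w, rfl⟩ (Hom.mk' 𝒢 γ₂.proj) (semiE γ₂)) (semiE γ₂)

theorem semiMul_congr {γ₁ γ₁' γ₂ γ₂' : (semiBun 𝒢 E C).Tot} (h₁ : γ₁ = γ₁') (h₂ : γ₂ = γ₂')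
    (w : semiSrc γ₁ = c.semiTgt γ₂) (w' : semiSrc γ₁' = c.semiTgt γ₂') :
    c.semiMul γ₁ γ₂ w = c.semiMul γ₁' γ₂' w' := by
  subst h₁; subst h₂; rfl

@[simp] theorem semiSrc_semiPt {x y : M} (g : 𝒢.Hom x y) (a : C.fiber y) (e : E.fiber x) :
    semiSrc (semiPt g a e) = E.pt x e := by
  obtain ⟨g, rfl, rfl⟩ := g; rfl

@[simp] theorem semiTgt_semiPt {x y : M} (g : 𝒢.Hom x y) (a : C.fiber y) (e : E.fiber x) :
    c.semiTgt (semiPt g a e) = E.pt y (c.an.f0 y a + c.dE.f1 g e) := by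
  obtain ⟨g, rfl, rfl⟩ := g; rfl

theorem semiMul_semiPt {x y z : M} (g : 𝒢.Hom y z) (k : 𝒢.Hom x y) (a₁ : C.fiber z) (e₁ : E.fiber y)
    (a₂ : C.fiber y) (e₂ : E.fiber x)
    (w : semiSrc (semiPt g a₁ e₁) = c.semiTgt (semiPt k a₂ e₂)) :
    c.semiMul (semiPt g a₁ e₁) (semiPt k a₂ e₂) w =
      semiPt (g.comp k) (a₁ + c.dC.f1 g a₂ - c.om.f2 g k e₂) e₂ := by
  obtain ⟨k, rfl, rfl⟩ := k
  obtain ⟨g, hg, rfl⟩ := g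
  rfl

theorem semiInv_semiPt {x y : M} (g : 𝒢.Hom x y) (a : C.fiber y) (e : E.fiber x) :
    c.semiInv (semiPt g a e) = semiPt g.inv (c.om.f2 g.inv g e - c.dC.f1 g.inv a)
      (c.an.f0 y a + c.dE.f1 g e) := by
  obtain ⟨g, rfl, rfl⟩ := g; rfl

theorem exists_semiPt_pair {γ₁ γ₂ : (semiBun 𝒢 E C).Tot} (w : semiSrc γ₁ = c.semiTgt γ₂) :
    ∃ (x y z : M) (g : 𝒢.Hom y z) (k : 𝒢.Hom x y) (a₁ : C.fiber z)
      (a₂ : C.fiber y) (e₂ : E.fiber x),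
      γ₁ = semiPt g a₁ (c.an.f0 y a₂ + c.dE.f1 k e₂) ∧ γ₂ = semiPt k a₂ e₂ := by
  obtain ⟨x, y, k, a₂, e₂, rfl⟩ := exists_eq_semiPt γ₂
  have hy : 𝒢.src γ₁.proj = y := (c.semi_comp w).trans k.tgt_val
  obtain ⟨z, g, a₁, e₁, rfl⟩ := exists_semiPt γ₁ hy
  rw [semiSrc_semiPt, semiTgt_semiPt, E.pt_inj] at w
  exact ⟨x, y, z, g, k, a₁, a₂, e₂, by rw [w], rfl⟩

variable {c}

/-- The core components of the two products differ by the equation `om_comp` at e₃ minus the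
equation `dC_comp` at a₃. -/
theorem Flat.semiMul_assoc (hc : c.Flat) (γ₁ γ₂ γ₃ : (semiBun 𝒢 E C).Tot)
    (w₁ : semiSrc γ₁ = c.semiTgt γ₂) (w₂ : semiSrc γ₂ = c.semiTgt γ₃) (w₃ w₄) :
    c.semiMul (c.semiMul γ₁ γ₂ w₁) γ₃ w₃ = c.semiMul γ₁ (c.semiMul γ₂ γ₃ w₂) w₄ := by
  obtain ⟨x, y, z, g, k, a₂, a₃, e₃, rfl, rfl⟩ := c.exists_semiPt_pair w₂
  have hz : 𝒢.src γ₁.proj = z := (c.semi_comp w₁).trans g.tgt_val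
  obtain ⟨t, f, a₁, e₁, rfl⟩ := exists_semiPt γ₁ hz
  rw [c.semiMul_congr (c.semiMul_semiPt f g _ _ _ _ w₁) rfl w₃
    ((congrArg semiSrc (c.semiMul_semiPt f g _ _ _ _ w₁)).symm.trans w₃),
    c.semiMul_congr rfl (c.semiMul_semiPt g k _ _ _ _ w₂) w₄
    (w₄.trans (congrArg c.semiTgt (c.semiMul_semiPt g k _ _ _ _ w₂))), c.semiMul_semiPt,
    c.semiMul_semiPt]
  refine semiPt_congr (congrArg Hom.val (Hom.comp_assoc f g k)) (C.pt_inj.2 ?_) rfl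
  have h1 := hc.dC_comp f g a₃
  have h2 := hc.om_comp f g k e₃
  rw [map_add (c.om.f2 f g), map_sub (c.dC.f1 f), map_add (c.dC.f1 f)]
  rw [← sub_eq_zero]
  refine Eq.trans ?_ (show _ = (0 : C.fiber t) from by rw [h1, h2, sub_zero] :
    (c.dC.f1 f (c.om.f2 g k e₃) - c.om.f2 (f.comp g) k e₃ + c.om.f2 f (g.comp k) e₃
      - c.om.f2 f g (c.dE.f1 k e₃)) - (c.dC.f1 f (c.dC.f1 g a₃) - c.dC.f1 (f.comp g) a₃ +
        c.om.f2 f g (c.an.f0 y a₃)) = 0)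
  abel

theorem semi_inv_mul (γ : (semiBun 𝒢 E C).Tot) (w) :
    c.semiMul (c.semiInv γ) γ w = semiOne (semiSrc γ) := by
  obtain ⟨x, y, g, a, e, rfl⟩ := exists_eq_semiPt γ
  rw [c.semiMul_congr (c.semiInv_semiPt g a e) rfl w
    ((congrArg semiSrc (c.semiInv_semiPt g a e)).symm.trans w), c.semiMul_semiPt, semiSrc_semiPt]
  refine semiPt_congr (congrArg Hom.val (Hom.inv_comp g)) (C.pt_inj.2 ?_) rfl
  abel

/-- Follows from the compatibility of ∂ with the actions and from `dE_comp` at the pair g⁻¹, g. -/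
theorem Flat.semiTgt_semiInv (hc : c.Flat) (γ : (semiBun 𝒢 E C).Tot) :
    c.semiTgt (c.semiInv γ) = semiSrc γ := by
  obtain ⟨x, y, g, a, e, rfl⟩ := exists_eq_semiPt γ
  rw [semiInv_semiPt, semiTgt_semiPt, semiSrc_semiPt, E.pt_inj, map_sub, map_add, hc.an_dC]
  have h1 := hc.dE_comp g.inv g e
  rw [Hom.inv_comp, c.dE_one] at h1
  rw [← sub_eq_zero, ← h1]
  abel

/-- In contrast to the left inverse law this one uses flatness: `dC_comp` at g, g⁻¹ and `om_comp` at
g, g⁻¹, g, where two of the Ω terms vanish because they contain a unit. -/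
theorem Flat.semi_mul_inv (hc : c.Flat) (γ : (semiBun 𝒢 E C).Tot) (w) :
    c.semiMul γ (c.semiInv γ) w = semiOne (c.semiTgt γ) := by
  obtain ⟨x, y, g, a, e, rfl⟩ := exists_eq_semiPt γ
  rw [c.semiMul_congr rfl (c.semiInv_semiPt g a e) w
    (w.trans (congrArg c.semiTgt (c.semiInv_semiPt g a e))), c.semiMul_semiPt, semiTgt_semiPt]
  refine semiPt_congr (congrArg Hom.val (Hom.comp_inv g)) (C.pt_inj.2 ?_) rfl
  have h1 := hc.dC_comp g g.inv a
  have h2 := hc.om_comp g g.inv g e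
  rw [Hom.comp_inv, c.dC_one] at h1
  rw [Hom.comp_inv, Hom.inv_comp, c.om_one_left, c.om_one_right] at h2
  rw [map_add, map_sub]
  refine Eq.trans ?_ (show _ = (0 : C.fiber y) from by rw [h1, h2, sub_zero] :
    (c.dC.f1 g (c.om.f2 g.inv g e) - 0 + 0 - c.om.f2 g g.inv (c.dE.f1 g e)) -
      (c.dC.f1 g (c.dC.f1 g.inv a) - a + c.om.f2 g g.inv (c.an.f0 y a)) = 0)
  abel

end Comp

end Semidirect

end

end VBG

namespace VBG

noncomputable section

open Filter Topology

open LieGroupoid (Hom)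

/-! ### The semidirect product as a `VB`-groupoid -/

section Semidirect

variable {EG HG EM HM : Type*} [NormedAddCommGroup EG] [NormedSpace ℝ EG] [TopologicalSpace HG]
  [NormedAddCommGroup EM] [NormedSpace ℝ EM] [TopologicalSpace HM]
  {I : ModelWithCorners ℝ EG HG} {G : Type*} [TopologicalSpace G] [ChartedSpace HG G]
  {J : ModelWithCorners ℝ EM HM} {M : Type*} [TopologicalSpace M] [ChartedSpace HM M]
  {𝒢 : LieGroupoid I G J M} {E C : VecBun.{v} J M}

theorem smooth_semi {n : ℕ} {u : EuclideanSpace ℝ (Fin n) → (semiBun 𝒢 E C).Tot} :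
    ContMDiff (𝓡 n) (semiBun 𝒢 E C).tModel ∞ u ↔ ContMDiff (𝓡 n) I ∞ (fun t => (u t).proj) ∧
      ContMDiff (𝓡 n) C.tModel ∞ (fun t => C.pt _ (semiC (u t))) ∧
        ContMDiff (𝓡 n) E.tModel ∞ (fun t => E.pt _ (semiE (u t))) := by
  have h := fun t => smoothAt_semiPt (IN := 𝓡 n) (g := fun t => Hom.mk' 𝒢 (u t).proj)
    (a := fun t => semiC (u t)) (e := fun t => semiE (u t)) (z := t)
  exact ⟨fun hu => ⟨fun t => ((h t).1 (hu t)).1, fun t => ((h t).1 (hu t)).2.1,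
    fun t => ((h t).1 (hu t)).2.2⟩, fun hu t => (h t).2 ⟨hu.1 t, hu.2.1 t, hu.2.2 t⟩⟩

theorem Fam.smooth_f0 {E E' : VecBun.{v} J M} (l : Fam 𝒢 E E' 0) {n : ℕ}
    {x : EuclideanSpace ℝ (Fin n) → M} {e : ∀ t, E.fiber (x t)}
    (he : ContMDiff (𝓡 n) E.tModel ∞ (fun t => E.pt (x t) (e t))) :
    ContMDiff (𝓡 n) E'.tModel ∞ (fun t => E'.pt (x t) (l.f0 (x t) (e t))) :=
  l.smooth n (fun t => Nerve.point 𝒢 (x t)) e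
    (Nerve.smoothMap_point ((Bundle.contMDiff_proj E.fiber).comp he)) he

theorem Fam.smooth_f1 {E E' : VecBun.{v} J M} (l : Fam 𝒢 E E' 1) {n : ℕ}
    {x y : EuclideanSpace ℝ (Fin n) → M} {g : ∀ t, 𝒢.Hom (x t) (y t)} {e : ∀ t, E.fiber (x t)}
    (hg : ContMDiff (𝓡 n) I ∞ (fun t => (g t).val))
    (he : ContMDiff (𝓡 n) E.tModel ∞ (fun t => E.pt (x t) (e t))) :
    ContMDiff (𝓡 n) E'.tModel ∞ (fun t => E'.pt (y t) (l.f1 (g t) (e t))) :=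
  l.smooth n (fun t => Nerve.ofHom (g t)) e (Nerve.smoothMap_ofHom hg) he

theorem Fam.smooth_f2 {E E' : VecBun.{v} J M} (l : Fam 𝒢 E E' 2) {n : ℕ}
    {x y z : EuclideanSpace ℝ (Fin n) → M} {g : ∀ t, 𝒢.Hom (y t) (z t)}
    {k : ∀ t, 𝒢.Hom (x t) (y t)} {e : ∀ t, E.fiber (x t)}
    (hg : ContMDiff (𝓡 n) I ∞ (fun t => (g t).val)) (hk : ContMDiff (𝓡 n) I ∞ (fun t => (k t).val))
    (he : ContMDiff (𝓡 n) E.tModel ∞ (fun t => E.pt (x t) (e t))) :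
    ContMDiff (𝓡 n) E'.tModel ∞ (fun t => E'.pt (z t) (l.f2 (g t) (k t) (e t))) :=
  l.smooth n (fun t => Nerve.ofPair (g t) (k t)) e (Nerve.smoothMap_ofPair hg hk) he

namespace Comp

variable {c : Comp 𝒢 E C}

theorem semiMul_smooth {n : ℕ} {u₁ u₂ : EuclideanSpace ℝ (Fin n) → (semiBun 𝒢 E C).Tot}
    (w : ∀ t, semiSrc (u₁ t) = c.semiTgt (u₂ t))
    (h₁ : ContMDiff (𝓡 n) (semiBun 𝒢 E C).tModel ∞ u₁)
    (h₂ : ContMDiff (𝓡 n) (semiBun 𝒢 E C).tModel ∞ u₂) :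
    ContMDiff (𝓡 n) (semiBun 𝒢 E C).tModel ∞ (fun t => c.semiMul (u₁ t) (u₂ t) (w t)) := by
  obtain ⟨p1, a1, e1⟩ := smooth_semi.1 h₁
  obtain ⟨p2, a2, e2⟩ := smooth_semi.1 h₂
  have hC := c.dC.smooth_f1 (g := fun t => ⟨(u₁ t).proj, c.semi_comp (w t), rfl⟩) p1 a2
  have hO := c.om.smooth_f2 (g := fun t => ⟨(u₁ t).proj, c.semi_comp (w t), rfl⟩)
    (k := fun t => Hom.mk' 𝒢 (u₂ t).proj) p1 p2 e2
  intro t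
  refine smoothAt_semiPt.2 ⟨𝒢.smooth_mul n _ _ _ p1 p2 t, ?_, e2 t⟩
  exact C.smoothAt_sub (C.smoothAt_add (a1 t) (hC t)) (hO t)

variable (c) in
theorem semiTgt_smooth {n : ℕ} {u : EuclideanSpace ℝ (Fin n) → (semiBun 𝒢 E C).Tot}
    (h : ContMDiff (𝓡 n) (semiBun 𝒢 E C).tModel ∞ u) :
    ContMDiff (𝓡 n) E.tModel ∞ (fun t => c.semiTgt (u t)) := by
  obtain ⟨p, a, e⟩ := smooth_semi.1 h
  exact fun t => E.smoothAt_add (c.an.smooth_f0 a t)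
    (c.dE.smooth_f1 (g := fun t => Hom.mk' 𝒢 (u t).proj) p e t)

variable (c) in
theorem semiInv_smooth {n : ℕ} {u : EuclideanSpace ℝ (Fin n) → (semiBun 𝒢 E C).Tot}
    (h : ContMDiff (𝓡 n) (semiBun 𝒢 E C).tModel ∞ u) :
    ContMDiff (𝓡 n) (semiBun 𝒢 E C).tModel ∞ (fun t => c.semiInv (u t)) := by
  obtain ⟨p, a, e⟩ := smooth_semi.1 h
  have p' : ContMDiff (𝓡 n) I ∞ (fun t => 𝒢.inv (u t).proj) := 𝒢.smooth_inv.comp p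
  have hC := c.dC.smooth_f1 (g := fun t => (Hom.mk' 𝒢 (u t).proj).inv) p' a
  have hO := c.om.smooth_f2 (g := fun t => (Hom.mk' 𝒢 (u t).proj).inv)
    (k := fun t => Hom.mk' 𝒢 (u t).proj) p' p e
  exact fun t => smoothAt_semiPt.2 ⟨p' t, C.smoothAt_sub (hO t) (hC t), c.semiTgt_smooth h t⟩

end Comp

theorem semiOne_smooth : ContMDiff E.tModel (semiBun 𝒢 E C).tModel ∞
    (Comp.semiOne : E.Tot → (semiBun 𝒢 E C).Tot) := by
  have hp : ContMDiff E.tModel J ∞ (fun ε : E.Tot => ε.proj) := Bundle.contMDiff_proj E.fiber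
  refine fun ε => smoothAt_semiPt.2 ⟨𝒢.smooth_one.comp hp ε, ?_, contMDiffAt_id⟩
  exact (Bundle.contMDiff_zeroSection ℝ C.fiber).comp hp ε

section

variable [FiniteDimensional ℝ EG] [IsManifold I ∞ G] [I.Boundaryless] [FiniteDimensional ℝ EM]
  [T2Space M] [IsManifold J ∞ M] [J.Boundaryless]

/-- A local section σ of the source map of G through the base arrow, and a smooth section of C
through the core component of γ, yield a local section of the new source map through γ. -/
theorem semiSrc_submersion (hs : ContMDiff (semiBun 𝒢 E C).tModel E.tModel ∞
      (Comp.semiSrc : (semiBun 𝒢 E C).Tot → E.Tot)) (γ : (semiBun 𝒢 E C).Tot) :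
    Function.Surjective (mfderiv (semiBun 𝒢 E C).tModel E.tModel Comp.semiSrc γ) := by
  classical
  obtain ⟨σ, hσ, hσγ, hσs⟩ := exists_section_of_surjective_mfderiv 𝒢.smooth_src γ.proj
    (𝒢.submersion_src γ.proj)
  obtain ⟨α, hα⟩ := exists_section_eq (𝒢 := 𝒢) _ (semiC γ)
  have hαs : ContMDiff J C.tModel ∞ (fun x => C.pt x (atPoint α x)) :=
    contMDiff_of_plots fun n u hu => α.2 n (fun t => Nerve.point 𝒢 (u t))
      (Nerve.smoothMap_point hu)
  let τ : E.Tot → (semiBun 𝒢 E C).Tot := fun ε =>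
    -- The map σ is a section only near the source of γ; the value elsewhere is irrelevant.
    if h : 𝒢.src (σ ε.proj) = ε.proj then
      semiPt ⟨σ ε.proj, h, rfl⟩ (atPoint α (𝒢.tgt (σ ε.proj))) ε.snd
    else semiPt (Hom.mk' 𝒢 (σ ε.proj)) (atPoint α (𝒢.tgt (σ ε.proj))) 0
  have hp : ContMDiff E.tModel J ∞ (fun ε : E.Tot => ε.proj) := Bundle.contMDiff_proj E.fiber
  have hev : ∀ᶠ ε : E.Tot in 𝓝 (Comp.semiSrc γ), 𝒢.src (σ ε.proj) = ε.proj :=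
    (hp.continuous.tendsto (Comp.semiSrc γ)).eventually hσs
  refine surjective_mfderiv_of_section hs γ (σ := τ) ?_ ?_ ?_
  · let e : ∀ ε : E.Tot, E.fiber (𝒢.src (σ ε.proj)) := fun ε =>
      if h : 𝒢.src (σ ε.proj) = ε.proj then E.tr h.symm ε.snd else 0
    have hτ : τ = fun ε => semiPt (Hom.mk' 𝒢 (σ ε.proj)) (atPoint α (𝒢.tgt (σ ε.proj))) (e ε) := by
      funext ε
      simp only [τ, e]
      split_ifs with h
      · exact semiPt_congr rfl rfl (E.pt_tr h.symm ε.snd).symm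
      · rfl
    rw [hτ]
    have h1 : ContMDiffAt E.tModel I ∞ (fun ε : E.Tot => σ ε.proj) (Comp.semiSrc γ) :=
      ContMDiffAt.comp (g := σ) (Comp.semiSrc γ) hσ hp.contMDiffAt
    refine smoothAt_semiPt.2 ⟨h1, ?_, ?_⟩
    · exact (hαs.comp 𝒢.smooth_tgt).contMDiffAt.comp _ h1
    · refine contMDiffAt_id.congr_of_eventuallyEq ?_
      filter_upwards [hev] with ε hε
      simp only [e, dif_pos hε]
      exact E.pt_tr hε.symm ε.snd
  · have h1 : 𝒢.src (σ (Comp.semiSrc γ).proj) = (Comp.semiSrc γ).proj := hev.self_of_nhds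
    simp only [τ, dif_pos h1]
    refine (semiPt_congr (g' := Hom.mk' 𝒢 γ.proj) (a' := semiC γ) (e' := semiE γ) hσγ ?_ rfl).trans rfl
    rw [← hα]
    exact congrArg (fun x => C.pt x (atPoint α x)) (congrArg 𝒢.tgt hσγ)
  · filter_upwards [hev] with ε hε
    simp only [τ, dif_pos hε]
    exact Comp.semiSrc_semiPt _ _ _

/-- The `VB`-groupoid with the given components. -/
def Comp.Flat.vb {c : Comp 𝒢 E C} (hc : c.Flat) : VBGroupoid 𝒢 E where
  bun := semiBun 𝒢 E C
  gpd :=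
    { src := Comp.semiSrc
      tgt := c.semiTgt
      one := Comp.semiOne
      inv := c.semiInv
      mul := c.semiMul
      src_one := fun ε => Comp.semiSrc_semiPt _ _ _
      tgt_one := fun ε => by
        rw [Comp.semiOne, c.semiTgt_semiPt, map_zero, zero_add, c.dE_one]
      src_inv := fun γ => Comp.semiSrc_semiPt _ _ _
      tgt_inv := hc.semiTgt_semiInv
      src_mul := fun γ₁ γ₂ w => Comp.semiSrc_semiPt _ _ _
      tgt_mul := fun γ₁ γ₂ w => by
        obtain ⟨x, y, z, g, k, a₁, a₂, e₂, rfl, rfl⟩ := c.exists_semiPt_pair w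
        rw [c.semiMul_semiPt, c.semiTgt_semiPt, c.semiTgt_semiPt, E.pt_inj, map_sub, map_add,
          hc.an_dC, map_add]
        -- The target of a product is the target of its first factor by `an_dC`, already used, and
        -- `dE_comp`.
        have := hc.dE_comp g k e₂
        rw [← sub_eq_zero]
        refine Eq.trans ?_ (show _ = (0 : E.fiber z) by rw [this, neg_zero] :
          -(c.dE.f1 g (c.dE.f1 k e₂) - c.dE.f1 (g.comp k) e₂ + c.an.f0 z (c.om.f2 g k e₂)) = 0)
        abel
      mul_assoc := fun γ₁ γ₂ γ₃ w₁ w₂ => hc.semiMul_assoc γ₁ γ₂ γ₃ w₁ w₂ _ _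
      one_mul := fun γ => by
        obtain ⟨x, y, g, a, e, rfl⟩ := exists_eq_semiPt γ
        refine (c.semiMul_congr (congrArg Comp.semiOne (c.semiTgt_semiPt g a e)) rfl _
          ((Comp.semiSrc_semiPt _ _ _).trans (c.semiTgt_semiPt g a e).symm)).trans ?_
        refine (c.semiMul_semiPt (Hom.one 𝒢 y) g 0 _ a e _).trans ?_
        refine semiPt_congr (congrArg Hom.val (Hom.one_comp g)) (C.pt_inj.2 ?_) rfl
        rw [c.dC_one, c.om_one_left, zero_add, sub_zero]
      mul_one := fun γ => by
        obtain ⟨x, y, g, a, e, rfl⟩ := exists_eq_semiPt γ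
        refine (c.semiMul_congr rfl (congrArg Comp.semiOne (Comp.semiSrc_semiPt g a e)) _
          (by rw [Comp.semiSrc_semiPt, Comp.semiOne, c.semiTgt_semiPt, map_zero, zero_add,
            c.dE_one])).trans ?_
        refine (c.semiMul_semiPt g (Hom.one 𝒢 x) a e 0 e _).trans ?_
        refine semiPt_congr (congrArg Hom.val (Hom.comp_one g)) (C.pt_inj.2 ?_) rfl
        rw [map_zero, c.om_one_right, add_zero, sub_zero]
      inv_mul := fun γ => Comp.semi_inv_mul γ _
      mul_inv := fun γ => hc.semi_mul_inv γ _
      smooth_src := contMDiff_of_plots fun n u hu => (smooth_semi.1 hu).2.2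
      smooth_tgt := contMDiff_of_plots fun n u hu => c.semiTgt_smooth hu
      smooth_one := semiOne_smooth
      smooth_inv := contMDiff_of_plots fun n u hu => c.semiInv_smooth hu
      submersion_src := semiSrc_submersion
        (contMDiff_of_plots fun n u hu => (smooth_semi.1 hu).2.2)
      smooth_mul := fun n u₁ u₂ w h₁ h₂ => Comp.semiMul_smooth w h₁ h₂ }
  srcL g := LinearMap.snd ℝ (C.fiber (𝒢.tgt g)) (E.fiber (𝒢.src g))
  tgtL g := LinearMap.coprod (c.an.f0 (𝒢.tgt g)) (c.dE.f1 (Hom.mk' 𝒢 g))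
  src_eq _ := rfl
  tgt_eq _ := rfl
  proj_mul _ _ _ _ := rfl
  interchange g₁ g₂ g γ₁ γ₃ γ₂ γ₄ b b' w₁ w₃ w h h' := by
    have w₀ : 𝒢.src g₁ = 𝒢.tgt g₂ := congrArg Bundle.TotalSpace.proj w₁
    obtain rfl : 𝒢.mul g₁ g₂ w₀ = g := congrArg Bundle.TotalSpace.proj h
    -- Over fixed composable arrows the product is the restriction of a linear map on pairs of
    -- factors, so the interchange law is additivity of this map.
    let L : (C.fiber (𝒢.tgt g₁) × E.fiber (𝒢.src g₁)) × (C.fiber (𝒢.tgt g₂) × E.fiber (𝒢.src g₂)) →ₗ[ℝ]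
        (semiBun 𝒢 E C).fiber (𝒢.mul g₁ g₂ w₀) :=
      semiFib (Hom.comp ⟨g₁, w₀, rfl⟩ (Hom.mk' 𝒢 g₂)) ∘ₗ LinearMap.prod
        (LinearMap.fst ℝ _ _ ∘ₗ LinearMap.fst ℝ _ _ +
          c.dC.f1 ⟨g₁, w₀, rfl⟩ ∘ₗ LinearMap.fst ℝ _ _ ∘ₗ LinearMap.snd ℝ _ _ -
          c.om.f2 ⟨g₁, w₀, rfl⟩ (Hom.mk' 𝒢 g₂) ∘ₗ LinearMap.snd ℝ _ _ ∘ₗ LinearMap.snd ℝ _ _)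
        (LinearMap.snd ℝ _ _ ∘ₗ LinearMap.snd ℝ _ _)
    obtain rfl : L (γ₁, γ₂) = b := (VecBun.pt_inj _).1 h
    obtain rfl : L (γ₃, γ₄) = b' := (VecBun.pt_inj _).1 h'
    exact congrArg (VecBun.pt _ _) (map_add L (γ₁, γ₂) (γ₃, γ₄))

variable {c : Comp 𝒢 E C} (hc : c.Flat)

/-- The core of the semidirect product. -/
def Comp.Flat.core : CoreIdent hc.vb C where
  incl x := LinearMap.prod (C.tr (𝒢.tgt_one x).symm).toLinearMap 0
  injective x a b h := (C.tr (𝒢.tgt_one x).symm).injective (congrArg Prod.fst h)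
  range_eq x := by
    ext b
    constructor
    · rintro ⟨a, rfl⟩
      rfl
    · intro h
      exact ⟨C.tr (𝒢.tgt_one x) b.1, Prod.ext ((C.tr_tr _ _ _).trans rfl)
        (show (0 : E.fiber _) = b.2 from (LinearMap.mem_ker.1 h).symm)⟩
  smooth := contMDiff_of_plots fun n u hu => by
    have hp : ContMDiff (𝓡 n) J ∞ (fun t => (u t).proj) := (Bundle.contMDiff_proj C.fiber).comp hu
    intro t
    refine ((smoothAt_semiPt (𝒢 := 𝒢) (g := fun t => Hom.one 𝒢 (u t).proj)
      (a := fun t => (u t).snd) (e := fun t => 0)).2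
      ⟨𝒢.smooth_one.comp hp t, hu t, E.smooth_zero hp t⟩).congr_of_eventuallyEq
      (Eventually.of_forall fun s => ?_)
    exact congrArg ((semiBun 𝒢 E C).pt _) (Prod.ext rfl (map_zero (E.tr _)).symm)

/-- The horizontal lift of the semidirect product. -/
def Comp.Flat.lift : HorLift hc.vb where
  lift g := LinearMap.prod (0 : E.fiber (𝒢.src g) →ₗ[ℝ] C.fiber (𝒢.tgt g)) LinearMap.id
  src_lift g e := rfl
  lift_one x e := semiPt_congr (g' := Hom.mk' 𝒢 (𝒢.one x)) (e' := e)
    (congrArg 𝒢.one (𝒢.src_one x)) (by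
      change C.pt (𝒢.src (𝒢.one x)) 0 = C.pt (𝒢.tgt (𝒢.one x)) 0
      rw [𝒢.src_one, 𝒢.tgt_one]) rfl
  smooth n u e hu he := fun t => smoothAt_semiPt (𝒢 := 𝒢) (g := fun t => Hom.mk' 𝒢 (u t))
      (a := fun t => 0) (e := e) |>.2
      ⟨hu t, C.smooth_zero (𝒢.smooth_tgt.comp hu) t, he t⟩

variable [T2Space G]

theorem Comp.Flat.R_semiFib {x y z : M} (g : 𝒢.Hom y z) (k : 𝒢.Hom x y) {l : 𝒢.Hom x z}
    (hl : g.comp k = l) {a₁ : C.fiber z} {e₁ : E.fiber y}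
    {a₂ : C.fiber y} {e₂ : E.fiber x} (w : e₁ = c.an.f0 y a₂ + c.dE.f1 k e₂) :
    hc.vb.R g k l (semiFib g (a₁, e₁)) (semiFib k (a₂, e₂))
      (semiFib l (a₁ + c.dC.f1 g a₂ - c.om.f2 g k e₂, e₂)) := by
  subst hl
  refine ⟨?_, c.semiMul_semiPt g k a₁ e₁ a₂ e₂ ?_⟩
  all_goals exact (Comp.semiSrc_semiPt _ _ _).trans (w ▸ (c.semiTgt_semiPt _ _ _).symm)

/-- The components reappear as the special cases of the product formula in which some coordinates
are zero. -/
theorem Comp.Flat.isCompOf : IsCompOf hc.core hc.lift c := by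
  have hcor : ∀ (x : M) (a : C.fiber x), hc.core.cor x a = semiFib (Hom.one 𝒢 x) (a, 0) :=
    fun x a => Prod.ext rfl (map_zero (E.tr _)).symm
  have hhl : ∀ {x y : M} (g : 𝒢.Hom x y) (e : E.fiber x), hc.lift.hl g e = semiFib g (0, e) :=
    fun g e => Prod.ext (map_zero (C.tr _)).symm rfl
  have htg : ∀ {x y : M} (g : 𝒢.Hom x y) (a : C.fiber y) (e : E.fiber x),
      hc.vb.tg g (semiFib g (a, e)) = c.an.f0 y a + c.dE.f1 g e := fun g a e =>
    E.pt_inj.1 ((hc.vb.tgt_pt g _).symm.trans (c.semiTgt_semiPt g a e))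
  have h0 : ∀ {x y : M} (g : 𝒢.Hom x y), (0 : (semiBun 𝒢 E C).fiber g.val) = semiFib g (0, 0) :=
    fun g => (map_zero (semiFib g)).symm
  have hZ : ∀ {x y : M} (g : 𝒢.Hom x y) (a : C.fiber y), hc.core.Z g a = semiFib g (a, 0) := by
    intro x y g a
    have h1 := hc.R_semiFib (Hom.one 𝒢 y) g (Hom.one_comp g) (a₁ := a) (e₁ := 0) (a₂ := 0) (e₂ := 0)
      (by rw [map_zero, map_zero, add_zero])
    rw [map_zero, map_zero, add_zero, sub_zero, ← hcor, ← h0] at h1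
    exact (hc.core.R_Z g a).unique h1
  refine ⟨fun x a => ?_, fun g e => ?_, fun {x y} g a => ?_, fun g k e => ?_⟩
  · rw [hcor, htg, map_zero, add_zero]
  · rw [hhl, htg, map_zero, zero_add]
  · have h1 := hc.R_semiFib g (Hom.one 𝒢 x) (Hom.comp_one g) (a₁ := 0) (e₁ := c.an.f0 x a) (a₂ := a)
      (e₂ := 0) (by rw [map_zero, add_zero])
    rw [map_zero, zero_add, sub_zero, ← hcor, ← hhl, ← hZ] at h1
    exact h1
  · have h1 := hc.R_semiFib g k rfl (a₁ := 0) (e₁ := c.dE.f1 k e) (a₂ := 0)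
      (e₂ := e) (by rw [map_zero, zero_add])
    rw [map_zero, zero_add, zero_sub, ← hhl, ← hhl] at h1
    refine h1.congr ?_
    rw [hhl, hZ]
    refine (congrArg (semiFib _) (Prod.ext ?_ ?_)).trans (map_sub (semiFib _) (0, e) (_, 0))
    · exact (zero_sub _).symm
    · exact (sub_zero _).symm

end

end Semidirect

end

end VBG

namespace VBG

noncomputable section

open Filter Topology

open LieGroupoid (Hom)

/-! ### Fibrewise surjectivity of the source map -/

section Lifting

variable {EG HG EM HM : Type*} [NormedAddCommGroup EG] [NormedSpace ℝ EG] [TopologicalSpace HG]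
  [NormedAddCommGroup EM] [NormedSpace ℝ EM] [TopologicalSpace HM]
  {I : ModelWithCorners ℝ EG HG} {G : Type*} [TopologicalSpace G] [ChartedSpace HG G]
  {J : ModelWithCorners ℝ EM HM} {M : Type*} [TopologicalSpace M] [ChartedSpace HM M]
  {𝒢 : LieGroupoid I G J M} {E : VecBun.{v} J M}
  [FiniteDimensional ℝ EG] [T2Space G] [IsManifold I ∞ G] [I.Boundaryless]
  [FiniteDimensional ℝ EM] [T2Space M] [IsManifold J ∞ M] [J.Boundaryless]

/-- The source map of a `VB`-groupoid is fibrewise surjective. -/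
theorem VBGroupoid.srcL_surjective (Γ : VBGroupoid 𝒢 E) (g : G) :
    Function.Surjective (Γ.srcL g) := by
  rw [← LinearMap.range_eq_top]
  by_contra hne
  -- Otherwise some nonzero functional l vanishes on the image. Below, φ extends it to a smooth
  -- fibrewise linear function on E.
  obtain ⟨l, hl, hle⟩ := Submodule.exists_le_ker_of_lt_top _ (lt_top_iff_ne_top.2 hne)
  obtain ⟨e, he⟩ : ∃ e, l e ≠ 0 := by
    by_contra! h
    exact hl (LinearMap.ext h)
  obtain ⟨F, -⟩ := E.exists_frame (𝒢.src g)
  obtain ⟨F', -⟩ := Γ.bun.exists_frame g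
  let φ : ∀ y, E.fiber y →ₗ[ℝ] ℝ := fun y => ∑ j, l (F.sec j (𝒢.src g)) • F.coord j y
  have hφx : ∀ a, φ (𝒢.src g) a = l a := fun a => by
    conv_rhs => rw [← F.expand_self a]
    simp [φ, mul_comm]
  have hφs : ContMDiff E.tModel 𝓘(ℝ, ℝ) ∞ (fun ε : E.Tot => φ ε.proj ε.snd) := by
    simp only [φ, LinearMap.sum_apply, LinearMap.smul_apply, smul_eq_mul]
    exact ContMDiff.sum fun j _ => contMDiff_const.mul (F.smooth_coord j)
  -- A local section of the source submersion through 0_g lifts the ray r ↦ r • e to a curve γ with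
  -- γ(0) = 0_g.
  obtain ⟨σ, hσ, hσ0, hσs⟩ := exists_section_of_surjective_mfderiv Γ.gpd.smooth_src
    (Γ.bun.pt g 0) (Γ.gpd.submersion_src _)
  have hsrc : Γ.gpd.src (Γ.bun.pt g 0) = E.pt (𝒢.src g) 0 :=
    (Γ.src_eq _).trans (congrArg (E.pt (𝒢.src g)) (map_zero (Γ.srcL g)))
  rw [hsrc] at hσ hσ0 hσs
  let ℓ : ℝ → E.Tot := fun r => E.pt (𝒢.src g) (r • e)
  have hℓ : ContMDiff 𝓘(ℝ, ℝ) E.tModel ∞ ℓ := fun r =>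
    E.smoothAt_smul (x := fun _ => 𝒢.src g) (a := fun _ => e) contMDiffAt_id contMDiffAt_const
  have hℓ0 : ℓ 0 = E.pt (𝒢.src g) 0 := congrArg (E.pt (𝒢.src g)) (zero_smul ℝ e)
  let γ : ℝ → Γ.bun.Tot := fun r => σ (ℓ r)
  have hγ : ContMDiffAt 𝓘(ℝ, ℝ) Γ.bun.tModel ∞ γ 0 :=
    ContMDiffAt.comp (g := σ) 0 (by rw [hℓ0]; exact hσ) hℓ.contMDiffAt
  have hγ0 : γ 0 = Γ.bun.pt g 0 := by simp only [γ, hℓ0, hσ0]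
  have hγp : ContMDiffAt 𝓘(ℝ, ℝ) I ∞ (fun r => (γ r).proj) 0 :=
    (Bundle.contMDiff_proj Γ.bun.fiber).contMDiffAt.comp 0 hγ
  -- In a frame, φ of the source of γ(r) is the sum of the products u_i w_i. Both factors vanish at
  -- r = 0: u_i because γ(0) = 0_g, and w_i because l kills the image. So the sum has derivative 0
  -- at r = 0, although near 0 it equals r · l(e) with l(e) ≠ 0.
  let u : Fin F'.rank → ℝ → ℝ := fun i r => F'.coord i (γ r).proj (γ r).snd
  let w : Fin F'.rank → ℝ → ℝ := fun i r =>
    φ (𝒢.src (γ r).proj) (Γ.srcL (γ r).proj (F'.sec i (γ r).proj))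
  have hone : (∞ : WithTop ℕ∞) ≠ 0 := by simp
  have hu : ∀ i, DifferentiableAt ℝ (u i) 0 := fun i =>
    (contMDiffAt_iff_contDiffAt.1 (F'.smoothAt_coord i hγ)).differentiableAt hone
  have hw : ∀ i, DifferentiableAt ℝ (w i) 0 := fun i => by
    have h1 := hφs.contMDiffAt.comp (0 : ℝ)
      (Γ.gpd.smooth_src.contMDiffAt.comp (0 : ℝ) (F'.smoothAt_sec i hγp))
    refine (contMDiffAt_iff_contDiffAt.1 (h1.congr_of_eventuallyEq ?_)).differentiableAt hone
    refine Eventually.of_forall fun r => ?_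
    exact (congrArg (fun ε : E.Tot => φ ε.proj ε.snd)
      (Γ.src_eq (Γ.bun.pt (γ r).proj (F'.sec i (γ r).proj)))).symm
  have hu0 : ∀ i, u i 0 = 0 := fun i => by
    have : (fun γ : Γ.bun.Tot => F'.coord i γ.proj γ.snd) (γ 0) = 0 := by
      rw [hγ0]; exact map_zero _
    exact this
  have hw0 : ∀ i, w i 0 = 0 := fun i => by
    have : (fun γ : Γ.bun.Tot => φ (𝒢.src γ.proj) (Γ.srcL γ.proj (F'.sec i γ.proj))) (γ 0) = 0 := by
      rw [hγ0]
      refine (hφx _).trans (LinearMap.mem_ker.1 (hle ⟨F'.sec i g, rfl⟩))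
    exact this
  have hd : HasDerivAt (fun r => ∑ i, u i r * w i r) 0 0 := by
    have h1 : HasDerivAt (fun r => ∑ i, u i r * w i r)
        (∑ i, (deriv (u i) 0 * w i 0 + u i 0 * deriv (w i) 0)) 0 :=
      HasDerivAt.fun_sum fun i _ => (hu i).hasDerivAt.mul (hw i).hasDerivAt
    simpa only [hu0, hw0, mul_zero, zero_mul, add_zero, Finset.sum_const_zero] using h1
  have hd' : HasDerivAt (fun r : ℝ => r * l e) (l e) 0 := by
    simpa using (hasDerivAt_id (0 : ℝ)).mul_const (l e)
  refine he (hd'.unique (hd.congr_of_eventuallyEq ?_))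
  have h1 : ∀ᶠ r in 𝓝 (0 : ℝ), Γ.gpd.src (γ r) = ℓ r := by
    have := hℓ.continuous.tendsto 0
    rw [hℓ0] at this
    exact this.eventually hσs
  filter_upwards [h1, F'.eventually_expand (x := fun r => (γ r).proj) hγp.continuousAt
    (congrArg Bundle.TotalSpace.proj hγ0)] with r hr hexp
  have h2 : φ (𝒢.src (γ r).proj) (Γ.srcL (γ r).proj (γ r).snd) = r * l e := by
    have h3 := congrArg (fun ε : E.Tot => φ ε.proj ε.snd) ((Γ.src_eq (γ r)).symm.trans hr)
    refine h3.trans ((hφx _).trans ?_)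
    rw [map_smul, smul_eq_mul]
  rw [← h2]
  conv_lhs => rw [← hexp (γ r).snd]
  simp only [map_sum, map_smul, smul_eq_mul, u, w]

end Lifting

end

end VBG

namespace VBG

noncomputable section

open Filter Topology

open LieGroupoid (Hom)

/-! ### Existence of horizontal lifts -/

section Lifting

variable {EG HG EM HM : Type*} [NormedAddCommGroup EG] [NormedSpace ℝ EG] [TopologicalSpace HG]
  [NormedAddCommGroup EM] [NormedSpace ℝ EM] [TopologicalSpace HM]
  {I : ModelWithCorners ℝ EG HG} {G : Type*} [TopologicalSpace G] [ChartedSpace HG G]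
  {J : ModelWithCorners ℝ EM HM} {M : Type*} [TopologicalSpace M] [ChartedSpace HM M]
  {𝒢 : LieGroupoid I G J M} {E : VecBun.{v} J M}

theorem VecBun.tr_section (A : VecBun.{v} J M) (s : ∀ x, A.fiber x) {x y : M} (h : x = y) :
    A.tr h (s x) = s y := by
  subst h; rfl

/-- A smooth family of vectors with prescribed value at a point. -/
theorem VecBun.exists_section (A : VecBun.{v} J M) [FiniteDimensional ℝ EM] [T2Space M]
    [IsManifold J ∞ M] (x : M) (a : A.fiber x) :
    ∃ s : ∀ y, A.fiber y, ContMDiff J A.tModel ∞ (fun y => A.pt y (s y)) ∧ s x = a := by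
  obtain ⟨F, -⟩ := A.exists_frame x
  exact ⟨fun y => ∑ i, F.coord i x a • F.sec i y, fun y => A.smoothAt_sum _ contMDiffAt_id
    fun i _ => A.smoothAt_smul contMDiffAt_const (F.smooth_sec i y), F.expand_self a⟩

variable [FiniteDimensional ℝ EG] [T2Space G] [IsManifold I ∞ G]

/-- A smooth linear right inverse of the source map over `U`, compatible with the units. -/
structure IsLiftOn (Γ : VBGroupoid 𝒢 E) (U : Set G)
    (L : ∀ g, E.fiber (𝒢.src g) →ₗ[ℝ] Γ.bun.fiber g) : Prop where
  src : ∀ g ∈ U, ∀ e, Γ.srcL g (L g e) = e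
  one : ∀ x, 𝒢.one x ∈ U → ∀ e, L (𝒢.one x) e = Γ.un x (E.tr (𝒢.src_one x) e)
  smooth : ∀ (n : ℕ) (u : EuclideanSpace ℝ (Fin n) → G) (e : ∀ z, E.fiber (𝒢.src (u z)))
    (z : EuclideanSpace ℝ (Fin n)), u z ∈ U → ContMDiffAt (𝓡 n) I ∞ u z →
      ContMDiffAt (𝓡 n) E.tModel ∞ (fun z => E.pt (𝒢.src (u z)) (e z)) z →
        ContMDiffAt (𝓡 n) Γ.bun.tModel ∞ (fun z => Γ.bun.pt (u z) (L (u z) (e z))) z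

/-- The sections β lift a frame at g₀ exactly and near g₀ up to the matrix K, which is the identity
at g₀; multiplication by K⁻¹ corrects them. The hypothesis at units ensures that the correction
stays compatible with the unit map. -/
theorem exists_isLiftOn_of_sections (Γ : VBGroupoid 𝒢 E) (g₀ : G) (F : E.Frame (𝒢.src g₀))
    (β : Fin F.rank → ∀ g, Γ.bun.fiber g)
    (hβ : ∀ j, ContMDiff I Γ.bun.tModel ∞ (fun g => Γ.bun.pt g (β j g)))
    (hβ₀ : ∀ j, Γ.srcL g₀ (β j g₀) = F.sec j (𝒢.src g₀))
    (hone : ∀ᶠ g in 𝓝 g₀, ∀ x, g = 𝒢.one x → ∀ j, β j (𝒢.one x) = Γ.un x (F.sec j x)) :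
    ∃ U, IsOpen U ∧ g₀ ∈ U ∧ ∃ L, IsLiftOn Γ U L := by
  classical
  let K : G → Matrix (Fin F.rank) (Fin F.rank) ℝ := fun g i j =>
    F.coord i (𝒢.src g) (Γ.srcL g (β j g))
  have hK : ∀ g i j, ContMDiffAt I 𝓘(ℝ, ℝ) ∞ (fun g => K g i j) g := fun g i j => by
    refine F.smoothAt_coord i (((Γ.gpd.smooth_src.comp (hβ j)).congr fun g => ?_) g)
    exact (Γ.src_eq (Γ.bun.pt g (β j g))).symm
  have hK₀ : K g₀ = 1 := by
    ext i j
    simp only [K, hβ₀, F.coord_sec, Matrix.one_apply]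
  have hdet : ∀ᶠ g in 𝓝 g₀, (K g).det ≠ 0 :=
    eventually_det_ne_zero (hK g₀) (by rw [hK₀, Matrix.det_one]; exact one_ne_zero)
  have hexp := F.eventually_expand 𝒢.smooth_src.continuous.continuousAt rfl
  obtain ⟨U, hU, hUo, hg₀⟩ := eventually_nhds_iff.1 (hdet.and (hexp.and hone))
  let L : ∀ g, E.fiber (𝒢.src g) →ₗ[ℝ] Γ.bun.fiber g := fun g =>
    ∑ j, (∑ k, (K g)⁻¹ j k • F.coord k (𝒢.src g)).smulRight (β j g)
  have hL : ∀ g e, L g e = ∑ j, (∑ k, (K g)⁻¹ j k * F.coord k (𝒢.src g) e) • β j g := fun g e => by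
    simp only [L, LinearMap.sum_apply, LinearMap.smulRight_apply, LinearMap.smul_apply, smul_eq_mul]
  have hsrc : ∀ g ∈ U, ∀ e, Γ.srcL g (L g e) = e := fun g hg e => by
    obtain ⟨h1, h2, -⟩ := hU g hg
    have h3 : ∀ j, Γ.srcL g (β j g) = ∑ i, K g i j • F.sec i (𝒢.src g) := fun j => (h2 _).symm
    have h4 : (K g).mulVec ((K g)⁻¹.mulVec fun k => F.coord k (𝒢.src g) e) =
        fun k => F.coord k (𝒢.src g) e := by
      rw [Matrix.mulVec_mulVec, Matrix.mul_nonsing_inv _ (isUnit_iff_ne_zero.2 h1),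
        Matrix.one_mulVec]
    rw [hL, map_sum]
    simp only [map_smul, h3, Finset.smul_sum, smul_smul]
    rw [Finset.sum_comm]
    conv_rhs => rw [← h2 e]
    refine Finset.sum_congr rfl fun i _ => ?_
    rw [← Finset.sum_smul]
    congr 1
    refine Eq.trans (Finset.sum_congr rfl fun j _ => ?_) (congrFun h4 i)
    exact mul_comm _ _
  refine ⟨U, hUo, hg₀, L, hsrc, fun x hx e => ?_, fun n u e z hz hu he => ?_⟩
  -- At a unit of G the value is a combination of units of Γ, hence a unit, and its source
  -- identifies it.
  · have h1 := hsrc _ hx e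
    obtain ⟨a, ha⟩ : ∃ a, L (𝒢.one x) e = Γ.un x a := by
      refine ⟨∑ j, (∑ k, (K (𝒢.one x))⁻¹ j k * F.coord k (𝒢.src (𝒢.one x)) e) • F.sec j x, ?_⟩
      rw [hL, map_sum]
      refine Finset.sum_congr rfl fun j _ => ?_
      rw [map_smul, (hU _ hx).2.2 x rfl j]
      rfl
    rw [ha] at h1 ⊢
    rw [← h1]
    exact congrArg (Γ.un x) (VBGroupoid.sr_un x a).symm
  · simp only [hL]
    refine Γ.bun.smoothAt_sum _ hu fun j _ => Γ.bun.smoothAt_smul ?_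
      ((hβ j).contMDiffAt.comp z hu)
    refine ContMDiffAt.sum fun k _ => ContMDiffAt.mul ?_ (F.smoothAt_coord k he)
    exact (contMDiffAt_matrix_inv (hK (u z)) (hU _ hz).1 j k).comp z hu

variable [I.Boundaryless] [FiniteDimensional ℝ EM] [T2Space M] [IsManifold J ∞ M] [J.Boundaryless]

/-- Near a unit, the units of Γ over a frame of E are extended to sections over a neighbourhood in
G. Away from the units, which form a closed set, any sections through preimages of the frame vectors
will do. -/
theorem exists_isLiftOn (Γ : VBGroupoid 𝒢 E) (g₀ : G) :
    ∃ U, IsOpen U ∧ g₀ ∈ U ∧ ∃ L, IsLiftOn Γ U L := by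
  by_cases h₀ : ∃ x₀, g₀ = 𝒢.one x₀
  · obtain ⟨x₀, rfl⟩ := h₀
    obtain ⟨F, -⟩ := E.exists_frame (𝒢.src (𝒢.one x₀))
    obtain ⟨F', -⟩ := Γ.bun.exists_frame (𝒢.one x₀)
    -- The coordinates, in a frame of Γ, of the units over the frame of E. Composed with the source
    -- map they become functions on G, and the resulting sections take the prescribed values at
    -- nearby units.
    let θ : Fin F'.rank → Fin F.rank → M → ℝ := fun i j x =>
      F'.coord i (𝒢.one x) (Γ.un x (F.sec j x))
    have hθ : ∀ i j, ContMDiff J 𝓘(ℝ, ℝ) ∞ (θ i j) := fun i j => by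
      have h1 : ContMDiff J Γ.bun.tModel ∞ (fun x => Γ.bun.pt (𝒢.one x) (Γ.un x (F.sec j x))) :=
        (Γ.gpd.smooth_one.comp (F.smooth_sec j)).congr fun x => (VBGroupoid.gpd_one x _).symm
      exact fun x => F'.smoothAt_coord i (h1 x)
    have hβ : ∀ᶠ g in 𝓝 (𝒢.one x₀), ∀ x, g = 𝒢.one x → ∀ j,
        ∑ i, θ i j (𝒢.src (𝒢.one x)) • F'.sec i (𝒢.one x) = Γ.un x (F.sec j x) := by
      filter_upwards [F'.eventually_expand (x := fun g => g) continuousAt_id rfl] with g hg x hx j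
      subst hx
      rw [𝒢.src_one]
      exact hg _
    refine exists_isLiftOn_of_sections Γ (𝒢.one x₀) F
      (fun j g => ∑ i, θ i j (𝒢.src g) • F'.sec i g) (fun j g => ?_) (fun j => ?_) hβ
    · exact Γ.bun.smoothAt_sum _ contMDiffAt_id fun i _ => Γ.bun.smoothAt_smul
        ((hθ i j).comp 𝒢.smooth_src g) (F'.smooth_sec i g)
    · have h1 := hβ.self_of_nhds x₀ rfl j
      refine (congrArg (Γ.srcL (𝒢.one x₀)) h1).trans ?_
      have h2 := VBGroupoid.sr_un (Γ := Γ) x₀ (F.sec j x₀)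
      refine (E.tr (𝒢.src_one x₀)).injective (h2.trans ?_)
      exact (E.tr_section (F.sec j) _).symm
  · obtain ⟨F, -⟩ := E.exists_frame (𝒢.src g₀)
    choose b hb using fun j => Γ.srcL_surjective g₀ (F.sec j (𝒢.src g₀))
    choose β hβ hβ₀ using fun j => Γ.bun.exists_section g₀ (b j)
    refine exists_isLiftOn_of_sections Γ g₀ F β hβ (fun j => by rw [hβ₀, hb]) ?_
    have hcl : IsClosed {g | 𝒢.one (𝒢.src g) = g} :=
      isClosed_eq (𝒢.smooth_one.continuous.comp 𝒢.smooth_src.continuous) continuous_id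
    have hmem : {g | 𝒢.one (𝒢.src g) = g}ᶜ ∈ 𝓝 g₀ :=
      hcl.isOpen_compl.mem_nhds fun h => h₀ ⟨_, h.symm⟩
    filter_upwards [hmem] with g hg x hx
    refine (hg ?_).elim
    change 𝒢.one (𝒢.src g) = g
    rw [hx, 𝒢.src_one]

/-- Being a right inverse of the source and taking prescribed values at units are affine conditions,
so the local lifts can be glued by a partition of unity. -/
theorem exists_horLift [SigmaCompactSpace G] (Γ : VBGroupoid 𝒢 E) : Nonempty (HorLift Γ) := by
  classical
  choose U hUo hU L hL using exists_isLiftOn Γ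
  obtain ⟨ρ, hρ⟩ := SmoothPartitionOfUnity.exists_isSubordinate I isClosed_univ U hUo
    fun g _ => Set.mem_iUnion.2 ⟨g, hU g⟩
  have hfs : ∀ (g : G) (S : Finset G), ρ.finsupport g ⊆ S → ∀ i ∉ S, ρ i g = 0 :=
    fun g S hS i hi => by
      by_contra h
      exact hi (hS ((ρ.mem_finsupport g).2 h))
  let Λ : ∀ g, E.fiber (𝒢.src g) →ₗ[ℝ] Γ.bun.fiber g := fun g =>
    ∑ i ∈ ρ.finsupport g, ρ i g • L i g
  have hΛ : ∀ g (S : Finset G), ρ.finsupport g ⊆ S → ∀ e, Λ g e = ∑ i ∈ S, ρ i g • L i g e :=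
    fun g S hS e => by
      simp only [Λ, LinearMap.sum_apply, LinearMap.smul_apply]
      refine Finset.sum_subset hS fun i _ hi => ?_
      rw [hfs g _ (Finset.Subset.refl _) i hi, zero_smul]
  have hmem : ∀ g i, i ∈ ρ.finsupport g → g ∈ U i := fun g i hi =>
    hρ i (subset_tsupport _ ((ρ.mem_finsupport g).1 hi))
  have hsum : ∀ g, ∑ i ∈ ρ.finsupport g, ρ i g = 1 := fun g => ρ.sum_finsupport g (Set.mem_univ g)
  refine ⟨{ lift := Λ
            src_lift := fun g e => ?_
            lift_one := fun x e => ?_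
            smooth := fun n u e hu he z => ?_ }⟩
  · rw [hΛ g _ (Finset.Subset.refl _), map_sum]
    refine Eq.trans (Finset.sum_congr rfl (g := fun i => ρ i g • e) fun i hi => ?_) ?_
    · rw [map_smul, (hL i).src g (hmem g i hi)]
    · rw [← Finset.sum_smul, hsum, one_smul]
  · rw [← E.pt_tr (𝒢.src_one x) e, VBGroupoid.gpd_one]
    refine congrArg (Γ.bun.pt (𝒢.one x)) ?_
    rw [hΛ _ _ (Finset.Subset.refl _)]
    refine Eq.symm (Eq.trans (Finset.sum_congr rfl
      (g := fun i => ρ i (𝒢.one x) • Γ.un x (E.tr (𝒢.src_one x) e)) fun i hi => ?_) ?_)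
    · rw [(hL i).one x (hmem _ i hi)]
      rfl
    · rw [← Finset.sum_smul, hsum, one_smul]
      rfl
  · have h1 : ∀ᶠ y in 𝓝 z, ρ.finsupport (u y) ⊆ ρ.fintsupport (u z) :=
      hu.continuous.continuousAt.eventually (ρ.eventually_finsupport_subset (u z))
    have h2 : ContMDiffAt (𝓡 n) Γ.bun.tModel ∞ (fun y => Γ.bun.pt (u y)
        (∑ i ∈ ρ.fintsupport (u z), ρ i (u y) • L i (u y) (e y))) z := by
      refine Γ.bun.smoothAt_sum _ (hu z) fun i hi => Γ.bun.smoothAt_smul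
        ((ρ i).contMDiff.comp hu z) ((hL i).smooth n u e z ?_ (hu z) (he z))
      exact hρ i ((ρ.mem_fintsupport_iff _ i).1 hi)
    refine h2.congr_of_eventuallyEq ?_
    filter_upwards [h1] with y hy
    rw [hΛ _ _ hy]

end Lifting

end

end VBG

namespace VBG

noncomputable section

open Filter Topology

open LieGroupoid (Hom)

/-! ### Families of subspaces with smooth frames as vector bundles -/

section Subbundles

variable {EM HM : Type*} [NormedAddCommGroup EM] [NormedSpace ℝ EM] [TopologicalSpace HM]
  {J : ModelWithCorners ℝ EM HM} {M : Type*} [TopologicalSpace M] [ChartedSpace HM M]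
  {A : VecBun.{v} J M}

/-- A smooth frame of a family of subspaces of the fibres of `A` over the open set `base`. -/
structure SubFrame (A : VecBun.{v} J M) (K : ∀ x, Submodule ℝ (A.fiber x)) (r : ℕ) where
  base : Set M
  isOpen_base : IsOpen base
  sec : Fin r → ∀ x, K x
  coord : Fin r → ∀ x, A.fiber x →ₗ[ℝ] ℝ
  smooth_sec : ∀ i, ContMDiff J A.tModel ∞ (fun x => A.pt x (sec i x))
  smooth_coord : ∀ i (s : ∀ x, A.fiber x), ContMDiff J A.tModel ∞ (fun x => A.pt x (s x)) →
    ContMDiffOn J 𝓘(ℝ, ℝ) ∞ (fun x => coord i x (s x)) base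
  expand : ∀ x ∈ base, ∀ a : K x, ∑ i, coord i x a • sec i x = a
  coord_sec : ∀ x ∈ base, ∀ i j, coord i x (sec j x) = if i = j then 1 else 0

variable {K : ∀ x, Submodule ℝ (A.fiber x)} {r : ℕ}

/-- The fibres of a subbundle. -/
def SubFiber (K : ∀ x, Submodule ℝ (A.fiber x)) (x : M) : Type v := K x

instance (x : M) : AddCommGroup (SubFiber K x) := inferInstanceAs (AddCommGroup (K x))

instance (x : M) : Module ℝ (SubFiber K x) := inferInstanceAs (Module ℝ (K x))

namespace SubFrame

/-- The coordinates of a vector of the subspace. -/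
def coords (S : SubFrame A K r) (x : M) : SubFiber K x →ₗ[ℝ] Fin r → ℝ :=
  LinearMap.pi fun i => (S.coord i x).comp (K x).subtype

/-- The vector of the subspace with given coordinates. -/
def combine (S : SubFrame A K r) (x : M) : (Fin r → ℝ) →ₗ[ℝ] SubFiber K x :=
  (Fintype.linearCombination ℝ fun i => S.sec i x : (Fin r → ℝ) →ₗ[ℝ] K x)

theorem combine_coords (S : SubFrame A K r) {x : M} (hx : x ∈ S.base) (a : SubFiber K x) :
    S.combine x (S.coords x a) = a := S.expand x hx a

theorem coords_combine (S : SubFrame A K r) {x : M} (hx : x ∈ S.base) (f : Fin r → ℝ) :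
    S.coords x (S.combine x f) = f := by
  funext i
  have h1 : S.coords x (S.combine x f) i =
      S.coord i x ((K x).subtype (∑ j, f j • S.sec j x)) := rfl
  rw [h1, map_sum, map_sum]
  refine Eq.trans (Finset.sum_congr rfl fun j _ => ?_) (Fintype.sum_ite_eq i f)
  rw [map_smul, map_smul, smul_eq_mul]
  refine Eq.trans (congrArg (f j * ·) (S.coord_sec x hx i j)) ?_
  split_ifs with h
  · rw [mul_one]
  · rw [mul_zero]

variable [∀ x, TopologicalSpace (SubFiber K x)]

/-- The local trivialization given by a frame. -/
def pretriv (S : SubFrame A K r) :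
    Bundle.Pretrivialization (Fin r → ℝ) (Bundle.TotalSpace.proj (F := Fin r → ℝ) (E := SubFiber K)) where
  toFun a := (a.proj, S.coords a.proj a.snd)
  invFun q := ⟨q.1, S.combine q.1 q.2⟩
  source := Bundle.TotalSpace.proj ⁻¹' S.base
  target := S.base ×ˢ Set.univ
  map_source' a ha := ⟨ha, trivial⟩
  map_target' q hq := hq.1
  left_inv' a ha := congrArg (Bundle.TotalSpace.mk a.proj) (S.combine_coords ha a.snd)
  right_inv' q hq := Prod.ext rfl (S.coords_combine hq.1 q.2)
  open_target := S.isOpen_base.prod isOpen_univ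
  baseSet := S.base
  open_baseSet := S.isOpen_base
  source_eq := rfl
  target_eq := rfl
  proj_toFun _ _ := rfl

instance (S : SubFrame A K r) : (S.pretriv).IsLinear ℝ where
  linear x _ := (S.coords x).isLinear

theorem pretriv_symm (S : SubFrame A K r) {x : M} (hx : x ∈ S.base) (f : Fin r → ℝ) :
    S.pretriv.symm x f = S.combine x f := by
  rw [S.pretriv.symm_apply hx]
  rfl

/-- The coordinate change between two frames. -/
def change (S S' : SubFrame A K r) (x : M) : (Fin r → ℝ) →L[ℝ] Fin r → ℝ :=
  LinearMap.toContinuousLinearMap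
    (Matrix.toLin' (Matrix.of fun i j => S'.coord i x (S.sec j x)))

theorem change_apply (S S' : SubFrame A K r) (x : M) (f : Fin r → ℝ) :
    S.change S' x f = S'.coords x (S.combine x f) := by
  funext i
  have h1 : S'.coords x (S.combine x f) i =
      S'.coord i x ((K x).subtype (∑ j, f j • S.sec j x)) := rfl
  rw [h1, map_sum, map_sum]
  change ∑ j, S'.coord i x (S.sec j x) * f j = _
  refine Finset.sum_congr rfl fun j _ => ?_
  rw [map_smul, map_smul, smul_eq_mul, mul_comm]
  rfl

/-- The matrix entries are the coordinates, in the second frame, of the sections of the first. The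
sections are globally smooth, so only the base of the second frame matters. -/
theorem contMDiffOn_change (S S' : SubFrame A K r) :
    ContMDiffOn J 𝓘(ℝ, (Fin r → ℝ) →L[ℝ] Fin r → ℝ) ∞ (S.change S') S'.base := by
  let L : (Fin r → Fin r → ℝ) →ₗ[ℝ] (Fin r → ℝ) →L[ℝ] Fin r → ℝ :=
    LinearMap.toContinuousLinearMap.toLinearMap ∘ₗ (Matrix.toLin' (R := ℝ)).toLinearMap ∘ₗ
      (Matrix.ofLinearEquiv ℝ).toLinearMap
  have hL : ContMDiff 𝓘(ℝ, Fin r → Fin r → ℝ) 𝓘(ℝ, (Fin r → ℝ) →L[ℝ] Fin r → ℝ) ∞ L :=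
    (LinearMap.toContinuousLinearMap L).contMDiff
  refine hL.comp_contMDiffOn (f := fun x i j => S'.coord i x (S.sec j x)) ?_
  refine contMDiffOn_pi_space.2 fun i => contMDiffOn_pi_space.2 fun j => ?_
  exact S'.smooth_coord i _ (S.smooth_sec j)

end SubFrame

/-- The topology of the fibres given by the coordinates in a frame. -/
def subTop (S : M → SubFrame A K r) (x : M) : TopologicalSpace (SubFiber K x) :=
  TopologicalSpace.induced ((S x).coords x) inferInstance

/-- A family of subspaces with smooth frames as a vector prebundle. -/
def subPrebundle (S : M → SubFrame A K r) (hS : ∀ x, x ∈ (S x).base) :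
    letI := subTop S
    VectorPrebundle ℝ (Fin r → ℝ) (SubFiber K) :=
  letI := subTop S
  { pretrivializationAtlas := Set.range fun x => (S x).pretriv
    pretrivialization_linear' := by
      rintro _ ⟨x, rfl⟩
      infer_instance
    pretrivializationAt x := (S x).pretriv
    mem_base_pretrivializationAt := hS
    pretrivialization_mem_atlas x := ⟨x, rfl⟩
    exists_coordChange := by
      rintro _ ⟨x, rfl⟩ _ ⟨y, rfl⟩
      refine ⟨(S x).change (S y),
        ((S x).contMDiffOn_change (S y)).continuousOn.mono Set.inter_subset_right, ?_⟩
      rintro z ⟨hz, -⟩ f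
      rw [(S x).change_apply, (S x).pretriv_symm hz]
      rfl
    totalSpaceMk_isInducing x := by
      refine (Topology.isInducing_const_prod (x := x)).2 ⟨rfl⟩ }

theorem isContMDiff_subPrebundle (S : M → SubFrame A K r) (hS : ∀ x, x ∈ (S x).base) :
    letI := subTop S
    VectorPrebundle.IsContMDiff J (subPrebundle S hS) ∞ := by
  letI := subTop S
  refine ⟨?_⟩
  rintro _ ⟨x, rfl⟩ _ ⟨y, rfl⟩
  refine ⟨(S x).change (S y),
    ((S x).contMDiffOn_change (S y)).mono Set.inter_subset_right, ?_⟩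
  rintro z ⟨hz, -⟩ f
  rw [(S x).change_apply, (S x).pretriv_symm hz]
  rfl

/-- The subbundle given by a family of subspaces with smooth frames. -/
def subBundle (S : M → SubFrame A K r) (hS : ∀ x, x ∈ (S x).base) : VecBun.{v} J M :=
  letI := subTop S
  letI := (subPrebundle S hS).totalSpaceTopology
  letI := (subPrebundle S hS).toFiberBundle
  { model := Fin r → ℝ
    fiber := SubFiber K
    vectorBundle := (subPrebundle S hS).toVectorBundle
    smooth :=
      haveI := isContMDiff_subPrebundle S hS
      (subPrebundle S hS).contMDiffVectorBundle J }

theorem smooth_subBundle_incl (S : M → SubFrame A K r) (hS : ∀ x, x ∈ (S x).base) :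
    ContMDiff (subBundle S hS).tModel A.tModel ∞
      (fun a : (subBundle S hS).Tot => A.pt a.proj ((K a.proj).subtype a.snd)) := by
  intro a₀
  let B := subBundle S hS
  have hid : ContMDiffAt B.tModel B.tModel ∞ (fun a : B.Tot => a) a₀ := contMDiffAt_id
  obtain ⟨h1, h2⟩ := Bundle.contMDiffAt_totalSpace.1 hid
  have hmem : ∀ᶠ a : B.Tot in 𝓝 a₀, a.proj ∈ (S a₀.proj).base :=
    h1.continuousAt.preimage_mem_nhds ((S a₀.proj).isOpen_base.mem_nhds (hS a₀.proj))
  have h3 : ∀ i, ContMDiffAt B.tModel 𝓘(ℝ, ℝ) ∞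
      (fun a : B.Tot => (S a₀.proj).coords a.proj a.snd i) a₀ := fun i =>
    contMDiffAt_pi_space.1 h2 i
  refine (A.smoothAt_sum Finset.univ h1 fun i _ => A.smoothAt_smul (h3 i)
    (((S a₀.proj).smooth_sec i).contMDiffAt.comp a₀ h1)).congr_of_eventuallyEq ?_
  filter_upwards [hmem] with a ha
  refine congrArg (A.pt a.proj) ?_
  have h4 := congrArg (K a.proj).subtype ((S a₀.proj).expand a.proj ha a.snd)
  rw [map_sum] at h4
  exact h4.symm

theorem VecBun.finiteDimensional_fiber (A : VecBun.{v} J M) (x : M) :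
    FiniteDimensional ℝ (A.fiber x) :=
  LinearEquiv.finiteDimensional ((trivializationAt A.model A.fiber x).linearEquivAt ℝ x
    (FiberBundle.mem_baseSet_trivializationAt A.model A.fiber x)).symm

theorem VecBun.finrank_fiber (A : VecBun.{v} J M) (x : M) :
    Module.finrank ℝ (A.fiber x) = Module.finrank ℝ A.model :=
  LinearEquiv.finrank_eq ((trivializationAt A.model A.fiber x).linearEquivAt ℝ x
    (FiberBundle.mem_baseSet_trivializationAt A.model A.fiber x))

/-- A basis of the subspace at x₀ is extended to sections, and the dual functionals to smooth
functionals nearby. Their pairing is a matrix N that is the identity at x₀; N⁻¹ turns the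
functionals into dual ones where N is invertible. Constancy of the dimension then makes the sections
a basis. -/
theorem exists_subFrame [FiniteDimensional ℝ EM] [T2Space M] [IsManifold J ∞ M]
    (hr : ∀ x, Module.finrank ℝ (K x) = r)
    (hK : ∀ x (a : K x), ∃ s : ∀ y, K y,
      ContMDiff J A.tModel ∞ (fun y => A.pt y (s y)) ∧ s x = a) (x₀ : M) :
    ∃ S : SubFrame A K r, x₀ ∈ S.base := by
  haveI : ∀ x, FiniteDimensional ℝ (A.fiber x) := A.finiteDimensional_fiber
  obtain ⟨F, -⟩ := A.exists_frame x₀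
  let c := Module.finBasisOfFinrankEq ℝ (K x₀) (hr x₀)
  choose s hs hs₀ using fun j => hK x₀ (c j)
  -- The coordinates on the subspace at x₀ are extended to the whole fibre; written in a frame of A
  -- with constant coefficients, they give smooth functionals l.
  obtain ⟨g, hg⟩ := LinearMap.exists_extend c.equivFun.toLinearMap
  let l : Fin r → ∀ x, A.fiber x →ₗ[ℝ] ℝ := fun i x =>
    ∑ k, g (F.sec k x₀) i • F.coord k x
  have hl : ∀ i x a, l i x a = ∑ k, g (F.sec k x₀) i * F.coord k x a := fun i x a => by
    simp only [l, LinearMap.sum_apply, LinearMap.smul_apply, smul_eq_mul]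
  have hsm : ∀ i (s : ∀ x, A.fiber x), ContMDiff J A.tModel ∞ (fun x => A.pt x (s x)) →
      ContMDiff J 𝓘(ℝ, ℝ) ∞ (fun x => l i x (s x)) := fun i s hs x => by
    simp only [hl]
    exact ContMDiffAt.sum fun k _ => contMDiffAt_const.mul (F.smoothAt_coord k (hs x))
  let N : M → Matrix (Fin r) (Fin r) ℝ := fun x i j => l i x (s j x)
  have hN : ∀ x i j, ContMDiffAt J 𝓘(ℝ, ℝ) ∞ (fun x => N x i j) x := fun x i j =>
    hsm i _ (hs j) x
  have hN₀ : N x₀ = 1 := by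
    ext i j
    have h1 : g (s j x₀) = c.equivFun (c j) := by
      rw [hs₀]
      exact LinearMap.congr_fun hg (c j)
    have h2 := congrArg (fun a => g a i) (F.expand_self (s j x₀ : A.fiber x₀))
    simp only [map_sum, map_smul, Finset.sum_apply, Pi.smul_apply, smul_eq_mul] at h2
    have h3 : N x₀ i j = g (s j x₀) i := by
      rw [← h2]
      exact (hl i x₀ _).trans (Finset.sum_congr rfl fun k _ => mul_comm _ _)
    rw [h3, h1, c.equivFun_self, Matrix.one_apply]
    exact if_congr eq_comm rfl rfl
  let co : Fin r → ∀ x, A.fiber x →ₗ[ℝ] ℝ := fun i x => ∑ k, (N x)⁻¹ i k • l k x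
  have hco : ∀ i x a, co i x a = ∑ k, (N x)⁻¹ i k * l k x a := fun i x a => by
    simp only [co, LinearMap.sum_apply, LinearMap.smul_apply, smul_eq_mul]
  have hcs : ∀ x, (N x).det ≠ 0 → ∀ i j, co i x (s j x) = if i = j then 1 else 0 := by
    intro x hx i j
    have h1 := congrFun₂ (Matrix.nonsing_inv_mul (N x) (isUnit_iff_ne_zero.2 hx)) i j
    rw [Matrix.one_apply] at h1
    rw [← h1, hco]
    rfl
  refine ⟨{
    base := {x | (N x).det ≠ 0}
    isOpen_base := isOpen_iff_mem_nhds.2 fun x hx => eventually_det_ne_zero (hN x) hx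
    sec := s
    coord := co
    smooth_sec := hs
    smooth_coord := fun i s hs x hx => by
      refine ContMDiffAt.contMDiffWithinAt ?_
      simp only [hco]
      exact ContMDiffAt.sum fun k _ => (contMDiffAt_matrix_inv (hN x) hx i k).mul (hsm k s hs x)
    coord_sec := hcs
    expand := fun x hx a => ?_ }, ?_⟩
  · let Λ : K x →ₗ[ℝ] Fin r → ℝ := LinearMap.pi fun i => (co i x).comp (K x).subtype
    have hΛ : ∀ f : Fin r → ℝ, Λ (∑ j, f j • s j x) = f := fun f => by
      funext i
      have h1 : Λ (∑ j, f j • s j x) i = co i x ((K x).subtype (∑ j, f j • s j x)) := rfl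
      rw [h1, map_sum, map_sum]
      refine Eq.trans (Finset.sum_congr rfl fun j _ => ?_) (Fintype.sum_ite_eq i f)
      rw [map_smul, map_smul, smul_eq_mul]
      refine Eq.trans (congrArg (f j * ·) (hcs x hx i j)) ?_
      split_ifs with h
      · rw [mul_one]
      · rw [mul_zero]
    have hsurj : Function.Surjective Λ := fun f => ⟨_, hΛ f⟩
    -- The coordinate map is onto, and both sides have dimension r, so it is injective; this gives
    -- the expansion of every vector of the subspace.
    have hinj := (LinearMap.injective_iff_surjective_of_finrank_eq_finrank
      (by rw [hr, Module.finrank_fin_fun])).2 hsurj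
    exact hinj (hΛ (Λ a))
  · change (N x₀).det ≠ 0
    rw [hN₀, Matrix.det_one]
    exact one_ne_zero

end Subbundles

/-! ### The core as a vector bundle -/

section Core

variable {EG HG EM HM : Type*} [NormedAddCommGroup EG] [NormedSpace ℝ EG] [TopologicalSpace HG]
  [NormedAddCommGroup EM] [NormedSpace ℝ EM] [TopologicalSpace HM]
  {I : ModelWithCorners ℝ EG HG} {G : Type*} [TopologicalSpace G] [ChartedSpace HG G]
  {J : ModelWithCorners ℝ EM HM} {M : Type*} [TopologicalSpace M] [ChartedSpace HM M]
  {𝒢 : LieGroupoid I G J M} {E : VecBun.{v} J M}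

/-- The core is the kernel of the source map in the pullback of Γ along the units. Its rank is
constant by fibrewise surjectivity, and b - 1_{s(b)} is a smooth projection onto it, so every core
vector extends to a smooth section. -/
theorem VBGroupoid.exists_coreIdent [FiniteDimensional ℝ EG] [T2Space G] [IsManifold I ∞ G]
    [I.Boundaryless] [J.Boundaryless] [FiniteDimensional ℝ EM] [T2Space M] [IsManifold J ∞ M]
    (Γ : VBGroupoid 𝒢 E) : ∃ C : VecBun.{v} J M, Nonempty (CoreIdent Γ C) := by
  let f : C^∞⟮J, M; I, G⟯ := ⟨𝒢.one, 𝒢.smooth_one⟩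
  let A : VecBun.{v} J M := Γ.bun.pullback f
  let K : ∀ x, Submodule ℝ (A.fiber x) := fun x => LinearMap.ker (Γ.sr (Hom.one 𝒢 x))
  have hker : ∀ x, LinearMap.ker (Γ.sr (Hom.one 𝒢 x)) = LinearMap.ker (Γ.srcL (𝒢.one x)) :=
    fun x => Submodule.ext fun b => (E.tr (𝒢.src_one x)).map_eq_zero_iff
  have hr : ∀ x, Module.finrank ℝ (K x) =
      Module.finrank ℝ Γ.bun.model - Module.finrank ℝ E.model := fun x => by
    haveI := Γ.bun.finiteDimensional_fiber (𝒢.one x)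
    have h1 := LinearMap.finrank_range_add_finrank_ker (Γ.srcL (𝒢.one x))
    rw [LinearMap.range_eq_top.2 (Γ.srcL_surjective _), finrank_top, E.finrank_fiber,
      Γ.bun.finrank_fiber, ← hker] at h1
    exact Nat.eq_sub_of_add_eq' h1
  have hK : ∀ x (a : K x), ∃ s : ∀ y, K y,
      ContMDiff J A.tModel ∞ (fun y => A.pt y (s y)) ∧ s x = a := by
    intro x a
    obtain ⟨σ, hσ, hσx⟩ := Γ.bun.exists_section (𝒢.one x) a.1
    have hσ1 : ContMDiff J Γ.bun.tModel ∞ (fun y => Γ.bun.pt (𝒢.one y) (σ (𝒢.one y))) :=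
      hσ.comp 𝒢.smooth_one
    have hsr : ContMDiff J E.tModel ∞
        (fun y => E.pt y (Γ.sr (Hom.one 𝒢 y) (σ (𝒢.one y)))) :=
      (Γ.gpd.smooth_src.comp hσ1).congr fun y => (Γ.src_pt (Hom.one 𝒢 y) _).symm
    have hun : ContMDiff J Γ.bun.tModel ∞ (fun y => Γ.bun.pt (𝒢.one y)
        (Γ.un y (Γ.sr (Hom.one 𝒢 y) (σ (𝒢.one y))))) :=
      (Γ.gpd.smooth_one.comp hsr).congr fun y => (VBGroupoid.gpd_one y _).symm
    -- The projection to the kernel along the units.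
    let p : ∀ y, Γ.bun.fiber (Hom.one 𝒢 y).val → Γ.bun.fiber (Hom.one 𝒢 y).val := fun y b =>
      b - Γ.un y (Γ.sr (Hom.one 𝒢 y) b)
    refine ⟨fun y => ⟨p y (σ (𝒢.one y)), ?_⟩, fun y => ?_, Subtype.ext ?_⟩
    · refine LinearMap.mem_ker.2 ((map_sub (Γ.sr (Hom.one 𝒢 y)) _ _).trans ?_)
      rw [VBGroupoid.sr_un]
      exact sub_self _
    · exact (Γ.bun.smoothAt_pullback f).2 ⟨contMDiffAt_id, Γ.bun.smoothAt_sub (hσ1 y) (hun y)⟩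
    · have h1 : Γ.sr (Hom.one 𝒢 x) a.1 = 0 := LinearMap.mem_ker.1 a.2
      change p x (σ (𝒢.one x)) = a.1
      refine (congrArg (p x) hσx).trans ?_
      refine (congrArg (fun e => (show Γ.bun.fiber (Hom.one 𝒢 x).val from a.1) - Γ.un x e)
        h1).trans ?_
      refine (congrArg _ (map_zero (Γ.un x))).trans (sub_zero _)
  choose S hS using exists_subFrame hr hK
  refine ⟨subBundle S hS, ⟨{
    incl := fun x => (K x).subtype
    injective := fun x => (K x).injective_subtype
    range_eq := fun x => (K x).range_subtype.trans (hker x)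
    smooth := fun a => ?_ }⟩⟩
  exact ((Γ.bun.smoothAt_pullback f).1 (smooth_subBundle_incl S hS a)).2

end Core

end

end VBG

/-! ### The correspondence of isomorphism classes -/

namespace VBG

noncomputable section

open Filter Topology

open LieGroupoid (Hom)

/-- A relation that is total on both sides and matches two equivalence relations induces a bijection
of the quotients. -/
theorem exists_quotient_equiv {α β : Type*} (s : Setoid α) (t : Setoid β) (P : α → β → Prop)
    (hex : ∀ a, ∃ b, P a b) (hsurj : ∀ b, ∃ a, P a b)
    (h : ∀ a a' b b', P a b → P a' b' → (s.r a a' ↔ t.r b b')) :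
    ∃ Φ : Quotient s ≃ Quotient t, ∀ a b, P a b → Φ (Quotient.mk s a) = Quotient.mk t b := by
  choose f hf using hex
  let F : Quotient s → Quotient t :=
    Quotient.map f fun a a' haa => (h a a' _ _ (hf a) (hf a')).1 haa
  have hF : ∀ a b, P a b → F (Quotient.mk s a) = Quotient.mk t b := fun a b hab =>
    Quotient.sound ((h a a _ _ (hf a) hab).1 (s.refl a))
  refine ⟨Equiv.ofBijective F ⟨?_, ?_⟩, hF⟩
  · intro q q'
    refine Quotient.inductionOn₂ q q' fun a a' haa => ?_
    exact Quotient.sound ((h a a' _ _ (hf a) (hf a')).2 (Quotient.exact haa))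
  · intro q
    refine Quotient.inductionOn q fun b => ?_
    obtain ⟨a, hab⟩ := hsurj b
    exact ⟨Quotient.mk s a, hF a b hab⟩

section Correspondence

variable {EG HG EM HM : Type*} [NormedAddCommGroup EG] [NormedSpace ℝ EG] [TopologicalSpace HG]
  [NormedAddCommGroup EM] [NormedSpace ℝ EM] [TopologicalSpace HM]
  {I : ModelWithCorners ℝ EG HG} {G : Type*} [TopologicalSpace G] [ChartedSpace HG G]
  {J : ModelWithCorners ℝ EM HM} {M : Type*} [TopologicalSpace M] [ChartedSpace HM M]
  {𝒢 : LieGroupoid I G J M} {E C : VecBun.{v} J M} {Γ Γ' : VBGroupoid 𝒢 E}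

/-- The pullback of a horizontal lift along an isomorphism that is the identity on the side
bundle. -/
def HorLift.comap (h : HorLift Γ') (Φ : VBGroupoidIso Γ Γ') (hs : ∀ x e, Φ.side.equiv x e = e) :
    HorLift Γ where
  lift g := (Φ.top.equiv g).symm.toLinearMap ∘ₗ h.lift g
  src_lift g e := by
    have h1 := Φ.sr_fib (Hom.mk' 𝒢 g) ((Φ.top.equiv g).symm (h.lift g e))
    rw [hs] at h1
    refine Eq.trans (Eq.trans h1.symm ?_) (h.src_lift g e)
    exact congrArg (Γ'.srcL g) ((Φ.top.equiv g).apply_symm_apply _)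
  lift_one x e := by
    have h1 := h.lift_one x e
    have h2 : Φ.top.total (Γ.gpd.one (E.pt (𝒢.src (𝒢.one x)) e)) =
        Γ'.gpd.one (E.pt (𝒢.src (𝒢.one x)) e) := by
      -- The image of a unit is idempotent, hence the unit at its source; so the pulled back lift
      -- takes the right values at units.
      have h3 := VBGroupoid.eq_unFun_of_R_self
        (Φ.R_fib (VBGroupoid.R_unFun_self (Γ := Γ) (𝒢.src (𝒢.one x)) e))
      rw [Φ.sr_fib, VBGroupoid.sr_unFun, hs] at h3
      rw [VBGroupoid.gpd_one, VBGroupoid.gpd_one]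
      exact congrArg (Γ'.bun.pt _) h3
    have h3 := congrArg Φ.top.symm.total (h2.trans h1)
    rw [VecBunIso.total_symm_total] at h3
    exact h3
  smooth k u e hu he := Φ.top.smooth_invFun.comp (h.smooth k u e hu he)

variable [FiniteDimensional ℝ EG] [T2Space G] [IsManifold I ∞ G]

/-- The components are characterized by products, and the inverse of Φ carries the products for h to
those for the pulled back lift while fixing E and C. -/
theorem IsCompOf.comap {κ : CoreIdent Γ C} {κ' : CoreIdent Γ' C} {h : HorLift Γ'} {c : Comp 𝒢 E C}
    (H : IsCompOf κ' h c) (Φ : VBGroupoidIso Γ Γ') (hs : ∀ x e, Φ.side.equiv x e = e)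
    (hc : ∀ x a, Φ.fib (Hom.one 𝒢 x) (κ.cor x a) = κ'.cor x a) :
    IsCompOf κ (h.comap Φ hs) c := by
  have hl : ∀ {x y : M} (g : 𝒢.Hom x y) e, Φ.symm.fib g (h.hl g e) = (h.comap Φ hs).hl g e :=
    fun g e => rfl
  have hk : ∀ x a, Φ.symm.fib (Hom.one 𝒢 x) (κ'.cor x a) = κ.cor x a := fun x a => by
    rw [← hc]
    exact (Φ.top.equiv _).symm_apply_apply _
  have hZ : ∀ {x y : M} (g : 𝒢.Hom x y) a, Φ.symm.fib g (κ'.Z g a) = κ.Z g a := fun {x y} g a => by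
    have r := Φ.symm.R_fib (κ'.R_Z g a)
    rw [hk, map_zero] at r
    exact r.unique (κ.R_Z g a)
  have ht : ∀ {x y : M} (g : 𝒢.Hom x y) b, Γ.tg g (Φ.symm.fib g b) = Γ'.tg g b :=
    fun {x y} g b => by
    refine (Φ.symm.tg_fib g b).trans ?_
    exact (Φ.side.equiv y).injective (((Φ.side.equiv y).apply_symm_apply _).trans (hs y _).symm)
  refine ⟨fun x a => ?_, fun g e => ?_, fun {x y} g a => ?_, fun {x y z} g k e => ?_⟩
  · rw [H.an, ← hk, ht]
  · rw [H.dE, ← hl, ht]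
  · have r := Φ.symm.R_fib (H.dC g a)
    rwa [hl, hk, hZ] at r
  · have r := Φ.symm.R_fib (H.om g k e)
    rwa [map_sub, hl, hl, hl, hZ] at r

variable [I.Boundaryless] [FiniteDimensional ℝ EM] [T2Space M] [IsManifold J ∞ M] [J.Boundaryless]
  [SigmaCompactSpace M]

/-- `R` is induced by `Γ`, an identification of its core and a horizontal lift. -/
def SomeVBGroupoid.Induces (Γ : SomeVBGroupoid.{v} 𝒢) (R : TwoTermRep.{v} 𝒢) : Prop :=
  ∃ (E C : VecBun.{v} J M) (Δ : VBGroupoid 𝒢 E) (κ : CoreIdent Δ C) (h : HorLift Δ)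
    (D : RepHtpy 𝒢 E C), Γ = ⟨E, Δ⟩ ∧ R = ⟨E, C, D⟩ ∧ IsInduced κ h D

/-- Take the semidirect product of the components of D, with its evident core and lift. -/
theorem exists_vbGroupoid_isInduced (D : RepHtpy 𝒢 E C) :
    ∃ (Γ : VBGroupoid 𝒢 E) (κ : CoreIdent Γ C) (h : HorLift Γ), IsInduced κ h D := by
  obtain ⟨c, hc, hD⟩ := D.exists_comp
  exact ⟨hc.vb, hc.core, hc.lift, (isInduced_iff hD).2 hc.isCompOf⟩

/-- Isomorphism of `VB`-groupoids and isomorphism of representations both amount to the existence of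
a `CompIso`. This gives injectivity and also independence of the lift and of the identification of
the core. -/
theorem exists_equiv_repSetoid [SigmaCompactSpace G] :
    ∃ Φ : Quotient (vbSetoid.{v} 𝒢) ≃ Quotient (repSetoid.{v} 𝒢),
      ∀ (E C : VecBun.{v} J M) (Γ : VBGroupoid 𝒢 E) (κ : CoreIdent Γ C) (h : HorLift Γ)
        (D : RepHtpy 𝒢 E C), IsInduced κ h D →
          Φ (Quotient.mk _ ⟨E, Γ⟩) = Quotient.mk _ ⟨E, C, D⟩ := by
  have h := exists_quotient_equiv (vbSetoid.{v} 𝒢) (repSetoid.{v} 𝒢) SomeVBGroupoid.Induces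
  obtain ⟨Φ, hΦ⟩ := h
    (by
      rintro ⟨E, Γ⟩
      obtain ⟨h⟩ := exists_horLift Γ
      obtain ⟨C, ⟨κ⟩⟩ := Γ.exists_coreIdent
      obtain ⟨D, hD, -⟩ := existsUnique_isInduced κ h
      exact ⟨⟨E, C, D⟩, E, C, Γ, κ, h, D, rfl, rfl, hD⟩)
    (by
      rintro ⟨E, C, D⟩
      obtain ⟨Γ, κ, h, hD⟩ := exists_vbGroupoid_isInduced D
      exact ⟨⟨E, Γ⟩, E, C, Γ, κ, h, D, rfl, rfl, hD⟩)
    (by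
      rintro _ _ _ _ ⟨E, C, Γ, κ, h, D, rfl, rfl, hD⟩ ⟨E', C', Γ', κ', h', D', rfl, rfl, hD'⟩
      obtain ⟨c, H⟩ := exists_isCompOf κ h
      obtain ⟨c', H'⟩ := exists_isCompOf κ' h'
      exact (nonempty_vbGroupoidIso_iff H H').trans
        (isomorphic_iff (H.isInduced_iff.1 hD) (H'.isInduced_iff.1 hD')).symm)
  exact ⟨Φ, fun E C Γ κ h D hD => hΦ _ _ ⟨E, C, Γ, κ, h, D, rfl, rfl, hD⟩⟩

/-- The gauge transformation gives an isomorphism, inducing the identity on E and C, from Γ to the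
semidirect product of D'. Pulled back along it, the lift of the semidirect product becomes a lift of
Γ that induces D'. -/
theorem isInduced_of_gaugeEquivalent {κ : CoreIdent Γ C} {h : HorLift Γ} {D D' : RepHtpy 𝒢 E C}
    (hD : IsInduced κ h D) (hg : D.GaugeEquivalent D') : ∃ h', IsInduced κ h' D' := by
  obtain ⟨c, H⟩ := exists_isCompOf κ h
  obtain ⟨c', hc', hD'⟩ := D'.exists_comp
  obtain ⟨i, hs, hc⟩ := (gaugeEquivalent_iff (H.isInduced_iff.1 hD) hD').1 hg
  obtain ⟨Φ, h1, h2⟩ := i.exists_vbGroupoidIso H hc'.isCompOf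
  have hs' : ∀ x e, Φ.side.equiv x e = e := fun x e => by rw [h1, hs]
  refine ⟨hc'.lift.comap Φ hs', (isInduced_iff hD').2 (hc'.isCompOf.comap Φ hs' fun x a => ?_)⟩
  rw [← h2, hc]

theorem exists_equiv_gaugeSetoid [SigmaCompactSpace G] (E C : VecBun.{v} J M) :
    ∃ Φ : Quotient (framedSetoid 𝒢 E C) ≃ Quotient (gaugeSetoid 𝒢 E C),
      ∀ (Γ : FramedVBGroupoid 𝒢 E C) (D : RepHtpy 𝒢 E C),
        Φ (Quotient.mk _ Γ) = Quotient.mk _ D ↔ ∃ h : HorLift Γ.vb, IsInduced Γ.core h D := by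
  have hex : ∀ Γ : FramedVBGroupoid 𝒢 E C, ∃ (D : RepHtpy 𝒢 E C) (h : HorLift Γ.vb),
      IsInduced Γ.core h D := fun Γ => by
    obtain ⟨h⟩ := exists_horLift Γ.vb
    obtain ⟨D, hD, -⟩ := existsUnique_isInduced Γ.core h
    exact ⟨D, h, hD⟩
  obtain ⟨Φ, hΦ⟩ := exists_quotient_equiv (framedSetoid 𝒢 E C) (gaugeSetoid 𝒢 E C)
    (fun Γ D => ∃ h : HorLift Γ.vb, IsInduced Γ.core h D) hex
    (fun D => by
      obtain ⟨Γ, κ, h, hD⟩ := exists_vbGroupoid_isInduced D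
      exact ⟨⟨Γ, κ⟩, h, hD⟩)
    (by
      rintro Γ Γ' D D' ⟨h, hD⟩ ⟨h', hD'⟩
      obtain ⟨c, H⟩ := exists_isCompOf Γ.core h
      obtain ⟨c', H'⟩ := exists_isCompOf Γ'.core h'
      exact (framed_iff H H').trans
        (gaugeEquivalent_iff (H.isInduced_iff.1 hD) (H'.isInduced_iff.1 hD')).symm)
  -- That Φ maps Γ to the class of D only gives a gauge equivalence between D and some induced
  -- representation; `isInduced_of_gaugeEquivalent` turns it into a lift.
  refine ⟨Φ, fun Γ D => ⟨fun hD => ?_, hΦ Γ D⟩⟩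
  obtain ⟨D₀, h, hD₀⟩ := hex Γ
  exact isInduced_of_gaugeEquivalent hD₀
    (Quotient.exact ((hΦ Γ D₀ ⟨h, hD₀⟩).symm.trans hD))

end Correspondence

end

end VBG

theorem corollary5p3 {m d : ℕ}
    {M : Type*} [TopologicalSpace M] [T2Space M] [SecondCountableTopology M]
    [ChartedSpace (EuclideanSpace ℝ (Fin m)) M] [IsManifold (𝓡 m) ∞ M]
    {G : Type*} [TopologicalSpace G] [T2Space G] [SecondCountableTopology G]
    [ChartedSpace (EuclideanSpace ℝ (Fin d)) G] [IsManifold (𝓡 d) ∞ G]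
    (𝒢 : VBG.LieGroupoid (𝓡 d) G (𝓡 m) M) :
    (∀ (E : VBG.VecBun.{v} (𝓡 m) M) (Γ : VBG.VBGroupoid 𝒢 E),
      Nonempty (VBG.HorLift Γ) ∧ (∃ C : VBG.VecBun.{v} (𝓡 m) M, Nonempty (VBG.CoreIdent Γ C)) ∧
        ∀ (C : VBG.VecBun.{v} (𝓡 m) M) (κ : VBG.CoreIdent Γ C) (h : VBG.HorLift Γ),
          ∃! D : VBG.RepHtpy 𝒢 E C, VBG.IsInduced κ h D) ∧
    (∃ Φ : Quotient (VBG.vbSetoid.{v} 𝒢) ≃ Quotient (VBG.repSetoid.{v} 𝒢),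
      ∀ (E C : VBG.VecBun.{v} (𝓡 m) M) (Γ : VBG.VBGroupoid 𝒢 E) (κ : VBG.CoreIdent Γ C)
        (h : VBG.HorLift Γ) (D : VBG.RepHtpy 𝒢 E C), VBG.IsInduced κ h D →
          Φ (Quotient.mk _ ⟨E, Γ⟩) = Quotient.mk _ ⟨E, C, D⟩) ∧
    ∀ E C : VBG.VecBun.{v} (𝓡 m) M,
      ∃ Φ : Quotient (VBG.framedSetoid 𝒢 E C) ≃ Quotient (VBG.gaugeSetoid 𝒢 E C),
        ∀ (Γ : VBG.FramedVBGroupoid 𝒢 E C) (D : VBG.RepHtpy 𝒢 E C),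
          Φ (Quotient.mk _ Γ) = Quotient.mk _ D ↔
            ∃ h : VBG.HorLift Γ.vb, VBG.IsInduced Γ.core h D := by
  -- Partitions of unity on M and G, and the countability argument for cochains, require
  -- σ-compactness.
  have : LocallyCompactSpace M := ChartedSpace.locallyCompactSpace (EuclideanSpace ℝ (Fin m)) M
  have : LocallyCompactSpace G := ChartedSpace.locallyCompactSpace (EuclideanSpace ℝ (Fin d)) G
  have : SigmaCompactSpace M := sigmaCompactSpace_of_locallyCompact_secondCountable
  have : SigmaCompactSpace G := sigmaCompactSpace_of_locallyCompact_secondCountable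
  exact ⟨fun E Γ => ⟨VBG.exists_horLift Γ, Γ.exists_coreIdent,
    fun C κ h => VBG.existsUnique_isInduced κ h⟩, VBG.exists_equiv_repSetoid,
    VBG.exists_equiv_gaugeSetoid⟩
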